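/- Let $\frac13<\beta<\frac12$, $T>0$, $\frac1\beta-2<\lambda\le 1$, and let $\alpha,\varepsilon>0$ satisfy $1-\beta<\alpha<2\beta$, $\alpha<\frac{\lambda\beta+1}{2}$ and $\varepsilon<\alpha+\beta-1$. Let $m,d,n$ be natural numbers. **Multiplicative functionals.** $(x,y,x\otimes y)$ is a $\beta$-Hölder continuous multiplicative functional on $\mathbb R^m\otimes\mathbb R^d$ if $x:[0,T]\to\mathbb R^m$ and $y:[0,T]\to\mathbb R^d$ are $\beta$-Hölder continuous and $x\otimes y:\{0\le s\le t\le T\}\to\mathbb R^m\otimes\mathbb R^d$ is continuous with $(x\otimes y)_{s,u}+(x\otimes y)_{u,t}+(x_u-x_s)\otimes(y_t-y_u)=(x\otimes y)_{s,t}$ for $s\le u\le t$ and $|(x\otimes y)_{s,t}|\le C|t-s|^{2\beta}$ for some constant $C$. **Norms.** $\|x\|_{a,b,\beta}=\sup_{a\le s<t\le b}\frac{|x_t-x_s|}{(t-s)^{\beta}}$, $\|x\otimes y\|_{a,b,\beta}=\sup_{a\le s<t\le b}\frac{|(x\otimes y)_{s,t}|}{(t-s)^{2\beta}}$; for functions on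 $\mathbb R^m$, $\|g\|_\infty=\sup_u|g(u)|$ and $\|g\|_\lambda=\sup_{u\ne v}\frac{|g(u)-g(v)|}{|u-v|^\lambda}$ (values in $[0,\infty]$, with $0\cdot\infty=0$). **Fractional operators.** For $0<\gamma<1$, $$D^\gamma_{a+}g(t)=\tfrac{1}{\Gamma(1-\gamma)}\Big(\tfrac{g(t)}{(t-a)^\gamma}+\gamma\int_a^t\tfrac{g(t)-g(s)}{(t-s)^{\gamma+1}}ds\Big),\qquad \bar D^\gamma_{b-}g(t)=\tfrac{1}{\Gamma(1-\gamma)}\Big(\tfrac{g(t)}{(b-t)^\gamma}+\gamma\int_t^b\tfrac{g(t)-g(s)}{(s-t)^{\gamma+1}}ds\Big),$$ $$\widehat D^\alpha_{a+}f(x)(r)=\tfrac1{\Gamma(1-\alpha)}\Big(\tfrac{f(x_r)}{(r-a)^\alpha}+\alpha\int_a^r\tfrac{f(x_r)-f(x_\theta)-f'(x_\theta)(x_r-x_\theta)}{(r-\theta)^{\alpha+1}}d\theta\Big).$$ For $\theta<\xi<\eta$ let $$G(\theta,\xi,\eta)=\tfrac{(\xi-\theta)^{\alpha-1}(\eta-\xi)^{\alpha-1}}{\Gamma(1-\alpha)\Gamma(\alpha)\Gamma(2\alpha-1)}\int_0^1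 q^{2\alpha-2}(1-q)^{-\alpha}\big(1+(1-q)\tfrac{\xi-\theta}{\eta-\xi}\big)^{-1}dq,$$ let $K_{\theta,b}(\xi,\eta)$ be obtained from $G(\theta,\cdot,\cdot)$ by applying $\bar D^{\alpha-\varepsilon}_{b-}$ in $\eta$ and then $D^{\alpha-\varepsilon}_{\theta+}$ in $\xi$, let $\Gamma^{\alpha-\varepsilon}\psi(\xi,\eta)$ be obtained from $\psi$ by applying $D^{1-\alpha+\varepsilon}_{\xi+}$ in the second variable and then $\bar D^{1-\alpha+\varepsilon}_{\eta-}$ in the first, and let $$\Lambda_a^b(\psi)=\int_a^b\int_a^\eta K_{a,b}(\xi,\eta)\,\Gamma^{\alpha-\varepsilon}\psi(\xi,\eta)\,d\xi\,d\eta .$$ **Integral.** For $f:\mathbb R^m\to\mathbb R^d$ of class $C^1$ with $f'$ $\lambda$-Hölder continuous, and $0\le a<b\le T$, $$\int_a^b f(x_r)\,dy_r=-\sum_{j}\int_a^b\widehat D^\alpha_{a+}f_j(x)(r)\,\bar D^{1-\alpha}_{b-}(y^j-y^j_b)(r)\,dr+\sum_{i,j}\int_a^bD^{2\alpha-1}_{a+}\big(\partial_if_j(x)\big)(r)\,\Lambda_r^b(x^i\otimes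 y^j)\,dr .$$ **Tensor product of two functionals.** For real-valued functionals $(x,y,x\otimes y)$, $(y,z,y\otimes z)$, put $(z\otimes y)_{s,t}=(z_t-z_s)(y_t-y_s)-(y\otimes z)_{s,t}$ and, for $a\le b\le c$, $$\big(x\otimes(y\otimes z)_{\cdot,c}\big)_{a,b}=-\int_a^b\tfrac1{\Gamma(1-\alpha)}\Big(\tfrac{(x_r-x_a)(z_c-z_r)}{(r-a)^\alpha}+\alpha\int_a^r\tfrac{(z_r-z_\theta)(x_\theta-x_r)}{(r-\theta)^{\alpha+1}}d\theta\Big)\bar D^{1-\alpha}_{b-}(y-y_b)(r)\,dr$$ $$\qquad+\int_a^bD^{2\alpha-1}_{a+}(z_c-z_\cdot)(r)\,\Lambda_r^b(x\otimes y)\,dr-\int_a^bD^{2\alpha-1}_{a+}(x_\cdot-x_a)(r)\,\Lambda_r^b(z\otimes y)\,dr .$$ This represents $\int_a^b(x_r-x_a)(z_c-z_r)\,dy_r$. For vector-valued functionals, with $y\otimes z$ valued in $\mathbb R^d\otimes\mathbb R^n$, the vector $\int_\xi^\eta f(x_r)\,d_r(y\otimes z)_{r,\eta}\in\mathbb R^n$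 has as $l$-th coordinate the integral above of $f(x)$ over $[\xi,\eta]$ with $y$ replaced by the path $r\mapsto\big((y^j\otimes z^l)_{r,\eta}\big)_{j\le d}$ and $x^i\otimes y^j$ replaced by $-\,x^i\otimes(y^j\otimes z^l)_{\cdot,\eta}$ (the sign because $d_r(y\otimes z)_{r,\eta}=-(z_\eta-z_r)dy_r$). **Statement.** There is a constant $k$ depending only on $\beta,\alpha,\lambda,\varepsilon,T$ and the dimensions $m,d,n$ such that for all $\beta$-Hölder continuous multiplicative functionals $(x,y,x\otimes y)$ on $\mathbb R^m\otimes\mathbb R^d$ and $(y,z,y\otimes z)$ on $\mathbb R^d\otimes\mathbb R^n$, all $f$ as above, and all $0\le a<b\le T$, $$\sup_{a\le\xi<\eta\le b}\frac1{(\eta-\xi)^{2\beta}}\left|\int_\xi^\eta f(x_r)\,d_r(y\otimes z)_{r,\eta}\right|\le k\Big[A_{a,b}+B_{a,b}\|x\otimes y\|_{a,b,\beta}(b-a)^{\beta-2\varepsilon}\Big],$$ where $$A_{a,b}=\big(\|y\otimes z\|_{a,b,\beta}+\|y\|_{a,b,\beta}\|z\|_{a,b,\beta}\big)\Big[\|f\|_\infty+\big(\|x\|_{a,b,\beta}\|f'\|_\infty+\|f'\|_\lambda\|x\|_{a,b,\beta}^{1+\lambda}(b-a)^{\lambda\beta}\big)(b-a)^{\beta-2\varepsilon}\Big],$$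 $$B_{a,b}=\|z\|_{a,b,\beta}\Big(\|f'\|_\infty+\|f'\|_\lambda\|x\|_{a,b,\beta}^{\lambda}(b-a)^{\lambda\beta}\Big).$$ -/

import Mathlib

open MeasureTheory Set
open scoped ENNReal NNReal

noncomputable section

namespace RoughFrac

/-! ### Hölder seminorms (valued in `[0, ∞]`) -/

/-- `‖x‖_{a,b,β} = sup_{a ≤ s < t ≤ b} |x_t - x_s| / (t - s)^β`. -/
def pathNorm {E : Type*} [NormedAddCommGroup E] (β a b : ℝ) (x : ℝ → E) : ℝ≥0∞ :=
  ⨆ (s : ℝ) (t : ℝ) (_ : a ≤ s ∧ s < t ∧ t ≤ b), ENNReal.ofReal (‖x t - x s‖ / (t - s) ^ β)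

/-- `‖V‖_{a,b,β} = sup_{a ≤ s < t ≤ b} |V_{s,t}| / (t - s)^{2β}` for a two-parameter function. -/
def tensorNorm {E : Type*} [NormedAddCommGroup E] (β a b : ℝ) (V : ℝ → ℝ → E) : ℝ≥0∞ :=
  ⨆ (s : ℝ) (t : ℝ) (_ : a ≤ s ∧ s < t ∧ t ≤ b), ENNReal.ofReal (‖V s t‖ / (t - s) ^ (2 * β))

/-- `‖g‖_∞`, the supremum over the whole space. -/
def supNorm {E F : Type*} [NormedAddCommGroup F] (g : E → F) : ℝ≥0∞ :=
  ⨆ u : E, ENNReal.ofReal ‖g u‖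

/-- `‖g‖_λ = sup_{u ≠ v} |g(u) - g(v)| / |u - v|^λ`, over the whole space. -/
def holderNorm {E F : Type*} [NormedAddCommGroup E] [NormedAddCommGroup F]
    (lam : ℝ) (g : E → F) : ℝ≥0∞ :=
  ⨆ (u : E) (v : E) (_ : u ≠ v), ENNReal.ofReal (‖g u - g v‖ / ‖u - v‖ ^ lam)

/-! ### Multiplicative functionals -/

/-- `(x, y, V)`, with `V` in the role of `x ⊗ y`, is a `β`-Hölder continuous multiplicative
functional on `ℝᵐ ⊗ ℝᵈ` over `[0, T]`.  The space `ℝᵐ ⊗ ℝᵈ` is `ℝ^{m × d}` with its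
Euclidean norm. -/
structure IsMultFunctional {m d : ℕ} (β T : ℝ) (x : ℝ → EuclideanSpace ℝ (Fin m))
    (y : ℝ → EuclideanSpace ℝ (Fin d)) (V : ℝ → ℝ → EuclideanSpace ℝ (Fin m × Fin d)) :
    Prop where
  holder_left : pathNorm β 0 T x ≠ ⊤
  holder_right : pathNorm β 0 T y ≠ ⊤
  continuousOn : ContinuousOn (fun p : ℝ × ℝ => V p.1 p.2)
    {p : ℝ × ℝ | 0 ≤ p.1 ∧ p.1 ≤ p.2 ∧ p.2 ≤ T}
  mult : ∀ s u t : ℝ, 0 ≤ s → s ≤ u → u ≤ t → t ≤ T → ∀ (i : Fin m) (j : Fin d),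
    V s u (i, j) + V u t (i, j) + (x u i - x s i) * (y t j - y u j) = V s t (i, j)
  bound : ∃ C : ℝ, ∀ s t : ℝ, 0 ≤ s → s ≤ t → t ≤ T → ‖V s t‖ ≤ C * (t - s) ^ (2 * β)

/-! ### Fractional derivatives

The right-sided derivatives are usually written with a phase `(-1)^α = e^{iπα}`.  Below they are
written without it; in every formula the phases multiply to the real sign that is put in by
hand: `(-1)^α (-1)^{1-α} = -1`. -/

/-- Left-sided Weyl derivative `D_{a+}^α f (t)`. -/
def weylLeft (α a : ℝ) (f : ℝ → ℝ) (t : ℝ) : ℝ :=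
  1 / Real.Gamma (1 - α) *
    (f t / (t - a) ^ α + α * ∫ s in a..t, (f t - f s) / (t - s) ^ (α + 1))

/-- Right-sided Weyl derivative `(-1)^{-α} D_{b-}^α f (t)`. -/
def weylRight (α b : ℝ) (f : ℝ → ℝ) (t : ℝ) : ℝ :=
  1 / Real.Gamma (1 - α) *
    (f t / (b - t) ^ α + α * ∫ s in t..b, (f t - f s) / (s - t) ^ (α + 1))

/-- Compensated fractional derivative of `f(x)` at `r`, for a scalar function `f` on `ℝᵐ`. -/
def compensatedDeriv {m : ℕ} (α a : ℝ) (f : EuclideanSpace ℝ (Fin m) → ℝ)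
    (x : ℝ → EuclideanSpace ℝ (Fin m)) (r : ℝ) : ℝ :=
  1 / Real.Gamma (1 - α) *
    (f (x r) / (r - a) ^ α +
      α * ∫ θ in a..r, (f (x r) - f (x θ) - fderiv ℝ f (x θ) (x r - x θ)) / (r - θ) ^ (α + 1))

/-- The kernel `G(θ, ξ, η)`, for `θ < ξ < η`.  The normalization is the one for which the integral
below agrees with the classical integral when `y` is smooth. -/
def kernelG (α θ ξ η : ℝ) : ℝ :=
  1 / (Real.Gamma (1 - α) * Real.Gamma α * Real.Gamma (2 * α - 1)) *
    (ξ - θ) ^ (α - 1) * (η - ξ) ^ (α - 1) *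
    ∫ q in (0 : ℝ)..1,
      q ^ (2 * α - 2) * (1 - q) ^ (-α) * (1 + (1 - q) * ((ξ - θ) / (η - ξ)))⁻¹

/-- The kernel `K_{θ,b}(ξ, η)` (up to phase): `G` differentiated to the order `α - ε`, from the left
in `ξ` and from the right in `η`. -/
def kernelK (α ε θ b ξ η : ℝ) : ℝ :=
  weylLeft (α - ε) θ
    (fun ξ' => weylRight (α - ε) b (fun η' => kernelG α θ ξ' η') η) ξ

/-- `Γ^α ψ (ξ, η) = D_{η-}^{1-α, ξ} D_{ξ+}^{1-α, η} ψ (ξ, η)` (up to phase). -/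
def gammaOp (α : ℝ) (ψ : ℝ → ℝ → ℝ) (ξ η : ℝ) : ℝ :=
  weylRight (1 - α) η (fun ξ' => weylLeft (1 - α) ξ' (fun η' => ψ ξ' η') η) ξ

/-- `Λ_a^b(ψ) = ∫_a^b ∫_a^η K_{a,b}(ξ, η) Γ^{α-ε} ψ (ξ, η) dξ dη`. -/
def lambdaOp (α ε a b : ℝ) (ψ : ℝ → ℝ → ℝ) : ℝ :=
  ∫ η in a..b, ∫ ξ in a..η, kernelK α ε a b ξ η * gammaOp (α - ε) ψ ξ η

/-! ### The integral of `f(x)` against `y` -/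

/-- `∫_a^b f(x_r) dy_r = ∑_j ∫_a^b f_j(x_r) dy^j_r`, for the functional `(x, y, V)`. -/
def fracIntegral {m d : ℕ} (α ε : ℝ) (f : EuclideanSpace ℝ (Fin m) → EuclideanSpace ℝ (Fin d))
    (x : ℝ → EuclideanSpace ℝ (Fin m)) (y : ℝ → EuclideanSpace ℝ (Fin d))
    (V : ℝ → ℝ → EuclideanSpace ℝ (Fin m × Fin d)) (a b : ℝ) : ℝ :=
  -(∑ j : Fin d, ∫ r in a..b,
      compensatedDeriv α a (fun u => f u j) x r *
        weylRight (1 - α) b (fun s => y s j - y b j) r) +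
    ∑ i : Fin m, ∑ j : Fin d, ∫ r in a..b,
      weylLeft (2 * α - 1) a
          (fun s => fderiv ℝ (fun u => f u j) (x s) (EuclideanSpace.single i 1)) r *
        lambdaOp α ε r b (fun s t => V s t (i, j))

/-! ### The tensor product of two multiplicative functionals -/

/-- `(z ⊗ y)_{s,t} = (z_t - z_s)(y_t - y_s) - (y ⊗ z)_{s,t}`. -/
def flipTensor (y z : ℝ → ℝ) (U : ℝ → ℝ → ℝ) (s t : ℝ) : ℝ :=
  (z t - z s) * (y t - y s) - U s t

/-- `(x ⊗ (y ⊗ z)_{·,c})_{a,b}` for real-valued functionals `(x, y, V)` and `(y, z, U)`: the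
integral `∫_a^b (x_r - x_a)(z_c - z_r) dy_r`, that is, the formula of `fracIntegral` for the
function `(u, w) ↦ u w` along the path `(x - x_a, z_c - z)`. -/
def tripleTensor (α ε : ℝ) (x y z : ℝ → ℝ) (V U : ℝ → ℝ → ℝ) (c a b : ℝ) : ℝ :=
  -(∫ r in a..b,
      1 / Real.Gamma (1 - α) *
          ((x r - x a) * (z c - z r) / (r - a) ^ α +
            α * ∫ θ in a..r, (z r - z θ) * (x θ - x r) / (r - θ) ^ (α + 1)) *
        weylRight (1 - α) b (fun s => y s - y b) r) +
    (∫ r in a..b, weylLeft (2 * α - 1) a (fun s => z c - z s) r * lambdaOp α ε r b V) -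
    ∫ r in a..b,
      weylLeft (2 * α - 1) a (fun s => x s - x a) r * lambdaOp α ε r b (flipTensor y z U)

/-- The `ℝⁿ`-valued integral `∫_ξ^η f(x_r) d_r (y ⊗ z)_{r,c}`: its `l`-th coordinate is the integral
of `f(x)` against the `ℝᵈ`-valued path `r ↦ (y ⊗ z^l)_{r,c}`.  Since
`d_r (y ⊗ z)_{r,c} = -(z_c - z_r) dy_r`, the second-order part that goes with this path is
`∫ (x_r - x_s) d_r (y ⊗ z)_{r,c} = -(x ⊗ (y ⊗ z)_{·,c})_{s,t}`. -/
def tensorIntegral {m d n : ℕ} (α ε : ℝ)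
    (f : EuclideanSpace ℝ (Fin m) → EuclideanSpace ℝ (Fin d))
    (x : ℝ → EuclideanSpace ℝ (Fin m)) (y : ℝ → EuclideanSpace ℝ (Fin d))
    (z : ℝ → EuclideanSpace ℝ (Fin n))
    (V : ℝ → ℝ → EuclideanSpace ℝ (Fin m × Fin d))
    (U : ℝ → ℝ → EuclideanSpace ℝ (Fin d × Fin n)) (c ξ η : ℝ) : EuclideanSpace ℝ (Fin n) :=
  WithLp.toLp 2 fun l : Fin n =>
    fracIntegral α ε f x
      (fun r => WithLp.toLp 2 fun j : Fin d => U r c (j, l))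
      (fun s t => WithLp.toLp 2 fun p : Fin m × Fin d =>
        -tripleTensor α ε (fun r => x r p.1) (fun r => y r p.2) (fun r => z r l)
          (fun s' t' => V s' t' p) (fun s' t' => U s' t' (p.2, l)) c s t)
      ξ η

/-! ### The quantities in the estimate -/

/-- `A_{a,b}`. -/
def constA {m d n : ℕ} (β lam ε : ℝ) (f : EuclideanSpace ℝ (Fin m) → EuclideanSpace ℝ (Fin d))
    (x : ℝ → EuclideanSpace ℝ (Fin m)) (y : ℝ → EuclideanSpace ℝ (Fin d))
    (z : ℝ → EuclideanSpace ℝ (Fin n))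
    (U : ℝ → ℝ → EuclideanSpace ℝ (Fin d × Fin n)) (a b : ℝ) : ℝ≥0∞ :=
  (tensorNorm β a b U + pathNorm β a b y * pathNorm β a b z) *
    (supNorm f +
      (pathNorm β a b x * supNorm (fderiv ℝ f) +
          holderNorm lam (fderiv ℝ f) * pathNorm β a b x ^ (1 + lam) *
            ENNReal.ofReal ((b - a) ^ (lam * β))) *
        ENNReal.ofReal ((b - a) ^ (β - 2 * ε)))

/-- `B_{a,b}`. -/
def constB {m d n : ℕ} (β lam : ℝ) (f : EuclideanSpace ℝ (Fin m) → EuclideanSpace ℝ (Fin d))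
    (x : ℝ → EuclideanSpace ℝ (Fin m)) (z : ℝ → EuclideanSpace ℝ (Fin n)) (a b : ℝ) : ℝ≥0∞ :=
  pathNorm β a b z *
    (supNorm (fderiv ℝ f) +
      holderNorm lam (fderiv ℝ f) * pathNorm β a b x ^ lam *
        ENNReal.ofReal ((b - a) ^ (lam * β)))

end RoughFrac

end

noncomputable section

namespace RoughFrac

open Filter Topology

/-! ### Integrals over open intervals -/

/-! The vector `tensorIntegral` over [ξ, η] is the integral `fracIntegral` of f(x) along the path
p_r = (y ⊗ z)_{r,η}, with ψ = -(x ⊗ (y ⊗ z)_{·,η}) in the role of the second-order part. Such an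
integral over [a, b] is under control as soon as x and p are β-Hölder, ψ is of order 2β, and ψ_{s,u}
+ ψ_{u,t} + (x_u - x_s)(p_t - p_u) = ψ_{s,t}. The first-order sum then pairs a compensated
derivative of size (r-a)^{-α} with a right derivative of size (b-r)^{α+β-1}, and the second-order
sum pairs a derivative of size (r-a)^{1-2α} with Λ_r^b(ψ), of size (b-r)^{2α+2β-2}. Beta integrals
give the powers β and 2β (`fracIntegral_bound`). The Hölder constant of p carries a further factor
(b-a)^β (`RoughOn.tensor_path`), so both sums have order 2β.

The size of Λ (`RoughPair.lambda_bound`) comes from two estimates, with γ = α - ε. The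
multiplicative relation makes the mixed derivative Γψ of size (η-ξ)^{2β+2γ-2}
(`RoughPair.gamma_bound`). The kernel K has a majorant whose integral over the triangle is of order
(b-a)^{2ε} (`kernelK_bound`, `kerSec_integral`): a substitution shows that G is a power of ξ - θ
times a function without singularity on the diagonal (`kernelG_eq`), and the simple and mixed
differences of that function are estimated by hand.

The heart of the matter is the multiplicative relation for x ⊗ (y ⊗ z) (`RoughOn.triple`), because
the fractional formula that defines it shows no additivity in the interval. Along Lipschitz paths
every fractional operator can be undone by integration by parts (`FracClass.integral_by_parts`): K
disappears, Λ becomes a fractional integral of order 2α - 1 (`LipPair.lambdaOp_eq_fracInt`), and the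
tensor product becomes a classical integral (`tripleAux_eq`), for which the relation is additivity
of integrals. To reach rough paths, a second-order part is written as h_t - h_s - x_s(p_t - p_s)
with a primitive h, and x, p, h are each averaged over [t, t+δ]. Nothing forces h to be ∫ x dp, so
the functional need not be a limit of canonical lifts of smooth paths. The averages satisfy bounds
uniform in δ (`RoughPair.steklov`), and dominated convergence (`tendsto_tripleAux`) carries the
relation to the limit (`tripleAux_add`).

The estimate comes out with (b-a)^β where (b-a)^{β-2ε} is claimed. The quotient is at most T^{2ε},
the only dependence of the constant on T. -/

lemma ae_uIoc_of_Ioo {a b : ℝ} (hab : a ≤ b) {P : ℝ → Prop} (h : ∀ r, a < r → r < b → P r) :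
    ∀ᵐ r : ℝ, r ∈ uIoc a b → P r := by
  have h₂ : ∀ᵐ x : ℝ, x ≠ b := by simp [ae_iff, measure_singleton]
  filter_upwards [h₂] with r hr hr'
  rw [uIoc_of_le hab] at hr'
  exact h r hr'.1 (lt_of_le_of_ne hr'.2 hr)

lemma abs_integral_le_of_Ioo {a b : ℝ} (hab : a ≤ b) {f g : ℝ → ℝ}
    (h : ∀ r, a < r → r < b → |f r| ≤ g r) (hg : IntervalIntegrable g volume a b) :
    |∫ r in a..b, f r| ≤ ∫ r in a..b, g r := by
  have := ae_uIoc_of_Ioo hab h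
  rw [uIoc_of_le hab] at this
  exact intervalIntegral.norm_integral_le_of_norm_le (f := f) hab this hg

lemma intervalIntegrable_of_Ioo {a b : ℝ} (hab : a ≤ b) {f g : ℝ → ℝ} (hf : Measurable f)
    (h : ∀ r, a < r → r < b → |f r| ≤ g r) (hg : IntervalIntegrable g volume a b) :
    IntervalIntegrable f volume a b := by
  have := ae_uIoc_of_Ioo hab h
  refine hg.mono_fun' hf.aestronglyMeasurable ?_
  rw [EventuallyLE, ae_restrict_iff' measurableSet_uIoc]
  exact this

lemma intervalIntegrable_congr_Ioo {a b : ℝ} (hab : a ≤ b) {f g : ℝ → ℝ}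
    (h : ∀ r, a < r → r < b → f r = g r) (hg : IntervalIntegrable g volume a b) :
    IntervalIntegrable f volume a b := by
  have := ae_uIoc_of_Ioo hab h
  refine hg.congr_ae ?_
  rw [EventuallyEq, ae_restrict_iff' measurableSet_uIoc]
  filter_upwards [this] with x hx hx' using (hx hx').symm

lemma integral_congr_Ioo {a b : ℝ} (hab : a ≤ b) {f g : ℝ → ℝ}
    (h : ∀ r, a < r → r < b → f r = g r) :
    ∫ r in a..b, f r = ∫ r in a..b, g r :=
  intervalIntegral.integral_congr_ae (ae_uIoc_of_Ioo hab h)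

lemma integral_mono_Ioo {a b : ℝ} (hab : a ≤ b) {f g : ℝ → ℝ}
    (hf : IntervalIntegrable f volume a b) (hg : IntervalIntegrable g volume a b)
    (h : ∀ r, a < r → r < b → f r ≤ g r) :
    ∫ r in a..b, f r ≤ ∫ r in a..b, g r := by
  refine intervalIntegral.integral_mono_ae_restrict hab hf hg ?_
  have := ae_uIoc_of_Ioo hab h
  rw [uIoc_of_le hab] at this
  rw [EventuallyLE, ← restrict_Ioc_eq_restrict_Icc, ae_restrict_iff' measurableSet_Ioc]
  exact this

lemma tendsto_integral_Ioo {ι : Type*} {l : Filter ι} [l.IsCountablyGenerated] {a b : ℝ}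
    (hab : a ≤ b) {F : ι → ℝ → ℝ} {f g : ℝ → ℝ} (hF : ∀ n, Measurable (F n))
    (hb : ∀ᶠ n in l, ∀ r, a < r → r < b → |F n r| ≤ g r) (hg : IntervalIntegrable g volume a b)
    (hl : ∀ r, a < r → r < b → Tendsto (fun n => F n r) l (𝓝 (f r))) :
    Tendsto (fun n => ∫ r in a..b, F n r) l (𝓝 (∫ r in a..b, f r)) := by
  refine intervalIntegral.tendsto_integral_filter_of_dominated_convergence g
    (Eventually.of_forall fun n => (hF n).aestronglyMeasurable) ?_ hg (ae_uIoc_of_Ioo hab hl)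
  filter_upwards [hb] with n hn
  exact ae_uIoc_of_Ioo hab hn

/-- The operators here are iterated integrals whose endpoints depend on outer variables, and Fubini
and dominated convergence both ask for their measurability. An interval integral is a difference of
two integrals over half-open intervals, each the integral of an indicator on the product space. -/
lemma measurable_intervalIntegral {X : Type*} [MeasurableSpace X] {f : X → ℝ → ℝ}
    (hf : Measurable (Function.uncurry f)) {l u : X → ℝ} (hl : Measurable l) (hu : Measurable u) :
    Measurable fun x => ∫ s in l x..u x, f x s := by
  have key : ∀ {l u : X → ℝ}, Measurable l → Measurable u →
      Measurable fun x => ∫ s in Ioc (l x) (u x), f x s := by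
    intro l u hl hu
    have h1 : MeasurableSet {q : X × ℝ | l q.1 < q.2 ∧ q.2 ≤ u q.1} :=
      (measurableSet_lt (hl.comp measurable_fst) measurable_snd).inter
        (measurableSet_le measurable_snd (hu.comp measurable_fst))
    have h2 : Measurable ({q : X × ℝ | l q.1 < q.2 ∧ q.2 ≤ u q.1}.indicator (Function.uncurry f)) :=
      hf.indicator h1
    have h3 := (h2.stronglyMeasurable.integral_prod_right' (ν := (volume : Measure ℝ))).measurable
    convert h3 using 2 with x
    rw [← integral_indicator measurableSet_Ioc]
    rfl
  simp only [intervalIntegral]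
  exact (key hl hu).sub (key hu hl)

/-! ### Beta integrals -/

lemma intervalIntegrable_beta01 {p q : ℝ} (hp : 0 < p) (hq : 0 < q) :
    IntervalIntegrable (fun t : ℝ => t ^ (p - 1) * (1 - t) ^ (q - 1)) volume 0 1 := by
  have h := Complex.betaIntegral_convergent (u := (p : ℂ)) (v := (q : ℂ)) (by simpa) (by simpa)
  have h' : IntervalIntegrable (fun x : ℝ =>
      ((x : ℂ) ^ ((p : ℂ) - 1) * (1 - (x : ℂ)) ^ ((q : ℂ) - 1)).re) volume 0 1 := ⟨h.1.re, h.2.re⟩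
  refine intervalIntegrable_congr_Ioo zero_le_one (fun r h0 h1 => ?_) h'
  rw [show ((r : ℂ) ^ ((p : ℂ) - 1) * (1 - (r : ℂ)) ^ ((q : ℂ) - 1))
    = ((r ^ (p - 1) * (1 - r) ^ (q - 1) : ℝ) : ℂ) by
      push_cast [Complex.ofReal_cpow h0.le, Complex.ofReal_cpow (sub_nonneg.2 h1.le)]; rfl]
  simp

/-- The real beta function, as an integral. -/
def betaR (p q : ℝ) : ℝ := ∫ t in (0 : ℝ)..1, t ^ (p - 1) * (1 - t) ^ (q - 1)

lemma betaR_eq_Gamma {p q : ℝ} (hp : 0 < p) (hq : 0 < q) :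
    betaR p q = Real.Gamma p * Real.Gamma q / Real.Gamma (p + q) := by
  have h1 := ProbabilityTheory.beta_eq_betaIntegralReal p q hp hq
  rw [ProbabilityTheory.beta] at h1
  rw [h1, betaR, Complex.betaIntegral]
  have : ∫ x : ℝ in (0 : ℝ)..1, (x : ℂ) ^ ((p : ℂ) - 1) * (1 - (x : ℂ)) ^ ((q : ℂ) - 1) =
      ∫ x : ℝ in (0 : ℝ)..1, ((x ^ (p - 1) * (1 - x) ^ (q - 1) : ℝ) : ℂ) := by
    refine intervalIntegral.integral_congr_ae (ae_uIoc_of_Ioo zero_le_one fun r h0 h1 => ?_)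
    push_cast [Complex.ofReal_cpow h0.le, Complex.ofReal_cpow (sub_nonneg.2 h1.le)]; rfl
  rw [this, intervalIntegral.integral_ofReal, Complex.ofReal_re]

lemma betaR_pos {p q : ℝ} (hp : 0 < p) (hq : 0 < q) : 0 < betaR p q := by
  rw [betaR_eq_Gamma hp hq]
  have := Real.Gamma_pos_of_pos hp
  have := Real.Gamma_pos_of_pos hq
  have := Real.Gamma_pos_of_pos (add_pos hp hq)
  positivity

lemma beta_scale {p q a b r : ℝ} (h1 : a < r) (h2 : r < b) :
    (r - a) ^ (p - 1) * (b - r) ^ (q - 1) = (b - a) ^ (p + q - 2) *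
      (((b - a)⁻¹ * r + -(a * (b - a)⁻¹)) ^ (p - 1) *
        (1 - ((b - a)⁻¹ * r + -(a * (b - a)⁻¹))) ^ (q - 1)) := by
  have hab : 0 < b - a := by linarith
  have e1 : (b - a)⁻¹ * r + -(a * (b - a)⁻¹) = (r - a) / (b - a) := by field_simp; ring
  have e2 : 1 - (r - a) / (b - a) = (b - r) / (b - a) := by field_simp; ring
  rw [e1, e2, Real.div_rpow (by linarith) hab.le, Real.div_rpow (by linarith) hab.le,
    show p + q - 2 = (p - 1) + (q - 1) by ring, Real.rpow_add hab]
  have := Real.rpow_pos_of_pos hab (p - 1)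
  have := Real.rpow_pos_of_pos hab (q - 1)
  field_simp

lemma intervalIntegrable_beta {p q : ℝ} (hp : 0 < p) (hq : 0 < q) {a b : ℝ} (hab : a ≤ b) :
    IntervalIntegrable (fun r : ℝ => (r - a) ^ (p - 1) * (b - r) ^ (q - 1)) volume a b := by
  rcases hab.eq_or_lt with rfl | hab'
  · simp
  have hab0 : 0 < b - a := by linarith
  refine intervalIntegrable_congr_Ioo hab (fun r h1 h2 => beta_scale h1 h2)
    (IntervalIntegrable.const_mul ?_ _)
  have h := intervalIntegrable_beta01 hp hq
  have h3 := (h.comp_add_right (-(a * (b - a)⁻¹))).comp_mul_left (c := (b - a)⁻¹)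
  convert h3 using 1 <;> field_simp <;> ring

lemma integral_beta {p q : ℝ} (a b : ℝ) (hab : a < b) :
    ∫ r in a..b, (r - a) ^ (p - 1) * (b - r) ^ (q - 1) = betaR p q * (b - a) ^ (p + q - 1) := by
  have hab0 : 0 < b - a := by linarith
  rw [integral_congr_Ioo hab.le (fun r h1 h2 => beta_scale h1 h2),
    intervalIntegral.integral_const_mul,
    intervalIntegral.integral_comp_mul_add (fun t => t ^ (p - 1) * (1 - t) ^ (q - 1))
      (inv_ne_zero hab0.ne')]
  have e1 : (b - a)⁻¹ * a + -(a * (b - a)⁻¹) = 0 := by ring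
  have e2 : (b - a)⁻¹ * b + -(a * (b - a)⁻¹) = 1 := by field_simp; ring
  rw [e1, e2, inv_inv, smul_eq_mul, betaR, show p + q - 1 = (p + q - 2) + 1 by ring,
    Real.rpow_add hab0, Real.rpow_one]
  ring

lemma intervalIntegrable_rpow_left {p : ℝ} (hp : 0 < p) {a b : ℝ} (hab : a ≤ b) :
    IntervalIntegrable (fun r : ℝ => (r - a) ^ (p - 1)) volume a b := by
  simpa using intervalIntegrable_beta hp one_pos hab

lemma intervalIntegrable_rpow_right {q : ℝ} (hq : 0 < q) {a b : ℝ} (hab : a ≤ b) :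
    IntervalIntegrable (fun r : ℝ => (b - r) ^ (q - 1)) volume a b := by
  simpa using intervalIntegrable_beta one_pos hq hab

lemma integral_rpow_left {p : ℝ} (hp : 0 < p) (a b : ℝ) :
    ∫ r in a..b, (r - a) ^ (p - 1) = (b - a) ^ p / p := by
  rw [intervalIntegral.integral_comp_sub_right (fun t => t ^ (p - 1)), sub_self,
    integral_rpow (Or.inl (by linarith))]
  simp [Real.zero_rpow hp.ne']

lemma integral_rpow_right {q : ℝ} (hq : 0 < q) (a b : ℝ) :
    ∫ r in a..b, (b - r) ^ (q - 1) = (b - a) ^ q / q := by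
  rw [intervalIntegral.integral_comp_sub_left (fun t => t ^ (q - 1)), sub_self,
    integral_rpow (Or.inl (by linarith))]
  simp [Real.zero_rpow hq.ne']

/-! ### Integrals over triangles -/

/-- Integrability of `f r s` over the triangle `a < s < r < b`. -/
def TriInt (a b : ℝ) (f : ℝ → ℝ → ℝ) : Prop :=
  Integrable ({q : ℝ × ℝ | a < q.2 ∧ q.2 < q.1 ∧ q.1 < b}.indicator (Function.uncurry f))
    (volume.prod volume)

lemma measurableSet_tri (a b : ℝ) : MeasurableSet {q : ℝ × ℝ | a < q.2 ∧ q.2 < q.1 ∧ q.1 < b} :=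
  (measurableSet_lt measurable_const measurable_snd).inter
    ((measurableSet_lt measurable_snd measurable_fst).inter
      (measurableSet_lt measurable_fst measurable_const))

lemma tri_left_section {a b r : ℝ} (f : ℝ → ℝ → ℝ) (h2 : r < b) :
    (fun s => {q : ℝ × ℝ | a < q.2 ∧ q.2 < q.1 ∧ q.1 < b}.indicator (Function.uncurry f) (r, s)) =
      (Ioo a r).indicator (f r) := by
  ext s
  by_cases hs : s ∈ Ioo a r
  · rw [indicator_of_mem hs, indicator_of_mem]; rfl
    exact ⟨hs.1, hs.2, h2⟩
  · rw [indicator_of_notMem hs, indicator_of_notMem]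
    exact fun h => hs ⟨h.1, h.2.1⟩

lemma tri_left_section_zero {a b r : ℝ} (f : ℝ → ℝ → ℝ) (h : r ∉ Ioo a b) :
    (fun s => {q : ℝ × ℝ | a < q.2 ∧ q.2 < q.1 ∧ q.1 < b}.indicator (Function.uncurry f) (r, s)) =
      fun _ => 0 := by
  ext s
  rw [indicator_of_notMem]
  exact fun h' => h ⟨h'.1.trans h'.2.1, h'.2.2⟩

lemma tri_right_section {a b s : ℝ} (f : ℝ → ℝ → ℝ) (h1 : a < s) :
    (fun r => {q : ℝ × ℝ | a < q.2 ∧ q.2 < q.1 ∧ q.1 < b}.indicator (Function.uncurry f) (r, s)) =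
      (Ioo s b).indicator (fun r => f r s) := by
  ext r
  by_cases hs : r ∈ Ioo s b
  · rw [indicator_of_mem hs, indicator_of_mem]; rfl
    exact ⟨h1, hs.1, hs.2⟩
  · rw [indicator_of_notMem hs, indicator_of_notMem]
    exact fun h => hs ⟨h.2.1, h.2.2⟩

lemma tri_right_section_zero {a b s : ℝ} (f : ℝ → ℝ → ℝ) (h : s ∉ Ioo a b) :
    (fun r => {q : ℝ × ℝ | a < q.2 ∧ q.2 < q.1 ∧ q.1 < b}.indicator (Function.uncurry f) (r, s)) =
      fun _ => 0 := by
  ext r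
  rw [indicator_of_notMem]
  exact fun h' => h ⟨h'.1, h'.2.1.trans h'.2.2⟩

lemma intervalIntegral_eq_Ioo {a b : ℝ} (hab : a ≤ b) (f : ℝ → ℝ) :
    ∫ s in a..b, f s = ∫ s in Ioo a b, f s := by
  rw [intervalIntegral.integral_of_le hab, integral_Ioc_eq_integral_Ioo]

lemma integral_tri_left {a b : ℝ} (hab : a ≤ b) (f : ℝ → ℝ → ℝ) :
    ∫ r, ∫ s, {q : ℝ × ℝ | a < q.2 ∧ q.2 < q.1 ∧ q.1 < b}.indicator (Function.uncurry f) (r, s) =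
      ∫ r in a..b, ∫ s in a..r, f r s := by
  rw [intervalIntegral_eq_Ioo hab, ← integral_indicator measurableSet_Ioo]
  congr 1
  ext r
  by_cases hr : r ∈ Ioo a b
  · rw [indicator_of_mem hr, tri_left_section f hr.2, integral_indicator measurableSet_Ioo,
      intervalIntegral_eq_Ioo hr.1.le]
  · rw [indicator_of_notMem hr, tri_left_section_zero f hr, integral_zero]

lemma integral_tri_right {a b : ℝ} (hab : a ≤ b) (f : ℝ → ℝ → ℝ) :
    ∫ s, ∫ r, {q : ℝ × ℝ | a < q.2 ∧ q.2 < q.1 ∧ q.1 < b}.indicator (Function.uncurry f) (r, s) =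
      ∫ s in a..b, ∫ r in s..b, f r s := by
  rw [intervalIntegral_eq_Ioo hab, ← integral_indicator measurableSet_Ioo]
  congr 1
  ext r
  by_cases hr : r ∈ Ioo a b
  · rw [indicator_of_mem hr, tri_right_section f hr.1, integral_indicator measurableSet_Ioo,
      intervalIntegral_eq_Ioo hr.2.le]
  · rw [indicator_of_notMem hr, tri_right_section_zero f hr, integral_zero]

lemma TriInt.swap {a b : ℝ} {f : ℝ → ℝ → ℝ} (h : TriInt a b f) (hab : a ≤ b) :
    ∫ r in a..b, ∫ s in a..r, f r s = ∫ s in a..b, ∫ r in s..b, f r s := by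
  rw [← integral_tri_left hab, ← integral_tri_right hab]
  exact integral_integral_swap h

lemma TriInt.intervalIntegrable_left {a b : ℝ} {f : ℝ → ℝ → ℝ} (h : TriInt a b f) (hab : a ≤ b) :
    IntervalIntegrable (fun r => ∫ s in a..r, f r s) volume a b := by
  have h1 := h.integral_prod_left
  rw [intervalIntegrable_iff_integrableOn_Ioo_of_le hab]
  refine (h1.integrableOn (s := Ioo a b)).congr_fun (fun r hr => ?_) measurableSet_Ioo
  simp only
  rw [tri_left_section f hr.2, integral_indicator measurableSet_Ioo,
      intervalIntegral_eq_Ioo hr.1.le]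

lemma TriInt.intervalIntegrable_right {a b : ℝ} {f : ℝ → ℝ → ℝ} (h : TriInt a b f) (hab : a ≤ b) :
    IntervalIntegrable (fun s => ∫ r in s..b, f r s) volume a b := by
  have h1 := h.integral_prod_right
  rw [intervalIntegrable_iff_integrableOn_Ioo_of_le hab]
  refine (h1.integrableOn (s := Ioo a b)).congr_fun (fun r hr => ?_) measurableSet_Ioo
  simp only
  rw [tri_right_section f hr.1, integral_indicator measurableSet_Ioo,
      intervalIntegral_eq_Ioo hr.2.le]

/-- Tonelli with a majorant given section by section: D dominates on each section, and φ dominates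
the integrals of D. In the applications both are explicit powers. -/
lemma TriInt.of_left {a b : ℝ} (hab : a ≤ b) {f D : ℝ → ℝ → ℝ} {φ : ℝ → ℝ}
    (hf : Measurable (Function.uncurry f))
    (hD : ∀ r, a < r → r < b → ∀ s, a < s → s < r → |f r s| ≤ D r s)
    (hDi : ∀ r, a < r → r < b → IntervalIntegrable (D r) volume a r)
    (hφ : ∀ r, a < r → r < b → ∫ s in a..r, D r s ≤ φ r)
    (hφi : IntervalIntegrable φ volume a b) : TriInt a b f := by
  have hfm := hf.indicator (measurableSet_tri a b)
  rw [TriInt, integrable_prod_iff hfm.aestronglyMeasurable]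
  have hfr : ∀ r, Measurable (f r) := fun r => hf.comp measurable_prodMk_left
  have hi : ∀ r, a < r → r < b → IntervalIntegrable (f r) volume a r := fun r h1 h2 =>
    intervalIntegrable_of_Ioo h1.le (hfr r) (hD r h1 h2) (hDi r h1 h2)
  constructor
  · refine Eventually.of_forall fun r => ?_
    by_cases hr : r ∈ Ioo a b
    · rw [tri_left_section f hr.2, integrable_indicator_iff measurableSet_Ioo,
        ← intervalIntegrable_iff_integrableOn_Ioo_of_le hr.1.le]
      exact hi r hr.1 hr.2
    · rw [tri_left_section_zero f hr]; exact integrable_zero _ _ _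
  · rw [intervalIntegrable_iff_integrableOn_Ioo_of_le hab,
      ← integrable_indicator_iff measurableSet_Ioo] at hφi
    refine hφi.mono' hfm.norm.stronglyMeasurable.integral_prod_right'.aestronglyMeasurable
      (Eventually.of_forall fun r => ?_)
    rw [Real.norm_of_nonneg (by positivity)]
    by_cases hr : r ∈ Ioo a b
    · rw [indicator_of_mem hr]
      refine le_trans ?_ (hφ r hr.1 hr.2)
      have : (fun s => ‖{q : ℝ × ℝ | a < q.2 ∧ q.2 < q.1 ∧ q.1 < b}.indicator
          (Function.uncurry f) (r, s)‖) = (Ioo a r).indicator fun s => ‖f r s‖ := by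
        ext s
        rw [congrFun (tri_left_section f hr.2) s, norm_indicator_eq_indicator_norm]
      rw [this, integral_indicator measurableSet_Ioo, ← intervalIntegral_eq_Ioo hr.1.le]
      exact integral_mono_Ioo hr.1.le (hi r hr.1 hr.2).norm (hDi r hr.1 hr.2) (hD r hr.1 hr.2)
    · rw [indicator_of_notMem hr]
      simp [congrFun (tri_left_section_zero f hr) _]

lemma TriInt.of_right {a b : ℝ} (hab : a ≤ b) {f D : ℝ → ℝ → ℝ} {φ : ℝ → ℝ}
    (hf : Measurable (Function.uncurry f))
    (hD : ∀ s, a < s → s < b → ∀ r, s < r → r < b → |f r s| ≤ D r s)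
    (hDi : ∀ s, a < s → s < b → IntervalIntegrable (fun r => D r s) volume s b)
    (hφ : ∀ s, a < s → s < b → ∫ r in s..b, D r s ≤ φ s)
    (hφi : IntervalIntegrable φ volume a b) : TriInt a b f := by
  have hfm := hf.indicator (measurableSet_tri a b)
  rw [TriInt, integrable_prod_iff' hfm.aestronglyMeasurable]
  have hfr : ∀ s, Measurable (fun r => f r s) := fun r => hf.comp measurable_prodMk_right
  have hi : ∀ s, a < s → s < b → IntervalIntegrable (fun r => f r s) volume s b := fun r h1 h2 =>
    intervalIntegrable_of_Ioo h2.le (hfr r) (hD r h1 h2) (hDi r h1 h2)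
  constructor
  · refine Eventually.of_forall fun s => ?_
    by_cases hr : s ∈ Ioo a b
    · rw [tri_right_section f hr.1, integrable_indicator_iff measurableSet_Ioo,
        ← intervalIntegrable_iff_integrableOn_Ioo_of_le hr.2.le]
      exact hi s hr.1 hr.2
    · rw [tri_right_section_zero f hr]; exact integrable_zero _ _ _
  · rw [intervalIntegrable_iff_integrableOn_Ioo_of_le hab,
      ← integrable_indicator_iff measurableSet_Ioo] at hφi
    refine hφi.mono' hfm.norm.stronglyMeasurable.integral_prod_left'.aestronglyMeasurable
      (Eventually.of_forall fun s => ?_)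
    rw [Real.norm_of_nonneg (by positivity)]
    by_cases hr : s ∈ Ioo a b
    · rw [indicator_of_mem hr]
      refine le_trans ?_ (hφ s hr.1 hr.2)
      have : (fun r => ‖{q : ℝ × ℝ | a < q.2 ∧ q.2 < q.1 ∧ q.1 < b}.indicator
          (Function.uncurry f) (r, s)‖) = (Ioo s b).indicator fun r => ‖f r s‖ := by
        ext r
        rw [congrFun (tri_right_section f hr.1) r, norm_indicator_eq_indicator_norm]
      rw [this, integral_indicator measurableSet_Ioo, ← intervalIntegral_eq_Ioo hr.2.le]
      exact integral_mono_Ioo hr.2.le (hi s hr.1 hr.2).norm (hDi s hr.1 hr.2) (hD s hr.1 hr.2)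
    · rw [indicator_of_notMem hr]
      simp [congrFun (tri_right_section_zero f hr) _]

end RoughFrac

end

noncomputable section

namespace RoughFrac

open Filter Topology

/-! ### Bounds for fractional derivatives -/

/-- The constant of `fracLeft_bound`. -/
def weylC (γ p q : ℝ) : ℝ := (1 + γ * betaR q (p - γ)) / Real.Gamma (1 - γ)

lemma weylC_pos {γ p q : ℝ} (hγ : 0 < γ) (hγ1 : γ < 1) (hp : γ < p) (hq : 0 < q) :
    0 < weylC γ p q := by
  have := betaR_pos hq (sub_pos.2 hp)
  have := Real.Gamma_pos_of_pos (sub_pos.2 hγ1)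
  unfold weylC
  positivity

lemma div_rpow_eq_mul_rpow_neg {x : ℝ} (hx : 0 ≤ x) (y γ : ℝ) : y / x ^ γ = y * x ^ (-γ) := by
  rw [Real.rpow_neg hx, div_eq_mul_inv]

lemma fracLeft_inner_bound {γ p q : ℝ} {a r Ψ : ℝ} {e : ℝ → ℝ}
    (he : ∀ s, a < s → s < r → |e s| ≤ Ψ * (r - s) ^ p * (s - a) ^ (q - 1)) :
    ∀ s, a < s → s < r →
      |e s / (r - s) ^ (γ + 1)| ≤ Ψ * ((s - a) ^ (q - 1) * (r - s) ^ (p - γ - 1)) := by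
  intro s h1 h2
  have h : 0 < r - s := by linarith
  rw [abs_div, abs_of_pos (Real.rpow_pos_of_pos h _), div_le_iff₀ (Real.rpow_pos_of_pos h _)]
  refine (he s h1 h2).trans (le_of_eq ?_)
  rw [mul_assoc, mul_assoc, mul_assoc, ← Real.rpow_add h, show p - γ - 1 + (γ + 1) = p by ring]
  ring

/-- The increments e are left free, rather than being g r - g s, so that compensated derivatives are
covered too. The inner integral is a beta integral, convergent at s = r because γ < p and at s = a
because 0 < q, and it scales like the boundary term. -/
lemma fracLeft_bound {γ p q : ℝ} (hγ : 0 < γ) (hγ1 : γ < 1) (hp : γ < p) (hq : 0 < q)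
    {a r A Ψ : ℝ} {e : ℝ → ℝ} (har : a < r) (hA : |A| ≤ Ψ * (r - a) ^ (p + q - 1))
    (he : ∀ s, a < s → s < r → |e s| ≤ Ψ * (r - s) ^ p * (s - a) ^ (q - 1)) :
    |1 / Real.Gamma (1 - γ) * (A / (r - a) ^ γ + γ * ∫ s in a..r, e s / (r - s) ^ (γ + 1))| ≤
      weylC γ p q * Ψ * (r - a) ^ (p - γ + q - 1) := by
  have h0 : 0 < r - a := by linarith
  have hG := Real.Gamma_pos_of_pos (sub_pos.2 hγ1)
  have h1 : |A / (r - a) ^ γ| ≤ Ψ * (r - a) ^ (p - γ + q - 1) := by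
    rw [abs_div, abs_of_pos (Real.rpow_pos_of_pos h0 _), div_le_iff₀ (Real.rpow_pos_of_pos h0 _),
      mul_assoc, ← Real.rpow_add h0, show p - γ + q - 1 + γ = p + q - 1 by ring]
    exact hA
  have h2 : |∫ s in a..r, e s / (r - s) ^ (γ + 1)| ≤
      Ψ * (betaR q (p - γ) * (r - a) ^ (p - γ + q - 1)) := by
    refine (abs_integral_le_of_Ioo har.le (fracLeft_inner_bound he)
      ((intervalIntegrable_beta hq (sub_pos.2 hp) har.le).const_mul _)).trans (le_of_eq ?_)
    rw [intervalIntegral.integral_const_mul, integral_beta a r har]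
    congr 3
    ring
  rw [abs_mul, abs_of_pos (by positivity : 0 < 1 / Real.Gamma (1 - γ))]
  calc _ ≤ 1 / Real.Gamma (1 - γ) * (Ψ * (r - a) ^ (p - γ + q - 1) +
        γ * (Ψ * (betaR q (p - γ) * (r - a) ^ (p - γ + q - 1)))) := by
        refine mul_le_mul_of_nonneg_left ((abs_add_le _ _).trans (add_le_add h1 ?_)) (by positivity)
        rw [abs_mul, abs_of_pos hγ]
        exact mul_le_mul_of_nonneg_left h2 hγ.le
    _ = _ := by rw [weylC]; ring

lemma fracRight_bound {γ p q : ℝ} (hγ : 0 < γ) (hγ1 : γ < 1) (hp : γ < p) (hq : 0 < q)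
    {b r A Ψ : ℝ} {e : ℝ → ℝ} (hrb : r < b) (hA : |A| ≤ Ψ * (b - r) ^ (p + q - 1))
    (he : ∀ s, r < s → s < b → |e s| ≤ Ψ * (s - r) ^ p * (b - s) ^ (q - 1)) :
    |1 / Real.Gamma (1 - γ) * (A / (b - r) ^ γ + γ * ∫ s in r..b, e s / (s - r) ^ (γ + 1))| ≤
      weylC γ p q * Ψ * (b - r) ^ (p - γ + q - 1) := by
  have h := fracLeft_bound hγ hγ1 hp hq (a := -b) (r := -r) (A := A) (Ψ := Ψ)
    (e := fun s => e (-s)) (by linarith) (by rwa [show -r - -b = b - r by ring]) (fun s h1 h2 => by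
      have := he (-s) (by linarith) (by linarith)
      rwa [show -r - s = -s - r by ring, show s - -b = b - -s by ring])
  rw [show -r - -b = b - r by ring] at h
  have e1 : ∫ s in -b..-r, e (-s) / (-r - s) ^ (γ + 1) =
      ∫ s in r..b, e s / (s - r) ^ (γ + 1) := by
    rw [← intervalIntegral.integral_comp_neg (a := r) (b := b)]
    simp only [neg_neg]
    congr 1
    ext s
    rw [show -r - -s = s - r by ring]
  rwa [e1] at h

lemma weylLeft_bound {γ p q : ℝ} (hγ : 0 < γ) (hγ1 : γ < 1) (hp : γ < p) (hq : 0 < q)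
    {a r Ψ : ℝ} {g : ℝ → ℝ} (har : a < r) (hA : |g r| ≤ Ψ * (r - a) ^ (p + q - 1))
    (he : ∀ s, a < s → s < r → |g r - g s| ≤ Ψ * (r - s) ^ p * (s - a) ^ (q - 1)) :
    |weylLeft γ a g r| ≤ weylC γ p q * Ψ * (r - a) ^ (p - γ + q - 1) :=
  fracLeft_bound (e := fun s => g r - g s) hγ hγ1 hp hq har hA he

lemma weylRight_bound {γ p q : ℝ} (hγ : 0 < γ) (hγ1 : γ < 1) (hp : γ < p) (hq : 0 < q)
    {b r Ψ : ℝ} {g : ℝ → ℝ} (hrb : r < b) (hA : |g r| ≤ Ψ * (b - r) ^ (p + q - 1))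
    (he : ∀ s, r < s → s < b → |g r - g s| ≤ Ψ * (s - r) ^ p * (b - s) ^ (q - 1)) :
    |weylRight γ b g r| ≤ weylC γ p q * Ψ * (b - r) ^ (p - γ + q - 1) :=
  fracRight_bound (e := fun s => g r - g s) hγ hγ1 hp hq hrb hA he

/-- Reflection of the line reduces right-sided statements to left-sided ones. -/
lemma weylRight_eq_weylLeft_neg (γ b : ℝ) (g : ℝ → ℝ) (t : ℝ) :
    weylRight γ b g t = weylLeft γ (-b) (fun s => g (-s)) (-t) := by
  unfold weylRight weylLeft
  simp only [neg_neg]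
  rw [show -t - -b = b - t by ring]
  congr 3
  rw [← intervalIntegral.integral_comp_neg (a := t) (b := b)]
  congr 1
  ext s
  rw [show -t - -s = s - t by ring, neg_neg]

/-! ### Fractional derivatives of primitives -/

lemma integral_rpow_shift {γ t a w : ℝ} (hγ1 : γ < 1) (haw : a ≤ w) (hw : w < t) :
    ∫ s in a..w, (t - s) ^ (γ - 2) = ((t - w) ^ (γ - 1) - (t - a) ^ (γ - 1)) / (1 - γ) := by
  rw [intervalIntegral.integral_comp_sub_left (fun s => s ^ (γ - 2)), integral_rpow]
  · rw [show γ - 2 + 1 = γ - 1 by ring, ← neg_div_neg_eq]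
    congr 1 <;> ring
  · right
    refine ⟨by linarith, ?_⟩
    rw [uIcc_of_le (by linarith)]
    intro h
    linarith [h.1]

/-- Differentiating a primitive to the order 1 - γ is integrating its density to the order γ. Write
φ t - φ s as the integral of j over [s, t] and exchange the integrals: the inner integral of
(t-s)^{γ-2} produces (t-w)^{γ-1}, which is wanted, and (t-a)^{γ-1}, which cancels the boundary term.
-/
lemma weylLeft_of_primitive {γ q C a t : ℝ} (hγ : 0 < γ) (hγ1 : γ < 1) (hq : 0 < q) (hat : a < t)
    {j φ : ℝ → ℝ} (hj : Measurable j) (hjb : ∀ w, a < w → w < t → |j w| ≤ C * (w - a) ^ (q - 1))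
    (hφ : ∀ s, a ≤ s → s ≤ t → φ s = ∫ w in a..s, j w) :
    weylLeft (1 - γ) a φ t = 1 / Real.Gamma γ * ∫ w in a..t, (t - w) ^ (γ - 1) * j w := by
  have h0 : 0 < t - a := by linarith
  have hji : ∀ s, a ≤ s → s ≤ t → IntervalIntegrable j volume a s := fun s h1 h2 =>
    intervalIntegrable_of_Ioo h1 hj (fun w h3 h4 => hjb w h3 (h4.trans_le h2))
      ((intervalIntegrable_rpow_left hq h1).const_mul C)
  have hbeta : IntervalIntegrable (fun w => C * (w - a) ^ (q - 1) * (t - w) ^ (γ - 1))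
      volume a t := by
    simpa only [mul_assoc] using (intervalIntegrable_beta hq hγ hat.le).const_mul C
  have hsec : ∀ w, w < t → IntervalIntegrable (fun s => (t - s) ^ (γ - 2)) volume a w := by
    intro w hw
    refine ContinuousOn.intervalIntegrable fun s hs => ?_
    refine ContinuousAt.continuousWithinAt (ContinuousAt.rpow_const (by fun_prop) (Or.inl ?_))
    have : s < t := lt_of_le_of_lt hs.2 (max_lt hat hw)
    linarith
  have htri : TriInt a t (fun w s => (t - s) ^ (γ - 2) * j w) := by
    refine TriInt.of_left hat.le (D := fun w s => (t - s) ^ (γ - 2) * (C * (w - a) ^ (q - 1)))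
      (φ := fun w => C * (w - a) ^ (q - 1) * (t - w) ^ (γ - 1) * (1 / (1 - γ)))
      ?_ ?_ ?_ ?_ (hbeta.mul_const _)
    · fun_prop
    · intro w h1 h2 s h3 h4
      rw [abs_mul, abs_of_nonneg (Real.rpow_nonneg (by linarith) _)]
      exact mul_le_mul_of_nonneg_left (hjb w h1 h2) (Real.rpow_nonneg (by linarith) _)
    · intro w h1 h2
      exact (hsec w h2).mul_const _
    · intro w h1 h2
      have hC : 0 ≤ C * (w - a) ^ (q - 1) := (abs_nonneg _).trans (hjb w h1 h2)
      rw [intervalIntegral.integral_mul_const, integral_rpow_shift hγ1 h1.le h2, mul_comm,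
        mul_assoc (C * (w - a) ^ (q - 1))]
      refine mul_le_mul_of_nonneg_left ?_ hC
      rw [mul_one_div]
      have := Real.rpow_nonneg h0.le (γ - 1)
      have : 0 < 1 - γ := by linarith
      gcongr
      linarith
  have hsw := htri.swap hat.le
  have e1 : ∫ s in a..t, (φ t - φ s) / (t - s) ^ ((1 - γ) + 1) =
      ∫ s in a..t, ∫ w in s..t, (t - s) ^ (γ - 2) * j w := by
    refine integral_congr_Ioo hat.le fun s h1 h2 => ?_
    rw [hφ t hat.le le_rfl, hφ s h1.le h2.le, intervalIntegral.integral_interval_sub_left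
      (hji t hat.le le_rfl) (hji s h1.le h2.le), intervalIntegral.integral_const_mul,
      div_rpow_eq_mul_rpow_neg (by linarith), mul_comm]
    congr 2
    ring
  have e2 : ∫ w in a..t, ∫ s in a..w, (t - s) ^ (γ - 2) * j w =
      ∫ w in a..t, (1 / (1 - γ)) * ((t - w) ^ (γ - 1) * j w - (t - a) ^ (γ - 1) * j w) := by
    refine integral_congr_Ioo hat.le fun w h1 h2 => ?_
    rw [intervalIntegral.integral_mul_const, integral_rpow_shift hγ1 h1.le h2]
    ring
  have hi : IntervalIntegrable (fun w => (t - w) ^ (γ - 1) * j w) volume a t := by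
    refine intervalIntegrable_of_Ioo hat.le (by fun_prop) (fun w h1 h2 => ?_) hbeta
    rw [abs_mul, abs_of_nonneg (Real.rpow_nonneg (by linarith) _), mul_comm]
    exact mul_le_mul_of_nonneg_right (hjb w h1 h2) (Real.rpow_nonneg (by linarith) _)
  have hγ' : 1 - γ ≠ 0 := by linarith
  rw [weylLeft, e1, ← hsw, e2, intervalIntegral.integral_const_mul,
    intervalIntegral.integral_sub hi ((hji t hat.le le_rfl).const_mul _),
    intervalIntegral.integral_const_mul, ← hφ t hat.le le_rfl, sub_sub_cancel,
    div_rpow_eq_mul_rpow_neg h0.le, neg_sub]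
  field_simp
  ring

lemma weylRight_of_primitive {γ q C t b : ℝ} (hγ : 0 < γ) (hγ1 : γ < 1) (hq : 0 < q) (htb : t < b)
    {j φ : ℝ → ℝ} (hj : Measurable j) (hjb : ∀ w, t < w → w < b → |j w| ≤ C * (b - w) ^ (q - 1))
    (hφ : ∀ s, t ≤ s → s ≤ b → φ s = ∫ w in s..b, j w) :
    weylRight (1 - γ) b φ t = 1 / Real.Gamma γ * ∫ w in t..b, (w - t) ^ (γ - 1) * j w := by
  rw [weylRight_eq_weylLeft_neg, weylLeft_of_primitive (C := C) hγ hγ1 hq (neg_lt_neg htb)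
    (j := fun w => j (-w)) (hj.comp measurable_neg), ← intervalIntegral.integral_comp_neg]
  · congr 2
    ext w
    rw [neg_neg, show -t - -w = w - t by ring]
  · intro w h1 h2
    rw [show w - -b = b - -w by ring]
    exact hjb _ (by linarith) (by linarith)
  · intro s h1 h2
    rw [hφ _ (by linarith) (by linarith), intervalIntegral.integral_comp_neg, neg_neg]

/-! ### Integration by parts -/

/-- Functions on `(a, b)` whose left-sided derivative of order `γ` is absolutely convergent and
integrable, by virtue of a weighted Hölder condition. -/
structure FracClass (γ p q a b : ℝ) (g Ψ : ℝ → ℝ) : Prop where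
  meas : Measurable g
  bd : ∀ r, a < r → r < b → |g r| ≤ Ψ r * (r - a) ^ (p + q - 1)
  inc : ∀ s r, a < s → s < r → r < b → |g r - g s| ≤ Ψ r * (r - s) ^ p * (s - a) ^ (q - 1)
  int : IntervalIntegrable (fun r => Ψ r * (r - a) ^ (p - γ + q - 1)) volume a b

lemma measurable_weylLeft {X : Type*} [MeasurableSpace X] {γ : ℝ} {g : X → ℝ → ℝ} {a t : X → ℝ}
    (hg : Measurable (Function.uncurry g)) (ha : Measurable a) (ht : Measurable t) :
    Measurable fun x => weylLeft γ (a x) (g x) (t x) := by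
  have h1 : Measurable fun x => g x (t x) := hg.comp (measurable_id.prodMk ht)
  have h2 : Measurable fun x => ∫ s in a x..t x, (g x (t x) - g x s) / (t x - s) ^ (γ + 1) := by
    refine measurable_intervalIntegral ?_ ha ht
    have h3 : Measurable fun q : X × ℝ => g q.1 (t q.1) := h1.comp measurable_fst
    have h4 : Measurable fun q : X × ℝ => t q.1 := ht.comp measurable_fst
    exact (h3.sub hg).div ((h4.sub measurable_snd).pow_const _)
  exact measurable_const.mul ((h1.div ((ht.sub ha).pow_const _)).add (measurable_const.mul h2))

lemma measurable_weylRight {X : Type*} [MeasurableSpace X] {γ : ℝ} {g : X → ℝ → ℝ} {b t : X → ℝ}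
    (hg : Measurable (Function.uncurry g)) (hb : Measurable b) (ht : Measurable t) :
    Measurable fun x => weylRight γ (b x) (g x) (t x) := by
  simp only [weylRight_eq_weylLeft_neg]
  exact measurable_weylLeft (g := fun x s => g x (-s))
    (hg.comp (measurable_fst.prodMk measurable_snd.neg)) hb.neg ht.neg

namespace FracClass

variable {γ p q a b : ℝ} {g Ψ : ℝ → ℝ}

lemma weyl_bd (h : FracClass γ p q a b g Ψ) (hγ : 0 < γ) (hγ1 : γ < 1) (hp : γ < p) (hq : 0 < q)
    (r : ℝ) (h1 : a < r) (h2 : r < b) :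
    |weylLeft γ a g r| ≤ weylC γ p q * (Ψ r * (r - a) ^ (p - γ + q - 1)) := by
  rw [← mul_assoc]
  exact weylLeft_bound hγ hγ1 hp hq h1 (h.bd r h1 h2) (fun s h3 h4 => h.inc s r h3 h4 h2)

lemma measurable_weyl (h : FracClass γ p q a b g Ψ) : Measurable (weylLeft γ a g) :=
  measurable_weylLeft (X := ℝ) (g := fun _ => g) (a := fun _ => a) (t := fun x => x)
    (h.meas.comp measurable_snd) measurable_const measurable_id

lemma weyl_int (h : FracClass γ p q a b g Ψ) (hγ : 0 < γ) (hγ1 : γ < 1) (hp : γ < p) (hq : 0 < q)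
    (hab : a ≤ b) : IntervalIntegrable (weylLeft γ a g) volume a b :=
  intervalIntegrable_of_Ioo hab h.measurable_weyl (h.weyl_bd hγ hγ1 hp hq) (h.int.const_mul _)

lemma left_int (h : FracClass γ p q a b g Ψ) (hab : a ≤ b) :
    IntervalIntegrable (fun r => (r - a) ^ (-γ) * g r) volume a b := by
  refine intervalIntegrable_of_Ioo hab (by have := h.meas; fun_prop) (fun r h1 h2 => ?_) h.int
  have h0 : 0 < r - a := by linarith
  rw [abs_mul, abs_of_pos (Real.rpow_pos_of_pos h0 _),
    show p - γ + q - 1 = (p + q - 1) + -γ by ring, Real.rpow_add h0, ← mul_assoc, mul_comm]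
  exact mul_le_mul_of_nonneg_right (h.bd r h1 h2) (Real.rpow_nonneg h0.le _)

lemma int_self (h : FracClass γ p q a b g Ψ) (hγ : 0 < γ) (hab : a ≤ b) :
    IntervalIntegrable g volume a b := by
  refine intervalIntegrable_of_Ioo hab h.meas (fun r h1 h2 => ?_)
    ((h.left_int hab).norm.const_mul ((b - a) ^ γ))
  have h0 : 0 < r - a := by linarith
  rw [norm_mul, Real.norm_eq_abs, Real.norm_eq_abs, abs_of_pos (Real.rpow_pos_of_pos h0 _),
    ← mul_assoc]
  refine le_mul_of_one_le_left (abs_nonneg _) ?_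
  rw [Real.rpow_neg h0.le, ← div_eq_mul_inv, one_le_div (Real.rpow_pos_of_pos h0 _)]
  exact Real.rpow_le_rpow h0.le (by linarith) hγ.le

lemma right_int (h : FracClass γ p q a b g Ψ) (hγ1 : γ < 1) (hp : γ < p) (hq : 0 < q)
    (x : ℝ) (h1 : a < x) (h2 : x < b) :
    IntervalIntegrable (fun r => (x - r) ^ (-γ) * g r) volume a x := by
  have i1 : IntervalIntegrable (fun r => |g x| * (x - r) ^ (-γ)) volume a x := by
    have := intervalIntegrable_rpow_right (q := 1 - γ) (by linarith) h1.le
    rw [show 1 - γ - 1 = -γ by ring] at this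
    exact this.const_mul _
  have i2 := (intervalIntegrable_beta (p := q) (q := p - γ + 1) hq (by linarith) h1.le).const_mul
    (Ψ x)
  refine intervalIntegrable_of_Ioo h1.le (by have := h.meas; fun_prop) (fun r h3 h4 => ?_)
    (i1.add i2)
  have h0 : 0 < x - r := by linarith
  have hg : |g r| ≤ |g x| + Ψ x * (x - r) ^ p * (r - a) ^ (q - 1) := by
    have := h.inc r x h3 h4 h2
    have h5 := abs_sub_abs_le_abs_sub (g r) (g x)
    rw [abs_sub_comm] at h5
    linarith
  rw [abs_mul, abs_of_pos (Real.rpow_pos_of_pos h0 _)]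
  refine (mul_le_mul_of_nonneg_left hg (Real.rpow_nonneg h0.le _)).trans (le_of_eq ?_)
  rw [show p - γ + 1 - 1 = -γ + p by ring, Real.rpow_add h0]
  ring

end FracClass

end RoughFrac

end

/-! ### Fractional integration as the inverse of fractional differentiation -/

noncomputable section

namespace RoughFrac

open Filter Topology

lemma integral_rpow_reg_left {γ δ a r : ℝ} (hγ : 0 < γ) (hδ : 0 < δ) (har : a ≤ r) :
    ∫ s in a..r, (r - s + δ) ^ (-γ - 1) = (δ ^ (-γ) - (r - a + δ) ^ (-γ)) / γ := by
  have h := integral_rpow_shift (γ := 1 - γ) (t := r + δ) (by linarith) har (by linarith)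
  rw [show 1 - γ - 2 = -γ - 1 by ring, show 1 - γ - 1 = -γ by ring, sub_sub_cancel,
    show r + δ - r = δ by ring, show r + δ - a = r - a + δ by ring] at h
  rw [← h]
  congr 1
  ext s
  congr 1
  ring

lemma integral_rpow_reg_right {γ δ s x : ℝ} (hγ : 0 < γ) (hδ : 0 < δ) (hsx : s ≤ x) :
    ∫ r in s..x, (r - s + δ) ^ (-γ - 1) = (δ ^ (-γ) - (x - s + δ) ^ (-γ)) / γ := by
  have h := integral_rpow_reg_left hγ hδ (neg_le_neg hsx)
  rw [show -s - -x = x - s by ring, ← intervalIntegral.integral_comp_neg] at h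
  rw [← h]
  congr 1
  ext s
  congr 1
  ring

lemma continuous_rpow_reg {δ : ℝ} (hδ : 0 < δ) (k r : ℝ) {a : ℝ} (har : a ≤ r) :
    IntervalIntegrable (fun s => (r - s + δ) ^ k) volume a r := by
  refine ContinuousOn.intervalIntegrable fun s hs => ?_
  refine ContinuousAt.continuousWithinAt (ContinuousAt.rpow_const (by fun_prop) (Or.inl ?_))
  rw [uIcc_of_le har] at hs
  linarith [hs.2]

lemma rpow_neg_le_of_le {x y k : ℝ} (hx : 0 < x) (hxy : x ≤ y) (hk : k ≤ 0) : y ^ k ≤ x ^ k :=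
  Real.rpow_le_rpow_of_nonpos hx hxy hk

lemma tendsto_rpow_reg {c k : ℝ} (hc : 0 < c) :
    Tendsto (fun δ : ℝ => (c + δ) ^ k) (𝓝[>] 0) (𝓝 (c ^ k)) := by
  have h : ContinuousAt (fun δ : ℝ => (c + δ) ^ k) 0 :=
    ContinuousAt.rpow_const (by fun_prop) (Or.inl (by linarith))
  have := h.tendsto
  simp only [add_zero] at this
  exact this.mono_left nhdsWithin_le_nhds

namespace FracClass

variable {γ p q a b : ℝ} {g Ψ : ℝ → ℝ}

/-- In the derivative itself g r - g s cannot be split, since (r-s)^{-γ-1} is not integrable.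
Replacing r - s by r - s + δ makes each half integrable; after Fubini the two terms in δ^{-γ}
cancel. -/
lemma reg_identity (h : FracClass γ p q a b g Ψ) (hγ : 0 < γ) {x δ : ℝ} (hδ : 0 < δ)
    (h1 : a < x) (h2 : x < b) :
    γ * ∫ r in a..x, ∫ s in a..r, (g r - g s) * (r - s + δ) ^ (-γ - 1) =
      (∫ u in a..x, (x - u + δ) ^ (-γ) * g u) - ∫ r in a..x, (r - a + δ) ^ (-γ) * g r := by
  have hgm := h.meas
  have gi : IntervalIntegrable g volume a x :=
    (h.int_self hγ (h1.trans h2).le).mono_set (by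
      rw [uIcc_of_le h1.le, uIcc_of_le (h1.trans h2).le]; exact Icc_subset_Icc_right h2.le)
  have gis : ∀ r, a < r → r < x → IntervalIntegrable g volume a r := fun r h3 h4 =>
    gi.mono_set (by rw [uIcc_of_le h1.le, uIcc_of_le h3.le]; exact Icc_subset_Icc_right h4.le)
  have bdd : ∀ r s, 0 ≤ r - s → (r - s + δ) ^ (-γ - 1) ≤ δ ^ (-γ - 1) := fun r s hrs =>
    rpow_neg_le_of_le hδ (by linarith) (by linarith)
  have bdd' : ∀ y, 0 ≤ y → (y + δ) ^ (-γ) ≤ δ ^ (-γ) := fun y hy =>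
    rpow_neg_le_of_le hδ (by linarith) (by linarith)
  have i1 : IntervalIntegrable (fun u => (x - u + δ) ^ (-γ) * g u) volume a x := by
    refine intervalIntegrable_of_Ioo h1.le (by fun_prop) (fun u h3 h4 => ?_)
      (gi.norm.const_mul (δ ^ (-γ)))
    rw [abs_mul, abs_of_nonneg (Real.rpow_nonneg (by linarith) _)]
    exact mul_le_mul_of_nonneg_right (bdd' _ (by linarith)) (abs_nonneg _)
  have i2 : IntervalIntegrable (fun r => (r - a + δ) ^ (-γ) * g r) volume a x := by
    refine intervalIntegrable_of_Ioo h1.le (by fun_prop) (fun u h3 h4 => ?_)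
      (gi.norm.const_mul (δ ^ (-γ)))
    rw [abs_mul, abs_of_nonneg (Real.rpow_nonneg (by linarith) _)]
    exact mul_le_mul_of_nonneg_right (bdd' _ (by linarith)) (abs_nonneg _)
  have tri : TriInt a x (fun r s => g s * (r - s + δ) ^ (-γ - 1)) := by
    refine TriInt.of_right h1.le (D := fun r s => |g s| * δ ^ (-γ - 1))
      (φ := fun s => (x - a) * (|g s| * δ ^ (-γ - 1))) (by fun_prop) ?_ ?_ ?_
      ((gi.norm.mul_const _).const_mul _)
    · intro s h3 h4 r h5 h6
      rw [abs_mul, abs_of_nonneg (Real.rpow_nonneg (by linarith) (-γ - 1))]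
      exact mul_le_mul_of_nonneg_left (bdd _ _ (by linarith)) (abs_nonneg _)
    · intro s _ _
      exact intervalIntegrable_const
    · intro s h3 h4
      rw [intervalIntegral.integral_const, smul_eq_mul]
      have := Real.rpow_pos_of_pos hδ (-γ - 1)
      gcongr
  have e1 : ∫ r in a..x, ∫ s in a..r, (g r - g s) * (r - s + δ) ^ (-γ - 1) =
      ∫ r in a..x, ((1 / γ) * (δ ^ (-γ) * g r - (r - a + δ) ^ (-γ) * g r) -
        ∫ s in a..r, g s * (r - s + δ) ^ (-γ - 1)) := by
    refine integral_congr_Ioo h1.le fun r h3 h4 => ?_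
    have hc := continuous_rpow_reg hδ (-γ - 1) r h3.le
    have hi : IntervalIntegrable (fun s => g s * (r - s + δ) ^ (-γ - 1)) volume a r := by
      refine intervalIntegrable_of_Ioo h3.le (by fun_prop) (fun u h5 h6 => ?_)
        ((gis r h3 h4).norm.mul_const (δ ^ (-γ - 1)))
      rw [abs_mul, abs_of_nonneg (Real.rpow_nonneg (by linarith) (-γ - 1))]
      exact mul_le_mul_of_nonneg_left (bdd _ _ (by linarith)) (abs_nonneg _)
    simp only [sub_mul]
    rw [intervalIntegral.integral_sub (hc.const_mul _) hi, intervalIntegral.integral_const_mul,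
      integral_rpow_reg_left hγ hδ h3.le]
    ring
  have e2 : ∫ s in a..x, ∫ r in s..x, g s * (r - s + δ) ^ (-γ - 1) =
      ∫ s in a..x, (1 / γ) * (δ ^ (-γ) * g s - (x - s + δ) ^ (-γ) * g s) := by
    refine integral_congr_Ioo h1.le fun s h3 h4 => ?_
    rw [intervalIntegral.integral_const_mul, integral_rpow_reg_right hγ hδ h4.le]
    ring
  rw [e1, intervalIntegral.integral_sub (((gi.const_mul _).sub i2).const_mul _)
    (tri.intervalIntegrable_left h1.le), tri.swap h1.le, e2, intervalIntegral.integral_const_mul,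
    intervalIntegral.integral_const_mul, intervalIntegral.integral_sub (gi.const_mul _) i2,
    intervalIntegral.integral_sub (gi.const_mul _) i1]
  field_simp
  ring

/-- This is I^1 D^γ = I^{1-γ}. It is the limit δ → 0 of `reg_identity`: the regularized integrands
are dominated by the unregularized ones, and the term at the left end cancels the boundary term of
the derivative. -/
lemma integral_weyl (h : FracClass γ p q a b g Ψ) (hγ : 0 < γ) (hγ1 : γ < 1) (hp : γ < p)
    (hq : 0 < q) {x : ℝ} (h1 : a < x) (h2 : x < b) :
    ∫ r in a..x, weylLeft γ a g r =
      1 / Real.Gamma (1 - γ) * ∫ u in a..x, (x - u) ^ (-γ) * g u := by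
  have hgm := h.meas
  have hab := h1.trans h2
  have hsub : uIcc a x ⊆ uIcc a b := by
    rw [uIcc_of_le h1.le, uIcc_of_le hab.le]; exact Icc_subset_Icc_right h2.le
  have hl := (h.left_int hab.le).mono_set hsub
  have hr := h.right_int hγ1 hp hq x h1 h2
  have hint := h.int.mono_set hsub
  have hδ0 : ∀ᶠ δ : ℝ in 𝓝[>] 0, 0 < δ := self_mem_nhdsWithin
  have hib : ∀ r, a < r → r < b → ∀ s, a < s → s < r →
      |(g r - g s) / (r - s) ^ (γ + 1)| ≤ Ψ r * ((s - a) ^ (q - 1) * (r - s) ^ (p - γ - 1)) :=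
    fun r h3 h4 => fracLeft_inner_bound fun s h5 h6 => h.inc s r h5 h6 h4
  have hibi : ∀ r, a < r → IntervalIntegrable
      (fun s => Ψ r * ((s - a) ^ (q - 1) * (r - s) ^ (p - γ - 1))) volume a r := fun r h3 =>
    (intervalIntegrable_beta hq (sub_pos.2 hp) h3.le).const_mul _
  have hbeta : ∀ r, a < r → ∫ s in a..r, Ψ r * ((s - a) ^ (q - 1) * (r - s) ^ (p - γ - 1)) =
      betaR q (p - γ) * (Ψ r * (r - a) ^ (p - γ + q - 1)) := fun r h3 => by
    rw [intervalIntegral.integral_const_mul, integral_beta a r h3,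
      show q + (p - γ) - 1 = p - γ + q - 1 by ring]
    ring
  have hregb : ∀ δ : ℝ, 0 < δ → ∀ r, a < r → r < b → ∀ s, a < s → s < r →
      |(g r - g s) * (r - s + δ) ^ (-γ - 1)| ≤
        Ψ r * ((s - a) ^ (q - 1) * (r - s) ^ (p - γ - 1)) := fun δ hδ r h3 h4 s h5 h6 => by
    refine le_trans ?_ (hib r h3 h4 s h5 h6)
    have h0 : 0 < r - s := by linarith
    rw [div_rpow_eq_mul_rpow_neg h0.le, abs_mul, abs_mul,
      abs_of_nonneg (Real.rpow_nonneg (by linarith) _), abs_of_nonneg (Real.rpow_nonneg h0.le _),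
      show -(γ + 1) = -γ - 1 by ring]
    exact mul_le_mul_of_nonneg_left (rpow_neg_le_of_le h0 (by linarith) (by linarith))
      (abs_nonneg _)
  have t1 : Tendsto (fun δ : ℝ => ∫ r in a..x, ∫ s in a..r, (g r - g s) * (r - s + δ) ^ (-γ - 1))
      (𝓝[>] 0) (𝓝 (∫ r in a..x, ∫ s in a..r, (g r - g s) / (r - s) ^ (γ + 1))) := by
    refine tendsto_integral_Ioo h1.le (fun δ => ?_) ?_ (hint.const_mul (betaR q (p - γ))) ?_
    · exact measurable_intervalIntegral (X := ℝ)
        (f := fun r s => (g r - g s) * (r - s + δ) ^ (-γ - 1)) (by fun_prop) measurable_const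
        measurable_id
    · filter_upwards [hδ0] with δ hδ r h3 h4
      rw [← hbeta r h3]
      exact abs_integral_le_of_Ioo h3.le (hregb δ hδ r h3 (h4.trans h2)) (hibi r h3)
    · intro r h3 h4
      refine tendsto_integral_Ioo h3.le (fun δ => by fun_prop) ?_ (hibi r h3) ?_
      · filter_upwards [hδ0] with δ hδ
        exact hregb δ hδ r h3 (h4.trans h2)
      · intro s h5 h6
        rw [div_rpow_eq_mul_rpow_neg (by linarith), show -(γ + 1) = -γ - 1 by ring]
        exact (tendsto_rpow_reg (by linarith)).const_mul _
  have t2 : Tendsto (fun δ : ℝ => ∫ u in a..x, (x - u + δ) ^ (-γ) * g u) (𝓝[>] 0)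
      (𝓝 (∫ u in a..x, (x - u) ^ (-γ) * g u)) := by
    refine tendsto_integral_Ioo h1.le (fun δ => by fun_prop) ?_ hr.norm ?_
    · filter_upwards [hδ0] with δ hδ u h3 h4
      rw [norm_mul, abs_mul, Real.norm_eq_abs, Real.norm_eq_abs,
        abs_of_nonneg (Real.rpow_nonneg (by linarith) _),
        abs_of_nonneg (Real.rpow_nonneg (by linarith) _)]
      exact mul_le_mul_of_nonneg_right
        (rpow_neg_le_of_le (by linarith) (by linarith) (by linarith)) (abs_nonneg _)
    · intro u h3 h4
      exact (tendsto_rpow_reg (by linarith)).mul_const _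
  have t3 : Tendsto (fun δ : ℝ => ∫ r in a..x, (r - a + δ) ^ (-γ) * g r) (𝓝[>] 0)
      (𝓝 (∫ r in a..x, (r - a) ^ (-γ) * g r)) := by
    refine tendsto_integral_Ioo h1.le (fun δ => by fun_prop) ?_ hl.norm ?_
    · filter_upwards [hδ0] with δ hδ u h3 h4
      rw [norm_mul, abs_mul, Real.norm_eq_abs, Real.norm_eq_abs,
        abs_of_nonneg (Real.rpow_nonneg (by linarith) _),
        abs_of_nonneg (Real.rpow_nonneg (by linarith) _)]
      exact mul_le_mul_of_nonneg_right
        (rpow_neg_le_of_le (by linarith) (by linarith) (by linarith)) (abs_nonneg _)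
    · intro u h3 h4
      exact (tendsto_rpow_reg (by linarith)).mul_const _
  have key : γ * (∫ r in a..x, ∫ s in a..r, (g r - g s) / (r - s) ^ (γ + 1)) =
      (∫ u in a..x, (x - u) ^ (-γ) * g u) - ∫ r in a..x, (r - a) ^ (-γ) * g r := by
    refine tendsto_nhds_unique (t1.const_mul γ) ((t2.sub t3).congr' ?_)
    filter_upwards [hδ0] with δ hδ using (h.reg_identity hγ hδ h1 h2).symm
  have hIm : Measurable fun r => ∫ s in a..r, (g r - g s) / (r - s) ^ (γ + 1) :=
    measurable_intervalIntegral (X := ℝ)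
        (f := fun r s => (g r - g s) / (r - s) ^ (γ + 1)) (by fun_prop) measurable_const
        measurable_id
  have hIi : IntervalIntegrable (fun r => ∫ s in a..r, (g r - g s) / (r - s) ^ (γ + 1))
      volume a x := by
    refine intervalIntegrable_of_Ioo h1.le hIm (fun r h3 h4 => ?_)
      (hint.const_mul (betaR q (p - γ)))
    rw [← hbeta r h3]
    exact abs_integral_le_of_Ioo h3.le (hib r h3 (h4.trans h2)) (hibi r h3)
  have e1 : ∫ r in a..x, weylLeft γ a g r = ∫ r in a..x, 1 / Real.Gamma (1 - γ) *
      ((r - a) ^ (-γ) * g r + γ * ∫ s in a..r, (g r - g s) / (r - s) ^ (γ + 1)) := by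
    refine integral_congr_Ioo h1.le fun r h3 h4 => ?_
    rw [weylLeft, div_rpow_eq_mul_rpow_neg (by linarith), mul_comm (g r)]
  rw [e1, intervalIntegral.integral_const_mul, intervalIntegral.integral_add hl (hIi.const_mul _),
    intervalIntegral.integral_const_mul, key]
  congr 1
  ring

lemma tri_pow_mul {κ a x : ℝ} (hκ : 0 < κ) (hax : a ≤ x) {D : ℝ → ℝ} (hDm : Measurable D)
    (hD : IntervalIntegrable D volume a x) : TriInt a x (fun s r => (s - r) ^ (κ - 1) * D r) := by
  refine TriInt.of_right hax (D := fun s r => (s - r) ^ (κ - 1) * |D r|)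
      (φ := fun r => (x - a) ^ κ / κ * |D r|) (by fun_prop) ?_ ?_ ?_ (hD.norm.const_mul _)
  · intro s h3 h4 r h5 h6
    rw [abs_mul, abs_of_nonneg (Real.rpow_nonneg (by linarith) _)]
  · intro s _ h4
    exact (intervalIntegrable_rpow_left hκ h4.le).mul_const _
  · intro s h3 h4
    rw [intervalIntegral.integral_mul_const, integral_rpow_left hκ]
    refine mul_le_mul_of_nonneg_right ?_ (abs_nonneg _)
    have : (x - s) ^ κ ≤ (x - a) ^ κ := Real.rpow_le_rpow (by linarith) (by linarith) hκ.le
    gcongr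

lemma tri_pow_mul' {κ a x : ℝ} (hκ : 0 < κ) (hax : a ≤ x) {D : ℝ → ℝ} (hDm : Measurable D)
    (hD : IntervalIntegrable D volume a x) : TriInt a x (fun s r => (x - s) ^ (κ - 1) * D r) := by
  refine TriInt.of_right hax (D := fun s r => (x - s) ^ (κ - 1) * |D r|)
      (φ := fun r => (x - a) ^ κ / κ * |D r|) (by fun_prop) ?_ ?_ ?_ (hD.norm.const_mul _)
  · intro s h3 h4 r h5 h6
    rw [abs_mul, abs_of_nonneg (Real.rpow_nonneg (by linarith) _)]
  · intro s _ h4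
    exact (intervalIntegrable_rpow_right hκ h4.le).mul_const _
  · intro s h3 h4
    rw [intervalIntegral.integral_mul_const, integral_rpow_right hκ]
    refine mul_le_mul_of_nonneg_right ?_ (abs_nonneg _)
    have : (x - s) ^ κ ≤ (x - a) ^ κ := Real.rpow_le_rpow (by linarith) (by linarith) hκ.le
    gcongr

/-- Fractional integrals commute, so I^1 I^γ D^γ g = I^γ (I^1 D^γ g) = I^γ I^{1-γ} g = I^1 g. The
last equality is the beta integral B(1-γ, γ) = Γ(1-γ)Γ(γ). -/
lemma integral_fracInt_weyl (h : FracClass γ p q a b g Ψ) (hγ : 0 < γ) (hγ1 : γ < 1) (hp : γ < p)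
    (hq : 0 < q) {x : ℝ} (h1 : a < x) (h2 : x < b) :
    ∫ s in a..x, 1 / Real.Gamma γ * ∫ r in a..s, (s - r) ^ (γ - 1) * weylLeft γ a g r =
      ∫ s in a..x, g s := by
  have hgm := h.meas
  have hab := h1.trans h2
  have hsub : uIcc a x ⊆ uIcc a b := by
    rw [uIcc_of_le h1.le, uIcc_of_le hab.le]; exact Icc_subset_Icc_right h2.le
  have hDi := (h.weyl_int hγ hγ1 hp hq hab.le).mono_set hsub
  have hDm := h.measurable_weyl
  have gi := (h.int_self hγ hab.le).mono_set hsub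
  have T1 := tri_pow_mul hγ h1.le hDm hDi
  have T2 := tri_pow_mul' hγ h1.le hDm hDi
  have hb1 : ∀ u, a < u → u < x →
      ∫ s in u..x, (x - s) ^ (γ - 1) * ((s - u) ^ (-γ) * |g u|) = betaR (1 - γ) γ * |g u| := by
    intro u h3 h4
    have := integral_beta (p := 1 - γ) (q := γ) u x h4
    rw [show 1 - γ + γ - 1 = 0 by ring, Real.rpow_zero, mul_one, show 1 - γ - 1 = -γ by ring] at this
    rw [← this, ← intervalIntegral.integral_mul_const]
    congr 1
    ext s
    ring
  have T3 : TriInt a x (fun s u => (x - s) ^ (γ - 1) * ((s - u) ^ (-γ) * g u)) := by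
    refine TriInt.of_right h1.le (D := fun s u => (x - s) ^ (γ - 1) * ((s - u) ^ (-γ) * |g u|))
      (φ := fun u => betaR (1 - γ) γ * |g u|) (by fun_prop) ?_ ?_ ?_ (gi.norm.const_mul _)
    · intro s h3 h4 r h5 h6
      rw [abs_mul, abs_mul, abs_of_nonneg (Real.rpow_nonneg (by linarith) _),
        abs_of_nonneg (Real.rpow_nonneg (by linarith) _)]
    · intro u h3 h4
      have := (intervalIntegrable_beta (p := 1 - γ) (q := γ) (by linarith) hγ h4.le).mul_const |g u|
      rw [show 1 - γ - 1 = -γ by ring] at this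
      convert this using 2
      ring
    · intro u h3 h4
      exact (hb1 u h3 h4).le
  rw [intervalIntegral.integral_const_mul, T1.swap h1.le]
  -- The commutation of I^1 and I^γ: over s in (r, x), the powers (s-r)^{γ-1} and (x-s)^{γ-1} have
  -- the same integral.
  have e1 : ∫ r in a..x, ∫ s in r..x, (s - r) ^ (γ - 1) * weylLeft γ a g r =
      ∫ r in a..x, ∫ s in r..x, (x - s) ^ (γ - 1) * weylLeft γ a g r := by
    refine integral_congr_Ioo h1.le fun r h3 h4 => ?_
    rw [intervalIntegral.integral_mul_const, intervalIntegral.integral_mul_const,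
      integral_rpow_left hγ, integral_rpow_right hγ]
  have e2 : ∫ s in a..x, ∫ r in a..s, (x - s) ^ (γ - 1) * weylLeft γ a g r =
      ∫ s in a..x, 1 / Real.Gamma (1 - γ) *
        ∫ u in a..s, (x - s) ^ (γ - 1) * ((s - u) ^ (-γ) * g u) := by
    refine integral_congr_Ioo h1.le fun s h3 h4 => ?_
    rw [intervalIntegral.integral_const_mul, intervalIntegral.integral_const_mul,
      h.integral_weyl hγ hγ1 hp hq h3 (h4.trans h2)]
    ring
  have e3 : ∫ u in a..x, ∫ s in u..x, (x - s) ^ (γ - 1) * ((s - u) ^ (-γ) * g u) =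
      ∫ u in a..x, betaR (1 - γ) γ * g u := by
    refine integral_congr_Ioo h1.le fun u h3 h4 => ?_
    have := integral_beta (p := 1 - γ) (q := γ) u x h4
    rw [show 1 - γ + γ - 1 = 0 by ring, Real.rpow_zero, mul_one, show 1 - γ - 1 = -γ by ring] at this
    rw [← this, ← intervalIntegral.integral_mul_const]
    congr 1
    ext s
    ring
  rw [e1, ← T2.swap h1.le, e2, intervalIntegral.integral_const_mul, T3.swap h1.le, e3,
    intervalIntegral.integral_const_mul, betaR_eq_Gamma (by linarith) hγ, sub_add_cancel,
    Real.Gamma_one]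
  have := (Real.Gamma_pos_of_pos hγ).ne'
  have := (Real.Gamma_pos_of_pos (sub_pos.2 hγ1)).ne'
  field_simp

/-- The integrals of the two sides agree up to every x, so Lebesgue differentiation gives equality
almost everywhere, which is enough under an integral. -/
lemma fracInt_weyl_ae (h : FracClass γ p q a b g Ψ) (hγ : 0 < γ) (hγ1 : γ < 1) (hp : γ < p)
    (hq : 0 < q) (hab : a ≤ b) :
    ∀ᵐ s, s ∈ uIoc a b →
      1 / Real.Gamma γ * ∫ r in a..s, (s - r) ^ (γ - 1) * weylLeft γ a g r = g s := by
  have hDi := h.weyl_int hγ hγ1 hp hq hab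
  have T1 := tri_pow_mul hγ hab h.measurable_weyl hDi
  have hQ := (T1.intervalIntegrable_left hab).const_mul (1 / Real.Gamma γ)
  have h₂ : ∀ᵐ x : ℝ, x ≠ b := by simp [ae_iff, measure_singleton]
  filter_upwards [hQ.ae_hasDerivAt_integral, (h.int_self hγ hab).ae_hasDerivAt_integral, h₂]
    with s hs1 hs2 hsb hs
  rw [uIoc_of_le hab] at hs
  have hs' : s ∈ uIcc a b := by rw [uIcc_of_le hab]; exact Ioc_subset_Icc_self hs
  have hsb' : s < b := lt_of_le_of_ne hs.2 hsb
  have d1 := hs1 hs' a left_mem_uIcc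
  have d2 := hs2 hs' a left_mem_uIcc
  refine d1.unique (d2.congr_of_eventuallyEq ?_)
  filter_upwards [Ioo_mem_nhds hs.1 hsb'] with x hx
  exact h.integral_fracInt_weyl hγ hγ1 hp hq hx.1 hx.2

/-- Fubini moves I^γ from m to D^γ g, where it gives back g. Boundedness of m is not asked for, only
a bound uniform in r on its fractional integral: the density to which this is applied is singular at
the right end. -/
lemma integral_by_parts (h : FracClass γ p q a b g Ψ) (hγ : 0 < γ) (hγ1 : γ < 1) (hp : γ < p)
    (hq : 0 < q) (hab : a ≤ b) {m : ℝ → ℝ} (hm : Measurable m) {C : ℝ}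
    (hmi : ∀ r, a < r → r < b → IntervalIntegrable (fun s => (s - r) ^ (γ - 1) * |m s|) volume r b)
    (hmC : ∀ r, a < r → r < b → ∫ s in r..b, (s - r) ^ (γ - 1) * |m s| ≤ C) :
    ∫ r in a..b, weylLeft γ a g r * (1 / Real.Gamma γ * ∫ s in r..b, (s - r) ^ (γ - 1) * m s) =
      ∫ s in a..b, g s * m s := by
  have hDi := h.weyl_int hγ hγ1 hp hq hab
  have hDm := h.measurable_weyl
  have T : TriInt a b (fun s r => (s - r) ^ (γ - 1) * m s * weylLeft γ a g r) := by
    refine TriInt.of_right hab (D := fun s r => (s - r) ^ (γ - 1) * |m s| * |weylLeft γ a g r|)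
      (φ := fun r => C * |weylLeft γ a g r|) (by fun_prop) ?_ ?_ ?_ (hDi.norm.const_mul _)
    · intro r h3 h4 s h5 h6
      rw [abs_mul, abs_mul, abs_of_nonneg (Real.rpow_nonneg (by linarith) _)]
    · intro r h3 h4
      exact (hmi r h3 h4).mul_const _
    · intro r h3 h4
      rw [intervalIntegral.integral_mul_const]
      exact mul_le_mul_of_nonneg_right (hmC r h3 h4) (abs_nonneg _)
  have e1 : ∫ r in a..b, weylLeft γ a g r *
      (1 / Real.Gamma γ * ∫ s in r..b, (s - r) ^ (γ - 1) * m s) =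
      1 / Real.Gamma γ * ∫ r in a..b, ∫ s in r..b, (s - r) ^ (γ - 1) * m s * weylLeft γ a g r := by
    rw [← intervalIntegral.integral_const_mul]
    congr 1
    ext r
    rw [intervalIntegral.integral_mul_const]
    ring
  rw [e1, ← T.swap hab, ← intervalIntegral.integral_const_mul]
  refine intervalIntegral.integral_congr_ae ?_
  filter_upwards [h.fracInt_weyl_ae hγ hγ1 hp hq hab] with s hs hs'
  rw [← hs hs', mul_assoc, ← intervalIntegral.integral_mul_const]
  congr 2
  ext r
  ring

/-- A bounded Hölder function need not vanish at a, so its weight must blow up like (r-a)^{-p}. The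
resulting derivative is of size (r-a)^{-γ}, still integrable. -/
lemma of_holder {C₀ C₁ : ℝ} (hγ1 : γ < 1) (hab : a ≤ b)
    (hg : Measurable g) (hC₁ : 0 ≤ C₁) (h0 : ∀ r, a < r → r < b → |g r| ≤ C₀)
    (h1 : ∀ s r, a < s → s < r → r < b → |g r - g s| ≤ C₁ * (r - s) ^ p) (hp0 : 0 < p) :
    FracClass γ p 1 a b g (fun r => (C₀ + C₁ * (b - a) ^ p) * (r - a) ^ (-p)) := by
  refine ⟨hg, fun r h3 h4 => ?_, fun s r h3 h4 h5 => ?_, ?_⟩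
  · have hr : 0 < r - a := by linarith
    rw [add_sub_cancel_right, mul_assoc, ← Real.rpow_add hr, neg_add_cancel, Real.rpow_zero, mul_one]
    have := Real.rpow_nonneg (sub_nonneg.2 hab) p
    have := h0 r h3 h4
    nlinarith
  · have hr : 0 < r - a := by linarith
    rw [sub_self, Real.rpow_zero, mul_one]
    refine (h1 s r h3 h4 h5).trans (mul_le_mul_of_nonneg_right ?_ (Real.rpow_nonneg (by linarith) _))
    have hC0 : 0 ≤ C₀ := (abs_nonneg _).trans (h0 r (h3.trans h4) h5)
    calc C₁ = C₁ * ((r - a) ^ p * (r - a) ^ (-p)) := by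
          rw [← Real.rpow_add hr, add_neg_cancel, Real.rpow_zero, mul_one]
      _ ≤ C₁ * ((b - a) ^ p * (r - a) ^ (-p)) := by
          have := Real.rpow_nonneg hr.le (-p)
          have : (r - a) ^ p ≤ (b - a) ^ p := Real.rpow_le_rpow hr.le (by linarith) hp0.le
          gcongr
      _ ≤ _ := by
          have := Real.rpow_nonneg hr.le (-p)
          rw [← mul_assoc]
          gcongr
          linarith
  · have := (intervalIntegrable_rpow_left (p := 1 - γ) (by linarith) hab).const_mul
      (C₀ + C₁ * (b - a) ^ p)
    refine intervalIntegrable_congr_Ioo hab (fun r h3 h4 => ?_) this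
    rw [mul_assoc, ← Real.rpow_add (by linarith)]
    congr 2
    ring

end FracClass

lemma rpow_mul_bounded_int {γ r b C : ℝ} (hγ : 0 < γ) (hrb : r ≤ b) {m : ℝ → ℝ}
    (hm : Measurable m) (hmb : ∀ s, |m s| ≤ C) :
    IntervalIntegrable (fun s => (s - r) ^ (γ - 1) * |m s|) volume r b ∧
      ∫ s in r..b, (s - r) ^ (γ - 1) * |m s| ≤ (b - r) ^ γ / γ * C := by
  have hi := (intervalIntegrable_rpow_left hγ hrb).mul_const C
  have hb : ∀ s, r < s → s < b → (s - r) ^ (γ - 1) * |m s| ≤ (s - r) ^ (γ - 1) * C := fun s h1 _ =>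
    mul_le_mul_of_nonneg_left (hmb s) (Real.rpow_nonneg (by linarith) _)
  have h1 : IntervalIntegrable (fun s => (s - r) ^ (γ - 1) * |m s|) volume r b := by
    refine intervalIntegrable_of_Ioo hrb (by fun_prop) (fun s h1 h2 => ?_) hi
    rw [abs_of_nonneg (mul_nonneg (Real.rpow_nonneg (by linarith) _) (abs_nonneg _))]
    exact hb s h1 h2
  refine ⟨h1, (integral_mono_Ioo hrb h1 hi hb).trans (le_of_eq ?_)⟩
  rw [intervalIntegral.integral_mul_const, integral_rpow_left hγ]

lemma integral_by_parts_holder {γ p a b C₀ C₁ C : ℝ} (hγ : 0 < γ) (hγ1 : γ < 1) (hp : γ < p)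
    (hab : a ≤ b) {g m : ℝ → ℝ} (hg : Measurable g) (hC₁ : 0 ≤ C₁)
    (h0 : ∀ r, a < r → r < b → |g r| ≤ C₀)
    (h1 : ∀ s r, a < s → s < r → r < b → |g r - g s| ≤ C₁ * (r - s) ^ p)
    (hm : Measurable m) (hmb : ∀ s, |m s| ≤ C) :
    ∫ r in a..b, weylLeft γ a g r * (1 / Real.Gamma γ * ∫ s in r..b, (s - r) ^ (γ - 1) * m s) =
      ∫ s in a..b, g s * m s := by
  have hC : 0 ≤ C := (abs_nonneg _).trans (hmb 0)
  refine (FracClass.of_holder hγ1 hab hg hC₁ h0 h1 (hγ.trans hp)).integral_by_parts hγ hγ1 hp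
    one_pos hab hm (C := (b - a) ^ γ / γ * C)
    (fun r h3 h4 => (rpow_mul_bounded_int hγ h4.le hm hmb).1)
    (fun r h3 h4 => (rpow_mul_bounded_int hγ h4.le hm hmb).2.trans ?_)
  have : (b - r) ^ γ ≤ (b - a) ^ γ := Real.rpow_le_rpow (by linarith) (by linarith) hγ.le
  gcongr

lemma integral_by_parts_right_holder {γ p a b C₀ C₁ C : ℝ} (hγ : 0 < γ) (hγ1 : γ < 1) (hp : γ < p)
    (hab : a ≤ b) {g m : ℝ → ℝ} (hg : Measurable g) (hC₁ : 0 ≤ C₁)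
    (h0 : ∀ r, a < r → r < b → |g r| ≤ C₀)
    (h1 : ∀ r s, a < r → r < s → s < b → |g r - g s| ≤ C₁ * (s - r) ^ p)
    (hm : Measurable m) (hmb : ∀ s, |m s| ≤ C) :
    ∫ r in a..b, weylRight γ b g r * (1 / Real.Gamma γ * ∫ s in a..r, (r - s) ^ (γ - 1) * m s) =
      ∫ s in a..b, g s * m s := by
  have h := integral_by_parts_holder hγ hγ1 hp (neg_le_neg hab) (g := fun s => g (-s))
    (m := fun s => m (-s)) (hg.comp measurable_neg) hC₁
    (fun r h3 h4 => h0 _ (by linarith) (by linarith))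
    (fun s r h3 h4 h5 => by
      have := h1 (-r) (-s) (by linarith) (by linarith) (by linarith)
      rwa [show -s - -r = r - s by ring] at this)
    (hm.comp measurable_neg) (fun s => hmb _)
  rw [intervalIntegral.integral_comp_neg (fun s => g s * m s), neg_neg, neg_neg] at h
  rw [← h, ← intervalIntegral.integral_comp_neg]
  congr 1
  ext r
  rw [weylRight_eq_weylLeft_neg]
  congr 2
  rw [← intervalIntegral.integral_comp_neg]
  congr 1
  ext s
  rw [neg_neg]
  congr 2
  ring

end RoughFrac

end

noncomputable section

namespace RoughFrac

open Filter Topology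

/-! ### Elementary inequalities for powers -/

lemma le_rpow_of_le_one {s p : ℝ} (hs : 0 ≤ s) (hs1 : s ≤ 1) (hp1 : p ≤ 1) :
    s ≤ s ^ p := by
  rcases hs.eq_or_lt with rfl | hs0
  · exact Real.rpow_nonneg le_rfl _
  · simpa using Real.rpow_le_rpow_of_exponent_ge hs0 hs1 hp1

/-- By homogeneity x = 1. For l ≤ 1, (1+l)^κ ≤ 1 + l and l ≤ l^p; for l ≥ 1, subadditivity of the
power κ and l^κ ≤ l^p. The free exponent p lets a Hölder rate be traded against a singularity at 0.
-/
lemma add_rpow_sub_rpow_le {x l κ p : ℝ} (hx : 0 < x) (hl : 0 ≤ l) (hκ : 0 < κ) (hκp : κ ≤ p)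
    (hp : p ≤ 1) : (x + l) ^ κ - x ^ κ ≤ l ^ p * x ^ (κ - p) := by
  have hs : 0 ≤ l / x := by positivity
  have h1 : (1 + l / x) ^ κ ≤ 1 + (l / x) ^ p := by
    rcases le_total (l / x) 1 with h | h
    · calc (1 + l / x) ^ κ ≤ (1 + l / x) ^ (1 : ℝ) :=
            Real.rpow_le_rpow_of_exponent_le (by linarith) (hκp.trans hp)
        _ = 1 + l / x := Real.rpow_one _
        _ ≤ _ := by gcongr; exact le_rpow_of_le_one hs h hp
    · calc (1 + l / x) ^ κ ≤ 1 ^ κ + (l / x) ^ κ :=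
            Real.rpow_add_le_add_rpow zero_le_one hs hκ.le (hκp.trans hp)
        _ ≤ _ := by
          rw [Real.one_rpow]
          gcongr
  have h2 : x + l = x * (1 + l / x) := by field_simp
  have h3 : l ^ p * x ^ (κ - p) = x ^ κ * (l / x) ^ p := by
    rw [Real.div_rpow hl hx.le, Real.rpow_sub hx]
    ring
  rw [h2, Real.mul_rpow hx.le (by positivity), h3]
  nlinarith [Real.rpow_pos_of_pos hx κ]

lemma rpow_neg_sub_le {x l k p : ℝ} (hx : 0 < x) (hl : 0 ≤ l) (hk1 : k ≤ 1)
    (hp0 : 0 ≤ p) (hp : p ≤ 1) : x ^ (-k) - (x + l) ^ (-k) ≤ l ^ p * x ^ (-k - p) := by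
  have hs : 0 ≤ l / x := by positivity
  have h1 : 1 - (1 + l / x) ^ (-k) ≤ (l / x) ^ p := by
    rcases le_total (l / x) 1 with h | h
    · have h4 : (1 + l / x) ^ (-1 : ℝ) ≤ (1 + l / x) ^ (-k) :=
        Real.rpow_le_rpow_of_exponent_le (by linarith) (by linarith)
      have h5 : 1 - l / x ≤ (1 + l / x) ^ (-1 : ℝ) := by
        rw [Real.rpow_neg_one, ← one_div, le_div_iff₀ (by linarith)]
        nlinarith
      have := le_rpow_of_le_one hs h hp
      linarith
    · have := Real.one_le_rpow h hp0
      have := Real.rpow_nonneg (by positivity : 0 ≤ 1 + l / x) (-k)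
      linarith
  have h2 : x + l = x * (1 + l / x) := by field_simp
  have h3 : l ^ p * x ^ (-k - p) = x ^ (-k) * (l / x) ^ p := by
    rw [Real.div_rpow hl hx.le, Real.rpow_sub hx]
    ring
  rw [h2, Real.mul_rpow hx.le (by positivity), h3]
  nlinarith [Real.rpow_pos_of_pos hx (-k)]

lemma rpow_le_mul_rpow {x y p r : ℝ} (hx : 0 < x) (hxy : x ≤ y) (hp : 0 ≤ p) :
    x ^ r ≤ y ^ p * x ^ (r - p) := by
  calc x ^ r = x ^ p * x ^ (r - p) := by rw [← Real.rpow_add hx]; congr 1; ring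
    _ ≤ _ := by gcongr

/-- A mixed difference gains h^p l^p at the price of A^{-2p}. If h ≤ A, the mean value inequality in
h is applied to the difference in l; if A ≤ h, the two differences in l are estimated separately and
A^p ≤ h^p supplies the missing factor. -/
lemma abs_double_diff_rpow_le {A h l κ p : ℝ} (hA : 0 < A) (hh : 0 ≤ h) (hl : 0 ≤ l) (hκ : 0 < κ)
    (hκp : κ ≤ p) (hp : p ≤ 1) :
    |((A + h + l) ^ κ - (A + h) ^ κ) - ((A + l) ^ κ - A ^ κ)| ≤
      h ^ p * l ^ p * A ^ (κ - 2 * p) := by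
  have hp0 : 0 < p := hκ.trans_le hκp
  have hlp := Real.rpow_nonneg hl p
  rcases le_total h A with hhA | hAh
  · have hder : ∀ y ∈ Icc (0 : ℝ) h, HasDerivWithinAt (fun y => (A + y + l) ^ κ - (A + y) ^ κ)
        (κ * ((A + y + l) ^ (κ - 1) - (A + y) ^ (κ - 1))) (Icc 0 h) y := by
      intro y hy
      have h1 : HasDerivAt (fun y : ℝ => A + y + l) 1 y := by
        simpa using ((hasDerivAt_id y).const_add A).add_const l
      have h2 : HasDerivAt (fun y : ℝ => A + y) 1 y := by
        simpa using (hasDerivAt_id y).const_add A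
      have h3 := (h1.rpow_const (p := κ) (Or.inl (by linarith [hy.1]))).sub
        (h2.rpow_const (p := κ) (Or.inl (by linarith [hy.1])))
      convert! h3.hasDerivWithinAt using 1
      ring
    have hbd : ∀ y ∈ Icc (0 : ℝ) h, ‖κ * ((A + y + l) ^ (κ - 1) - (A + y) ^ (κ - 1))‖ ≤
        l ^ p * A ^ (κ - 1 - p) := by
      intro y hy
      have hAy : 0 < A + y := by linarith [hy.1]
      have h1 := rpow_neg_sub_le (x := A + y) (k := 1 - κ) hAy hl (by linarith) hp0.le hp
      rw [neg_sub] at h1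
      have h2 : (A + y + l) ^ (κ - 1) ≤ (A + y) ^ (κ - 1) :=
        Real.rpow_le_rpow_of_nonpos hAy (by linarith) (by linarith)
      have h3 : (A + y) ^ (κ - 1 - p) ≤ A ^ (κ - 1 - p) :=
        Real.rpow_le_rpow_of_nonpos hA (by linarith [hy.1]) (by linarith)
      rw [norm_mul, Real.norm_eq_abs, Real.norm_eq_abs, abs_of_pos hκ, abs_sub_comm,
        abs_of_nonneg (by linarith)]
      calc _ ≤ 1 * (l ^ p * (A + y) ^ (κ - 1 - p)) :=
            mul_le_mul (by linarith) h1 (by linarith) zero_le_one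
        _ ≤ _ := by
          rw [one_mul]; gcongr
    have hm := (convex_Icc (0 : ℝ) h).norm_image_sub_le_of_norm_hasDerivWithin_le hder hbd
      (left_mem_Icc.2 hh) (right_mem_Icc.2 hh)
    simp only [add_zero, sub_zero, Real.norm_eq_abs, abs_of_nonneg hh] at hm
    refine hm.trans ?_
    -- The linear gain from the mean value inequality is weakened to the rate p, which is possible
    -- because h ≤ A.
    have e : h ≤ h ^ p * A ^ (1 - p) := by
      rcases hh.eq_or_lt with rfl | hh0
      · exact mul_nonneg (Real.rpow_nonneg le_rfl _) (Real.rpow_nonneg hA.le _)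
      calc h = h ^ p * h ^ (1 - p) := by rw [← Real.rpow_add hh0]; simp
        _ ≤ _ := by
          have : h ^ (1 - p) ≤ A ^ (1 - p) := Real.rpow_le_rpow hh hhA (by linarith)
          have := Real.rpow_nonneg hh p
          gcongr
    calc l ^ p * A ^ (κ - 1 - p) * h ≤ l ^ p * A ^ (κ - 1 - p) * (h ^ p * A ^ (1 - p)) := by
          have := Real.rpow_nonneg hA.le (κ - 1 - p)
          gcongr
      _ = h ^ p * l ^ p * (A ^ (κ - 1 - p) * A ^ (1 - p)) := by ring
      _ = _ := by rw [← Real.rpow_add hA]; congr 2; ring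
  · have b1 := add_rpow_sub_rpow_le hA hl hκ hκp hp
    have b2 := add_rpow_sub_rpow_le (x := A + h) (by linarith) hl hκ hκp hp
    have b3 : (A + h) ^ (κ - p) ≤ A ^ (κ - p) :=
      Real.rpow_le_rpow_of_nonpos hA (by linarith) (by linarith)
    have c1 : A ^ κ ≤ (A + l) ^ κ := Real.rpow_le_rpow hA.le (by linarith) hκ.le
    have c2 : (A + h) ^ κ ≤ (A + h + l) ^ κ := Real.rpow_le_rpow (by linarith) (by linarith) hκ.le
    have b4 : l ^ p * A ^ (κ - p) ≤ h ^ p * l ^ p * A ^ (κ - 2 * p) := by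
      have := rpow_le_mul_rpow (r := κ - p) hA hAh hp0.le
      rw [show κ - p - p = κ - 2 * p by ring] at this
      nlinarith
    have b5 : l ^ p * (A + h) ^ (κ - p) ≤ l ^ p * A ^ (κ - p) := by gcongr
    rw [abs_le]
    constructor <;> linarith

/-! ### The kernel in regular form -/

/-- The integrand of `kerReg`. -/
def kerT (α t u v : ℝ) : ℝ := v ^ (2 * α - 2) * (v - t * u) ^ (1 - α)

lemma kerT_nonneg {α t u v : ℝ} (ht1 : t ≤ 1) (hu : 0 ≤ u) (huv : u ≤ v) :
    0 ≤ kerT α t u v := by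
  have : 0 ≤ v - t * u := by nlinarith
  exact mul_nonneg (Real.rpow_nonneg (hu.trans huv) _) (Real.rpow_nonneg this _)

lemma kerT_le {α t u v : ℝ} (hα : α < 1) (ht : 0 ≤ t) (ht1 : t ≤ 1) (hu : 0 ≤ u) (huv : u ≤ v)
    (hv : 0 < v) : kerT α t u v ≤ v ^ (α - 1) := by
  have h1 : 0 ≤ v - t * u := by nlinarith
  have h2 : v - t * u ≤ v := by nlinarith
  calc kerT α t u v ≤ v ^ (2 * α - 2) * v ^ (1 - α) := by
        unfold kerT
        have := Real.rpow_le_rpow h1 h2 (sub_pos.2 hα).le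
        have := Real.rpow_nonneg hv.le (2 * α - 2)
        gcongr
    _ = _ := by rw [← Real.rpow_add hv]; congr 1; ring

/-- For s ≥ v ≥ u one has s - t u ≥ (1-t) v, and the exponent is not positive. The singularity at v
= 0 is thus separated from the one at t = 1. -/
lemma rpow_sub_mul_le {α p t u v s : ℝ} (hp : 1 - α ≤ p) (ht1 : t < 1)
    (hu : u ≤ v) (hv : 0 < v) (ht : 0 < t) (hvs : v ≤ s) :
    (s - t * u) ^ (1 - α - p) ≤ (1 - t) ^ (1 - α - p) * v ^ (1 - α - p) := by
  rw [← Real.mul_rpow (by linarith) hv.le]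
  exact Real.rpow_le_rpow_of_nonpos (by nlinarith) (by nlinarith) (by linarith)

lemma kerT_diff_left {α p t u u' v : ℝ} (hα1 : α < 1) (hp : 1 - α ≤ p) (hp1 : p ≤ 1) (ht : 0 < t) (ht1 : t < 1)
    (hu' : 0 ≤ u') (huu : u' ≤ u) (huv : u < v) :
    |kerT α t u v - kerT α t u' v| ≤
      (u - u') ^ p * v ^ (α - 1 - p) * (1 - t) ^ (1 - α - p) := by
  have hv : 0 < v := by linarith
  have hx : 0 < v - t * u := by nlinarith
  have h1 := add_rpow_sub_rpow_le (l := t * (u - u')) hx (by nlinarith) (sub_pos.2 hα1) hp hp1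
  rw [show v - t * u + t * (u - u') = v - t * u' by ring] at h1
  have h2 : (v - t * u) ^ (1 - α) ≤ (v - t * u') ^ (1 - α) :=
    Real.rpow_le_rpow hx.le (by nlinarith) (by linarith)
  have h3 : (t * (u - u')) ^ p ≤ (u - u') ^ p :=
    Real.rpow_le_rpow (by nlinarith) (by nlinarith) (by linarith)
  have h4 := rpow_sub_mul_le (s := v) hp ht1 huv.le hv ht le_rfl
  have h5 := Real.rpow_nonneg hv.le (2 * α - 2)
  rw [abs_sub_comm, kerT, kerT, ← mul_sub, abs_mul, abs_of_nonneg h5, abs_of_nonneg (by linarith)]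
  calc _ ≤ v ^ (2 * α - 2) * ((u - u') ^ p * ((1 - t) ^ (1 - α - p) * v ^ (1 - α - p))) := by
        refine mul_le_mul_of_nonneg_left (h1.trans ?_) h5
        exact mul_le_mul h3 h4 (Real.rpow_nonneg hx.le _) (Real.rpow_nonneg (by linarith) _)
    _ = (u - u') ^ p * (v ^ (2 * α - 2) * v ^ (1 - α - p)) * (1 - t) ^ (1 - α - p) := by ring
    _ = _ := by rw [← Real.rpow_add hv]; congr 3; ring

lemma one_le_weight {α p t : ℝ} (hp : 1 - α ≤ p) (ht : 0 < t) (ht1 : t < 1)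
    : 1 ≤ (1 - t) ^ (1 - α - p) :=
  Real.one_le_rpow_of_pos_of_le_one_of_nonpos (by linarith) (by linarith) (by linarith)

/-- Product rule for the two powers of v. The second power is first compared with its value at s,
which exceeds its size at v by at most (s-v)^{1-α}. -/
lemma kerT_diff_right {α p t u v s : ℝ} (hα : 1 / 2 < α) (hα1 : α < 1) (hp : 1 - α ≤ p) (hp1 : p ≤ 1) (ht : 0 < t) (ht1 : t < 1)
    (hu : 0 ≤ u) (huv : u ≤ v) (hv : 0 < v) (hvs : v ≤ s) :
    |kerT α t u v - kerT α t u s| ≤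
      3 * ((s - v) ^ p * v ^ (α - 1 - p) * (1 - t) ^ (1 - α - p)) := by
  have hx : 0 < v - t * u := by nlinarith
  have hl : 0 ≤ s - v := by linarith
  have hW := one_le_weight hp ht ht1
  have h1 := add_rpow_sub_rpow_le (l := s - v) hx hl (sub_pos.2 hα1) hp hp1
  rw [show v - t * u + (s - v) = s - t * u by ring] at h1
  have h1' : (v - t * u) ^ (1 - α) ≤ (s - t * u) ^ (1 - α) :=
    Real.rpow_le_rpow hx.le (by linarith) (by linarith)
  have h4 := rpow_sub_mul_le (s := v) hp ht1 huv hv ht le_rfl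
  have hlp := Real.rpow_nonneg hl p
  have h5 := Real.rpow_nonneg hv.le (2 * α - 2)
  have a1 := rpow_neg_sub_le (x := v) (l := s - v) (k := 2 - 2 * α) (p := p) hv hl (by linarith)
    (by linarith) hp1
  have a2 := rpow_neg_sub_le (x := v) (l := s - v) (k := 2 - 2 * α) (p := p - (1 - α)) hv hl
    (by linarith) (by linarith) (by linarith)
  rw [show v + (s - v) = s by ring, show -(2 - 2 * α) = 2 * α - 2 by ring] at a1 a2
  have a0 : s ^ (2 * α - 2) ≤ v ^ (2 * α - 2) :=
    Real.rpow_le_rpow_of_nonpos hv hvs (by linarith)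
  have e1 : (s - t * u) ^ (1 - α) ≤ v ^ (1 - α) + (s - v) ^ (1 - α) := by
    calc (s - t * u) ^ (1 - α) ≤ (v + (s - v)) ^ (1 - α) :=
          Real.rpow_le_rpow (by nlinarith) (by nlinarith) (by linarith)
      _ ≤ _ := Real.rpow_add_le_add_rpow hv.le hl (by linarith) (by linarith)
  have c1 : v ^ (2 * α - 2) * ((s - t * u) ^ (1 - α) - (v - t * u) ^ (1 - α)) ≤
      (s - v) ^ p * v ^ (α - 1 - p) * (1 - t) ^ (1 - α - p) := by
    calc _ ≤ v ^ (2 * α - 2) * ((s - v) ^ p * ((1 - t) ^ (1 - α - p) * v ^ (1 - α - p))) :=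
          mul_le_mul_of_nonneg_left (h1.trans (mul_le_mul_of_nonneg_left h4 hlp)) h5
      _ = (s - v) ^ p * (v ^ (2 * α - 2) * v ^ (1 - α - p)) * (1 - t) ^ (1 - α - p) := by ring
      _ = _ := by rw [← Real.rpow_add hv]; congr 3; ring
  have c2 : (v ^ (2 * α - 2) - s ^ (2 * α - 2)) * v ^ (1 - α) ≤ (s - v) ^ p * v ^ (α - 1 - p) := by
    calc _ ≤ (s - v) ^ p * v ^ (2 * α - 2 - p) * v ^ (1 - α) :=
          mul_le_mul_of_nonneg_right a1 (Real.rpow_nonneg hv.le _)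
      _ = (s - v) ^ p * (v ^ (2 * α - 2 - p) * v ^ (1 - α)) := by ring
      _ = _ := by rw [← Real.rpow_add hv]; congr 2; ring
  -- The factor (s-v)^{1-α} already provides part of the rate, so only the exponent p - (1-α) is
  -- asked of the first factor; this uses 1 - α ≤ p.
  have c3 : (v ^ (2 * α - 2) - s ^ (2 * α - 2)) * (s - v) ^ (1 - α) ≤
      (s - v) ^ p * v ^ (α - 1 - p) := by
    rcases hl.eq_or_lt with hl0 | hl0
    · rw [← hl0, Real.zero_rpow (by linarith), Real.zero_rpow (by linarith)]; simp
    calc _ ≤ (s - v) ^ (p - (1 - α)) * v ^ (2 * α - 2 - (p - (1 - α))) * (s - v) ^ (1 - α) :=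
          mul_le_mul_of_nonneg_right a2 (Real.rpow_nonneg hl _)
      _ = ((s - v) ^ (p - (1 - α)) * (s - v) ^ (1 - α)) * v ^ (2 * α - 2 - (p - (1 - α))) := by ring
      _ = _ := by rw [← Real.rpow_add hl0]; congr 2 <;> ring
  have c4 : (v ^ (2 * α - 2) - s ^ (2 * α - 2)) * (s - t * u) ^ (1 - α) ≤
      2 * ((s - v) ^ p * v ^ (α - 1 - p) * (1 - t) ^ (1 - α - p)) := by
    have : 0 ≤ (s - v) ^ p * v ^ (α - 1 - p) := mul_nonneg hlp (Real.rpow_nonneg hv.le _)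
    have : (v ^ (2 * α - 2) - s ^ (2 * α - 2)) * (s - t * u) ^ (1 - α) ≤
      (v ^ (2 * α - 2) - s ^ (2 * α - 2)) * (v ^ (1 - α) + (s - v) ^ (1 - α)) :=
      mul_le_mul_of_nonneg_left e1 (by linarith)
    nlinarith
  have c5 : 0 ≤ v ^ (2 * α - 2) * ((s - t * u) ^ (1 - α) - (v - t * u) ^ (1 - α)) :=
    mul_nonneg h5 (by linarith)
  have c6 : 0 ≤ (v ^ (2 * α - 2) - s ^ (2 * α - 2)) * (s - t * u) ^ (1 - α) :=
    mul_nonneg (by linarith) (Real.rpow_nonneg (by nlinarith) _)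
  have e : kerT α t u v - kerT α t u s = (v ^ (2 * α - 2) - s ^ (2 * α - 2)) *
      (s - t * u) ^ (1 - α) - v ^ (2 * α - 2) * ((s - t * u) ^ (1 - α) - (v - t * u) ^ (1 - α)) := by
    unfold kerT; ring
  rw [e, abs_le]
  constructor <;> linarith

/-- Product rule again: one term has the mixed difference of (v - t u)^{1-α}, the other a simple
difference in each factor. The weight (v-u)^{-p} is the price of differencing in both variables near
the diagonal. -/
lemma kerT_double_diff {α p t u u' v s : ℝ} (hα : 1 / 2 < α) (hα1 : α < 1) (hp : 1 - α ≤ p) (hp1 : p ≤ 1) (ht : 0 < t) (ht1 : t < 1)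
    (hu' : 0 ≤ u') (huu : u' ≤ u) (huv : u < v) (hvs : v ≤ s) :
    |(kerT α t u v - kerT α t u' v) - (kerT α t u s - kerT α t u' s)| ≤
      2 * ((u - u') ^ p * (s - v) ^ p * v ^ (α - 1 - p) * (v - u) ^ (-p) *
        (1 - t) ^ (1 - α - p)) := by
  have hv : 0 < v := by linarith
  have hx : 0 < v - t * u := by nlinarith
  have hl : 0 ≤ s - v := by linarith
  have hh : 0 ≤ u - u' := by linarith
  have hp0 : 0 < p := by linarith
  have hlp := Real.rpow_nonneg hl p
  have hhp := Real.rpow_nonneg hh p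
  have h5 := Real.rpow_nonneg hv.le (2 * α - 2)
  have hW0 := Real.rpow_nonneg (by linarith : 0 ≤ 1 - t) (1 - α - p)
  have h3 : (t * (u - u')) ^ p ≤ (u - u') ^ p :=
    Real.rpow_le_rpow (by nlinarith) (by nlinarith) (by linarith)
  have h30 : 0 ≤ (t * (u - u')) ^ p := Real.rpow_nonneg (by nlinarith) _
  have h4 := rpow_sub_mul_le (s := v) hp ht1 huv.le hv ht le_rfl
  have h4s := rpow_sub_mul_le (s := s) hp ht1 huv.le hv ht hvs
  have a1 := rpow_neg_sub_le (x := v) (l := s - v) (k := 2 - 2 * α) (p := p) hv hl (by linarith)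
    hp0.le hp1
  rw [show v + (s - v) = s by ring, show -(2 - 2 * α) = 2 * α - 2 by ring] at a1
  have a0 : s ^ (2 * α - 2) ≤ v ^ (2 * α - 2) :=
    Real.rpow_le_rpow_of_nonpos hv hvs (by linarith)
  have d1 := abs_double_diff_rpow_le (h := t * (u - u')) (l := s - v) hx (by nlinarith) hl
    (sub_pos.2 hα1) hp hp1
  rw [show v - t * u + t * (u - u') + (s - v) = s - t * u' by ring,
    show v - t * u + t * (u - u') = v - t * u' by ring,
    show v - t * u + (s - v) = s - t * u by ring] at d1
  have vu : (v - t * u) ^ (-p) ≤ (v - u) ^ (-p) :=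
    Real.rpow_le_rpow_of_nonpos (by linarith) (by nlinarith) (by linarith)
  have vv : v ^ (-p) ≤ (v - u) ^ (-p) :=
    Real.rpow_le_rpow_of_nonpos (by linarith) (by linarith) (by linarith)
  have hvu0 := Real.rpow_nonneg (by linarith : 0 ≤ v - u) (-p)
  -- Only one of the two factors is bounded through (1-t) v; the other uses v - t u ≥ v - u.
  -- Spending both on 1 - t would give a power of 1 - t that is not integrable against `kerW`.
  have d2 : (v - t * u) ^ (1 - α - 2 * p) ≤
      (1 - t) ^ (1 - α - p) * v ^ (1 - α - p) * (v - u) ^ (-p) := by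
    rw [show 1 - α - 2 * p = (1 - α - p) + -p by ring, Real.rpow_add hx]
    exact mul_le_mul h4 vu (Real.rpow_nonneg hx.le _)
      (mul_nonneg hW0 (Real.rpow_nonneg hv.le _))
  have c1 : |v ^ (2 * α - 2) * (((s - t * u') ^ (1 - α) - (v - t * u') ^ (1 - α)) -
      ((s - t * u) ^ (1 - α) - (v - t * u) ^ (1 - α)))| ≤
      (u - u') ^ p * (s - v) ^ p * v ^ (α - 1 - p) * (v - u) ^ (-p) * (1 - t) ^ (1 - α - p) := by
    rw [abs_mul, abs_of_nonneg h5]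
    calc _ ≤ v ^ (2 * α - 2) * ((u - u') ^ p * (s - v) ^ p *
          ((1 - t) ^ (1 - α - p) * v ^ (1 - α - p) * (v - u) ^ (-p))) := by
          refine mul_le_mul_of_nonneg_left (d1.trans ?_) h5
          refine mul_le_mul (mul_le_mul_of_nonneg_right h3 hlp) d2 (Real.rpow_nonneg hx.le _)
            (mul_nonneg hhp hlp)
      _ = (u - u') ^ p * (s - v) ^ p * (v ^ (2 * α - 2) * v ^ (1 - α - p)) * (v - u) ^ (-p) *
          (1 - t) ^ (1 - α - p) := by ring
      _ = _ := by rw [← Real.rpow_add hv]; congr 4; ring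
  have f1 := add_rpow_sub_rpow_le (x := s - t * u) (l := t * (u - u')) (by nlinarith)
    (by nlinarith) (sub_pos.2 hα1) hp hp1
  rw [show s - t * u + t * (u - u') = s - t * u' by ring] at f1
  have f0 : (s - t * u) ^ (1 - α) ≤ (s - t * u') ^ (1 - α) :=
    Real.rpow_le_rpow (by nlinarith) (by nlinarith) (by linarith)
  have c2 : |(v ^ (2 * α - 2) - s ^ (2 * α - 2)) *
      ((s - t * u') ^ (1 - α) - (s - t * u) ^ (1 - α))| ≤
      (u - u') ^ p * (s - v) ^ p * v ^ (α - 1 - p) * (v - u) ^ (-p) * (1 - t) ^ (1 - α - p) := by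
    rw [abs_of_nonneg (mul_nonneg (by linarith) (by linarith))]
    calc _ ≤ ((s - v) ^ p * v ^ (2 * α - 2 - p)) *
          ((u - u') ^ p * ((1 - t) ^ (1 - α - p) * v ^ (1 - α - p))) := by
          refine mul_le_mul a1 (f1.trans ?_) (by linarith)
            (mul_nonneg hlp (Real.rpow_nonneg hv.le _))
          exact mul_le_mul h3 h4s (Real.rpow_nonneg (by nlinarith) _) hhp
      _ = (u - u') ^ p * (s - v) ^ p * (v ^ (2 * α - 2 - p) * v ^ (1 - α - p)) *
          (1 - t) ^ (1 - α - p) := by ring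
      _ = (u - u') ^ p * (s - v) ^ p * v ^ (α - 1 - p) * v ^ (-p) * (1 - t) ^ (1 - α - p) := by
          rw [← Real.rpow_add hv, mul_assoc _ (v ^ (α - 1 - p)), ← Real.rpow_add hv]
          congr 3; ring
      _ ≤ _ := by
          have := Real.rpow_nonneg hv.le (α - 1 - p)
          gcongr
  have e : (kerT α t u v - kerT α t u' v) - (kerT α t u s - kerT α t u' s) =
      v ^ (2 * α - 2) * (((s - t * u') ^ (1 - α) - (v - t * u') ^ (1 - α)) -
      ((s - t * u) ^ (1 - α) - (v - t * u) ^ (1 - α))) - (v ^ (2 * α - 2) - s ^ (2 * α - 2)) *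
      ((s - t * u') ^ (1 - α) - (s - t * u) ^ (1 - α)) := by
    unfold kerT; ring
  rw [e]
  refine (abs_sub _ _).trans ((add_le_add c1 c2).trans (le_of_eq ?_))
  ring

end RoughFrac

end

/-! ### The kernel `G` without its diagonal singularity -/

noncomputable section

namespace RoughFrac

open Filter Topology

/-- The weight of `kerReg`. -/
def kerW (α t : ℝ) : ℝ := t ^ (-α) * (1 - t) ^ (2 * α - 2)

/-- `kernelG` without its singular factor `(ξ - θ)^{α-1}`, as a function of `u = ξ - θ` and
`v = η - θ`. -/
def kerReg (α u v : ℝ) : ℝ := ∫ t in (0 : ℝ)..1, kerW α t * kerT α t u v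

/-- The normalizing constant of `kernelG`. -/
def kerC (α : ℝ) : ℝ := 1 / (Real.Gamma (1 - α) * Real.Gamma α * Real.Gamma (2 * α - 1))

lemma kerC_pos {α : ℝ} (hα : 1 / 2 < α) (hα1 : α < 1) : 0 < kerC α := by
  have := Real.Gamma_pos_of_pos (sub_pos.2 hα1)
  have := Real.Gamma_pos_of_pos (by linarith : 0 < α)
  have := Real.Gamma_pos_of_pos (by linarith : 0 < 2 * α - 1)
  unfold kerC
  positivity

lemma kerW_nonneg {α t : ℝ} (ht : 0 ≤ t) (ht1 : t ≤ 1) : 0 ≤ kerW α t :=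
  mul_nonneg (Real.rpow_nonneg ht _) (Real.rpow_nonneg (by linarith) _)

lemma measurable_kerReg (α : ℝ) : Measurable (fun q : ℝ × ℝ => kerReg α q.1 q.2) := by
  unfold kerReg kerW kerT
  refine measurable_intervalIntegral (X := ℝ × ℝ) ?_ measurable_const measurable_const
  simp only [Function.uncurry_def]
  fun_prop

lemma kernel_subst_pointwise {α t τ : ℝ} (ht : 0 < t) (ht1 : t < 1) (hτ1 : τ < 1) :
    (1 - τ) / (1 - t * τ) ^ 2 * (((1 - t) / (1 - t * τ)) ^ (2 * α - 2) *
      (1 - (1 - t) / (1 - t * τ)) ^ (-α) *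
      (1 + (1 - (1 - t) / (1 - t * τ)) * (τ / (1 - τ)))⁻¹) =
    kerW α t * ((1 - τ) ^ (1 - α) * (1 - t * τ) ^ (1 - α)) := by
  have hD : 0 < 1 - t * τ := by nlinarith
  have h1 : 0 < 1 - t := by linarith
  have h2 : 0 < 1 - τ := by linarith
  have e1 : 1 - (1 - t) / (1 - t * τ) = t * (1 - τ) / (1 - t * τ) := by field_simp; ring
  have e2 : 1 + t * (1 - τ) / (1 - t * τ) * (τ / (1 - τ)) = 1 / (1 - t * τ) := by field_simp; ring
  rw [e1, e2, one_div, inv_inv, Real.div_rpow h1.le hD.le, Real.div_rpow (by positivity) hD.le,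
    Real.mul_rpow ht.le h2.le, kerW, Real.rpow_sub hD, Real.rpow_sub h1, Real.rpow_neg hD.le,
    Real.rpow_neg h2.le, Real.rpow_sub hD, Real.rpow_sub h2, mul_comm 2 α,
    Real.rpow_mul hD.le, Real.rpow_one, Real.rpow_one]
  have := Real.rpow_pos_of_pos hD α
  have := Real.rpow_pos_of_pos h2 α
  have := Real.rpow_pos_of_pos ht (-α)
  have e3 : (1 - t * τ) ^ (2 : ℝ) = (1 - t * τ) ^ 2 := by norm_cast
  have e4 : ((1 - t * τ) ^ α) ^ (2 : ℝ) = ((1 - t * τ) ^ α) ^ 2 := by norm_cast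
  rw [e3, e4]
  have := Real.rpow_pos_of_pos h1 (2 : ℝ)
  field_simp

/-- The substitution q = (1-t)/(1-tτ) turns the rational factor into a power and brings out
(1-τ)^{1-α}, the factor that cancels the singularity (η-ξ)^{α-1} of `kernelG`. -/
lemma kernelG_integral_subst {α τ : ℝ} (hτ : 0 < τ) (hτ1 : τ < 1) :
    ∫ q in (0 : ℝ)..1, q ^ (2 * α - 2) * (1 - q) ^ (-α) * (1 + (1 - q) * (τ / (1 - τ)))⁻¹ =
      ∫ t in (0 : ℝ)..1, kerW α t * ((1 - τ) ^ (1 - α) * (1 - t * τ) ^ (1 - α)) := by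
  rw [intervalIntegral_eq_Ioo zero_le_one, intervalIntegral_eq_Ioo zero_le_one]
  -- This Möbius map is an involution of (0, 1), so injectivity and surjectivity both follow from f
  -- (f t) = t.
  set f : ℝ → ℝ := fun t => (1 - t) / (1 - t * τ) with hf
  have hD : ∀ t ∈ Ioo (0 : ℝ) 1, 0 < 1 - t * τ := fun t ht => by nlinarith [ht.1, ht.2]
  have hinv : ∀ t ∈ Ioo (0 : ℝ) 1, f (f t) = t := fun t ht => by
    have h1 := hD t ht
    have h2 : 1 - t * τ - (1 - t) * τ ≠ 0 := by nlinarith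
    have h3 : 1 - (1 - t) / (1 - t * τ) * τ = (1 - t * τ - (1 - t) * τ) / (1 - t * τ) := by
      field_simp
    simp only [hf]
    rw [h3]
    field_simp
    ring
  have hmap : ∀ t ∈ Ioo (0 : ℝ) 1, f t ∈ Ioo (0 : ℝ) 1 := fun t ht => by
    have h1 := hD t ht
    refine ⟨div_pos (by linarith [ht.2]) h1, (div_lt_one h1).2 ?_⟩
    nlinarith [ht.1]
  have himg : f '' Ioo 0 1 = Ioo 0 1 := by
    ext t
    constructor
    · rintro ⟨s, hs, rfl⟩; exact hmap s hs
    · intro ht; exact ⟨f t, hmap t ht, hinv t ht⟩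
  have hinj : InjOn f (Ioo 0 1) := fun s hs t ht hst => by
    rw [← hinv s hs, hst, hinv t ht]
  have hder : ∀ t ∈ Ioo (0 : ℝ) 1, HasDerivWithinAt f (-((1 - τ) / (1 - t * τ) ^ 2)) (Ioo 0 1) t := by
    intro t ht
    have h1 := hD t ht
    have d1 : HasDerivAt (fun t : ℝ => 1 - t) (-1) t := by
      simpa using (hasDerivAt_id t).const_sub 1
    have d2 : HasDerivAt (fun t : ℝ => 1 - t * τ) (-τ) t := by
      simpa using ((hasDerivAt_id t).mul_const τ).const_sub 1
    convert! (d1.div d2 h1.ne').hasDerivWithinAt using 1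
    field_simp
    ring
  have := integral_image_eq_integral_abs_deriv_smul measurableSet_Ioo hder hinj
    (fun q : ℝ => q ^ (2 * α - 2) * (1 - q) ^ (-α) * (1 + (1 - q) * (τ / (1 - τ)))⁻¹)
  rw [himg] at this
  rw [this]
  refine setIntegral_congr_fun measurableSet_Ioo fun t ht => ?_
  have h1 := hD t ht
  have h2 : 0 < (1 - τ) / (1 - t * τ) ^ 2 := div_pos (by linarith) (by positivity)
  simp only [smul_eq_mul]
  rw [abs_neg, abs_of_pos h2, ← kernel_subst_pointwise ht.1 ht.2 hτ1]

/-- With τ = (ξ-θ)/(η-θ), the powers of η - ξ cancel after the substitution. What remains extends to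
η = ξ, and its only singularity in ξ is the explicit power. -/
lemma kernelG_eq {α θ ξ η : ℝ} (hα : 1 / 2 < α) (hα1 : α < 1) (h1 : θ < ξ) (h2 : ξ < η) :
    kernelG α θ ξ η = kerC α * (ξ - θ) ^ (α - 1) * kerReg α (ξ - θ) (η - θ) := by
  have hu : 0 < ξ - θ := by linarith
  have hv : 0 < η - θ := by linarith
  have huv : 0 < η - ξ := by linarith
  set τ := (ξ - θ) / (η - θ) with hτ
  have hτ0 : 0 < τ := by positivity
  have hτ1 : τ < 1 := (div_lt_one hv).2 (by linarith)
  have e1 : (ξ - θ) / (η - ξ) = τ / (1 - τ) := by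
    have : 1 - τ = (η - ξ) / (η - θ) := by rw [hτ]; field_simp; ring
    rw [this, hτ]
    field_simp
  rw [kernelG, e1, kernelG_integral_subst hτ0 hτ1, kerC, mul_assoc _ ((η - ξ) ^ (α - 1))]
  congr 1
  rw [← intervalIntegral.integral_const_mul, kerReg]
  refine integral_congr_Ioo zero_le_one fun t ht ht1 => ?_
  have e2 : 1 - τ = (η - ξ) / (η - θ) := by rw [hτ]; field_simp; ring
  have e3 : 1 - t * τ = ((η - θ) - t * (ξ - θ)) / (η - θ) := by rw [hτ]; field_simp
  have h3 : 0 ≤ (η - θ) - t * (ξ - θ) := by nlinarith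
  rw [e2, e3, Real.div_rpow huv.le hv.le, Real.div_rpow h3 hv.le, kerT]
  have e4 : (η - ξ) ^ (α - 1) * (η - ξ) ^ (1 - α) = 1 := by
    rw [← Real.rpow_add huv]; simp
  have e5 : (η - θ) ^ (2 * α - 2) * ((η - θ) ^ (1 - α) * (η - θ) ^ (1 - α)) = 1 := by
    rw [← Real.rpow_add hv, ← Real.rpow_add hv,
      show 2 * α - 2 + (1 - α + (1 - α)) = 0 by ring, Real.rpow_zero]
  have := Real.rpow_pos_of_pos hv (1 - α)
  rw [show (η - ξ) ^ (α - 1) * (kerW α t * ((η - ξ) ^ (1 - α) / (η - θ) ^ (1 - α) *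
      ((η - θ - t * (ξ - θ)) ^ (1 - α) / (η - θ) ^ (1 - α)))) =
      (η - ξ) ^ (α - 1) * (η - ξ) ^ (1 - α) * (kerW α t *
      ((η - θ - t * (ξ - θ)) ^ (1 - α) / ((η - θ) ^ (1 - α) * (η - θ) ^ (1 - α)))) by
      field_simp, e4, one_mul, ← mul_assoc, mul_div_assoc', mul_comm (kerW α t * _)]
  rw [div_eq_iff (by positivity)]
  linear_combination (-(kerW α t * (η - θ - t * (ξ - θ)) ^ (1 - α))) * e5

/-! ### Bounds for the regular kernel -/

/-- The constant in the bounds for `kerReg`. -/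
def kerB (α p : ℝ) : ℝ := betaR (1 - α) (α - p)

lemma kerB_pos {α p : ℝ} (hα1 : α < 1) (hpα : p < α) : 0 < kerB α p :=
  betaR_pos (by linarith) (by linarith)

/-- The weight collected from the differences of `kerT` leaves a beta density in t, integrable
exactly when p < α. Together with γ < p, needed to differentiate to the order γ, this fixes the
range of p. -/
lemma kerW_mul {α p t : ℝ} (ht1 : t < 1) :
    kerW α t * (1 - t) ^ (1 - α - p) = t ^ ((1 - α) - 1) * (1 - t) ^ ((α - p) - 1) := by
  rw [kerW, mul_assoc, ← Real.rpow_add (by linarith)]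
  congr 2 <;> ring

lemma kerW_mul_int {α p : ℝ} (hα1 : α < 1) (hpα : p < α) :
    IntervalIntegrable (fun t => kerW α t * (1 - t) ^ (1 - α - p)) volume 0 1 :=
  intervalIntegrable_congr_Ioo zero_le_one (fun t _ ht1 => kerW_mul ht1)
    (intervalIntegrable_beta01 (by linarith) (by linarith))

lemma integral_kerW_mul {α p : ℝ} :
    ∫ t in (0 : ℝ)..1, kerW α t * (1 - t) ^ (1 - α - p) = kerB α p :=
  integral_congr_Ioo zero_le_one fun _ _ ht1 => kerW_mul ht1

lemma kerW_int {α : ℝ} (hα : 1 / 2 < α) (hα1 : α < 1) :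
    IntervalIntegrable (fun t => kerW α t) volume 0 1 := by
  have := intervalIntegrable_beta01 (p := 1 - α) (q := 2 * α - 1) (by linarith) (by linarith)
  convert this using 2
  rw [kerW]
  congr 2 <;> ring

lemma kerW_kerT_int {α u v : ℝ} (hα : 1 / 2 < α) (hα1 : α < 1) (hu : 0 ≤ u) (huv : u ≤ v)
    (hv : 0 < v) : IntervalIntegrable (fun t => kerW α t * kerT α t u v) volume 0 1 := by
  refine intervalIntegrable_of_Ioo zero_le_one (by unfold kerW kerT; fun_prop)
    (fun t ht ht1 => ?_) ((kerW_int hα hα1).mul_const (v ^ (α - 1)))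
  rw [abs_mul, abs_of_nonneg (kerW_nonneg ht.le ht1.le),
    abs_of_nonneg (kerT_nonneg ht1.le hu huv)]
  exact mul_le_mul_of_nonneg_left (kerT_le hα1 ht.le ht1.le hu huv hv) (kerW_nonneg ht.le ht1.le)

lemma abs_integral_kerW_le {α p C : ℝ} (hα1 : α < 1) (hpα : p < α) {f : ℝ → ℝ}
    (hf : ∀ t, 0 < t → t < 1 → |f t| ≤ C * (1 - t) ^ (1 - α - p)) :
    |∫ t in (0 : ℝ)..1, kerW α t * f t| ≤ kerB α p * C := by
  have := abs_integral_le_of_Ioo zero_le_one (f := fun t => kerW α t * f t) (fun t ht ht1 => ?_)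
    ((kerW_mul_int hα1 hpα).mul_const C)
  · rwa [intervalIntegral.integral_mul_const, integral_kerW_mul] at this
  · rw [abs_mul, abs_of_nonneg (kerW_nonneg ht.le ht1.le)]
    calc _ ≤ kerW α t * (C * (1 - t) ^ (1 - α - p)) :=
          mul_le_mul_of_nonneg_left (hf t ht ht1) (kerW_nonneg ht.le ht1.le)
      _ = _ := by ring

lemma kerReg_le {α p u v : ℝ} (hα1 : α < 1) (hpα : p < α) (hp : 1 - α ≤ p) (hu : 0 ≤ u)
    (huv : u ≤ v) (hv : 0 < v) : |kerReg α u v| ≤ kerB α p * v ^ (α - 1) := by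
  refine abs_integral_kerW_le hα1 hpα fun t ht ht1 => ?_
  rw [abs_of_nonneg (kerT_nonneg ht1.le hu huv)]
  refine (kerT_le hα1 ht.le ht1.le hu huv hv).trans ?_
  exact le_mul_of_one_le_right (Real.rpow_nonneg hv.le _) (one_le_weight hp ht ht1)

lemma kerReg_diff_left {α p u u' v : ℝ} (hα : 1 / 2 < α) (hα1 : α < 1) (hpα : p < α)
    (hp : 1 - α ≤ p) (hu' : 0 ≤ u') (huu : u' ≤ u) (huv : u < v) :
    |kerReg α u v - kerReg α u' v| ≤ kerB α p * ((u - u') ^ p * v ^ (α - 1 - p)) := by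
  have hv : 0 < v := by linarith
  rw [kerReg, kerReg, ← intervalIntegral.integral_sub
    (kerW_kerT_int hα hα1 (hu'.trans huu) huv.le hv)
    (kerW_kerT_int hα hα1 hu' (huu.trans huv.le) hv)]
  simp only [← mul_sub]
  exact abs_integral_kerW_le hα1 hpα fun t ht ht1 =>
    kerT_diff_left hα1 hp (by linarith) ht ht1 hu' huu huv

lemma kerReg_diff_right {α p u v s : ℝ} (hα : 1 / 2 < α) (hα1 : α < 1) (hpα : p < α)
    (hp : 1 - α ≤ p) (hu : 0 ≤ u) (huv : u ≤ v) (hv : 0 < v) (hvs : v ≤ s) :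
    |kerReg α u v - kerReg α u s| ≤ kerB α p * (3 * ((s - v) ^ p * v ^ (α - 1 - p))) := by
  rw [kerReg, kerReg, ← intervalIntegral.integral_sub
    (kerW_kerT_int hα hα1 hu huv hv)
    (kerW_kerT_int hα hα1 hu (huv.trans hvs) (hv.trans_le hvs))]
  simp only [← mul_sub]
  refine abs_integral_kerW_le hα1 hpα fun t ht ht1 => ?_
  rw [mul_assoc]
  exact kerT_diff_right hα hα1 hp (by linarith) ht ht1 hu huv hv hvs

lemma kerReg_double_diff {α p u u' v s : ℝ} (hα : 1 / 2 < α) (hα1 : α < 1) (hpα : p < α)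
    (hp : 1 - α ≤ p) (hu' : 0 ≤ u') (huu : u' ≤ u) (huv : u < v) (hvs : v ≤ s) :
    |(kerReg α u v - kerReg α u' v) - (kerReg α u s - kerReg α u' s)| ≤
      kerB α p * (2 * ((u - u') ^ p * (s - v) ^ p * v ^ (α - 1 - p) * (v - u) ^ (-p))) := by
  have hv : 0 < v := by linarith
  have i1 := kerW_kerT_int hα hα1 (hu'.trans huu) huv.le hv
  have i2 := kerW_kerT_int hα hα1 hu' (huu.trans huv.le) hv
  have i3 := kerW_kerT_int hα hα1 (hu'.trans huu) (huv.le.trans hvs) (hv.trans_le hvs)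
  have i4 := kerW_kerT_int hα hα1 hu' ((huu.trans huv.le).trans hvs) (hv.trans_le hvs)
  rw [kerReg, kerReg, kerReg, kerReg, ← intervalIntegral.integral_sub i1 i2,
    ← intervalIntegral.integral_sub i3 i4, ← intervalIntegral.integral_sub (i1.sub i2) (i3.sub i4)]
  simp only [← mul_sub]
  refine abs_integral_kerW_le hα1 hpα fun t ht ht1 => ?_
  rw [mul_assoc]
  exact kerT_double_diff hα hα1 hp (by linarith) ht ht1 hu' huu huv hvs

/-- The value of the kernel on the diagonal. -/
lemma kerReg_diag {α u : ℝ} (hα : 1 / 2 < α) (hα1 : α < 1) (hu : 0 < u) :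
    kerC α * kerReg α u u = 1 / Real.Gamma (2 * α - 1) * u ^ (α - 1) := by
  have e : kerReg α u u = betaR (1 - α) α * u ^ (α - 1) := by
    rw [kerReg, betaR, ← intervalIntegral.integral_mul_const]
    refine integral_congr_Ioo zero_le_one fun t ht ht1 => ?_
    rw [kerW, kerT, show u - t * u = (1 - t) * u by ring, Real.mul_rpow (by linarith) hu.le,
      show t ^ (-α) * (1 - t) ^ (2 * α - 2) * (u ^ (2 * α - 2) * ((1 - t) ^ (1 - α) * u ^ (1 - α)))
        = t ^ (-α) * ((1 - t) ^ (2 * α - 2) * (1 - t) ^ (1 - α)) *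
          (u ^ (2 * α - 2) * u ^ (1 - α)) by ring,
      ← Real.rpow_add (by linarith), ← Real.rpow_add hu]
    rw [show 1 - α - 1 = -α by ring, show 2 * α - 2 + (1 - α) = α - 1 by ring]
  rw [e, betaR_eq_Gamma (by linarith) (by linarith), sub_add_cancel, Real.Gamma_one, kerC]
  have := (Real.Gamma_pos_of_pos (sub_pos.2 hα1)).ne'
  have := (Real.Gamma_pos_of_pos (by linarith : 0 < α)).ne'
  field_simp

end RoughFrac

end

/-! ### Weyl derivatives under Hölder bounds: size, linearity, locality -/

noncomputable section

namespace RoughFrac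

open Filter Topology

lemma weylRight_bound_holder {γ p : ℝ} (hγ : 0 < γ) (hγ1 : γ < 1) (hp : γ < p)
    {b r Ψ : ℝ} {g : ℝ → ℝ} (hrb : r < b) (hA : |g r| ≤ Ψ * (b - r) ^ p)
    (he : ∀ s, r < s → s < b → |g r - g s| ≤ Ψ * (s - r) ^ p) :
    |weylRight γ b g r| ≤ weylC γ p 1 * Ψ * (b - r) ^ (p - γ) := by
  have := weylRight_bound (Ψ := Ψ) (g := g) hγ hγ1 hp one_pos hrb (by simpa using hA)
    (fun s h1 h2 => by simpa using he s h1 h2)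
  simpa using this

lemma weylLeft_bound_holder {γ p : ℝ} (hγ : 0 < γ) (hγ1 : γ < 1) (hp : γ < p)
    {a r Ψ : ℝ} {g : ℝ → ℝ} (har : a < r) (hA : |g r| ≤ Ψ * (r - a) ^ p)
    (he : ∀ s, a < s → s < r → |g r - g s| ≤ Ψ * (r - s) ^ p) :
    |weylLeft γ a g r| ≤ weylC γ p 1 * Ψ * (r - a) ^ (p - γ) := by
  have := weylLeft_bound (Ψ := Ψ) (g := g) hγ hγ1 hp one_pos har (by simpa using hA)
    (fun s h1 h2 => by simpa using he s h1 h2)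
  simpa using this

lemma weylRight_integrand_int {γ p C b r : ℝ} (hp : γ < p) (hrb : r ≤ b) {g : ℝ → ℝ}
    (hg : Measurable g) (he : ∀ s, r < s → s < b → |g r - g s| ≤ C * (s - r) ^ p) :
    IntervalIntegrable (fun s => (g r - g s) / (s - r) ^ (γ + 1)) volume r b := by
  refine intervalIntegrable_of_Ioo hrb (by fun_prop) (fun s h1 h2 => ?_)
    ((intervalIntegrable_rpow_left (sub_pos.2 hp) hrb).const_mul C)
  have h : 0 < s - r := by linarith
  rw [abs_div, abs_of_pos (Real.rpow_pos_of_pos h _), div_le_iff₀ (Real.rpow_pos_of_pos h _),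
    mul_assoc, ← Real.rpow_add h, show p - γ - 1 + (γ + 1) = p by ring]
  exact he s h1 h2

lemma weylRight_sub_holder {γ p C₁ C₂ b r : ℝ} (hp : γ < p) (hrb : r ≤ b) {g₁ g₂ : ℝ → ℝ}
    (hg₁ : Measurable g₁) (hg₂ : Measurable g₂)
    (he₁ : ∀ s, r < s → s < b → |g₁ r - g₁ s| ≤ C₁ * (s - r) ^ p)
    (he₂ : ∀ s, r < s → s < b → |g₂ r - g₂ s| ≤ C₂ * (s - r) ^ p) :
    weylRight γ b g₁ r - weylRight γ b g₂ r = weylRight γ b (fun s => g₁ s - g₂ s) r := by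
  have i1 := weylRight_integrand_int hp hrb hg₁ he₁
  have i2 := weylRight_integrand_int hp hrb hg₂ he₂
  have e : ∫ s in r..b, (g₁ r - g₂ r - (g₁ s - g₂ s)) / (s - r) ^ (γ + 1) =
      (∫ s in r..b, (g₁ r - g₁ s) / (s - r) ^ (γ + 1)) -
        ∫ s in r..b, (g₂ r - g₂ s) / (s - r) ^ (γ + 1) := by
    rw [← intervalIntegral.integral_sub i1 i2]
    congr 1
    ext s
    ring
  rw [weylRight, weylRight, weylRight, e]
  ring

lemma weylLeft_congr {γ a t : ℝ} {g₁ g₂ : ℝ → ℝ} (hat : a < t)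
    (h : ∀ s, a < s → s ≤ t → g₁ s = g₂ s) : weylLeft γ a g₁ t = weylLeft γ a g₂ t := by
  rw [weylLeft, weylLeft, h t hat le_rfl]
  congr 3
  exact integral_congr_Ioo hat.le fun s h1 h2 => by rw [h s h1 h2.le]

lemma weylRight_congr {γ b t : ℝ} {g₁ g₂ : ℝ → ℝ} (htb : t < b)
    (h : ∀ s, t ≤ s → s < b → g₁ s = g₂ s) : weylRight γ b g₁ t = weylRight γ b g₂ t := by
  rw [weylRight, weylRight, h t le_rfl htb]
  congr 3
  exact integral_congr_Ioo htb.le fun s h1 h2 => by rw [h s h1.le h2]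

lemma weylRight_const_mul (γ b c t : ℝ) (g : ℝ → ℝ) :
    weylRight γ b (fun s => c * g s) t = c * weylRight γ b g t := by
  simp only [weylRight, ← mul_sub, mul_div_assoc, intervalIntegral.integral_const_mul]
  ring

/-! ### The kernel after the first differentiation -/

/-- The right-sided derivative of `kerReg` in the second variable. -/
def kerH (γ α θ b ξ η : ℝ) : ℝ := weylRight γ b (fun η' => kerReg α (ξ - θ) (η' - θ)) η

/-- The function of `ξ` to which the second differentiation in `kernelK` is applied. -/
def kerHs (γ α θ b η ξ : ℝ) : ℝ := kerC α * (ξ - θ) ^ (α - 1) * kerH γ α θ b ξ η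

/-- The size of `kerH`. -/
def kerS (γ α p θ b ξ η : ℝ) : ℝ :=
  (η - θ) ^ (α - 1) * ((b - η) ^ (-p) + (η - ξ) ^ (-p)) * (b - η) ^ (p - γ)

/-- The constant in the bounds for `kerH`. -/
def kerHC (γ α p : ℝ) : ℝ := weylC γ p 1 * (3 * kerB α p)

lemma weylRight_kernelG_eq {γ α θ b ξ η : ℝ} (hα : 1 / 2 < α) (hα1 : α < 1) (h1 : θ < ξ)
    (h2 : ξ < η) (h3 : η < b) :
    weylRight γ b (fun η' => kernelG α θ ξ η') η = kerHs γ α θ b η ξ := by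
  rw [kerHs, kerH, ← weylRight_const_mul]
  exact weylRight_congr h3 fun s h4 _ => kernelG_eq hα hα1 h1 (h2.trans_le h4)

lemma kernelK_eq {α ε θ b ξ η : ℝ} (hα : 1 / 2 < α) (hα1 : α < 1) (h1 : θ < ξ)
    (h2 : ξ < η) (h3 : η < b) :
    kernelK α ε θ b ξ η = weylLeft (α - ε) θ (kerHs (α - ε) α θ b η) ξ :=
  weylLeft_congr h1 fun _ h4 h5 => weylRight_kernelG_eq hα hα1 h4 (h5.trans_lt h2) h3

lemma measurable_kerReg_comp {X : Type*} [MeasurableSpace X] (α : ℝ) {u v : X → ℝ}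
    (hu : Measurable u) (hv : Measurable v) : Measurable fun x => kerReg α (u x) (v x) :=
  (measurable_kerReg α).comp (hu.prodMk hv)

lemma measurable_kerH_comp {X : Type*} [MeasurableSpace X] (γ α : ℝ) {θ b ξ η : X → ℝ}
    (hθ : Measurable θ) (hb : Measurable b) (hξ : Measurable ξ) (hη : Measurable η) :
    Measurable fun x => kerH γ α (θ x) (b x) (ξ x) (η x) := by
  refine measurable_weylRight (g := fun x η' => kerReg α (ξ x - θ x) (η' - θ x)) ?_ hb hη
  exact measurable_kerReg_comp α ((hξ.sub hθ).comp measurable_fst)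
    (measurable_snd.sub (hθ.comp measurable_fst))

lemma measurable_kerHs_comp {X : Type*} [MeasurableSpace X] (γ α : ℝ) {θ b ξ η : X → ℝ}
    (hθ : Measurable θ) (hb : Measurable b) (hξ : Measurable ξ) (hη : Measurable η) :
    Measurable fun x => kerHs γ α (θ x) (b x) (η x) (ξ x) := by
  have := measurable_kerH_comp γ α hθ hb hξ hη
  unfold kerHs
  fun_prop

section

variable {γ α p : ℝ}

lemma kerReg_inc {θ ξ η b : ℝ} (hγ : 1 / 2 < γ) (hγp : γ < p) (hpα : p < α) (hα1 : α < 1)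
    (h1 : θ ≤ ξ) (h2 : ξ < η) :
    ∀ s, η < s → s < b → |kerReg α (ξ - θ) (η - θ) - kerReg α (ξ - θ) (s - θ)| ≤
      3 * kerB α p * (η - θ) ^ (α - 1 - p) * (s - η) ^ p := by
  intro s h3 _
  have := kerReg_diff_right (α := α) (p := p) (u := ξ - θ) (v := η - θ) (s := s - θ)
    (by linarith) hα1 hpα (by linarith) (by linarith) (by linarith) (by linarith) (by linarith)
  rw [show s - θ - (η - θ) = s - η by ring] at this
  linarith

/-- The value of `kerReg` is of order (η-θ)^{α-1} and does not vanish at b, whence the factor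
(b-η)^{-p}; the increments give (η-θ)^{α-1-p}. The bound does not involve ξ, which matters in
`triInt_kerHs`. -/
lemma kerH_bound {θ ξ η b : ℝ} (hγ : 1 / 2 < γ) (hγp : γ < p) (hpα : p < α) (hα1 : α < 1)
    (h1 : θ ≤ ξ) (h2 : ξ < η) (h3 : η < b) :
    |kerH γ α θ b ξ η| ≤ kerHC γ α p *
      (((η - θ) ^ (α - 1) * (b - η) ^ (-p) + (η - θ) ^ (α - 1 - p)) * (b - η) ^ (p - γ)) := by
  have hv : 0 < η - θ := by linarith
  have hb : 0 < b - η := by linarith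
  have hB := kerB_pos hα1 hpα
  have hp1 := Real.rpow_nonneg hb.le p
  have := weylRight_bound_holder (γ := γ) (p := p) (b := b) (r := η)
    (Ψ := 3 * kerB α p * ((η - θ) ^ (α - 1) * (b - η) ^ (-p) + (η - θ) ^ (α - 1 - p)))
    (g := fun η' => kerReg α (ξ - θ) (η' - θ)) (by linarith) (by linarith) hγp h3 ?_ ?_
  · rw [kerHC]
    refine this.trans (le_of_eq ?_)
    ring
  · have e := kerReg_le (α := α) (p := p) (u := ξ - θ) (v := η - θ) hα1 hpα (by linarith)
      (by linarith) (by linarith) hv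
    have e2 : (b - η) ^ (-p) * (b - η) ^ p = 1 := by rw [← Real.rpow_add hb]; simp
    have := Real.rpow_nonneg hv.le (α - 1 - p)
    have := Real.rpow_nonneg hv.le (α - 1)
    calc |kerReg α (ξ - θ) (η - θ)| ≤ kerB α p * (η - θ) ^ (α - 1) := e
      _ ≤ 3 * (kerB α p * (η - θ) ^ (α - 1)) + 3 * kerB α p * (η - θ) ^ (α - 1 - p) * (b - η) ^ p := by
        have : 0 ≤ kerB α p * (η - θ) ^ (α - 1) := by positivity
        have : 0 ≤ 3 * kerB α p * (η - θ) ^ (α - 1 - p) * (b - η) ^ p := by positivity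
        linarith
      _ = _ := by linear_combination (-(3 * kerB α p * (η - θ) ^ (α - 1))) * e2
  · intro s h4 h5
    refine (kerReg_inc hγ hγp hpα hα1 h1 h2 s h4 h5).trans ?_
    have := Real.rpow_nonneg (by linarith : 0 ≤ s - η) p
    have := Real.rpow_nonneg hv.le (α - 1)
    have := Real.rpow_nonneg hb.le (-p)
    gcongr
    have : 0 ≤ (η - θ) ^ (α - 1) * (b - η) ^ (-p) := by positivity
    linarith

lemma kerS_nonneg {θ ξ η b : ℝ} (h1 : θ ≤ ξ) (h2 : ξ < η) (h3 : η < b) :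
    0 ≤ kerS γ α p θ b ξ η := by
  have := Real.rpow_nonneg (by linarith : 0 ≤ η - θ) (α - 1)
  have := Real.rpow_nonneg (by linarith : 0 ≤ η - ξ) (-p)
  have := Real.rpow_nonneg (by linarith : 0 ≤ b - η) (-p)
  have := Real.rpow_nonneg (by linarith : 0 ≤ b - η) (p - γ)
  unfold kerS
  positivity

lemma kerS_mono {θ ξ ξ' η b : ℝ} (hp : 0 ≤ p) (h0 : θ ≤ ξ') (h1 : ξ' ≤ ξ) (h2 : ξ < η)
    (h3 : η < b) : kerS γ α p θ b ξ' η ≤ kerS γ α p θ b ξ η := by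
  have := Real.rpow_nonneg (by linarith : 0 ≤ η - θ) (α - 1)
  have := Real.rpow_nonneg (by linarith : 0 ≤ b - η) (p - γ)
  have : (η - ξ') ^ (-p) ≤ (η - ξ) ^ (-p) :=
    Real.rpow_le_rpow_of_nonpos (by linarith) (by linarith) (by linarith)
  unfold kerS
  gcongr

lemma kerHC_pos (hγ : 1 / 2 < γ) (hγp : γ < p) (hpα : p < α) (hα1 : α < 1) :
    0 < kerHC γ α p := by
  have h1 := kerB_pos hα1 hpα
  have h2 := weylC_pos (γ := γ) (p := p) (q := 1) (by linarith) (by linarith) hγp one_pos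
  unfold kerHC
  positivity

/-- A weaker bound, singular at ξ = η, so that the values and the increments of `kerH` in ξ share
one majorant. -/
lemma kerH_le_kerS {θ ξ η b : ℝ} (hγ : 1 / 2 < γ) (hγp : γ < p) (hpα : p < α) (hα1 : α < 1)
    (h1 : θ ≤ ξ) (h2 : ξ < η) (h3 : η < b) :
    |kerH γ α θ b ξ η| ≤ kerHC γ α p * kerS γ α p θ b ξ η := by
  refine (kerH_bound hγ hγp hpα hα1 h1 h2 h3).trans ?_
  have hC := kerHC_pos hγ hγp hpα hα1
  have hv : 0 < η - θ := by linarith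
  have := Real.rpow_nonneg (by linarith : 0 ≤ b - η) (p - γ)
  have := Real.rpow_nonneg hv.le (α - 1)
  rw [kerS]
  gcongr
  rw [mul_add, show α - 1 - p = (α - 1) + -p by ring, Real.rpow_add hv]
  have : (η - θ) ^ (-p) ≤ (η - ξ) ^ (-p) :=
    Real.rpow_le_rpow_of_nonpos (by linarith) (by linarith) (by linarith)
  gcongr

/-- The derivative in η of a difference in ξ: its value is controlled by the simple difference of
`kerReg` in the first variable, its increments in η by the mixed difference. -/
lemma kerH_diff {θ ξ ξ' η b : ℝ} (hγ : 1 / 2 < γ) (hγp : γ < p) (hpα : p < α) (hα1 : α < 1)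
    (h0 : θ ≤ ξ') (h1 : ξ' ≤ ξ) (h2 : ξ < η) (h3 : η < b) :
    |kerH γ α θ b ξ η - kerH γ α θ b ξ' η| ≤
      kerHC γ α p * ((ξ - ξ') ^ p * (η - θ) ^ (-p) * kerS γ α p θ b ξ η) := by
  have hv : 0 < η - θ := by linarith
  have hb : 0 < b - η := by linarith
  have hB := kerB_pos hα1 hpα
  have hhp := Real.rpow_nonneg (by linarith : 0 ≤ ξ - ξ') p
  have hvp := Real.rpow_nonneg hv.le (α - 1 - p)
  have hbp := Real.rpow_nonneg hb.le (-p)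
  have hvup := Real.rpow_nonneg (by linarith : 0 ≤ η - ξ) (-p)
  have hm : ∀ w, Measurable fun η' => kerReg α w (η' - θ) := fun w =>
    measurable_kerReg_comp α measurable_const (measurable_id.sub_const θ)
  rw [kerH, kerH, weylRight_sub_holder hγp h3.le (hm _) (hm _)
    (kerReg_inc hγ hγp hpα hα1 (h0.trans h1) h2) (kerReg_inc hγ hγp hpα hα1 h0 (h1.trans_lt h2))]
  have := weylRight_bound_holder (γ := γ) (p := p) (b := b) (r := η)
    (Ψ := 3 * kerB α p * ((ξ - ξ') ^ p * (η - θ) ^ (α - 1 - p) *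
      ((b - η) ^ (-p) + (η - ξ) ^ (-p))))
    (g := fun η' => kerReg α (ξ - θ) (η' - θ) - kerReg α (ξ' - θ) (η' - θ)) (by linarith)
    (by linarith) hγp h3 ?_ ?_
  · refine this.trans (le_of_eq ?_)
    rw [kerHC, kerS, show α - 1 - p = (α - 1) + -p by ring, Real.rpow_add hv]
    ring
  · have e := kerReg_diff_left (α := α) (p := p) (u := ξ - θ) (u' := ξ' - θ) (v := η - θ)
      (by linarith) hα1 hpα (by linarith) (by linarith) (by linarith) (by linarith)
    rw [show ξ - θ - (ξ' - θ) = ξ - ξ' by ring] at e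
    have e2 : (b - η) ^ (-p) * (b - η) ^ p = 1 := by rw [← Real.rpow_add hb]; simp
    have hp1 := Real.rpow_nonneg hb.le p
    refine e.trans ?_
    have n1 : 0 ≤ kerB α p * ((ξ - ξ') ^ p * (η - θ) ^ (α - 1 - p)) := by positivity
    have n2 : 0 ≤ 3 * kerB α p * ((ξ - ξ') ^ p * (η - θ) ^ (α - 1 - p)) * (η - ξ) ^ (-p) *
        (b - η) ^ p := by positivity
    linear_combination 2 * n1 + n2 - (3 * (kerB α p * ((ξ - ξ') ^ p * (η - θ) ^ (α - 1 - p)))) * e2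
  · intro s h4 h5
    have e := kerReg_double_diff (α := α) (p := p) (u := ξ - θ) (u' := ξ' - θ) (v := η - θ)
      (s := s - θ) (by linarith) hα1 hpα (by linarith) (by linarith) (by linarith) (by linarith)
      (by linarith)
    rw [show ξ - θ - (ξ' - θ) = ξ - ξ' by ring, show s - θ - (η - θ) = s - η by ring,
      show η - θ - (ξ - θ) = η - ξ by ring] at e
    refine e.trans ?_
    have hsp := Real.rpow_nonneg (by linarith : 0 ≤ s - η) p
    calc _ = 2 * (kerB α p * ((ξ - ξ') ^ p * (η - θ) ^ (α - 1 - p) * (η - ξ) ^ (-p) * (s - η) ^ p))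
          := by ring
      _ ≤ 3 * (kerB α p * ((ξ - ξ') ^ p * (η - θ) ^ (α - 1 - p) *
          ((b - η) ^ (-p) + (η - ξ) ^ (-p)) * (s - η) ^ p)) := by
          gcongr
          · norm_num
          · linarith
      _ = _ := by ring

/-- By homogeneity the claim is 1 - (u'/u)^{1-α} ≤ (1 - u'/u)^p; both exponents are at most 1 and
the bases lie in (0, 1], so each power is at least its base. -/
lemma rpow_sub_rpow_le {u u' : ℝ} (hα1 : α < 1) (hα0 : 0 < α) (hp1 : p ≤ 1) (hu' : 0 < u')
    (huu : u' ≤ u) : |u ^ (α - 1) - u' ^ (α - 1)| ≤ u' ^ (α - 1) * ((u - u') ^ p * u ^ (-p)) := by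
  have hu : 0 < u := by linarith
  have h1 : u ^ (α - 1) ≤ u' ^ (α - 1) := Real.rpow_le_rpow_of_nonpos hu' huu (by linarith)
  have h2 : u' / u ≤ 1 := (div_le_one hu).2 huu
  have h3 : u' / u ≤ (u' / u) ^ (1 - α) := le_rpow_of_le_one (by positivity) h2 (by linarith)
  have h4 : u ^ (α - 1) = u' ^ (α - 1) * (u' / u) ^ (1 - α) := by
    rw [Real.div_rpow hu'.le hu.le, mul_div_assoc', ← Real.rpow_add hu', sub_add_sub_cancel,
      sub_self, Real.rpow_zero, one_div, ← Real.rpow_neg hu.le, neg_sub]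
  have h5 : (u - u') / u ≤ ((u - u') / u) ^ p :=
    le_rpow_of_le_one (div_nonneg (by linarith) hu.le) ((div_le_one hu).2 (by linarith)) hp1
  have h6 : ((u - u') / u) ^ p = (u - u') ^ p * u ^ (-p) := by
    rw [Real.div_rpow (by linarith) hu.le, Real.rpow_neg hu.le, div_eq_mul_inv]
  have h7 : (u - u') / u = 1 - u' / u := by field_simp
  rw [abs_sub_comm, abs_of_nonneg (by linarith), ← h6]
  have h8 := Real.rpow_pos_of_pos hu' (α - 1)
  rw [h4]
  nlinarith

/-- The weight for `kerHs` as a function in `FracClass`. -/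
def kerPsi (γ α p θ b η ξ : ℝ) : ℝ :=
  2 * (kerC α * kerHC γ α p) * kerS γ α p θ b ξ η * (ξ - θ) ^ (-p)

/-- The factor (ξ-θ)^{α-1} dictates q = α in the weighted Hölder condition. Its weight is integrable
because γ < α makes (r-θ)^{α-γ-1} integrable at θ and p < 1 makes (η-r)^{-p} integrable at η. -/
lemma fracClass_kerHs {θ η b : ℝ} (hγ : 1 / 2 < γ) (hγp : γ < p) (hpα : p < α) (hα1 : α < 1)
    (h2 : θ < η) (h3 : η < b) :
    FracClass γ p α θ η (kerHs γ α θ b η) (kerPsi γ α p θ b η) := by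
  have hcc := kerC_pos (α := α) (by linarith) hα1
  have hC := kerHC_pos hγ hγp hpα hα1
  refine ⟨measurable_kerHs_comp γ α measurable_const measurable_const measurable_id
    measurable_const, fun r h4 h5 => ?_, fun s r h4 h5 h6 => ?_, ?_⟩
  · have hr : 0 < r - θ := by linarith
    have hr' := Real.rpow_nonneg hr.le (α - 1)
    have hS := kerS_nonneg (γ := γ) (α := α) (p := p) h4.le h5 h3
    rw [kerHs, abs_mul, abs_of_nonneg (by positivity), kerPsi, mul_assoc _ ((r - θ) ^ (-p)),
      ← Real.rpow_add hr, show -p + (p + α - 1) = α - 1 by ring]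
    calc _ ≤ kerC α * (r - θ) ^ (α - 1) * (kerHC γ α p * kerS γ α p θ b r η) := by
          gcongr
          exact kerH_le_kerS hγ hγp hpα hα1 h4.le h5 h3
      _ ≤ 2 * (kerC α * (r - θ) ^ (α - 1) * (kerHC γ α p * kerS γ α p θ b r η)) :=
          le_mul_of_one_le_left (by positivity) (by norm_num)
      _ = _ := by ring
  · have hr : 0 < r - θ := by linarith
    have hs : 0 < s - θ := by linarith
    have hv : 0 < η - θ := by linarith
    have hS := kerS_nonneg (γ := γ) (α := α) (p := p) (h4.trans h5).le h6 h3
    have b1 := kerH_diff hγ hγp hpα hα1 h4.le h5.le h6 h3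
    have b2 := (kerH_le_kerS hγ hγp hpα hα1 h4.le (h5.trans h6) h3).trans
      (mul_le_mul_of_nonneg_left (kerS_mono (γ := γ) (α := α) (p := p) (by linarith) h4.le h5.le
        h6 h3) hC.le)
    have b3 := rpow_sub_rpow_le (p := p) (u := r - θ) (u' := s - θ) hα1 (by linarith) (by linarith)
      hs (by linarith)
    rw [show r - θ - (s - θ) = r - s by ring] at b3
    have c1 : (r - θ) ^ (α - 1) ≤ (s - θ) ^ (α - 1) :=
      Real.rpow_le_rpow_of_nonpos hs (by linarith) (by linarith)
    have c2 : (η - θ) ^ (-p) ≤ (r - θ) ^ (-p) :=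
      Real.rpow_le_rpow_of_nonpos hr (by linarith) (by linarith)
    have n1 := Real.rpow_nonneg hr.le (α - 1)
    have n2 := Real.rpow_nonneg hs.le (α - 1)
    have n3 := Real.rpow_nonneg hr.le (-p)
    have n4 := Real.rpow_nonneg (by linarith : 0 ≤ r - s) p
    have n5 := Real.rpow_nonneg hv.le (-p)
    -- Product rule: the increment falls either on `kerH` or on the power of r - θ.
    have e : kerHs γ α θ b η r - kerHs γ α θ b η s = kerC α * ((r - θ) ^ (α - 1) *
        (kerH γ α θ b r η - kerH γ α θ b s η) +
        ((r - θ) ^ (α - 1) - (s - θ) ^ (α - 1)) * kerH γ α θ b s η) := by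
      unfold kerHs; ring
    rw [e, abs_mul, abs_of_pos hcc, kerPsi]
    have f1 : |(r - θ) ^ (α - 1) * (kerH γ α θ b r η - kerH γ α θ b s η)| ≤
        (s - θ) ^ (α - 1) *
          (kerHC γ α p * ((r - s) ^ p * (r - θ) ^ (-p) * kerS γ α p θ b r η)) := by
      rw [abs_mul, abs_of_nonneg n1]
      refine mul_le_mul c1 (b1.trans ?_) (abs_nonneg _) n2
      gcongr
    have f2 : |((r - θ) ^ (α - 1) - (s - θ) ^ (α - 1)) * kerH γ α θ b s η| ≤
        (s - θ) ^ (α - 1) * ((r - s) ^ p * (r - θ) ^ (-p)) *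
          (kerHC γ α p * kerS γ α p θ b r η) := by
      rw [abs_mul]
      exact mul_le_mul b3 b2 (abs_nonneg _) (by positivity)
    calc _ ≤ kerC α * ((s - θ) ^ (α - 1) *
          (kerHC γ α p * ((r - s) ^ p * (r - θ) ^ (-p) * kerS γ α p θ b r η)) +
          (s - θ) ^ (α - 1) * ((r - s) ^ p * (r - θ) ^ (-p)) *
          (kerHC γ α p * kerS γ α p θ b r η)) := by
          gcongr
          exact (abs_add_le _ _).trans (add_le_add f1 f2)
      _ = _ := by ring
  · have i1 := intervalIntegrable_rpow_left (p := α - γ) (by linarith) h2.le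
    have i2 := intervalIntegrable_beta (p := α - γ) (q := 1 - p) (by linarith) (by linarith) h2.le
    have i3 := ((i1.const_mul ((b - η) ^ (-p))).add i2).const_mul
      (2 * (kerC α * kerHC γ α p) * (η - θ) ^ (α - 1) * (b - η) ^ (p - γ))
    refine intervalIntegrable_congr_Ioo h2.le (fun r h4 h5 => ?_) i3
    have hr : 0 < r - θ := by linarith
    rw [kerPsi, mul_assoc _ ((r - θ) ^ (-p)), ← Real.rpow_add hr,
      show -p + (p - γ + α - 1) = α - γ - 1 by ring, show 1 - p - 1 = -p by ring, kerS]
    ring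

end

/-! ### The kernel `K` -/

/-- The majorant of `kernelK`. -/
def kerM (γ α p θ b ξ η : ℝ) : ℝ :=
  weylC γ p α * (2 * (kerC α * kerHC γ α p)) * ((ξ - θ) ^ (α - γ - 1) * kerS γ α p θ b ξ η)

/-- Below the diagonal the kernel K is the left derivative of `kerHs`, which belongs to `FracClass`.
-/
lemma kernelK_bound {α ε p θ b ξ η : ℝ} (hγ : 1 / 2 < α - ε) (hγp : α - ε < p) (hpα : p < α)
    (hα1 : α < 1) (h1 : θ < ξ) (h2 : ξ < η) (h3 : η < b) :
    |kernelK α ε θ b ξ η| ≤ kerM (α - ε) α p θ b ξ η := by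
  rw [kernelK_eq (by linarith) hα1 h1 h2 h3]
  refine ((fracClass_kerHs hγ hγp hpα hα1 (h1.trans h2) h3).weyl_bd (by linarith) (by linarith)
    hγp (by linarith) ξ h1 h2).trans (le_of_eq ?_)
  have hr : 0 < ξ - θ := by linarith
  rw [kerPsi, kerM, mul_assoc _ ((ξ - θ) ^ (-p)), ← Real.rpow_add hr,
    show -p + (p - (α - ε) + α - 1) = α - (α - ε) - 1 by ring]
  ring

/-- The integral of `kerM` in the variable `ξ`. -/
def kerSec (γ α p θ b η : ℝ) : ℝ :=
  weylC γ p α * (2 * (kerC α * kerHC γ α p)) *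
    (1 / (α - γ) * ((η - θ) ^ (2 * α - γ - 1) * (b - η) ^ (1 - γ - 1)) +
      betaR (α - γ) (1 - p) * ((η - θ) ^ (2 * α - γ - p - 1) * (b - η) ^ (p - γ + 1 - 1)))

/-- The constant in the integral of `kerM` over the triangle. -/
def kerTot (γ α p : ℝ) : ℝ :=
  weylC γ p α * (2 * (kerC α * kerHC γ α p)) *
    (1 / (α - γ) * betaR (2 * α - γ) (1 - γ) +
      betaR (α - γ) (1 - p) * betaR (2 * α - γ - p) (p - γ + 1))

section

variable {γ α p : ℝ}

lemma kerM_const_pos (hγ : 1 / 2 < γ) (hγp : γ < p) (hpα : p < α) (hα1 : α < 1) :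
    0 < weylC γ p α * (2 * (kerC α * kerHC γ α p)) := by
  have h1 := kerC_pos (α := α) (by linarith) hα1
  have h2 := kerHC_pos hγ hγp hpα hα1
  have h3 := weylC_pos (γ := γ) (p := p) (q := α) (by linarith) (by linarith) hγp (by linarith)
  positivity

lemma kerM_section {θ b η : ℝ} (hγp : γ < p) (hpα : p < α) (hα1 : α < 1) (h2 : θ < η)
    (h3 : η < b) :
    IntervalIntegrable (fun ξ => kerM γ α p θ b ξ η) volume θ η ∧
    ∫ ξ in θ..η, kerM γ α p θ b ξ η = kerSec γ α p θ b η := by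
  have i1 := intervalIntegrable_rpow_left (p := α - γ) (by linarith) h2.le
  have i2 := intervalIntegrable_beta (p := α - γ) (q := 1 - p) (by linarith) (by linarith) h2.le
  have e : (fun ξ => kerM γ α p θ b ξ η) = fun ξ =>
      weylC γ p α * (2 * (kerC α * kerHC γ α p)) * (η - θ) ^ (α - 1) * (b - η) ^ (p - γ) *
      ((b - η) ^ (-p) * (ξ - θ) ^ (α - γ - 1) +
        (ξ - θ) ^ (α - γ - 1) * (η - ξ) ^ (1 - p - 1)) := by
    ext ξ
    rw [kerM, kerS, show 1 - p - 1 = -p by ring]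
    ring
  have hv : 0 < η - θ := by linarith
  have hb : 0 < b - η := by linarith
  rw [e]
  refine ⟨((i1.const_mul _).add i2).const_mul _, ?_⟩
  rw [intervalIntegral.integral_const_mul, intervalIntegral.integral_add (i1.const_mul _) i2,
    intervalIntegral.integral_const_mul, integral_rpow_left (by linarith), integral_beta _ _ h2,
    kerSec, show 2 * α - γ - 1 = (α - 1) + (α - γ) by ring,
    show 2 * α - γ - p - 1 = (α - 1) + (α - γ + (1 - p) - 1) by ring,
    show 1 - γ - 1 = (p - γ) + -p by ring, Real.rpow_add hv, Real.rpow_add hv, Real.rpow_add hb,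
    show p - γ + 1 - 1 = p - γ by ring]
  ring

/-- The total exponent 2(α-γ) is 2ε: the two differentiations stop ε short of α in each variable. -/
lemma kerSec_integral {θ b : ℝ} (hγ : 1 / 2 < γ) (hγp : γ < p) (hpα : p < α) (hα1 : α < 1)
    (h : θ < b) :
    IntervalIntegrable (fun η => kerSec γ α p θ b η) volume θ b ∧
    ∫ η in θ..b, kerSec γ α p θ b η = kerTot γ α p * (b - θ) ^ (2 * (α - γ)) := by
  have i1 := intervalIntegrable_beta (p := 2 * α - γ) (q := 1 - γ) (by linarith) (by linarith) h.le
  have i2 := intervalIntegrable_beta (p := 2 * α - γ - p) (q := p - γ + 1) (by linarith)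
    (by linarith) h.le
  unfold kerSec
  refine ⟨((i1.const_mul _).add (i2.const_mul _)).const_mul _, ?_⟩
  rw [intervalIntegral.integral_const_mul,
    intervalIntegral.integral_add (i1.const_mul _) (i2.const_mul _),
    intervalIntegral.integral_const_mul, intervalIntegral.integral_const_mul, integral_beta _ _ h,
    integral_beta _ _ h, kerTot, show 2 * α - γ + (1 - γ) - 1 = 2 * (α - γ) by ring,
    show 2 * α - γ - p + (p - γ + 1) - 1 = 2 * (α - γ) by ring]
  ring

lemma kerTot_pos (hγ : 1 / 2 < γ) (hγp : γ < p) (hpα : p < α) (hα1 : α < 1) :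
    0 < kerTot γ α p := by
  have h := kerM_const_pos hγ hγp hpα hα1
  have h1 := betaR_pos (p := 2 * α - γ) (q := 1 - γ) (by linarith) (by linarith)
  have h2 := betaR_pos (p := α - γ) (q := 1 - p) (by linarith) (by linarith)
  have h3 := betaR_pos (p := 2 * α - γ - p) (q := p - γ + 1) (by linarith) (by linarith)
  have h4 : 0 < α - γ := by linarith
  unfold kerTot
  positivity

end

end RoughFrac

end

/-! ### Second-order parts with a primitive, and their mixed derivative -/

noncomputable section

namespace RoughFrac

open Filter Topology

/-- The second-order part attached to the paths `x`, `p` and the primitive `h`. -/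
def lev (x p h : ℝ → ℝ) (s t : ℝ) : ℝ := h t - h s - x s * (p t - p s)

/-- Real-valued paths with a second-order part, with explicit bounds on the whole line. -/
structure RoughPair (β X P M : ℝ) (x p h : ℝ → ℝ) : Prop where
  contx : Continuous x
  contp : Continuous p
  conth : Continuous h
  holx : ∀ s t, s ≤ t → |x t - x s| ≤ X * (t - s) ^ β
  holp : ∀ s t, s ≤ t → |p t - p s| ≤ P * (t - s) ^ β
  hollev : ∀ s t, s ≤ t → |lev x p h s t| ≤ M * (t - s) ^ (2 * β)

/-- For a second-order part of the form `lev` the multiplicative relation is automatic, whatever the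
primitive h is. This is what makes h convenient for smoothing. -/
lemma lev_sub_right (x p h : ℝ → ℝ) (s u t : ℝ) :
    lev x p h s t - lev x p h s u = lev x p h u t + (x u - x s) * (p t - p u) := by
  unfold lev; ring

lemma lev_sub_left (x p h : ℝ → ℝ) (s u t : ℝ) :
    lev x p h s t - lev x p h u t = lev x p h s u + (x u - x s) * (p t - p u) := by
  unfold lev; ring

/-- The inner derivative in `gammaOp`. -/
def levJ (γ : ℝ) (x p h : ℝ → ℝ) (η ξ : ℝ) : ℝ := weylLeft (1 - γ) ξ (fun s => lev x p h ξ s) η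

/-- The constant in the bound for `gammaOp`. -/
def gamC (γ β : ℝ) : ℝ :=
  1 / Real.Gamma (1 - (1 - γ)) * (2 + (1 - γ) / (β - (1 - γ))) + weylC (1 - γ) β 1

namespace RoughPair

variable {β X P M : ℝ} {x p h : ℝ → ℝ}

lemma nonneg_x (H : RoughPair β X P M x p h) : 0 ≤ X := by
  have := (abs_nonneg _).trans (H.holx 0 1 zero_le_one)
  simpa using this

lemma nonneg_p (H : RoughPair β X P M x p h) : 0 ≤ P := by
  have := (abs_nonneg _).trans (H.holp 0 1 zero_le_one)
  simpa using this

lemma nonneg_m (H : RoughPair β X P M x p h) : 0 ≤ M := by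
  have := (abs_nonneg _).trans (H.hollev 0 1 zero_le_one)
  simpa using this

lemma cont_lev (H : RoughPair β X P M x p h) : Continuous (Function.uncurry (lev x p h)) := by
  have := H.contx
  have := H.contp
  have := H.conth
  unfold lev Function.uncurry
  fun_prop

lemma meas_lev (H : RoughPair β X P M x p h) : Measurable (Function.uncurry (lev x p h)) :=
  H.cont_lev.measurable

lemma cont_lev_right (H : RoughPair β X P M x p h) (ξ : ℝ) : Continuous (lev x p h ξ) :=
  H.cont_lev.comp (by fun_prop : Continuous fun s : ℝ => (ξ, s))

lemma lev_inc_right (H : RoughPair β X P M x p h) (hβ : 0 < β) {ξ s η : ℝ} (h1 : ξ ≤ s)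
    (h2 : s ≤ η) : |lev x p h ξ η - lev x p h ξ s| ≤
      (M + X * P) * (η - ξ) ^ β * (η - s) ^ β := by
  rw [lev_sub_right]
  have a1 := H.hollev s η h2
  have a2 := H.holx ξ s h1
  have a3 := H.holp s η h2
  rw [two_mul, Real.rpow_add_of_nonneg (by linarith) hβ.le hβ.le] at a1
  have b1 : (η - s) ^ β ≤ (η - ξ) ^ β := Real.rpow_le_rpow (by linarith) (by linarith) hβ.le
  have b2 : (s - ξ) ^ β ≤ (η - ξ) ^ β := Real.rpow_le_rpow (by linarith) (by linarith) hβ.le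
  have n1 := Real.rpow_nonneg (by linarith : 0 ≤ η - s) β
  have n2 := Real.rpow_nonneg (by linarith : 0 ≤ s - ξ) β
  have hX := H.nonneg_x
  have hP := H.nonneg_p
  have hM := H.nonneg_m
  refine (abs_add_le _ _).trans ?_
  rw [abs_mul]
  calc _ ≤ M * ((η - s) ^ β * (η - s) ^ β) + (X * (s - ξ) ^ β) * (P * (η - s) ^ β) := by gcongr
    _ ≤ M * ((η - ξ) ^ β * (η - s) ^ β) + (X * (η - ξ) ^ β) * (P * (η - s) ^ β) := by gcongr
    _ = _ := by ring

lemma lev_inc_left (H : RoughPair β X P M x p h) (hβ : 0 < β) {ξ s η : ℝ} (h1 : ξ ≤ s)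
    (h2 : s ≤ η) : |lev x p h ξ η - lev x p h s η| ≤
      (M + X * P) * (s - ξ) ^ β * (η - ξ) ^ β := by
  rw [lev_sub_left]
  have a1 := H.hollev ξ s h1
  have a2 := H.holx ξ s h1
  have a3 := H.holp s η h2
  rw [two_mul, Real.rpow_add_of_nonneg (by linarith) hβ.le hβ.le] at a1
  have b1 : (η - s) ^ β ≤ (η - ξ) ^ β := Real.rpow_le_rpow (by linarith) (by linarith) hβ.le
  have b2 : (s - ξ) ^ β ≤ (η - ξ) ^ β := Real.rpow_le_rpow (by linarith) (by linarith) hβ.le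
  have n1 := Real.rpow_nonneg (by linarith : 0 ≤ η - s) β
  have n2 := Real.rpow_nonneg (by linarith : 0 ≤ s - ξ) β
  have hX := H.nonneg_x
  have hP := H.nonneg_p
  have hM := H.nonneg_m
  refine (abs_add_le _ _).trans ?_
  rw [abs_mul]
  calc _ ≤ M * ((s - ξ) ^ β * (s - ξ) ^ β) + (X * (s - ξ) ^ β) * (P * (η - s) ^ β) := by gcongr
    _ ≤ M * ((s - ξ) ^ β * (η - ξ) ^ β) + (X * (s - ξ) ^ β) * (P * (η - ξ) ^ β) := by gcongr
    _ = _ := by ring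

lemma lev_le (H : RoughPair β X P M x p h) (hβ : 0 < β) {ξ η : ℝ} (h1 : ξ ≤ η) :
    |lev x p h ξ η| ≤ (M + X * P) * (η - ξ) ^ β * (η - ξ) ^ β := by
  have := H.lev_inc_right hβ le_rfl h1
  rwa [show lev x p h ξ ξ = 0 by unfold lev; ring, sub_zero] at this

lemma levJ_bound (H : RoughPair β X P M x p h) {γ : ℝ} (hγ1 : γ < 1) (hγβ : 1 - γ < β)
    (hβ : β < 1 / 2) {ξ η : ℝ} (h1 : ξ < η) :
    |levJ γ x p h η ξ| ≤ weylC (1 - γ) β 1 * ((M + X * P) * (η - ξ) ^ β) *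
      (η - ξ) ^ (β - (1 - γ)) :=
  weylLeft_bound_holder (by linarith) (by linarith) hγβ h1 (H.lev_le (by linarith) h1.le)
    fun s h2 h3 => H.lev_inc_right (by linarith) h2.le h3.le

lemma integrand_int (H : RoughPair β X P M x p h) {κ : ℝ} (hκβ : κ < β) (hβ : 0 < β)
    {ξ η : ℝ} (h1 : ξ ≤ η) :
    IntervalIntegrable (fun s => (lev x p h ξ η - lev x p h ξ s) / (η - s) ^ (κ + 1))
      volume ξ η := by
  have hc := (H.cont_lev_right ξ).measurable
  refine intervalIntegrable_of_Ioo h1 (by fun_prop) (fun s h2 h3 => ?_)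
    ((intervalIntegrable_rpow_right (q := β - κ) (by linarith) h1).const_mul
      ((M + X * P) * (η - ξ) ^ β))
  have h : 0 < η - s := by linarith
  rw [abs_div, abs_of_pos (Real.rpow_pos_of_pos h _), div_le_iff₀ (Real.rpow_pos_of_pos h _),
    mul_assoc, ← Real.rpow_add h, show β - κ - 1 + (κ + 1) = β by ring]
  exact H.lev_inc_right hβ h2.le h3.le

lemma integral_rpow_away {κ ξ s η : ℝ} (hκ : 0 < κ) (h1 : ξ ≤ s) (h2 : s < η) :
    ∫ r in ξ..s, 1 / (η - r) ^ (κ + 1) = ((η - s) ^ (-κ) - (η - ξ) ^ (-κ)) / κ := by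
  have e : ∫ r in ξ..s, 1 / (η - r) ^ (κ + 1) = ∫ r in ξ..s, (η - r) ^ (-κ - 1) :=
    integral_congr_Ioo h1 fun r h3 h4 => by
      rw [div_rpow_eq_mul_rpow_neg (by linarith), one_mul, show -(κ + 1) = -κ - 1 by ring]
  rw [e, intervalIntegral.integral_comp_sub_left (fun u => u ^ (-κ - 1)) η, integral_rpow]
  · rw [show -κ - 1 + 1 = -κ by ring]
    field_simp
    ring
  · right
    refine ⟨by linarith, ?_⟩
    rw [uIcc_of_le (by linarith)]
    intro h
    linarith [h.1]

/-- Split the integral from ξ at s. Over [ξ, s] the constant part integrates explicitly and replaces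
(η-ξ)^{-κ} by (η-s)^{-κ}; over [s, η] the two integrands differ by (x_s - x_ξ)(p_η - p_r), by the
multiplicative relation. Each remaining term is small with s - ξ. -/
lemma levJ_sub (H : RoughPair β X P M x p h) {κ : ℝ} (hκ : 0 < κ) (hκβ : κ < β)
    {ξ s η : ℝ} (h1 : ξ < s) (h2 : s < η) :
    (lev x p h ξ η / (η - ξ) ^ κ +
        κ * ∫ r in ξ..η, (lev x p h ξ η - lev x p h ξ r) / (η - r) ^ (κ + 1)) -
      (lev x p h s η / (η - s) ^ κ +
        κ * ∫ r in s..η, (lev x p h s η - lev x p h s r) / (η - r) ^ (κ + 1)) =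
    (lev x p h ξ η - lev x p h s η) * (η - s) ^ (-κ) -
      κ * (∫ r in ξ..s, lev x p h ξ r / (η - r) ^ (κ + 1)) +
      κ * ((x s - x ξ) * ∫ r in s..η, (p η - p r) / (η - r) ^ (κ + 1)) := by
  have hβ0 : 0 < β := by linarith
  have i1 := H.integrand_int hκβ hβ0 (h1.trans h2).le
  have i2 := H.integrand_int hκβ hβ0 h2.le
  have i1a : IntervalIntegrable (fun r => (lev x p h ξ η - lev x p h ξ r) / (η - r) ^ (κ + 1))
      volume ξ s := i1.mono_set (by
        rw [uIcc_of_le h1.le, uIcc_of_le (h1.trans h2).le]; exact Icc_subset_Icc_right h2.le)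
  have i1b : IntervalIntegrable (fun r => (lev x p h ξ η - lev x p h ξ r) / (η - r) ^ (κ + 1))
      volume s η := i1.mono_set (by
        rw [uIcc_of_le h2.le, uIcc_of_le (h1.trans h2).le]; exact Icc_subset_Icc_left h1.le)
  have c1 : ContinuousOn (fun r => 1 / (η - r) ^ (κ + 1)) (uIcc ξ s) := by
    rw [uIcc_of_le h1.le]
    refine ContinuousOn.div continuousOn_const (ContinuousOn.rpow_const (by fun_prop) ?_) ?_
    · intro r hr; left; linarith [hr.2]
    · intro r hr; exact (Real.rpow_pos_of_pos (by linarith [hr.2]) _).ne'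
  have i3 : IntervalIntegrable (fun r => 1 / (η - r) ^ (κ + 1)) volume ξ s :=
    c1.intervalIntegrable
  have i4 : IntervalIntegrable (fun r => lev x p h ξ r / (η - r) ^ (κ + 1)) volume ξ s := by
    have := ((H.cont_lev_right ξ).continuousOn (s := uIcc ξ s)).mul c1
    exact this.intervalIntegrable.congr fun r _ => by simp only [Pi.mul_apply, mul_one_div]
  have e1 : ∫ r in ξ..s, (lev x p h ξ η - lev x p h ξ r) / (η - r) ^ (κ + 1) =
      lev x p h ξ η * (((η - s) ^ (-κ) - (η - ξ) ^ (-κ)) / κ) -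
        ∫ r in ξ..s, lev x p h ξ r / (η - r) ^ (κ + 1) := by
    rw [← integral_rpow_away hκ h1.le h2, ← intervalIntegral.integral_const_mul,
      ← intervalIntegral.integral_sub (i3.const_mul _) i4]
    congr 1; ext r; ring
  have e2 : (∫ r in s..η, (lev x p h ξ η - lev x p h ξ r) / (η - r) ^ (κ + 1)) -
      (∫ r in s..η, (lev x p h s η - lev x p h s r) / (η - r) ^ (κ + 1)) =
      (x s - x ξ) * ∫ r in s..η, (p η - p r) / (η - r) ^ (κ + 1) := by
    rw [← intervalIntegral.integral_sub i1b i2, ← intervalIntegral.integral_const_mul]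
    congr 1; ext r; unfold lev; ring
  rw [← intervalIntegral.integral_add_adjacent_intervals i1a i1b, e1,
    div_rpow_eq_mul_rpow_neg (by linarith), div_rpow_eq_mul_rpow_neg (by linarith)]
  field_simp
  linear_combination κ * e2

/-- This is the weighted Hölder condition, with exponent β and weight (η-s)^{γ-1}, needed for the
second, right-sided differentiation. The three terms of `levJ_sub` are bounded one by one. -/
lemma levJ_inc (H : RoughPair β X P M x p h) {γ : ℝ} (hγ1 : γ < 1) (hγβ : 1 - γ < β)
    (hβ : β < 1 / 2) {ξ s η : ℝ} (h1 : ξ < s) (h2 : s < η) :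
    |levJ γ x p h η ξ - levJ γ x p h η s| ≤
      gamC γ β * (M + X * P) * (η - ξ) ^ β * (s - ξ) ^ β * (η - s) ^ (γ - 1) := by
  obtain ⟨κ, hκ⟩ : ∃ κ, κ = 1 - γ := ⟨_, rfl⟩
  have hκ0 : 0 < κ := by linarith
  have hβ0 : 0 < β := by linarith
  have hκβ : κ < β := by linarith
  have hX := H.nonneg_x
  have hP := H.nonneg_p
  have hM := H.nonneg_m
  have hs : 0 < η - s := by linarith
  have hξ : 0 < s - ξ := by linarith
  have hΓ : 0 < Real.Gamma (1 - κ) := Real.Gamma_pos_of_pos (by linarith)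
  have n1 := Real.rpow_nonneg hs.le β
  have n2 := Real.rpow_nonneg hξ.le β
  have n3 := Real.rpow_nonneg (by linarith : 0 ≤ η - ξ) β
  have n4 := Real.rpow_nonneg hs.le (-κ)
  have b1 : (η - s) ^ β ≤ (η - ξ) ^ β := Real.rpow_le_rpow (by linarith) (by linarith) hβ0.le
  have b2 : (s - ξ) ^ β ≤ (η - ξ) ^ β := Real.rpow_le_rpow (by linarith) (by linarith) hβ0.le
  set R := (η - ξ) ^ β * (s - ξ) ^ β * (η - s) ^ (-κ) with hR
  have hR0 : 0 ≤ R := by positivity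
  have t1 : |(lev x p h ξ η - lev x p h s η) * (η - s) ^ (-κ)| ≤ (M + X * P) * R := by
    rw [abs_mul, abs_of_nonneg n4, hR]
    have := mul_le_mul_of_nonneg_right (H.lev_inc_left hβ0 h1.le h2.le) n4
    linarith
  have t2 : |κ * (∫ r in ξ..s, lev x p h ξ r / (η - r) ^ (κ + 1))| ≤ M * R := by
    have i3 : IntervalIntegrable (fun r => M * ((η - ξ) ^ β * (s - ξ) ^ β) *
        (1 / (η - r) ^ (κ + 1))) volume ξ s := by
      refine (ContinuousOn.intervalIntegrable ?_).const_mul _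
      rw [uIcc_of_le h1.le]
      refine ContinuousOn.div continuousOn_const (ContinuousOn.rpow_const (by fun_prop) ?_) ?_
      · intro r hr; left; linarith [hr.2]
      · intro r hr; exact (Real.rpow_pos_of_pos (by linarith [hr.2]) _).ne'
    have := abs_integral_le_of_Ioo (f := fun r => lev x p h ξ r / (η - r) ^ (κ + 1)) h1.le
      (fun r h3 h4 => ?_) i3
    · rw [intervalIntegral.integral_const_mul, integral_rpow_away hκ0 h1.le h2] at this
      rw [abs_mul, abs_of_pos hκ0]
      calc _ ≤ κ * (M * ((η - ξ) ^ β * (s - ξ) ^ β) * (((η - s) ^ (-κ) - (η - ξ) ^ (-κ)) / κ)) := by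
            gcongr
        _ = M * ((η - ξ) ^ β * (s - ξ) ^ β) * ((η - s) ^ (-κ) - (η - ξ) ^ (-κ)) := by field_simp
        _ ≤ M * ((η - ξ) ^ β * (s - ξ) ^ β) * (η - s) ^ (-κ) := by
            gcongr
            linarith [Real.rpow_nonneg (by linarith : 0 ≤ η - ξ) (-κ)]
        _ = _ := by rw [hR]; ring
    · have hr : 0 < η - r := by linarith
      rw [abs_div, abs_of_pos (Real.rpow_pos_of_pos hr _), mul_one_div]
      gcongr
      refine (H.hollev ξ r h3.le).trans ?_
      rw [two_mul, Real.rpow_add_of_nonneg (by linarith) hβ0.le hβ0.le]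
      have c1 : (r - ξ) ^ β ≤ (η - ξ) ^ β := Real.rpow_le_rpow (by linarith) (by linarith) hβ0.le
      have c2 : (r - ξ) ^ β ≤ (s - ξ) ^ β := Real.rpow_le_rpow (by linarith) (by linarith) hβ0.le
      have := Real.rpow_nonneg (by linarith : 0 ≤ r - ξ) β
      gcongr
  have t3 : |κ * ((x s - x ξ) * ∫ r in s..η, (p η - p r) / (η - r) ^ (κ + 1))| ≤
      κ / (β - κ) * (X * P) * R := by
    have := abs_integral_le_of_Ioo (f := fun r => (p η - p r) / (η - r) ^ (κ + 1)) h2.le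
      (fun r h3 h4 => ?_)
      ((intervalIntegrable_rpow_right (q := β - κ) (by linarith) h2.le).const_mul P)
    · rw [intervalIntegral.integral_const_mul, integral_rpow_right (by linarith)] at this
      rw [abs_mul, abs_mul, abs_of_pos hκ0]
      have hx := H.holx ξ s h1.le
      have hbk : 0 < β - κ := by linarith
      calc _ ≤ κ * ((X * (s - ξ) ^ β) * (P * ((η - s) ^ (β - κ) / (β - κ)))) := by gcongr
        _ = κ / (β - κ) * (X * P) * ((η - s) ^ β * (s - ξ) ^ β * (η - s) ^ (-κ)) := by
          rw [sub_eq_add_neg β κ, Real.rpow_add hs]; ring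
        _ ≤ _ := by rw [hR]; gcongr
    · have hr : 0 < η - r := by linarith
      rw [abs_div, abs_of_pos (Real.rpow_pos_of_pos hr _), div_le_iff₀ (Real.rpow_pos_of_pos hr _),
        mul_assoc, ← Real.rpow_add hr, show β - κ - 1 + (κ + 1) = β by ring]
      exact H.holp r η h4.le
  have hw := weylC_pos (γ := κ) (p := β) (q := 1) hκ0 (by linarith) hκβ one_pos
  rw [levJ, levJ, gamC, ← hκ, show γ - 1 = -κ by linarith, weylLeft, weylLeft, ← mul_sub,
    H.levJ_sub hκ0 hκβ h1 h2, abs_mul, abs_of_pos (by positivity)]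
  have hbk : 0 < β - κ := by linarith
  calc _ ≤ 1 / Real.Gamma (1 - κ) * ((M + X * P) * R + M * R + κ / (β - κ) * (X * P) * R) := by
        gcongr
        exact (abs_add_le _ _).trans (add_le_add ((abs_sub _ _).trans (add_le_add t1 t2)) t3)
    _ ≤ 1 / Real.Gamma (1 - κ) * ((M + X * P) * R + (M + X * P) * R +
          κ / (β - κ) * (M + X * P) * R) := by
        gcongr <;> nlinarith [mul_nonneg hX hP]
    _ ≤ 1 / Real.Gamma (1 - κ) * ((M + X * P) * R + (M + X * P) * R +
          κ / (β - κ) * (M + X * P) * R) + weylC κ β 1 * ((M + X * P) * R) := by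
        have : 0 ≤ weylC κ β 1 * ((M + X * P) * R) := by positivity
        linarith
    _ = _ := by rw [hR]; ring

/-- `levJ` is the function to be differentiated from the right. It is of size (η-ξ)^{2β+γ-1}, and
the second derivative removes another 1 - γ. -/
lemma gamma_bound (H : RoughPair β X P M x p h) {γ : ℝ} (hγ1 : γ < 1) (hγβ : 1 - γ < β)
    (hβ : β < 1 / 2) {ξ η : ℝ} (h1 : ξ < η) :
    |gammaOp γ (lev x p h) ξ η| ≤
      weylC (1 - γ) β γ * gamC γ β * (M + X * P) * (η - ξ) ^ (2 * β + 2 * γ - 2) := by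
  have h0 : 0 < η - ξ := by linarith
  have hX := H.nonneg_x
  have hP := H.nonneg_p
  have hM := H.nonneg_m
  have hw := weylC_pos (γ := 1 - γ) (p := β) (q := 1) (by linarith) (by linarith) hγβ one_pos
  have hΓ : 0 < Real.Gamma (1 - (1 - γ)) := Real.Gamma_pos_of_pos (by linarith)
  have hbk : 0 < β - (1 - γ) := by linarith
  have hk : 0 < 1 - γ := by linarith
  have := weylRight_bound (γ := 1 - γ) (p := β) (q := γ) (b := η) (r := ξ)
    (Ψ := gamC γ β * (M + X * P) * (η - ξ) ^ β) (g := levJ γ x p h η) hk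
    (by linarith) hγβ (by linarith) h1 ?_ fun s h2 h3 => H.levJ_inc hγ1 hγβ hβ h2 h3
  · refine this.trans (le_of_eq ?_)
    rw [show 2 * β + 2 * γ - 2 = β + (β - (1 - γ) + γ - 1) by ring, Real.rpow_add h0]
    ring
  · refine (H.levJ_bound hγ1 hγβ hβ h1).trans ?_
    rw [show β - (1 - γ) = β + γ - 1 by ring]
    have : weylC (1 - γ) β 1 ≤ gamC γ β := by
      rw [gamC]
      have : 0 ≤ 1 / Real.Gamma (1 - (1 - γ)) * (2 + (1 - γ) / (β - (1 - γ))) := by positivity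
      linarith
    have n1 := Real.rpow_nonneg h0.le β
    have n2 := Real.rpow_nonneg h0.le (β + γ - 1)
    calc _ ≤ gamC γ β * ((M + X * P) * (η - ξ) ^ β) * (η - ξ) ^ (β + γ - 1) := by gcongr
      _ = _ := by ring

end RoughPair

end RoughFrac

end

/-! ### Measurability, size and continuity of `lambdaOp` -/

noncomputable section

namespace RoughFrac

open Filter Topology

section

variable {Ω : Type*} [MeasurableSpace Ω]

lemma measurable_kernelG_comp (α : ℝ) {θ ξ η : Ω → ℝ} (hθ : Measurable θ) (hξ : Measurable ξ)
    (hη : Measurable η) : Measurable fun x => kernelG α (θ x) (ξ x) (η x) := by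
  unfold kernelG
  refine Measurable.mul (by fun_prop) (measurable_intervalIntegral
    (f := fun x q => q ^ (2 * α - 2) * (1 - q) ^ (-α) *
      (1 + (1 - q) * ((ξ x - θ x) / (η x - ξ x)))⁻¹) ?_ measurable_const measurable_const)
  unfold Function.uncurry
  fun_prop

lemma measurable_kernelK_comp (α ε : ℝ) {θ b ξ η : Ω → ℝ} (hθ : Measurable θ)
    (hb : Measurable b) (hξ : Measurable ξ) (hη : Measurable η) :
    Measurable fun x => kernelK α ε (θ x) (b x) (ξ x) (η x) := by
  refine measurable_weylLeft (g := fun x ξ' => weylRight (α - ε) (b x)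
    (fun η' => kernelG α (θ x) ξ' η') (η x)) ?_ hθ hξ
  refine measurable_weylRight (X := Ω × ℝ) (g := fun q η' => kernelG α (θ q.1) q.2 η') ?_
    (hb.comp measurable_fst) (hη.comp measurable_fst)
  exact measurable_kernelG_comp α (by fun_prop) (by fun_prop) (by fun_prop)

lemma measurable_gammaOp_comp (γ : ℝ) {ψ : ℝ → ℝ → ℝ} (hψ : Measurable (Function.uncurry ψ))
    {ξ η : Ω → ℝ} (hξ : Measurable ξ) (hη : Measurable η) :
    Measurable fun x => gammaOp γ ψ (ξ x) (η x) := by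
  refine measurable_weylRight (g := fun x ξ' => weylLeft (1 - γ) ξ' (fun η' => ψ ξ' η') (η x))
    ?_ hη hξ
  refine measurable_weylLeft (X := Ω × ℝ) (g := fun q η' => ψ q.2 η') ?_ measurable_snd
    (hη.comp measurable_fst)
  exact hψ.comp (by fun_prop : Measurable fun q : (Ω × ℝ) × ℝ => (q.1.2, q.2))

lemma measurable_lambda_inner (α ε : ℝ) {ψ : ℝ → ℝ → ℝ} (hψ : Measurable (Function.uncurry ψ))
    {θ b η : Ω → ℝ} (hθ : Measurable θ) (hb : Measurable b) (hη : Measurable η) :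
    Measurable fun x => ∫ ξ in θ x..η x,
      kernelK α ε (θ x) (b x) ξ (η x) * gammaOp (α - ε) ψ ξ (η x) :=
  measurable_intervalIntegral (f := fun x ξ =>
    kernelK α ε (θ x) (b x) ξ (η x) * gammaOp (α - ε) ψ ξ (η x))
    ((measurable_kernelK_comp α ε (by fun_prop) (by fun_prop) measurable_snd (by fun_prop)).mul
      (measurable_gammaOp_comp _ hψ measurable_snd (by fun_prop))) hθ hη

lemma measurable_lambdaOp_comp (α ε : ℝ) {ψ : ℝ → ℝ → ℝ} (hψ : Measurable (Function.uncurry ψ))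
    {θ b : Ω → ℝ} (hθ : Measurable θ) (hb : Measurable b) :
    Measurable fun x => lambdaOp α ε (θ x) (b x) ψ :=
  measurable_intervalIntegral (X := Ω) (f := fun x η => ∫ ξ in θ x..η,
      kernelK α ε (θ x) (b x) ξ η * gammaOp (α - ε) ψ ξ η)
    (measurable_lambda_inner (Ω := Ω × ℝ) α ε hψ (by fun_prop) (by fun_prop) measurable_snd) hθ hb

end

lemma measurable_levJ {γ : ℝ} {x p h : ℝ → ℝ} (hψ : Measurable (Function.uncurry (lev x p h)))
    (η : ℝ) : Measurable (levJ γ x p h η) :=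
  measurable_weylLeft (g := lev x p h) hψ measurable_id measurable_const

/-- The constant in the bound for `lambdaOp`. -/
def lamC (α ε β : ℝ) : ℝ :=
  weylC (1 - (α - ε)) β (α - ε) * gamC (α - ε) β * kerTot (α - ε) α (α - ε / 2)

lemma gamC_pos {γ β : ℝ} (hγ0 : 0 < γ) (hγ1 : γ < 1) (hγβ : 1 - γ < β) : 0 < gamC γ β := by
  have hw := weylC_pos (γ := 1 - γ) (p := β) (q := 1) (by linarith) (by linarith) hγβ one_pos
  have hΓ : 0 < Real.Gamma (1 - (1 - γ)) := Real.Gamma_pos_of_pos (by linarith)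
  have hbk : 0 < β - (1 - γ) := by linarith
  have hk : 0 < 1 - γ := by linarith
  unfold gamC
  positivity

lemma lamC_pos {α ε β : ℝ} (hγ : 1 - β < α - ε) (hα1 : α < 1) (hε : 0 < ε) (hβ : β < 1 / 2) :
    0 < lamC α ε β := by
  have h1 := gamC_pos (γ := α - ε) (β := β) (by linarith) (by linarith) (by linarith)
  have h2 := kerTot_pos (γ := α - ε) (α := α) (p := α - ε / 2) (by linarith) (by linarith)
    (by linarith) hα1
  have h3 := weylC_pos (γ := 1 - (α - ε)) (p := β) (q := α - ε) (by linarith) (by linarith)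
    (by linarith) (by linarith)
  unfold lamC
  positivity

namespace RoughPair

variable {β X P M : ℝ} {x p h : ℝ → ℝ} {α ε : ℝ}

/-- The auxiliary exponent p is the midpoint α - ε/2 of the admissible interval (α-ε, α). The power
of η - ξ from `gamma_bound` is not negative, since 1 - β < α - ε, and may be replaced by the same
power of b - r. -/
lemma kernel_gamma_bound (H : RoughPair β X P M x p h) (hγ : 1 - β < α - ε) (hα1 : α < 1)
    (hε : 0 < ε) (hβ : β < 1 / 2) {r b ξ η : ℝ} (h1 : r < ξ) (h2 : ξ < η) (h3 : η < b) :
    |kernelK α ε r b ξ η * gammaOp (α - ε) (lev x p h) ξ η| ≤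
      weylC (1 - (α - ε)) β (α - ε) * gamC (α - ε) β * (M + X * P) *
        (b - r) ^ (2 * β + 2 * (α - ε) - 2) * kerM (α - ε) α (α - ε / 2) r b ξ η := by
  have hX := H.nonneg_x
  have hP := H.nonneg_p
  have hM := H.nonneg_m
  have c1 := gamC_pos (γ := α - ε) (β := β) (by linarith) (by linarith) (by linarith)
  have c3 := weylC_pos (γ := 1 - (α - ε)) (p := β) (q := α - ε) (by linarith) (by linarith)
    (by linarith) (by linarith)
  have hb := H.gamma_bound (γ := α - ε) (by linarith) (by linarith) hβ h2
  have hk := kernelK_bound (α := α) (ε := ε) (p := α - ε / 2) (by linarith) (by linarith)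
    (by linarith) hα1 h1 h2 h3
  have hk0 := (abs_nonneg _).trans hk
  have hpow : (η - ξ) ^ (2 * β + 2 * (α - ε) - 2) ≤ (b - r) ^ (2 * β + 2 * (α - ε) - 2) :=
    Real.rpow_le_rpow (by linarith) (by linarith) (by linarith)
  rw [abs_mul, mul_comm]
  refine mul_le_mul (hb.trans ?_) hk (abs_nonneg _) ?_
  · gcongr
  · have := Real.rpow_nonneg (by linarith : 0 ≤ b - r) (2 * β + 2 * (α - ε) - 2)
    positivity

lemma lambda_inner_bound (H : RoughPair β X P M x p h) (hγ : 1 - β < α - ε) (hα1 : α < 1)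
    (hε : 0 < ε) (hβ : β < 1 / 2) {r b η : ℝ} (h1 : r < η) (h3 : η < b) :
    |∫ ξ in r..η, kernelK α ε r b ξ η * gammaOp (α - ε) (lev x p h) ξ η| ≤
      weylC (1 - (α - ε)) β (α - ε) * gamC (α - ε) β * (M + X * P) *
        (b - r) ^ (2 * β + 2 * (α - ε) - 2) * kerSec (α - ε) α (α - ε / 2) r b η := by
  obtain ⟨i1, e1⟩ := kerM_section (γ := α - ε) (α := α) (p := α - ε / 2) (by linarith)
    (by linarith) hα1 h1 h3
  rw [← e1, ← intervalIntegral.integral_const_mul]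
  exact abs_integral_le_of_Ioo h1.le
    (fun ξ h4 h5 => H.kernel_gamma_bound hγ hα1 hε hβ h4 h5 h3) (i1.const_mul _)

/-- The exponent 2β + 2(α-ε) - 2 of the mixed derivative and the 2ε of the kernel add up to 2β + 2α
- 2, so ε survives only in the constant. -/
lemma lambda_bound (H : RoughPair β X P M x p h) (hγ : 1 - β < α - ε) (hα1 : α < 1)
    (hε : 0 < ε) (hβ : β < 1 / 2) {r b : ℝ} (h1 : r < b) :
    |lambdaOp α ε r b (lev x p h)| ≤ lamC α ε β * (M + X * P) * (b - r) ^ (2 * β + 2 * α - 2) := by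
  obtain ⟨i1, e1⟩ := kerSec_integral (γ := α - ε) (α := α) (p := α - ε / 2) (θ := r) (b := b)
    (by linarith) (by linarith) (by linarith) hα1 h1
  refine (abs_integral_le_of_Ioo h1.le
    (fun η h4 h5 => H.lambda_inner_bound hγ hα1 hε hβ h4 h5) (i1.const_mul _)).trans
      (le_of_eq ?_)
  have h0 : 0 < b - r := by linarith
  rw [intervalIntegral.integral_const_mul, e1, lamC,
    show 2 * β + 2 * α - 2 = (2 * β + 2 * (α - ε) - 2) + 2 * (α - (α - ε)) by ring,
    Real.rpow_add h0]
  ring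

end RoughPair

section Limit

variable {β X P M : ℝ} {x p h : ℝ → ℝ} {xn pn hn : ℕ → ℝ → ℝ} {α ε : ℝ}

lemma tendsto_lev (hx : ∀ t, Tendsto (fun n => xn n t) atTop (𝓝 (x t)))
    (hp : ∀ t, Tendsto (fun n => pn n t) atTop (𝓝 (p t)))
    (hh : ∀ t, Tendsto (fun n => hn n t) atTop (𝓝 (h t))) (s t : ℝ) :
    Tendsto (fun n => lev (xn n) (pn n) (hn n) s t) atTop (𝓝 (lev x p h s t)) :=
  ((hh t).sub (hh s)).sub ((hx s).mul ((hp t).sub (hp s)))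

lemma tendsto_levJ (H : ∀ n, RoughPair β X P M (xn n) (pn n) (hn n))
    (hx : ∀ t, Tendsto (fun n => xn n t) atTop (𝓝 (x t)))
    (hp : ∀ t, Tendsto (fun n => pn n t) atTop (𝓝 (p t)))
    (hh : ∀ t, Tendsto (fun n => hn n t) atTop (𝓝 (h t))) {γ : ℝ} (hγβ : 1 - γ < β)
    (hβ : 0 < β) {ξ η : ℝ} (h1 : ξ < η) :
    Tendsto (fun n => levJ γ (xn n) (pn n) (hn n) η ξ) atTop (𝓝 (levJ γ x p h η ξ)) := by
  have hl := tendsto_lev hx hp hh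
  refine Tendsto.const_mul _ (((hl ξ η).div_const _).add (Tendsto.const_mul _ ?_))
  refine tendsto_integral_Ioo h1.le (fun n => ?_) (Eventually.of_forall fun n s h2 h3 => ?_)
    ((intervalIntegrable_rpow_right (q := β - (1 - γ)) (by linarith) h1.le).const_mul
      ((M + X * P) * (η - ξ) ^ β)) (fun s _ _ => ((hl ξ η).sub (hl ξ s)).div_const _)
  · have := ((H n).cont_lev_right ξ).measurable
    fun_prop
  · have h : 0 < η - s := by linarith
    rw [abs_div, abs_of_pos (Real.rpow_pos_of_pos h _), div_le_iff₀ (Real.rpow_pos_of_pos h _),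
      mul_assoc, ← Real.rpow_add h, show β - (1 - γ) - 1 + (1 - γ + 1) = β by ring]
    exact (H n).lev_inc_right hβ h2.le h3.le

lemma tendsto_gammaOp (H : ∀ n, RoughPair β X P M (xn n) (pn n) (hn n))
    (hx : ∀ t, Tendsto (fun n => xn n t) atTop (𝓝 (x t)))
    (hp : ∀ t, Tendsto (fun n => pn n t) atTop (𝓝 (p t)))
    (hh : ∀ t, Tendsto (fun n => hn n t) atTop (𝓝 (h t))) {γ : ℝ} (hγ0 : 0 < γ) (hγ1 : γ < 1)
    (hγβ : 1 - γ < β) (hβ : β < 1 / 2) {ξ η : ℝ} (h1 : ξ < η) :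
    Tendsto (fun n => gammaOp γ (lev (xn n) (pn n) (hn n)) ξ η) atTop
      (𝓝 (gammaOp γ (lev x p h) ξ η)) := by
  have hl : ∀ s, s < η → Tendsto (fun n => levJ γ (xn n) (pn n) (hn n) η s) atTop
    (𝓝 (levJ γ x p h η s)) := fun s hs => tendsto_levJ H hx hp hh hγβ (by linarith) hs
  refine Tendsto.const_mul _ (((hl ξ h1).div_const _).add (Tendsto.const_mul _ ?_))
  refine tendsto_integral_Ioo (F := fun n s => (levJ γ (xn n) (pn n) (hn n) η ξ -
      levJ γ (xn n) (pn n) (hn n) η s) / (s - ξ) ^ (1 - γ + 1)) h1.le (fun n => ?_)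
    (Eventually.of_forall fun n s h2 h3 => ?_)
    ((intervalIntegrable_beta (p := β - (1 - γ)) (q := γ) (by linarith) hγ0 h1.le).const_mul
      (gamC γ β * (M + X * P) * (η - ξ) ^ β))
    (fun s _ h3 => ((hl ξ h1).sub (hl s h3)).div_const _)
  · have := measurable_levJ (γ := γ) (H n).meas_lev η
    fun_prop
  · have h : 0 < s - ξ := by linarith
    rw [abs_div, abs_of_pos (Real.rpow_pos_of_pos h _), div_le_iff₀ (Real.rpow_pos_of_pos h _)]
    refine ((H n).levJ_inc hγ1 hγβ hβ h2 h3).trans (le_of_eq ?_)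
    rw [show (s - ξ) ^ β = (s - ξ) ^ (β - (1 - γ) - 1) * (s - ξ) ^ (1 - γ + 1) by
      rw [← Real.rpow_add h]; congr 1; ring]
    ring

/-- Pointwise convergence of paths with common Hölder constants suffices: the majorants of the inner
and outer integrals depend on X, P, M only. -/
lemma tendsto_lambdaOp (H : ∀ n, RoughPair β X P M (xn n) (pn n) (hn n))
    (hx : ∀ t, Tendsto (fun n => xn n t) atTop (𝓝 (x t)))
    (hp : ∀ t, Tendsto (fun n => pn n t) atTop (𝓝 (p t)))
    (hh : ∀ t, Tendsto (fun n => hn n t) atTop (𝓝 (h t)))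
    (hγ : 1 - β < α - ε) (hα1 : α < 1) (hε : 0 < ε) (hβ : β < 1 / 2) {r b : ℝ} (h1 : r < b) :
    Tendsto (fun n => lambdaOp α ε r b (lev (xn n) (pn n) (hn n))) atTop
      (𝓝 (lambdaOp α ε r b (lev x p h))) := by
  obtain ⟨i1, e1⟩ := kerSec_integral (γ := α - ε) (α := α) (p := α - ε / 2) (θ := r) (b := b)
    (by linarith) (by linarith) (by linarith) hα1 h1
  refine tendsto_integral_Ioo h1.le (fun n => measurable_lambda_inner α ε (H n).meas_lev
    measurable_const measurable_const measurable_id) (Eventually.of_forall fun n η h4 h5 =>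
      (H n).lambda_inner_bound hγ hα1 hε hβ h4 h5) (i1.const_mul _) fun η h4 h5 => ?_
  obtain ⟨i2, e2⟩ := kerM_section (γ := α - ε) (α := α) (p := α - ε / 2) (by linarith)
    (by linarith) hα1 h4 h5
  refine tendsto_integral_Ioo h4.le (fun n => ?_) (Eventually.of_forall fun n ξ h6 h7 =>
    (H n).kernel_gamma_bound hγ hα1 hε hβ h6 h7 h5) (i2.const_mul _) fun ξ h6 h7 => ?_
  · exact (measurable_kernelK_comp α ε measurable_const measurable_const measurable_id
      measurable_const).mul (measurable_gammaOp_comp _ (H n).meas_lev measurable_id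
      measurable_const)
  · exact (tendsto_gammaOp H hx hp hh (by linarith) (by linarith) (by linarith) hβ h7).const_mul _

end Limit

end RoughFrac

end

/-! ### A fractional integral of a right derivative, evaluated at the left end -/

noncomputable section

namespace RoughFrac

open Filter Topology

lemma tendsto_average_right {a : ℝ} {f : ℝ → ℝ} (hfm : Measurable f)
    (hc : ContinuousWithinAt f (Ici a) a) :
    Tendsto (fun κ : ℝ => κ⁻¹ * ∫ s in a..a + κ, f s) (𝓝[>] 0) (𝓝 (f a)) := by
  have h := intervalIntegral.integral_hasDerivWithinAt_right (a := a) (b := a) (f := f)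
    (s := Ici a) (t := Ioi a) (by simp) hfm.stronglyMeasurable.stronglyMeasurableAtFilter
    (hc.mono Ioi_subset_Ici_self)
  have h' := h.mono Ioi_subset_Ici_self
  rw [hasDerivWithinAt_iff_tendsto_slope' (by simp)] at h'
  have hk : Tendsto (fun κ : ℝ => a + κ) (𝓝[>] 0) (𝓝[>] a) := by
    refine tendsto_nhdsWithin_iff.2 ⟨?_, ?_⟩
    · have : Tendsto (fun κ : ℝ => a + κ) (𝓝 0) (𝓝 (a + 0)) := by
        exact (continuous_const.add continuous_id).tendsto 0
      rw [add_zero] at this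
      exact this.mono_left nhdsWithin_le_nhds
    · filter_upwards [self_mem_nhdsWithin] with κ hκ
      have : 0 < κ := hκ
      simpa using this
  refine (h'.comp hk).congr fun κ => ?_
  simp [slope]

/-- As g need not vanish at b, its derivative may grow like (b-r)^{-γ}; this is the bound with Ψ
proportional to (b-r)^{-p}. -/
lemma weylRight_bound_bdd_holder {γ p C₀ C₁ a b : ℝ} (hγ : 0 < γ) (hγ1 : γ < 1) (hp : γ < p)
    {g : ℝ → ℝ} (hC₀ : 0 ≤ C₀) (hC₁ : 0 ≤ C₁) (h0 : ∀ r, a ≤ r → r < b → |g r| ≤ C₀)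
    (h1 : ∀ r s, a ≤ r → r < s → s < b → |g r - g s| ≤ C₁ * (s - r) ^ p)
    {r : ℝ} (h2 : a ≤ r) (h3 : r < b) :
    |weylRight γ b g r| ≤ weylC γ p 1 * (C₀ + C₁ * (b - a) ^ p) * (b - r) ^ (1 - γ - 1) := by
  have hr : 0 < b - r := by linarith
  have e : (b - r) ^ (-p) * (b - r) ^ p = 1 := by rw [← Real.rpow_add hr]; simp
  have hle : (b - r) ^ p ≤ (b - a) ^ p := Real.rpow_le_rpow hr.le (by linarith) (by linarith)
  have n1 := Real.rpow_nonneg hr.le p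
  have n2 := Real.rpow_nonneg hr.le (-p)
  have n3 : 0 ≤ (b - a) ^ p := n1.trans hle
  have := weylRight_bound_holder (Ψ := (C₀ + C₁ * (b - a) ^ p) * (b - r) ^ (-p)) (g := g)
    hγ hγ1 hp h3 ?_ ?_
  · refine this.trans (le_of_eq ?_)
    rw [show 1 - γ - 1 = -p + (p - γ) by ring, Real.rpow_add hr]
    ring
  · rw [mul_assoc, e, mul_one]
    refine (h0 r h2 h3).trans ?_
    have : 0 ≤ C₁ * (b - a) ^ p := by positivity
    linarith
  · intro s h4 h5
    refine (h1 r s h2 h4 h5).trans ?_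
    have := Real.rpow_nonneg (by linarith : 0 ≤ s - r) p
    gcongr
    calc C₁ = C₁ * (b - r) ^ p * (b - r) ^ (-p) := by rw [mul_assoc, mul_comm _ ((b - r) ^ (-p)), e, mul_one]
      _ ≤ (C₀ + C₁ * (b - a) ^ p) * (b - r) ^ (-p) := by
        gcongr
        nlinarith

lemma sub_rpow_ge {γ x κ : ℝ} (hγ1 : γ < 1) (hκ : 0 < κ) (hx : κ < x) :
    x ^ γ - (x - κ) ^ γ ≤ κ * x ^ (γ - 1) := by
  have hx0 : 0 < x := by linarith
  have h1 : (x - κ) / x ≤ ((x - κ) / x) ^ γ :=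
    le_rpow_of_le_one (div_nonneg (by linarith) hx0.le) ((div_le_one hx0).2 (by linarith)) hγ1.le
  rw [Real.div_rpow (by linarith) hx0.le] at h1
  have h2 := Real.rpow_pos_of_pos hx0 γ
  rw [le_div_iff₀ h2] at h1
  rw [Real.rpow_sub_one hx0.ne']
  have : (x - κ) / x * x ^ γ = x ^ γ - κ * (x ^ γ / x) := by field_simp
  linarith

/-- The fractional integral at the left end of the right-sided derivative. -/
lemma fracInt_weylRight_left_end {γ p C₀ C₁ a b : ℝ} (hγ : 0 < γ) (hγ1 : γ < 1) (hp : γ < p)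
    (hab : a < b) {g : ℝ → ℝ} (hg : Measurable g) (hC₀ : 0 ≤ C₀) (hC₁ : 0 ≤ C₁)
    (h0 : ∀ r, a ≤ r → r < b → |g r| ≤ C₀)
    (h1 : ∀ r s, a ≤ r → r < s → s < b → |g r - g s| ≤ C₁ * (s - r) ^ p) :
    ∫ η in a..b, weylRight γ b g η * (1 / Real.Gamma γ * (η - a) ^ (γ - 1)) = g a := by
  have hΓ := Real.Gamma_pos_of_pos hγ
  -- An approximate identity at a from the right. The almost-everywhere inversion says nothing about
  -- one point, so integration by parts is tested against averages over (a, a+κ) and κ tends to 0,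
  -- using that g is right continuous at a.
  set m : ℝ → ℝ → ℝ := fun κ s => if s ≤ a + κ then κ⁻¹ else 0 with hm
  have hmm : ∀ κ, Measurable (m κ) := fun κ =>
    Measurable.ite measurableSet_Iic measurable_const measurable_const
  have hsmall : ∀ κ r, 0 < κ → a + κ ≤ r → ∀ f : ℝ → ℝ, IntervalIntegrable f volume a r →
      ∫ s in a..r, f s * m κ s = κ⁻¹ * ∫ s in a..a + κ, f s := by
    intro κ r hκ hr f hf
    have e1 : ∫ s in a..a + κ, f s * m κ s = κ⁻¹ * ∫ s in a..a + κ, f s := by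
      rw [← intervalIntegral.integral_const_mul]
      refine integral_congr_Ioo (by linarith) fun s _ h3 => ?_
      rw [hm]; simp only [if_pos h3.le]; ring
    have i1 : IntervalIntegrable (fun s => f s * m κ s) volume a (a + κ) := by
      refine intervalIntegrable_congr_Ioo (g := fun s => κ⁻¹ * f s) (by linarith) (fun s _ h3 => ?_)
        ((hf.mono_set ?_).const_mul _)
      · rw [hm]; simp only [if_pos h3.le]; ring
      · rw [uIcc_of_le (by linarith), uIcc_of_le (by linarith)]; exact Icc_subset_Icc_right hr
    have i2 : IntervalIntegrable (fun s => f s * m κ s) volume (a + κ) r := by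
      refine intervalIntegrable_congr_Ioo (g := fun s => 0) hr (fun s h3 _ => ?_)
        intervalIntegrable_const
      rw [hm]; simp only [if_neg (not_le.2 h3)]; ring
    have e2 : ∫ s in a + κ..r, f s * m κ s = 0 := by
      rw [integral_congr_Ioo (g := fun s => 0) hr]
      · simp
      · intro s h3 _
        rw [hm]; simp only [if_neg (not_le.2 h3)]; ring
    rw [← intervalIntegral.integral_add_adjacent_intervals i1 i2, e1, e2, add_zero]
  have hp0 : 0 < p := by linarith
  have hgc : ContinuousWithinAt g (Ici a) a := by
    rw [ContinuousWithinAt, tendsto_iff_norm_sub_tendsto_zero]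
    have hlim : Tendsto (fun s => C₁ * (s - a) ^ p) (𝓝[≥] a) (𝓝 0) := by
      have : Continuous fun s : ℝ => C₁ * (s - a) ^ p :=
        continuous_const.mul ((continuous_id.sub continuous_const).rpow_const fun _ => Or.inr hp0.le)
      have h2 := this.tendsto a
      simp only [sub_self, Real.zero_rpow hp0.ne', mul_zero] at h2
      exact h2.mono_left nhdsWithin_le_nhds
    refine squeeze_zero' (Eventually.of_forall fun _ => norm_nonneg _) ?_ hlim
    have : ∀ᶠ s in 𝓝[≥] a, s < b := nhdsWithin_le_nhds (Iio_mem_nhds hab)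
    filter_upwards [this, self_mem_nhdsWithin] with s h3 h4
    rcases eq_or_lt_of_le (mem_Ici.1 h4) with h5 | h5
    · subst h5; simp [Real.zero_rpow hp0.ne']
    · rw [Real.norm_eq_abs, abs_sub_comm]; exact h1 a s le_rfl h5 h3
  have hgi : IntervalIntegrable g volume a b :=
    intervalIntegrable_of_Ioo hab.le hg (fun r h2 h3 => h0 r h2.le h3) intervalIntegrable_const
  have key : ∀ᶠ κ in 𝓝[>] (0 : ℝ), ∫ η in a..b, weylRight γ b g η *
      (1 / Real.Gamma γ * ∫ s in a..η, (η - s) ^ (γ - 1) * m κ s) =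
      κ⁻¹ * ∫ s in a..a + κ, g s := by
    have : ∀ᶠ κ in 𝓝[>] (0 : ℝ), κ < b - a := nhdsWithin_le_nhds (Iio_mem_nhds (by linarith))
    filter_upwards [this, self_mem_nhdsWithin] with κ h2 h3
    rw [integral_by_parts_right_holder (C₀ := C₀) (C₁ := C₁) (C := κ⁻¹) hγ hγ1 hp hab.le hg hC₁
      (fun r h4 h5 => h0 r h4.le h5) (fun r s h4 h5 h6 => h1 r s h4.le h5 h6) (hmm κ)]
    · exact hsmall κ b h3 (by linarith) g hgi
    · intro s
      have : 0 < κ⁻¹ := inv_pos.2 h3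
      rw [hm]; dsimp only
      split_ifs
      · rw [abs_of_pos this]
      · rw [abs_zero]; exact this.le
  have lim1 := (tendsto_average_right hg hgc).congr' (key.mono fun _ h => h.symm)
  refine tendsto_nhds_unique (tendsto_integral_Ioo (l := 𝓝[>] (0 : ℝ)) hab.le (fun κ => ?_)
    (g := fun η => weylC γ p 1 * (C₀ + C₁ * (b - a) ^ p) * (1 / Real.Gamma γ * γ⁻¹) *
      ((η - a) ^ (γ - 1) * (b - η) ^ (1 - γ - 1))) ?_
    ((intervalIntegrable_beta hγ (by linarith) hab.le).const_mul _) fun η h2 h3 => ?_) lim1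
  · refine Measurable.mul (measurable_weylRight (g := fun _ => g) (hg.comp measurable_snd)
      measurable_const measurable_id) (Measurable.const_mul ?_ _)
    refine measurable_intervalIntegral (f := fun η s => (η - s) ^ (γ - 1) * m κ s) ?_
      measurable_const measurable_id
    exact Measurable.mul (by fun_prop) ((hmm κ).comp measurable_snd)
  · filter_upwards [self_mem_nhdsWithin] with κ hκ η h2 h3
    have hκ' : 0 < κ := hκ
    have hη : 0 < η - a := by linarith
    have b1 := weylRight_bound_bdd_holder hγ hγ1 hp hC₀ hC₁ h0 h1 h2.le h3
    have hi := intervalIntegrable_rpow_right (q := γ) hγ h2.le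
    -- A majorant uniform in κ. If κ < η - a, the difference of powers is controlled by
    -- `sub_rpow_ge`; otherwise the average meets the whole of (a, η) and κ^{-1} ≤ (η-a)^{-1}.
    have b2 : |∫ s in a..η, (η - s) ^ (γ - 1) * m κ s| ≤ γ⁻¹ * (η - a) ^ (γ - 1) := by
      rcases lt_or_ge κ (η - a) with hlt | hge
      · rw [hsmall κ η hκ' (by linarith) (fun s => (η - s) ^ (γ - 1)) hi]
        have e3 : ∫ s in a..a + κ, (η - s) ^ (γ - 1) =
            ((η - a) ^ γ - (η - a - κ) ^ γ) / γ := by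
          rw [intervalIntegral.integral_comp_sub_left (fun u => u ^ (γ - 1)) η,
            integral_rpow (Or.inl (by linarith)), sub_add_cancel, sub_sub]
        have hm1 : (η - a - κ) ^ γ ≤ (η - a) ^ γ :=
          Real.rpow_le_rpow (by linarith) (by linarith) hγ.le
        rw [e3, abs_of_nonneg (mul_nonneg (inv_pos.2 hκ').le (div_nonneg (by linarith) hγ.le))]
        have := sub_rpow_ge hγ1 hκ' hlt
        calc _ ≤ κ⁻¹ * (κ * (η - a) ^ (γ - 1) / γ) := by gcongr
          _ = _ := by field_simp
      · have := abs_integral_le_of_Ioo (f := fun s => (η - s) ^ (γ - 1) * m κ s)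
          (g := fun s => κ⁻¹ * (η - s) ^ (γ - 1)) h2.le (fun s h4 h5 => ?_) (hi.const_mul _)
        · rw [intervalIntegral.integral_const_mul, integral_rpow_right hγ] at this
          refine this.trans ?_
          have : κ⁻¹ ≤ (η - a)⁻¹ := inv_anti₀ hη hge
          calc _ ≤ (η - a)⁻¹ * ((η - a) ^ γ / γ) := by gcongr
            _ = _ := by rw [Real.rpow_sub_one hη.ne']; field_simp
        · have hs := Real.rpow_nonneg (by linarith : 0 ≤ η - s) (γ - 1)
          rw [abs_mul, abs_of_nonneg hs, mul_comm]
          gcongr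
          rw [hm]; dsimp only
          split_ifs
          · rw [abs_of_pos (inv_pos.2 hκ')]
          · rw [abs_zero]; positivity
    have n1 := (abs_nonneg _).trans b1
    rw [abs_mul, abs_mul, abs_of_pos (by positivity : 0 < 1 / Real.Gamma γ)]
    calc _ ≤ weylC γ p 1 * (C₀ + C₁ * (b - a) ^ p) * (b - η) ^ (1 - γ - 1) *
          (1 / Real.Gamma γ * (γ⁻¹ * (η - a) ^ (γ - 1))) := by gcongr
      _ = _ := by ring
  · refine Tendsto.const_mul _ (Tendsto.const_mul _ ?_)
    have hi := intervalIntegrable_rpow_right (q := γ) hγ h2.le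
    have hc : ContinuousWithinAt (fun s => (η - s) ^ (γ - 1)) (Ici a) a := by
      refine ContinuousAt.continuousWithinAt ?_
      exact ContinuousAt.rpow_const (by fun_prop) (Or.inl (by linarith))
    refine (tendsto_average_right (by fun_prop) hc).congr' ?_
    have : ∀ᶠ κ in 𝓝[>] (0 : ℝ), κ < η - a := nhdsWithin_le_nhds (Iio_mem_nhds (by linarith))
    filter_upwards [this, self_mem_nhdsWithin] with κ h4 h5
    rw [hsmall κ η h5 (by linarith) (fun s => (η - s) ^ (γ - 1)) hi]

end RoughFrac

end

/-! ### `lambdaOp` along Lipschitz paths -/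

noncomputable section

namespace RoughFrac

open Filter Topology

/-- Bounded Lipschitz paths `x`, `y` and a primitive `h`, with bounded derivatives `px`, `q`, `w`. -/
structure LipPair (C : ℝ) (x y h px q w : ℝ → ℝ) : Prop where
  contx : Continuous x
  conty : Continuous y
  conth : Continuous h
  mpx : Measurable px
  mq : Measurable q
  mw : Measurable w
  bx : ∀ t, |x t| ≤ C
  bpx : ∀ t, |px t| ≤ C
  bq : ∀ t, |q t| ≤ C
  bw : ∀ t, |w t| ≤ C
  ex : ∀ s t, s ≤ t → x t - x s = ∫ u in s..t, px u
  ey : ∀ s t, s ≤ t → y t - y s = ∫ u in s..t, q u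
  eh : ∀ s t, s ≤ t → h t - h s = ∫ u in s..t, w u

lemma intervalIntegrable_of_bdd {f : ℝ → ℝ} {C : ℝ} (hf : Measurable f) (hb : ∀ t, |f t| ≤ C)
    {a b : ℝ} (hab : a ≤ b) : IntervalIntegrable f volume a b :=
  intervalIntegrable_of_Ioo hab hf (fun r _ _ => hb r) intervalIntegrable_const

lemma abs_integral_le_of_bdd {f : ℝ → ℝ} {C : ℝ} (hb : ∀ t, |f t| ≤ C) {a b : ℝ} (hab : a ≤ b) :
    |∫ u in a..b, f u| ≤ C * (b - a) := by
  refine (abs_integral_le_of_Ioo hab (fun r _ _ => hb r) intervalIntegrable_const).trans ?_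
  rw [intervalIntegral.integral_const, smul_eq_mul, mul_comm]

/-- The density of `levJ` along Lipschitz paths. -/
def levj (γ : ℝ) (x px q w : ℝ → ℝ) (η u : ℝ) : ℝ :=
  1 / Real.Gamma γ * ((η - u) ^ (γ - 1) * (w u - x u * q u) +
    px u * ∫ s in u..η, (η - s) ^ (γ - 1) * q s)

/-- The constant in the bound for `levj`. -/
def levjC (γ C B : ℝ) : ℝ := 1 / Real.Gamma γ * (C + C * C + C * C * B / γ)

lemma measurable_levj {Ω : Type*} [MeasurableSpace Ω] {γ : ℝ} {x px q w : ℝ → ℝ}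
    (hx : Measurable x) (hpx : Measurable px) (hq : Measurable q) (hw : Measurable w)
    {η u : Ω → ℝ} (hη : Measurable η) (hu : Measurable u) :
    Measurable fun o => levj γ x px q w (η o) (u o) := by
  have h1 : Measurable fun o => ∫ s in u o..η o, (η o - s) ^ (γ - 1) * q s :=
    measurable_intervalIntegral (f := fun o s => (η o - s) ^ (γ - 1) * q s)
      (by unfold Function.uncurry; fun_prop) hu hη
  unfold levj
  fun_prop

namespace LipPair

variable {C : ℝ} {x y h px q w : ℝ → ℝ}

lemma nonneg (H : LipPair C x y h px q w) : 0 ≤ C := (abs_nonneg _).trans (H.bx 0)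

lemma mx (H : LipPair C x y h px q w) : Measurable x := H.contx.measurable

lemma lev_eq (H : LipPair C x y h px q w) {s t : ℝ} (hst : s ≤ t) (c : ℝ) :
    h t - h s - c * (y t - y s) = ∫ u in s..t, (w u - c * q u) := by
  rw [H.eh s t hst, H.ey s t hst, ← intervalIntegral.integral_const_mul,
    ← intervalIntegral.integral_sub (intervalIntegrable_of_bdd H.mw H.bw hst)
      ((intervalIntegrable_of_bdd H.mq H.bq hst).const_mul _)]

lemma w_sub_bound (H : LipPair C x y h px q w) (s u : ℝ) : |w u - x s * q u| ≤ C + C * C := by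
  refine (abs_sub _ _).trans (add_le_add (H.bw u) ?_)
  rw [abs_mul]
  exact mul_le_mul (H.bx s) (H.bq u) (abs_nonneg _) H.nonneg

lemma levJ_eq (H : LipPair C x y h px q w) {γ ξ η : ℝ} (hγ : 0 < γ) (hγ1 : γ < 1) (h1 : ξ < η) :
    levJ γ x y h η ξ =
      1 / Real.Gamma γ * ∫ s in ξ..η, (η - s) ^ (γ - 1) * (w s - x ξ * q s) := by
  have := H.mq
  have := H.mw
  refine weylLeft_of_primitive (q := 1) (C := C + C * C) hγ hγ1 one_pos h1 (by fun_prop)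
    (fun s _ _ => ?_) fun s h2 _ => H.lev_eq h2 (x ξ)
  simpa using H.w_sub_bound ξ s

lemma q_int_bound (H : LipPair C x y h px q w) {γ u η : ℝ} (hγ : 0 < γ) (h1 : u ≤ η) :
    |∫ s in u..η, (η - s) ^ (γ - 1) * q s| ≤ C * ((η - u) ^ γ / γ) := by
  rw [← integral_rpow_right hγ u η, ← intervalIntegral.integral_const_mul]
  refine abs_integral_le_of_Ioo h1 (fun s h2 h3 => ?_)
    ((intervalIntegrable_rpow_right hγ h1).const_mul _)
  have := Real.rpow_nonneg (by linarith : 0 ≤ η - s) (γ - 1)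
  rw [abs_mul, abs_of_nonneg this, mul_comm]
  gcongr
  exact H.bq s

lemma levj_bound (H : LipPair C x y h px q w) {γ u η B : ℝ} (hγ : 0 < γ) (h1 : u < η)
    (hB : η - u ≤ B) : |levj γ x px q w η u| ≤ levjC γ C B * (η - u) ^ (γ - 1) := by
  have hΓ := Real.Gamma_pos_of_pos hγ
  have hC := H.nonneg
  have h0 : 0 < η - u := by linarith
  have n1 := Real.rpow_nonneg h0.le (γ - 1)
  rw [levj, levjC, abs_mul, abs_of_pos (by positivity : 0 < 1 / Real.Gamma γ), mul_assoc]
  gcongr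
  have t1 : |(η - u) ^ (γ - 1) * (w u - x u * q u)| ≤ (η - u) ^ (γ - 1) * (C + C * C) := by
    rw [abs_mul, abs_of_nonneg n1]
    gcongr
    exact H.w_sub_bound u u
  have t2 : |px u * ∫ s in u..η, (η - s) ^ (γ - 1) * q s| ≤
      C * (C * ((η - u) ^ (γ - 1) * B / γ)) := by
    rw [abs_mul]
    refine mul_le_mul (H.bpx u) ((H.q_int_bound hγ h1.le).trans ?_) (abs_nonneg _) hC
    gcongr
    rw [show γ = γ - 1 + 1 by ring, Real.rpow_add_one h0.ne']
    simp only [add_sub_cancel_right]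
    gcongr
  refine (abs_add_le _ _).trans ((add_le_add t1 t2).trans (le_of_eq ?_))
  ring

/-- In the fractional integral for `levJ`, write x_ξ as x_s minus the integral of px over [ξ, s] and
exchange the integrals. This makes `levJ` a primitive in its left variable, ready for the second
differentiation. -/
lemma levJ_eq_integral (H : LipPair C x y h px q w) {γ ξ η : ℝ} (hγ : 0 < γ) (hγ1 : γ < 1)
    (h1 : ξ < η) : levJ γ x y h η ξ = ∫ u in ξ..η, levj γ x px q w η u := by
  have hC := H.nonneg
  have mq := H.mq
  have mw := H.mw
  have mx := H.mx
  have mpx := H.mpx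
  have hi := intervalIntegrable_rpow_right (q := γ) hγ h1.le
  have tri : TriInt ξ η (fun r s => px s * ((η - r) ^ (γ - 1) * q r)) := by
    refine TriInt.of_left h1.le (D := fun r _ => C * C * (η - r) ^ (γ - 1))
      (φ := fun r => C * C * (η - ξ) * (η - r) ^ (γ - 1)) (by unfold Function.uncurry; fun_prop)
      (fun r _ h3 s _ _ => ?_) (fun r _ _ => intervalIntegrable_const) (fun r h2 h3 => ?_)
      (hi.const_mul _)
    · have := Real.rpow_nonneg (by linarith : 0 ≤ η - r) (γ - 1)
      rw [abs_mul, abs_mul, abs_of_nonneg this]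
      calc _ ≤ C * ((η - r) ^ (γ - 1) * C) := by
            gcongr
            · exact H.bpx s
            · exact H.bq r
        _ = _ := by ring
    · rw [intervalIntegral.integral_const, smul_eq_mul]
      have := Real.rpow_nonneg (by linarith : 0 ≤ η - r) (γ - 1)
      calc _ ≤ (η - ξ) * (C * C * (η - r) ^ (γ - 1)) := by gcongr
        _ = _ := by ring
  have sw := tri.swap h1.le
  have iR := tri.intervalIntegrable_right h1.le
  have e1 : ∀ r, ξ < r → r < η → ∫ s in ξ..r, px s * ((η - r) ^ (γ - 1) * q r) =
      (η - r) ^ (γ - 1) * ((x r - x ξ) * q r) := by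
    intro r h2 _
    rw [intervalIntegral.integral_mul_const, ← H.ex ξ r h2.le]
    ring
  rw [integral_congr_Ioo h1.le e1] at sw
  simp only [intervalIntegral.integral_const_mul] at sw iR
  have hb : ∀ f : ℝ → ℝ, Measurable f → ∀ K, (∀ s, |f s| ≤ K) →
      IntervalIntegrable (fun s => (η - s) ^ (γ - 1) * f s) volume ξ η := by
    intro f hf K hK
    refine intervalIntegrable_of_Ioo h1.le (by fun_prop) (fun s _ h3 => ?_) (hi.const_mul K)
    have := Real.rpow_nonneg (by linarith : 0 ≤ η - s) (γ - 1)
    rw [abs_mul, abs_of_nonneg this, mul_comm]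
    gcongr
    exact hK s
  have i1 := hb (fun s => w s - x s * q s) (by fun_prop) _ fun s => H.w_sub_bound s s
  have i2 := hb (fun s => (x s - x ξ) * q s) (by fun_prop) ((C + C) * C) fun s => by
    rw [abs_mul]
    exact mul_le_mul ((abs_sub _ _).trans (add_le_add (H.bx s) (H.bx ξ))) (H.bq s) (abs_nonneg _)
      (by linarith)
  rw [H.levJ_eq hγ hγ1 h1]
  unfold levj
  rw [intervalIntegral.integral_const_mul, intervalIntegral.integral_add i1 iR, ← sw,
    ← intervalIntegral.integral_add i1 i2]
  congr 2
  ext s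
  ring

lemma gammaOp_eq (H : LipPair C x y h px q w) {γ ξ η : ℝ} (hγ : 0 < γ) (hγ1 : γ < 1)
    (h1 : ξ < η) : gammaOp γ (lev x y h) ξ η =
      1 / Real.Gamma γ * ∫ u in ξ..η, (u - ξ) ^ (γ - 1) * levj γ x px q w η u := by
  refine weylRight_of_primitive (q := γ) (C := levjC γ C (η - ξ)) (φ := levJ γ x y h η) hγ hγ1 hγ h1
    (measurable_levj H.mx H.mpx H.mq H.mw measurable_const measurable_id)
    (fun u h2 h3 => H.levj_bound hγ h3 (by linarith)) fun s h2 h3 => ?_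
  -- At s = η both `levJ` and the integral are zero; the formula for a primitive is required up to
  -- the endpoint.
  rcases eq_or_lt_of_le h3 with h4 | h4
  · subst h4
    simp [levJ, weylLeft, lev]
  · exact H.levJ_eq_integral hγ hγ1 h4

/-- In the variable ξ, K is a left derivative of order γ and the mixed derivative is a right
fractional integral of the same order, so integration by parts removes both. The density grows like
(η-s)^{γ-1}; its fractional integral stays bounded because 2γ > 1. -/
lemma lambda_inner_eq (H : LipPair C x y h px q w) {α ε θ η b : ℝ} (hγ : 1 / 2 < α - ε)
    (hε : 0 < ε) (hα1 : α < 1) (h1 : θ < η) (h2 : η < b) :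
    ∫ ξ in θ..η, kernelK α ε θ b ξ η * gammaOp (α - ε) (lev x y h) ξ η =
      ∫ ξ in θ..η, kerHs (α - ε) α θ b η ξ * levj (α - ε) x px q w η ξ := by
  have hΓ := Real.Gamma_pos_of_pos (by linarith : 0 < α - ε)
  have hC := H.nonneg
  have hfc := fracClass_kerHs (γ := α - ε) (α := α) (p := α - ε / 2) hγ (by linarith)
    (by linarith) hα1 h1 h2
  have mj : Measurable (levj (α - ε) x px q w η) :=
    measurable_levj H.mx H.mpx H.mq H.mw measurable_const measurable_id
  have hdom : ∀ r, θ < r → r < η → ∀ s, r < s → s < η →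
      |(s - r) ^ (α - ε - 1) * (|levj (α - ε) x px q w η s|)| ≤ levjC (α - ε) C (η - θ) *
        ((s - r) ^ (α - ε - 1) * (η - s) ^ (α - ε - 1)) := by
    intro r h3 h4 s h5 h6
    have := Real.rpow_nonneg (by linarith : 0 ≤ s - r) (α - ε - 1)
    rw [abs_mul, abs_of_nonneg this, abs_abs]
    calc _ ≤ (s - r) ^ (α - ε - 1) * (levjC (α - ε) C (η - θ) * (η - s) ^ (α - ε - 1)) := by
          gcongr
          exact H.levj_bound (by linarith) h6 (by linarith)
      _ = _ := by ring
  rw [← hfc.integral_by_parts (by linarith) (by linarith) (by linarith) (by linarith) h1.le mj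
    (C := levjC (α - ε) C (η - θ) * (betaR (α - ε) (α - ε) * (η - θ) ^ (2 * (α - ε) - 1)))]
  · refine integral_congr_Ioo h1.le fun ξ h3 h4 => ?_
    rw [kernelK_eq (by linarith) hα1 h3 h4 h2, H.gammaOp_eq (by linarith) (by linarith) h4]
  · intro r h3 h4
    exact intervalIntegrable_of_Ioo h4.le (by fun_prop) (hdom r h3 h4)
      ((intervalIntegrable_beta (by linarith) (by linarith) h4.le).const_mul _)
  · intro r h3 h4
    refine (le_abs_self _).trans ((abs_integral_le_of_Ioo h4.le (hdom r h3 h4)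
      ((intervalIntegrable_beta (by linarith) (by linarith) h4.le).const_mul _)).trans ?_)
    have hb := betaR_pos (p := α - ε) (q := α - ε) (by linarith) (by linarith)
    rw [intervalIntegral.integral_const_mul, integral_beta _ _ h4,
      show α - ε + (α - ε) - 1 = 2 * (α - ε) - 1 by ring]
    have hB : 0 ≤ levjC (α - ε) C (η - θ) := by
      unfold levjC
      have : 0 < η - θ := by linarith
      have : 0 < α - ε := by linarith
      positivity
    have : (η - r) ^ (2 * (α - ε) - 1) ≤ (η - θ) ^ (2 * (α - ε) - 1) :=
      Real.rpow_le_rpow (by linarith) (by linarith) (by linarith)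
    gcongr

/-- The bound of `kerH` uniform in ξ is indispensable here: with `kerS` the singularity at ξ = η
would be (η-ξ)^{γ-1-p}, which is not integrable since γ < p. -/
lemma triInt_kerHs (H : LipPair C x y h px q w) {γ α p θ b : ℝ} (hγ : 1 / 2 < γ) (hγp : γ < p)
    (hpα : p < α) (hα1 : α < 1) (h1 : θ < b) :
    TriInt θ b (fun η ξ => kerHs γ α θ b η ξ * levj γ x px q w η ξ) := by
  have hC := H.nonneg
  have hcc := kerC_pos (α := α) (by linarith) hα1
  have hHC := kerHC_pos hγ hγp hpα hα1
  have hΓ := Real.Gamma_pos_of_pos (by linarith : 0 < γ)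
  have hγ0 : 0 < γ := by linarith
  have hb0 : 0 < b - θ := by linarith
  have hJ : 0 ≤ levjC γ C (b - θ) := by
    unfold levjC
    positivity
  have hB := betaR_pos (p := α) (q := γ) (by linarith) (by linarith)
  set K := kerC α * kerHC γ α p * levjC γ C (b - θ) with hK
  have hK0 : 0 ≤ K := by positivity
  set S : ℝ → ℝ := fun η =>
    ((η - θ) ^ (α - 1) * (b - η) ^ (-p) + (η - θ) ^ (α - 1 - p)) * (b - η) ^ (p - γ) with hS
  have hm : Measurable (Function.uncurry
      (fun η ξ => kerHs γ α θ b η ξ * levj γ x px q w η ξ)) :=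
    (measurable_kerHs_comp γ α measurable_const measurable_const measurable_snd
      measurable_fst).mul (measurable_levj H.mx H.mpx H.mq H.mw measurable_fst measurable_snd)
  have hS0 : ∀ η, θ < η → η < b → 0 ≤ S η := by
    intro η h2 h3
    have := Real.rpow_nonneg (by linarith : 0 ≤ η - θ) (α - 1)
    have := Real.rpow_nonneg (by linarith : 0 ≤ η - θ) (α - 1 - p)
    have := Real.rpow_nonneg (by linarith : 0 ≤ b - η) (-p)
    have := Real.rpow_nonneg (by linarith : 0 ≤ b - η) (p - γ)
    simp only [hS]
    positivity
  refine TriInt.of_left h1.le (D := fun η ξ => K * S η * ((ξ - θ) ^ (α - 1) * (η - ξ) ^ (γ - 1)))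
    (φ := fun η => K * betaR α γ *
      ((η - θ) ^ (2 * α + γ - 1 - 1) * (b - η) ^ (1 - γ - 1) +
        (η - θ) ^ (2 * α + γ - 1 - p - 1) * (b - η) ^ (p - γ + 1 - 1))) hm
    (fun η h2 h3 ξ h4 h5 => ?_)
    (fun η h2 h3 => (intervalIntegrable_beta (by linarith) (by linarith) h2.le).const_mul _)
    (fun η h2 h3 => ?_) ?_
  · have n1 := Real.rpow_nonneg (by linarith : 0 ≤ ξ - θ) (α - 1)
    have n2 := Real.rpow_nonneg (by linarith : 0 ≤ η - ξ) (γ - 1)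
    have b1 := kerH_bound hγ hγp hpα hα1 h4.le h5 h3
    have b2 := H.levj_bound (B := b - θ) (γ := γ) (by linarith) h5 (by linarith)
    rw [abs_mul, kerHs, abs_mul, abs_of_nonneg (by positivity : 0 ≤ kerC α * (ξ - θ) ^ (α - 1))]
    have n3 := (abs_nonneg _).trans b1
    calc _ ≤ kerC α * (ξ - θ) ^ (α - 1) * (kerHC γ α p * S η) *
          (levjC γ C (b - θ) * (η - ξ) ^ (γ - 1)) := by
          refine mul_le_mul ?_ b2 (abs_nonneg _) ?_
          · exact mul_le_mul_of_nonneg_left b1 (by positivity)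
          · have := hS0 η h2 h3
            positivity
      _ = _ := by rw [hK]; ring
  · have hv : 0 < η - θ := by linarith
    have hv' : 0 < b - η := by linarith
    rw [intervalIntegral.integral_const_mul, integral_beta _ _ h2,
      show 2 * α + γ - 1 - 1 = (α - 1) + (α + γ - 1) by ring,
      show 2 * α + γ - 1 - p - 1 = (α - 1 - p) + (α + γ - 1) by ring,
      show 1 - γ - 1 = -p + (p - γ) by ring, show p - γ + 1 - 1 = p - γ by ring,
      Real.rpow_add hv (α - 1), Real.rpow_add hv (α - 1 - p), Real.rpow_add hv']
    refine le_of_eq ?_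
    simp only [hS]
    ring
  · exact ((intervalIntegrable_beta (by linarith) (by linarith) h1.le).add
      (intervalIntegrable_beta (by linarith) (by linarith) h1.le)).const_mul _

/-- Integration by parts in η removes the remaining derivative. The part of `levj` with (η-ξ)^{γ-1}
is a unit mass at the left end and yields the kernel on the diagonal; the part with the fractional
integral of q yields the kernel paired with q. -/
lemma kerH_integral (H : LipPair C x y h px q w) {γ α p θ b ξ : ℝ} (hγ : 1 / 2 < γ) (hγp : γ < p)
    (hpα : p < α) (hα1 : α < 1) (h1 : θ < ξ) (h2 : ξ < b) :
    ∫ η in ξ..b, kerH γ α θ b ξ η * levj γ x px q w η ξ =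
      kerReg α (ξ - θ) (ξ - θ) * (w ξ - x ξ * q ξ) +
        px ξ * ∫ s in ξ..b, kerReg α (ξ - θ) (s - θ) * q s := by
  have hu : 0 < ξ - θ := by linarith
  have hB := kerB_pos (α := α) (p := p) hα1 hpα
  have mq := H.mq
  have n1 := Real.rpow_nonneg hu.le (α - 1)
  have n2 := Real.rpow_nonneg hu.le (α - 1 - p)
  have mg : Measurable fun η => kerReg α (ξ - θ) (η - θ) :=
    measurable_kerReg_comp α measurable_const (by fun_prop)
  have h0 : ∀ r, ξ ≤ r → r < b → |kerReg α (ξ - θ) (r - θ)| ≤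
      kerB α p * (ξ - θ) ^ (α - 1) := by
    intro r h3 _
    refine (kerReg_le (α := α) (p := p) (u := ξ - θ) (v := r - θ) hα1 hpα (by linarith)
      hu.le (by linarith) (by linarith)).trans ?_
    gcongr ?_ * ?_
    exact Real.rpow_le_rpow_of_nonpos hu (by linarith) (by linarith)
  have hh1 : ∀ r s, ξ ≤ r → r < s → s < b → |kerReg α (ξ - θ) (r - θ) -
      kerReg α (ξ - θ) (s - θ)| ≤ 3 * kerB α p * (ξ - θ) ^ (α - 1 - p) * (s - r) ^ p := by
    intro r s h3 h4 h5
    have := kerReg_diff_right (α := α) (p := p) (u := ξ - θ) (v := r - θ) (s := s - θ)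
      (by linarith) hα1 hpα (by linarith) hu.le (by linarith) (by linarith) (by linarith)
    rw [show s - θ - (r - θ) = s - r by ring] at this
    have n3 := Real.rpow_nonneg (by linarith : 0 ≤ s - r) p
    have : (r - θ) ^ (α - 1 - p) ≤ (ξ - θ) ^ (α - 1 - p) :=
      Real.rpow_le_rpow_of_nonpos hu (by linarith) (by linarith)
    calc _ ≤ 3 * kerB α p * (r - θ) ^ (α - 1 - p) * (s - r) ^ p := by linarith
      _ ≤ _ := by gcongr
  have ea := fracInt_weylRight_left_end (γ := γ) (p := p) (a := ξ) (b := b)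
    (g := fun η => kerReg α (ξ - θ) (η - θ)) (by linarith) (by linarith) hγp h2 mg
    (by positivity) (by positivity) h0 hh1
  have eb := integral_by_parts_right_holder (γ := γ) (p := p) (a := ξ) (b := b)
    (g := fun η => kerReg α (ξ - θ) (η - θ)) (m := q) (by linarith) (by linarith) hγp h2.le mg
    (by positivity) (fun r h3 h4 => h0 r h3.le h4) (fun r s h3 h4 h5 => hh1 r s h3.le h4 h5) mq
    H.bq
  have hw : ∀ r, ξ < r → r < b → _ := fun r h3 h4 => weylRight_bound_bdd_holder (γ := γ)
    (p := p) (a := ξ) (b := b) (g := fun η => kerReg α (ξ - θ) (η - θ)) (by linarith)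
    (by linarith) hγp (by positivity) (by positivity) h0 hh1 (r := r) h3.le h4
  have mH : Measurable fun η => kerH γ α θ b ξ η :=
    measurable_kerH_comp γ α measurable_const measurable_const measurable_const measurable_id
  have hΓ := Real.Gamma_pos_of_pos (by linarith : 0 < γ)
  have hγ0 : 0 < γ := by linarith
  have hC := H.nonneg
  have ia : IntervalIntegrable (fun η => kerH γ α θ b ξ η *
      (1 / Real.Gamma γ * (η - ξ) ^ (γ - 1))) volume ξ b := by
    refine intervalIntegrable_of_Ioo h2.le (by fun_prop) (fun r h3 h4 => ?_)
      ((intervalIntegrable_beta (p := γ) (q := 1 - γ) (by linarith) (by linarith)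
        h2.le).const_mul (weylC γ p 1 * (kerB α p * (ξ - θ) ^ (α - 1) +
          3 * kerB α p * (ξ - θ) ^ (α - 1 - p) * (b - ξ) ^ p) * (1 / Real.Gamma γ)))
    have n3 := Real.rpow_nonneg (by linarith : 0 ≤ r - ξ) (γ - 1)
    rw [abs_mul, abs_of_nonneg (by positivity : 0 ≤ 1 / Real.Gamma γ * (r - ξ) ^ (γ - 1))]
    refine (mul_le_mul_of_nonneg_right (hw r h3 h4) (by positivity)).trans (le_of_eq ?_)
    ring
  have ib : IntervalIntegrable (fun η => kerH γ α θ b ξ η *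
      (1 / Real.Gamma γ * ∫ s in ξ..η, (η - s) ^ (γ - 1) * q s)) volume ξ b := by
    have mi : Measurable fun η => ∫ s in ξ..η, (η - s) ^ (γ - 1) * q s :=
      measurable_intervalIntegral (f := fun η s => (η - s) ^ (γ - 1) * q s)
        (by unfold Function.uncurry; fun_prop) measurable_const measurable_id
    refine intervalIntegrable_of_Ioo h2.le (by fun_prop) (fun r h3 h4 => ?_)
      ((intervalIntegrable_rpow_right (q := 1 - γ) (by linarith) h2.le).const_mul
        (weylC γ p 1 * (kerB α p * (ξ - θ) ^ (α - 1) +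
          3 * kerB α p * (ξ - θ) ^ (α - 1 - p) * (b - ξ) ^ p) * (1 / Real.Gamma γ *
            (C * ((b - ξ) ^ γ / γ)))))
    rw [abs_mul, abs_mul, abs_of_pos (by positivity : 0 < 1 / Real.Gamma γ)]
    have n5 := (abs_nonneg _).trans (hw r h3 h4)
    have n6 : (r - ξ) ^ γ ≤ (b - ξ) ^ γ := Real.rpow_le_rpow (by linarith) (by linarith) hγ0.le
    calc _ ≤ (weylC γ p 1 * (kerB α p * (ξ - θ) ^ (α - 1) +
          3 * kerB α p * (ξ - θ) ^ (α - 1 - p) * (b - ξ) ^ p) * (b - r) ^ (1 - γ - 1)) *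
          (1 / Real.Gamma γ * (C * ((b - ξ) ^ γ / γ))) := by
          refine mul_le_mul (hw r h3 h4) ?_ (by positivity) n5
          gcongr
          refine (H.q_int_bound hγ0 h3.le).trans ?_
          gcongr
      _ = _ := by ring
  have e1 : (fun η => kerH γ α θ b ξ η * levj γ x px q w η ξ) = fun η =>
      (w ξ - x ξ * q ξ) * (kerH γ α θ b ξ η * (1 / Real.Gamma γ * (η - ξ) ^ (γ - 1))) +
      px ξ * (kerH γ α θ b ξ η *
        (1 / Real.Gamma γ * ∫ s in ξ..η, (η - s) ^ (γ - 1) * q s)) := by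
    ext η
    rw [levj]
    ring
  rw [e1, intervalIntegral.integral_add (ia.const_mul _) (ib.const_mul _),
    intervalIntegral.integral_const_mul, intervalIntegral.integral_const_mul]
  have ea' : ∫ η in ξ..b, kerH γ α θ b ξ η * (1 / Real.Gamma γ * (η - ξ) ^ (γ - 1)) =
    kerReg α (ξ - θ) (ξ - θ) := ea
  have eb' : ∫ η in ξ..b, kerH γ α θ b ξ η *
    (1 / Real.Gamma γ * ∫ s in ξ..η, (η - s) ^ (γ - 1) * q s) =
    ∫ s in ξ..b, kerReg α (ξ - θ) (s - θ) * q s := eb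
  rw [ea', eb']
  ring

/-- `lambdaOp` along Lipschitz paths. -/
lemma lambdaOp_eq (H : LipPair C x y h px q w) {α ε θ b : ℝ} (hγ : 1 / 2 < α - ε)
    (hε : 0 < ε) (hα1 : α < 1) (h1 : θ < b) :
    lambdaOp α ε θ b (lev x y h) = ∫ ξ in θ..b,
      (1 / Real.Gamma (2 * α - 1) * (ξ - θ) ^ (2 * α - 2) * (w ξ - x ξ * q ξ) +
        px ξ * ∫ s in ξ..b, kernelG α θ ξ s * q s) := by
  have e1 : lambdaOp α ε θ b (lev x y h) = ∫ η in θ..b, ∫ ξ in θ..η,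
      kerHs (α - ε) α θ b η ξ * levj (α - ε) x px q w η ξ :=
    integral_congr_Ioo h1.le fun η h2 h3 => H.lambda_inner_eq hγ hε hα1 h2 h3
  rw [e1, (H.triInt_kerHs (p := α - ε / 2) hγ (by linarith) (by linarith) hα1 h1).swap h1.le]
  refine integral_congr_Ioo h1.le fun ξ h2 h3 => ?_
  have hu : 0 < ξ - θ := by linarith
  have e2 : ∫ s in ξ..b, kernelG α θ ξ s * q s =
      kerC α * (ξ - θ) ^ (α - 1) * ∫ s in ξ..b, kerReg α (ξ - θ) (s - θ) * q s := by
    rw [← intervalIntegral.integral_const_mul]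
    refine integral_congr_Ioo h3.le fun s h4 _ => ?_
    rw [kernelG_eq (by linarith) hα1 h2 h4]
    ring
  simp only [kerHs, mul_assoc (kerC α * (ξ - θ) ^ (α - 1))]
  rw [intervalIntegral.integral_const_mul,
    H.kerH_integral (p := α - ε / 2) hγ (by linarith) (by linarith) hα1 h2 h3, e2,
    show 2 * α - 2 = (α - 1) + (α - 1) by ring, Real.rpow_add hu]
  linear_combination ((ξ - θ) ^ (α - 1) * (w ξ - x ξ * q ξ)) *
    kerReg_diag (α := α) (by linarith) hα1 hu

end LipPair

end RoughFrac

end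

/-! ### `lambdaOp` as a fractional integral of order 2α - 1 -/

noncomputable section

namespace RoughFrac

open Filter Topology

lemma rect_swap {a b c d : ℝ} (hab : a ≤ b) (hcd : c ≤ d) {f : ℝ → ℝ → ℝ} {A B : ℝ → ℝ}
    (hf : Measurable (Function.uncurry f))
    (hb : ∀ r s, a < r → r < b → c < s → s < d → |f r s| ≤ A r * B s)
    (hA : IntervalIntegrable A volume a b) (hB : IntervalIntegrable B volume c d) :
    ∫ r in a..b, ∫ s in c..d, f r s = ∫ s in c..d, ∫ r in a..b, f r s := by
  simp only [intervalIntegral_eq_Ioo hab, intervalIntegral_eq_Ioo hcd]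
  refine integral_integral_swap ?_
  rw [intervalIntegrable_iff_integrableOn_Ioo_of_le hab] at hA
  rw [intervalIntegrable_iff_integrableOn_Ioo_of_le hcd] at hB
  refine (Integrable.mul_prod hA hB).mono' hf.aestronglyMeasurable ?_
  rw [Measure.prod_restrict]
  refine (ae_restrict_mem (measurableSet_Ioo.prod measurableSet_Ioo)).mono fun q hq => ?_
  exact hb q.1 q.2 hq.1.1 hq.1.2 hq.2.1 hq.2.2

/-- The integral `∫_u^s (r - ρ)^{-α-1} (s - r)^{α-1} dr`. -/
def kerL (α ρ u s : ℝ) : ℝ := 1 / α * (s - ρ)⁻¹ * ((s - u) ^ α * (u - ρ) ^ (-α))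

/-- The integrand has an elementary primitive, a multiple of ((s-r)/(r-ρ))^α: in its derivative the
factors r - ρ and s - r add up to the constant s - ρ. -/
lemma kerL_eq {α ρ u s : ℝ} (hα : 0 < α) (h1 : ρ < u) (h2 : u < s) :
    ∫ r in u..s, (r - ρ) ^ (-α - 1) * (s - r) ^ (α - 1) = kerL α ρ u s := by
  have hs : 0 < s - ρ := by linarith
  have key := intervalIntegral.integral_eq_sub_of_hasDerivAt_of_le (a := u) (b := s)
    (f := fun r => -(1 / α * (s - ρ)⁻¹ * ((s - r) ^ α * (r - ρ) ^ (-α))))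
    (f' := fun r => (r - ρ) ^ (-α - 1) * (s - r) ^ (α - 1)) h2.le ?_ (fun r hr => ?_) ?_
  · rw [key, kerL, sub_self, Real.zero_rpow hα.ne']
    ring
  · refine ContinuousOn.neg (ContinuousOn.mul continuousOn_const (ContinuousOn.mul ?_ ?_))
    · exact ContinuousOn.rpow_const (by fun_prop) fun r _ => Or.inr hα.le
    · exact ContinuousOn.rpow_const (by fun_prop) fun r hr => Or.inl (by linarith [hr.1])
  · have hr1 : 0 < r - ρ := by linarith [hr.1]
    have hr2 : 0 < s - r := by linarith [hr.2]
    have d1 : HasDerivAt (fun r : ℝ => (s - r) ^ α) (-1 * α * (s - r) ^ (α - 1)) r :=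
      ((hasDerivAt_id r).const_sub s).rpow_const (Or.inl hr2.ne')
    have d2 : HasDerivAt (fun r : ℝ => (r - ρ) ^ (-α)) (1 * (-α) * (r - ρ) ^ (-α - 1)) r :=
      ((hasDerivAt_id r).sub_const ρ).rpow_const (Or.inl hr1.ne')
    refine ((d1.mul d2).const_mul (1 / α * (s - ρ)⁻¹)).neg.congr_deriv ?_
    rw [show (s - r) ^ α = (s - r) ^ (α - 1) * (s - r) by
      rw [← Real.rpow_add_one hr2.ne', sub_add_cancel], show (r - ρ) ^ (-α) =
      (r - ρ) ^ (-α - 1) * (r - ρ) by rw [← Real.rpow_add_one hr1.ne', sub_add_cancel]]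
    field_simp
    ring
  · refine intervalIntegrable_of_Ioo h2.le (by fun_prop) (fun r h3 h4 => ?_)
      ((intervalIntegrable_rpow_right hα h2.le).const_mul ((u - ρ) ^ (-α - 1)))
    have n1 := Real.rpow_nonneg (by linarith : 0 ≤ r - ρ) (-α - 1)
    have n2 := Real.rpow_nonneg (by linarith : 0 ≤ s - r) (α - 1)
    rw [abs_of_nonneg (by positivity)]
    exact mul_le_mul_of_nonneg_right
      (Real.rpow_le_rpow_of_nonpos (by linarith) (by linarith) (by linarith)) n2

/-- This is where the formula for G comes from: with ρ = θ + q(u-θ), the left fractional integral of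
order 2α - 1 of `kerL` becomes the integral over q in `kernelG`. -/
lemma kernelG_eq_integral {α θ u s : ℝ} (hα : 1 / 2 < α) (h1 : θ < u) (h2 : u < s) :
    1 / Real.Gamma (2 * α - 1) * (α / (Real.Gamma (1 - α) * Real.Gamma α)) *
      ∫ ρ in θ..u, (ρ - θ) ^ (2 * α - 2) * kerL α ρ u s = kernelG α θ u s := by
  have hu : 0 < u - θ := by linarith
  have hs : 0 < s - u := by linarith
  have e := intervalIntegral.integral_comp_add_mul (a := 0) (b := 1)
    (fun ρ => (ρ - θ) ^ (2 * α - 2) * kerL α ρ u s) hu.ne' θ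
  rw [mul_zero, add_zero, mul_one, add_sub_cancel, smul_eq_mul, ← div_eq_inv_mul,
    eq_div_iff hu.ne'] at e
  have e2 : ∀ q : ℝ, 0 < q → q < 1 → (θ + (u - θ) * q - θ) ^ (2 * α - 2) *
      kerL α (θ + (u - θ) * q) u s = 1 / α * (u - θ) ^ (α - 2) * (s - u) ^ (α - 1) *
        (q ^ (2 * α - 2) * (1 - q) ^ (-α) * (1 + (1 - q) * ((u - θ) / (s - u)))⁻¹) := by
    intro q h3 h4
    have hq : 0 < 1 - q := by linarith
    rw [kerL, show θ + (u - θ) * q - θ = (u - θ) * q by ring,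
      show u - (θ + (u - θ) * q) = (u - θ) * (1 - q) by ring,
      Real.mul_rpow hu.le h3.le, Real.mul_rpow hu.le hq.le,
      show s - (θ + (u - θ) * q) = (s - u) * (1 + (1 - q) * ((u - θ) / (s - u))) by
        field_simp; ring, mul_inv, Real.rpow_sub_one hs.ne',
      show α - 2 = (2 * α - 2) + -α by ring, Real.rpow_add hu]
    ring
  rw [← e, integral_congr_Ioo zero_le_one e2, intervalIntegral.integral_const_mul, kernelG,
    show α - 1 = α - 2 + 1 by ring, Real.rpow_add_one hu.ne']
  rw [show α - 2 + 1 = α - 1 by ring]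
  field_simp

/-- `∫_r^b (s - r)^{α-1} q_s ds`. -/
def fracY (α b : ℝ) (q : ℝ → ℝ) (r : ℝ) : ℝ := ∫ s in r..b, (s - r) ^ (α - 1) * q s

/-- The density of which `lambdaOp` is a fractional integral. -/
def lamN (α b : ℝ) (x q w : ℝ → ℝ) (ρ : ℝ) : ℝ :=
  w ρ - x ρ * q ρ + α / (Real.Gamma (1 - α) * Real.Gamma α) *
    ∫ r in ρ..b, (x r - x ρ) * ((r - ρ) ^ (-α - 1) * fracY α b q r)

lemma measurable_fracY {α b : ℝ} {q : ℝ → ℝ} (hq : Measurable q) : Measurable (fracY α b q) :=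
  measurable_intervalIntegral (f := fun r s => (s - r) ^ (α - 1) * q s)
    (by unfold Function.uncurry; fun_prop) measurable_id measurable_const

lemma measurable_lamN {α b : ℝ} {x q w : ℝ → ℝ} (hx : Measurable x) (hq : Measurable q)
    (hw : Measurable w) : Measurable (lamN α b x q w) := by
  have hY := measurable_fracY (α := α) (b := b) hq
  have : Measurable fun ρ => ∫ r in ρ..b, (x r - x ρ) * ((r - ρ) ^ (-α - 1) * fracY α b q r) :=
    measurable_intervalIntegral
      (f := fun ρ r => (x r - x ρ) * ((r - ρ) ^ (-α - 1) * fracY α b q r))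
      (by unfold Function.uncurry; fun_prop) measurable_id measurable_const
  unfold lamN
  fun_prop

namespace LipPair

variable {C : ℝ} {x y h px q w : ℝ → ℝ}

lemma abs_x_sub (H : LipPair C x y h px q w) {s t : ℝ} (hst : s ≤ t) :
    |x t - x s| ≤ C * (t - s) := by
  rw [H.ex s t hst]
  exact abs_integral_le_of_bdd H.bpx hst

lemma fracY_bound (H : LipPair C x y h px q w) {α a b r : ℝ} (hα : 0 < α) (h1 : a ≤ r)
    (h2 : r ≤ b) : |fracY α b q r| ≤ C * ((b - a) ^ α / α) := by
  have hC := H.nonneg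
  have := abs_integral_le_of_Ioo (f := fun s => (s - r) ^ (α - 1) * q s) h2 (fun s h3 h4 => ?_)
    ((intervalIntegrable_rpow_left hα h2).const_mul C)
  · refine this.trans ?_
    rw [intervalIntegral.integral_const_mul, integral_rpow_left hα]
    have : (b - r) ^ α ≤ (b - a) ^ α := Real.rpow_le_rpow (by linarith) (by linarith) hα.le
    gcongr
  · have := Real.rpow_nonneg (by linarith : 0 ≤ s - r) (α - 1)
    rw [abs_mul, abs_of_nonneg this, mul_comm]
    gcongr
    exact H.bq s

lemma incr_Y_bound (H : LipPair C x y h px q w) {α a b ρ r : ℝ} (hα : 0 < α) (h1 : a ≤ ρ)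
    (h2 : ρ < r) (h3 : r < b) :
    |(x r - x ρ) * ((r - ρ) ^ (-α - 1) * fracY α b q r)| ≤
      C * (C * ((b - a) ^ α / α)) * (r - ρ) ^ (1 - α - 1) := by
  have hC := H.nonneg
  have hr : 0 < r - ρ := by linarith
  have n1 := Real.rpow_nonneg hr.le (-α - 1)
  rw [abs_mul, abs_mul, abs_of_nonneg n1, show 1 - α - 1 = (-α - 1) + 1 by ring,
    Real.rpow_add_one hr.ne']
  calc _ ≤ C * (r - ρ) * ((r - ρ) ^ (-α - 1) * (C * ((b - a) ^ α / α))) := by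
        gcongr
        · exact H.abs_x_sub h2.le
        · exact H.fracY_bound hα (by linarith) h3.le
    _ = _ := by ring

lemma lamN_bound (H : LipPair C x y h px q w) {α a b ρ : ℝ} (hα : 0 < α) (hα1 : α < 1)
    (h1 : a ≤ ρ) (h2 : ρ < b) :
    |lamN α b x q w ρ| ≤ C + C * C + α / (Real.Gamma (1 - α) * Real.Gamma α) *
      (C * (C * ((b - a) ^ α / α)) * ((b - a) ^ (1 - α) / (1 - α))) := by
  have hC := H.nonneg
  have hΓ := Real.Gamma_pos_of_pos hα
  have hΓ' := Real.Gamma_pos_of_pos (sub_pos.2 hα1)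
  have hba : 0 < b - a := by linarith
  have := abs_integral_le_of_Ioo h2.le (fun r h3 h4 => H.incr_Y_bound hα h1 h3 h4)
    ((intervalIntegrable_rpow_left (p := 1 - α) (by linarith) h2.le).const_mul _)
  rw [intervalIntegral.integral_const_mul, integral_rpow_left (by linarith)] at this
  rw [lamN]
  refine (abs_add_le _ _).trans (add_le_add (H.w_sub_bound ρ ρ) ?_)
  rw [abs_mul, abs_of_pos (by positivity)]
  refine mul_le_mul_of_nonneg_left (this.trans ?_) (by positivity)
  have : (b - ρ) ^ (1 - α) ≤ (b - a) ^ (1 - α) :=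
    Real.rpow_le_rpow (by linarith) (by linarith) (by linarith)
  have h0 : 0 < 1 - α := by linarith
  gcongr

/-- x_r - x_ρ is the integral of px over [ρ, r]; exchanging the integrals isolates px, as in the
formula of `lambdaOp_eq`. -/
lemma incr_Y_integral (H : LipPair C x y h px q w) {α b ρ : ℝ} (hα : 0 < α) (hα1 : α < 1)
    (h1 : ρ < b) :
    ∫ r in ρ..b, (x r - x ρ) * ((r - ρ) ^ (-α - 1) * fracY α b q r) =
      ∫ u in ρ..b, px u * ∫ r in u..b, (r - ρ) ^ (-α - 1) * fracY α b q r := by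
  have hC := H.nonneg
  have mpx := H.mpx
  have mY := measurable_fracY (α := α) (b := b) H.mq
  have hbρ : 0 < b - ρ := by linarith
  have tri : TriInt ρ b (fun r u => px u * ((r - ρ) ^ (-α - 1) * fracY α b q r)) := by
    refine TriInt.of_left h1.le
      (D := fun r _ => C * ((r - ρ) ^ (-α - 1) * (C * ((b - ρ) ^ α / α))))
      (φ := fun r => C * (C * ((b - ρ) ^ α / α)) * (r - ρ) ^ (1 - α - 1))
      (by unfold Function.uncurry; fun_prop) (fun r h2 h3 u _ _ => ?_)
      (fun r _ _ => intervalIntegrable_const) (fun r h2 h3 => ?_)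
      ((intervalIntegrable_rpow_left (by linarith) h1.le).const_mul _)
    · have := Real.rpow_nonneg (by linarith : 0 ≤ r - ρ) (-α - 1)
      rw [abs_mul, abs_mul, abs_of_nonneg this]
      gcongr
      · exact H.bpx u
      · exact H.fracY_bound hα h2.le h3.le
    · have hr : 0 < r - ρ := by linarith
      rw [intervalIntegral.integral_const, smul_eq_mul, show 1 - α - 1 = (-α - 1) + 1 by ring,
        Real.rpow_add_one hr.ne']
      exact le_of_eq (by ring)
  have sw := tri.swap h1.le
  simp only [intervalIntegral.integral_const_mul, intervalIntegral.integral_mul_const] at sw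
  rw [← sw]
  refine integral_congr_Ioo h1.le fun r h2 _ => ?_
  rw [H.ex ρ r h2.le]

lemma Y_integral (H : LipPair C x y h px q w) {α b ρ u : ℝ} (hα : 0 < α)
    (h1 : ρ < u) (h2 : u < b) :
    ∫ r in u..b, (r - ρ) ^ (-α - 1) * fracY α b q r = ∫ s in u..b, q s * kerL α ρ u s := by
  have hC := H.nonneg
  have mq := H.mq
  have n0 := Real.rpow_nonneg (by linarith : 0 ≤ u - ρ) (-α - 1)
  have tri : TriInt u b (fun s r => q s * ((r - ρ) ^ (-α - 1) * (s - r) ^ (α - 1))) := by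
    refine TriInt.of_left h2.le
      (D := fun s r => C * (u - ρ) ^ (-α - 1) * (s - r) ^ (α - 1))
      (φ := fun s => C * (u - ρ) ^ (-α - 1) * ((b - u) ^ α / α))
      (by unfold Function.uncurry; fun_prop) (fun s h3 h4 r h5 h6 => ?_)
      (fun s h3 _ => (intervalIntegrable_rpow_right hα h3.le).const_mul _) (fun s h3 h4 => ?_)
      intervalIntegrable_const
    · have n1 := Real.rpow_nonneg (by linarith : 0 ≤ r - ρ) (-α - 1)
      have n2 := Real.rpow_nonneg (by linarith : 0 ≤ s - r) (α - 1)
      have : (r - ρ) ^ (-α - 1) ≤ (u - ρ) ^ (-α - 1) :=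
        Real.rpow_le_rpow_of_nonpos (by linarith) (by linarith) (by linarith)
      rw [abs_mul, abs_mul, abs_of_nonneg n1, abs_of_nonneg n2]
      calc _ ≤ C * ((u - ρ) ^ (-α - 1) * (s - r) ^ (α - 1)) := by
            gcongr
            exact H.bq s
        _ = _ := by ring
    · rw [intervalIntegral.integral_const_mul, integral_rpow_right hα]
      have : (s - u) ^ α ≤ (b - u) ^ α := Real.rpow_le_rpow (by linarith) (by linarith) hα.le
      gcongr
  have sw := tri.swap h2.le
  have e1 : ∀ s, u < s → s < b →
      ∫ r in u..s, q s * ((r - ρ) ^ (-α - 1) * (s - r) ^ (α - 1)) = q s * kerL α ρ u s := by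
    intro s h3 _
    rw [intervalIntegral.integral_const_mul, kerL_eq hα h1 h3]
  rw [integral_congr_Ioo h2.le e1] at sw
  rw [sw]
  refine integral_congr_Ioo h2.le fun r _ _ => ?_
  rw [fracY, ← intervalIntegral.integral_const_mul]
  congr 1
  ext s
  ring

lemma Q_bound (H : LipPair C x y h px q w) {α a b ρ u : ℝ} (hα : 0 < α) (h0 : a ≤ u)
    (h1 : ρ < u) (h2 : u < b) :
    |∫ r in u..b, (r - ρ) ^ (-α - 1) * fracY α b q r| ≤
      C * ((b - a) ^ α / α) * (u - ρ) ^ (-α) / α := by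
  have hC := H.nonneg
  have hba : 0 < b - a := by linarith
  have hi : IntervalIntegrable (fun r => (r - ρ) ^ (-α - 1)) volume u b := by
    refine (ContinuousOn.rpow_const (by fun_prop) fun r hr => Or.inl ?_).intervalIntegrable
    rw [uIcc_of_le h2.le] at hr
    linarith [hr.1]
  have hv : ∫ r in u..b, (r - ρ) ^ (-α - 1) ≤ (u - ρ) ^ (-α) / α := by
    rw [intervalIntegral.integral_comp_sub_right (fun t => t ^ (-α - 1)) ρ, integral_rpow]
    · have := Real.rpow_nonneg (by linarith : 0 ≤ b - ρ) (-α)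
      rw [show -α - 1 + 1 = -α by ring, div_neg, ← neg_div]
      gcongr
      linarith
    · right
      refine ⟨by linarith, fun h => ?_⟩
      rw [uIcc_of_le (by linarith)] at h
      linarith [h.1]
  have := abs_integral_le_of_Ioo (f := fun r => (r - ρ) ^ (-α - 1) * fracY α b q r) h2.le
    (fun r h3 h4 => ?_) (hi.const_mul (C * ((b - a) ^ α / α)))
  · rw [intervalIntegral.integral_const_mul] at this
    refine this.trans ?_
    rw [mul_div_assoc]
    gcongr
  · have := Real.rpow_nonneg (by linarith : 0 ≤ r - ρ) (-α - 1)
    rw [abs_mul, abs_of_nonneg this, mul_comm]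
    gcongr
    exact H.fracY_bound hα (by linarith) h4.le

/-- By `Y_integral` the inner integral pairs q with `kerL`, and fractional integration in ρ turns
`kerL` into G. -/
lemma Q_frac_integral (H : LipPair C x y h px q w) {α b θ u : ℝ} (hα : 1 / 2 < α) (hα1 : α < 1)
    (h1 : θ < u) (h2 : u < b) :
    1 / Real.Gamma (2 * α - 1) * (α / (Real.Gamma (1 - α) * Real.Gamma α)) *
      (∫ ρ in θ..u, (ρ - θ) ^ (2 * α - 2) *
        ∫ r in u..b, (r - ρ) ^ (-α - 1) * fracY α b q r) =
      ∫ s in u..b, kernelG α θ u s * q s := by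
  have hC := H.nonneg
  have hα0 : 0 < α := by linarith
  have mq := H.mq
  have e1 : ∫ ρ in θ..u, (ρ - θ) ^ (2 * α - 2) *
        (∫ r in u..b, (r - ρ) ^ (-α - 1) * fracY α b q r) =
      ∫ ρ in θ..u, ∫ s in u..b, (ρ - θ) ^ (2 * α - 2) * (q s * kerL α ρ u s) := by
    refine integral_congr_Ioo h1.le fun ρ _ h4 => ?_
    rw [H.Y_integral hα0 h4 h2, intervalIntegral.integral_const_mul]
  have hm : Measurable (Function.uncurry fun ρ s =>
      (ρ - θ) ^ (2 * α - 2) * (q s * kerL α ρ u s)) := by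
    unfold Function.uncurry kerL
    fun_prop
  rw [e1, rect_swap h1.le h2.le
    (A := fun ρ => (ρ - θ) ^ (2 * α - 1 - 1) * (u - ρ) ^ (1 - α - 1))
    (B := fun s => C / α * (s - u) ^ (α - 1)) hm ?_
    (intervalIntegrable_beta (by linarith) (by linarith) h1.le)
    ((intervalIntegrable_rpow_left hα0 h2.le).const_mul _),
    ← intervalIntegral.integral_const_mul]
  · refine integral_congr_Ioo h2.le fun s h3 h4 => ?_
    rw [← kernelG_eq_integral hα h1 h3]
    have : ∫ r in θ..u, (r - θ) ^ (2 * α - 2) * (q s * kerL α r u s) =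
        q s * ∫ r in θ..u, (r - θ) ^ (2 * α - 2) * kerL α r u s := by
      rw [← intervalIntegral.integral_const_mul]
      congr 1
      ext r
      ring
    rw [this]
    ring
  · intro ρ s h3 h4 h5 h6
    have hs : 0 < s - u := by linarith
    have hs' : 0 < s - ρ := by linarith
    have n1 := Real.rpow_nonneg (by linarith : 0 ≤ ρ - θ) (2 * α - 2)
    have n2 := Real.rpow_nonneg (by linarith : 0 ≤ u - ρ) (-α)
    have n3 := Real.rpow_nonneg hs.le α
    have i1 : (s - ρ)⁻¹ ≤ (s - u)⁻¹ := inv_anti₀ hs (by linarith)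
    rw [abs_mul, abs_mul, abs_of_nonneg n1, kerL, abs_of_nonneg (by positivity :
      0 ≤ 1 / α * (s - ρ)⁻¹ * ((s - u) ^ α * (u - ρ) ^ (-α))), Real.rpow_sub_one hs.ne',
      show 2 * α - 1 - 1 = 2 * α - 2 by ring, show 1 - α - 1 = -α by ring]
    calc _ ≤ (ρ - θ) ^ (2 * α - 2) *
          (C * (1 / α * (s - u)⁻¹ * ((s - u) ^ α * (u - ρ) ^ (-α)))) := by
          gcongr
          exact H.bq s
      _ = _ := by ring

/-- `lambdaOp` is the fractional integral of order `2α - 1` of `lamN`. -/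
lemma lambdaOp_eq_fracInt (H : LipPair C x y h px q w) {α ε θ b : ℝ} (hγ : 1 / 2 < α - ε)
    (hε : 0 < ε) (hα1 : α < 1) (h1 : θ < b) :
    lambdaOp α ε θ b (lev x y h) = 1 / Real.Gamma (2 * α - 1) *
      ∫ ρ in θ..b, (ρ - θ) ^ (2 * α - 1 - 1) * lamN α b x q w ρ := by
  have hC := H.nonneg
  have hα : 1 / 2 < α := by linarith
  have hα0 : 0 < α := by linarith
  have mq := H.mq
  have mw := H.mw
  have mx := H.mx
  have mpx := H.mpx
  have hbθ : 0 < b - θ := by linarith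
  have mY := measurable_fracY (α := α) (b := b) mq
  have mQ : Measurable fun a : ℝ × ℝ => ∫ r in a.1..b, (r - a.2) ^ (-α - 1) * fracY α b q r :=
    measurable_intervalIntegral (X := ℝ × ℝ)
      (f := fun a r => (r - a.2) ^ (-α - 1) * fracY α b q r)
      (by unfold Function.uncurry; fun_prop) measurable_fst measurable_const
  -- One double integral carries the identity: integrating in ρ first gives the term with G from
  -- `lambdaOp_eq`, integrating in u first gives the fractional integral of the second part of
  -- `lamN`.
  have tri : TriInt θ b (fun u ρ => (ρ - θ) ^ (2 * α - 2) *
      (px u * ∫ r in u..b, (r - ρ) ^ (-α - 1) * fracY α b q r)) := by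
    refine TriInt.of_right h1.le
      (D := fun u ρ => (ρ - θ) ^ (2 * α - 2) * (C * (C * ((b - θ) ^ α / α) / α)) *
        (u - ρ) ^ (1 - α - 1))
      (φ := fun ρ => C * (C * ((b - θ) ^ α / α) / α) * ((b - θ) ^ (1 - α) / (1 - α)) *
        (ρ - θ) ^ (2 * α - 1 - 1))
      (Measurable.mul (by fun_prop) ((mpx.comp measurable_fst).mul mQ))
      (fun ρ h2 h3 u h4 h5 => ?_)
      (fun ρ _ h3 => (intervalIntegrable_rpow_left (by linarith) h3.le).const_mul _)
      (fun ρ h2 h3 => ?_) ((intervalIntegrable_rpow_left (by linarith) h1.le).const_mul _)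
    · have n1 := Real.rpow_nonneg (by linarith : 0 ≤ ρ - θ) (2 * α - 2)
      rw [abs_mul, abs_mul, abs_of_nonneg n1, show 1 - α - 1 = -α by ring, mul_assoc]
      refine mul_le_mul_of_nonneg_left ?_ n1
      calc _ ≤ C * (C * ((b - θ) ^ α / α) * (u - ρ) ^ (-α) / α) := by
            gcongr
            · exact H.bpx u
            · exact H.Q_bound hα0 (by linarith) h4 h5
        _ = _ := by ring
    · have n1 := Real.rpow_nonneg (by linarith : 0 ≤ ρ - θ) (2 * α - 2)
      have h0 : 0 < 1 - α := by linarith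
      have : (b - ρ) ^ (1 - α) ≤ (b - θ) ^ (1 - α) :=
        Real.rpow_le_rpow (by linarith) (by linarith) h0.le
      rw [intervalIntegral.integral_const_mul, integral_rpow_left h0,
        show 2 * α - 1 - 1 = 2 * α - 2 by ring]
      calc _ ≤ (ρ - θ) ^ (2 * α - 2) * (C * (C * ((b - θ) ^ α / α) / α)) *
            ((b - θ) ^ (1 - α) / (1 - α)) := by gcongr
        _ = _ := by ring
  set c := 1 / Real.Gamma (2 * α - 1) with hc
  set c' := α / (Real.Gamma (1 - α) * Real.Gamma α) with hc'
  have sw := tri.swap h1.le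
  have eL : ∀ u, θ < u → u < b → c * c' * (∫ ρ in θ..u, (ρ - θ) ^ (2 * α - 2) *
      (px u * ∫ r in u..b, (r - ρ) ^ (-α - 1) * fracY α b q r)) =
      px u * ∫ s in u..b, kernelG α θ u s * q s := by
    intro u h2 h3
    rw [← H.Q_frac_integral hα hα1 h2 h3]
    have : ∫ ρ in θ..u, (ρ - θ) ^ (2 * α - 2) *
        (px u * ∫ r in u..b, (r - ρ) ^ (-α - 1) * fracY α b q r) =
        px u * ∫ ρ in θ..u, (ρ - θ) ^ (2 * α - 2) *
          ∫ r in u..b, (r - ρ) ^ (-α - 1) * fracY α b q r := by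
      rw [← intervalIntegral.integral_const_mul]
      congr 1
      ext ρ
      ring
    rw [this]
    ring
  have eR : ∀ ρ, θ < ρ → ρ < b → ∫ u in ρ..b, (ρ - θ) ^ (2 * α - 2) *
      (px u * ∫ r in u..b, (r - ρ) ^ (-α - 1) * fracY α b q r) = (ρ - θ) ^ (2 * α - 2) *
        ∫ r in ρ..b, (x r - x ρ) * ((r - ρ) ^ (-α - 1) * fracY α b q r) := by
    intro ρ _ h3
    rw [intervalIntegral.integral_const_mul, H.incr_Y_integral hα0 hα1 h3]
  have iG : IntervalIntegrable (fun u => px u * ∫ s in u..b, kernelG α θ u s * q s)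
      volume θ b :=
    intervalIntegrable_congr_Ioo h1.le (fun u h2 h3 => (eL u h2 h3).symm)
      ((tri.intervalIntegrable_left h1.le).const_mul _)
  have iW : IntervalIntegrable (fun ξ => c * (ξ - θ) ^ (2 * α - 2) * (w ξ - x ξ * q ξ))
      volume θ b := by
    refine intervalIntegrable_of_Ioo h1.le (by fun_prop) (fun r h2 h3 => ?_)
      ((intervalIntegrable_rpow_left (p := 2 * α - 1) (by linarith) h1.le).const_mul
        (|c| * (C + C * C)))
    have n1 := Real.rpow_nonneg (by linarith : 0 ≤ r - θ) (2 * α - 2)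
    rw [abs_mul, abs_mul, abs_of_nonneg n1, show 2 * α - 1 - 1 = 2 * α - 2 by ring]
    calc _ ≤ |c| * (r - θ) ^ (2 * α - 2) * (C + C * C) := by
          gcongr
          exact H.w_sub_bound r r
      _ = _ := by ring
  have iR : IntervalIntegrable (fun ρ => (ρ - θ) ^ (2 * α - 2) *
      ∫ r in ρ..b, (x r - x ρ) * ((r - ρ) ^ (-α - 1) * fracY α b q r)) volume θ b :=
    intervalIntegrable_congr_Ioo h1.le (fun u h2 h3 => (eR u h2 h3).symm)
      (tri.intervalIntegrable_right h1.le)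
  have e3 : ∫ u in θ..b, px u * ∫ s in u..b, kernelG α θ u s * q s = c * c' *
      ∫ ρ in θ..b, (ρ - θ) ^ (2 * α - 2) *
        ∫ r in ρ..b, (x r - x ρ) * ((r - ρ) ^ (-α - 1) * fracY α b q r) := by
    rw [← integral_congr_Ioo h1.le eR, ← sw, ← intervalIntegral.integral_const_mul]
    exact (integral_congr_Ioo h1.le eL).symm
  rw [H.lambdaOp_eq hγ hε hα1 h1, intervalIntegral.integral_add iW iG, e3,
    ← intervalIntegral.integral_const_mul, ← intervalIntegral.integral_const_mul,
    ← intervalIntegral.integral_add iW (iR.const_mul _)]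
  congr 1
  ext ρ
  rw [lamN, show 2 * α - 1 - 1 = 2 * α - 2 by ring]
  ring

end LipPair

end RoughFrac

end

/-! ### The tensor product along Lipschitz paths as a classical integral -/

noncomputable section

namespace RoughFrac

open Filter Topology

/-- The compensated derivative of `(x - x_a)(z_c - z)` in `tripleTensor`. -/
def tripleComp (α : ℝ) (x z : ℝ → ℝ) (c a r : ℝ) : ℝ :=
  1 / Real.Gamma (1 - α) *
    ((x r - x a) * (z c - z r) / (r - a) ^ α +
      α * ∫ θ in a..r, (z r - z θ) * (x θ - x r) / (r - θ) ^ (α + 1))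

/-- `tripleTensor` with general second-order parts. -/
def tripleAux (α ε : ℝ) (x y z : ℝ → ℝ) (ψ₁ ψ₂ : ℝ → ℝ → ℝ) (c a b : ℝ) : ℝ :=
  -(∫ r in a..b, tripleComp α x z c a r * weylRight (1 - α) b (fun s => y s - y b) r) +
    (∫ r in a..b, weylLeft (2 * α - 1) a (fun s => z c - z s) r * lambdaOp α ε r b ψ₁) -
    ∫ r in a..b, weylLeft (2 * α - 1) a (fun s => x s - x a) r * lambdaOp α ε r b ψ₂

lemma tripleTensor_eq (α ε : ℝ) (x y z : ℝ → ℝ) (V U : ℝ → ℝ → ℝ) (c a b : ℝ) :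
    tripleTensor α ε x y z V U c a b = tripleAux α ε x y z V (flipTensor y z U) c a b := rfl

/-- The inner integral after exchanging the order of integration. -/
def incrInt (α : ℝ) (g x : ℝ → ℝ) (a r : ℝ) : ℝ :=
  ∫ ρ in a..r, g ρ * ((x r - x ρ) * (r - ρ) ^ (-α - 1))

lemma intervalIntegrable_mul_bdd {a b K : ℝ} (hab : a ≤ b) {f g : ℝ → ℝ} (hf : Measurable f)
    (hfi : IntervalIntegrable f volume a b) (hg : Measurable g)
    (hb : ∀ r, a < r → r < b → |g r| ≤ K) :
    IntervalIntegrable (fun r => f r * g r) volume a b := by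
  refine intervalIntegrable_of_Ioo hab (hf.mul hg) (fun r h1 h2 => ?_) (hfi.abs.mul_const K)
  rw [abs_mul]
  exact mul_le_mul_of_nonneg_left (hb r h1 h2) (abs_nonneg _)

namespace LipPair

variable {C : ℝ} {x y h px q w : ℝ → ℝ}

lemma incr_integrand_bound (H : LipPair C x y h px q w) {α G ρ r : ℝ} {g : ℝ → ℝ}
    (hg : ∀ s, |g s| ≤ G) (h1 : ρ < r) :
    |g ρ * ((x r - x ρ) * (r - ρ) ^ (-α - 1))| ≤ G * C * (r - ρ) ^ (1 - α - 1) := by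
  have hr : 0 < r - ρ := by linarith
  have n1 := Real.rpow_nonneg hr.le (-α - 1)
  have hG : 0 ≤ G := (abs_nonneg _).trans (hg ρ)
  rw [abs_mul, abs_mul, abs_of_nonneg n1, show 1 - α - 1 = (-α - 1) + 1 by ring,
    Real.rpow_add_one hr.ne']
  calc _ ≤ G * (C * (r - ρ) * (r - ρ) ^ (-α - 1)) := by
        gcongr
        · exact hg ρ
        · exact H.abs_x_sub h1.le
    _ = _ := by ring

lemma incr_integrand_int (H : LipPair C x y h px q w) {α G a r : ℝ} {g : ℝ → ℝ}
    (hg : ∀ s, |g s| ≤ G) (hgm : Measurable g) (hα1 : α < 1) (h1 : a ≤ r) :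
    IntervalIntegrable (fun ρ => g ρ * ((x r - x ρ) * (r - ρ) ^ (-α - 1))) volume a r := by
  have mx := H.mx
  exact intervalIntegrable_of_Ioo h1 (by fun_prop)
    (fun ρ _ h3 => H.incr_integrand_bound hg h3)
    ((intervalIntegrable_rpow_right (by linarith) h1).const_mul _)

/-- Exchange of the order of integration for the compensating terms. -/
lemma incr_swap (H : LipPair C x y h px q w) {α G a b : ℝ} {g : ℝ → ℝ}
    (hg : ∀ s, |g s| ≤ G) (hgm : Measurable g) (hα : 0 < α) (hα1 : α < 1) (h1 : a ≤ b) :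
    IntervalIntegrable (fun r => incrInt α g x a r * fracY α b q r) volume a b ∧
    IntervalIntegrable (fun ρ => g ρ *
      ∫ r in ρ..b, (x r - x ρ) * ((r - ρ) ^ (-α - 1) * fracY α b q r)) volume a b ∧
    ∫ ρ in a..b, g ρ * (∫ r in ρ..b, (x r - x ρ) * ((r - ρ) ^ (-α - 1) * fracY α b q r)) =
      ∫ r in a..b, incrInt α g x a r * fracY α b q r := by
  have hC := H.nonneg
  have mx := H.mx
  have mY := measurable_fracY (α := α) (b := b) H.mq
  have hG : 0 ≤ G := (abs_nonneg _).trans (hg 0)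
  have tri : TriInt a b (fun r ρ =>
      g ρ * ((x r - x ρ) * ((r - ρ) ^ (-α - 1) * fracY α b q r))) := by
    refine TriInt.of_left h1
      (D := fun r ρ => G * (C * (C * ((b - a) ^ α / α))) * (r - ρ) ^ (1 - α - 1))
      (φ := fun r => G * (C * (C * ((b - a) ^ α / α))) * ((b - a) ^ (1 - α) / (1 - α)))
      (by unfold Function.uncurry; fun_prop) (fun r h2 h3 ρ h4 h5 => ?_)
      (fun r h2 _ => (intervalIntegrable_rpow_right (by linarith) h2.le).const_mul _)
      (fun r h2 h3 => ?_) intervalIntegrable_const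
    · rw [abs_mul, mul_assoc]
      exact mul_le_mul (hg ρ) (H.incr_Y_bound hα h4.le h5 h3) (abs_nonneg _) hG
    · have h0 : 0 < 1 - α := by linarith
      have hba : 0 < b - a := by linarith
      rw [intervalIntegral.integral_const_mul, integral_rpow_right h0]
      have : (r - a) ^ (1 - α) ≤ (b - a) ^ (1 - α) :=
        Real.rpow_le_rpow (by linarith) (by linarith) h0.le
      gcongr
  have e1 : ∀ r, ∫ ρ in a..r, g ρ * ((x r - x ρ) * ((r - ρ) ^ (-α - 1) * fracY α b q r)) =
      incrInt α g x a r * fracY α b q r := by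
    intro r
    rw [incrInt, ← intervalIntegral.integral_mul_const]
    congr 1
    ext ρ
    ring
  have i1 := tri.intervalIntegrable_left h1
  have i2 := tri.intervalIntegrable_right h1
  have sw := tri.swap h1
  simp only [e1, intervalIntegral.integral_const_mul] at i1 i2 sw
  exact ⟨i1, i2, sw.symm⟩

lemma weylRight_y (H : LipPair C x y h px q w) {α r b : ℝ} (hα : 0 < α) (hα1 : α < 1)
    (h1 : r < b) :
    weylRight (1 - α) b (fun s => y s - y b) r = -(1 / Real.Gamma α * fracY α b q r) := by
  have mq := H.mq
  rw [weylRight_of_primitive (q := 1) (C := C) (j := fun s => -q s) hα hα1 one_pos h1 mq.neg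
    (fun u _ _ => by simpa using H.bq u) (fun s _ h3 => ?_), fracY]
  · simp only [mul_neg, intervalIntegral.integral_neg]
  · rw [intervalIntegral.integral_neg, ← H.ey s b h3]
    ring

/-- Λ is I^{2α-1} of `lamN`, so it is dual to D^{2α-1} g and the pairing is ∫ g · `lamN`. The
nonlocal part of `lamN` is kept in the form `incrInt`, to be cancelled by the compensation in
`tripleComp`. -/
lemma weyl_lambda_integral (H : LipPair C x y h px q w) {α ε a b G L : ℝ} {g : ℝ → ℝ}
    (hg : ∀ s, |g s| ≤ G) (hgm : Measurable g) (hL : 0 ≤ L)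
    (hgl : ∀ s r, s ≤ r → |g r - g s| ≤ L * (r - s))
    (hγ : 1 / 2 < α - ε) (hε : 0 < ε) (hα1 : α < 1) (h1 : a ≤ b) :
    ∫ r in a..b, weylLeft (2 * α - 1) a g r * lambdaOp α ε r b (lev x y h) =
      (∫ ρ in a..b, g ρ * (w ρ - x ρ * q ρ)) + α / (Real.Gamma (1 - α) * Real.Gamma α) *
        ∫ r in a..b, incrInt α g x a r * fracY α b q r := by
  have hα0 : 0 < α := by linarith
  have mq := H.mq
  have mw := H.mw
  have mx := H.mx
  obtain ⟨-, i2, e2⟩ := H.incr_swap hg hgm hα0 hα1 h1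
  have hC := H.nonneg
  set K := C + C * C + α / (Real.Gamma (1 - α) * Real.Gamma α) *
      (C * (C * ((b - a) ^ α / α)) * ((b - a) ^ (1 - α) / (1 - α))) with hK
  -- Integration by parts is stated for a density bounded on the whole line, while `lamN` is bounded
  -- on (a, b) only.
  set m : ℝ → ℝ := (Ioo a b).indicator (lamN α b x q w) with hm
  have mm : Measurable m := (measurable_lamN mx mq mw).indicator measurableSet_Ioo
  have hK0 : 0 ≤ K := by
    have hΓ := Real.Gamma_pos_of_pos hα0
    have hΓ' := Real.Gamma_pos_of_pos (sub_pos.2 hα1)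
    have : 0 ≤ b - a := by linarith
    have : 0 < 1 - α := by linarith
    positivity
  have hmb : ∀ s, |m s| ≤ K := by
    intro s
    by_cases hs : s ∈ Ioo a b
    · rw [hm, indicator_of_mem hs]
      exact H.lamN_bound hα0 hα1 hs.1.le hs.2
    · rw [hm, indicator_of_notMem hs, abs_zero]
      exact hK0
  have ibp := integral_by_parts_holder (γ := 2 * α - 1) (p := 1) (a := a) (b := b) (g := g)
    (C₀ := G) (C₁ := L) (by linarith) (by linarith) (by linarith) h1 hgm hL (fun r _ _ => hg r)
    (fun s r _ h3 _ => by simpa using hgl s r h3.le) mm hmb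
  have e3 : ∀ r, a < r → r < b → weylLeft (2 * α - 1) a g r * lambdaOp α ε r b (lev x y h) =
      weylLeft (2 * α - 1) a g r * (1 / Real.Gamma (2 * α - 1) *
        ∫ s in r..b, (s - r) ^ (2 * α - 1 - 1) * m s) := by
    intro r h2 h3
    rw [H.lambdaOp_eq_fracInt hγ hε hα1 h3]
    congr 2
    refine integral_congr_Ioo h3.le fun s h4 h5 => ?_
    rw [hm, indicator_of_mem (show s ∈ Ioo a b from ⟨h2.trans h4, h5⟩)]
  have e4 : ∀ s, a < s → s < b → g s * m s = g s * (w s - x s * q s) +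
      α / (Real.Gamma (1 - α) * Real.Gamma α) * (g s *
        ∫ r in s..b, (x r - x s) * ((r - s) ^ (-α - 1) * fracY α b q r)) := by
    intro s h2 h3
    rw [hm, indicator_of_mem (show s ∈ Ioo a b from ⟨h2, h3⟩), lamN]
    ring
  have i1 : IntervalIntegrable (fun ρ => g ρ * (w ρ - x ρ * q ρ)) volume a b :=
    intervalIntegrable_mul_bdd h1 hgm (intervalIntegrable_of_bdd hgm hg h1) (by fun_prop)
      fun r _ _ => H.w_sub_bound r r
  rw [integral_congr_Ioo h1 e3, ibp, integral_congr_Ioo h1 e4,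
    intervalIntegral.integral_add i1 (i2.const_mul _), intervalIntegral.integral_const_mul, e2]

end LipPair

section

variable {C : ℝ} {x y z h k px pz q w v : ℝ → ℝ}

/-- The compensated derivative of the product uw with u = x - x_a, w = z_c - z is its plain
derivative minus the first-order increments, one for each factor. -/
lemma tripleComp_eq (H : LipPair C x y h px q w) (K : LipPair C z y k pz q v) {α a c r : ℝ}
    (hα1 : α < 1) (h1 : a < r) :
    tripleComp α x z c a r =
      weylLeft α a (fun s => (x s - x a) * (z c - z s)) r - α / Real.Gamma (1 - α) *
        (incrInt α (fun s => z c - z s) x a r - incrInt α (fun s => x s - x a) z a r) := by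
  have mx := H.mx
  have mz := K.mx
  have hC := H.nonneg
  have i1 := H.incr_integrand_int (α := α) (G := C + C) (g := fun s => z c - z s)
    (fun s => (abs_sub _ _).trans (add_le_add (K.bx c) (K.bx s))) (by fun_prop) hα1 h1.le
  have i2 := K.incr_integrand_int (α := α) (G := C + C) (g := fun s => x s - x a)
    (fun s => (abs_sub _ _).trans (add_le_add (H.bx s) (H.bx a))) (by fun_prop) hα1 h1.le
  have i3 := H.incr_integrand_int (α := α) (G := C + C) (g := fun s => z r - z s)
    (fun s => (abs_sub _ _).trans (add_le_add (K.bx r) (K.bx s))) (by fun_prop) hα1 h1.le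
  -- The increment of the product equals the two first-order increments plus the product of the
  -- increments; the last term is the one that `tripleComp` retains.
  have e1 : ∫ s in a..r, ((x r - x a) * (z c - z r) - (x s - x a) * (z c - z s)) /
      (r - s) ^ (α + 1) = incrInt α (fun s => z c - z s) x a r -
        incrInt α (fun s => x s - x a) z a r - incrInt α (fun s => z r - z s) x a r := by
    unfold incrInt
    rw [← intervalIntegral.integral_sub i1 i2, ← intervalIntegral.integral_sub (i1.sub i2) i3]
    refine integral_congr_Ioo h1.le fun s _ h3 => ?_
    rw [div_rpow_eq_mul_rpow_neg (by linarith), show -(α + 1) = -α - 1 by ring]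
    ring
  have e2 : ∫ s in a..r, (z r - z s) * (x s - x r) / (r - s) ^ (α + 1) =
      -incrInt α (fun s => z r - z s) x a r := by
    unfold incrInt
    rw [← intervalIntegral.integral_neg]
    refine integral_congr_Ioo h1.le fun s _ h3 => ?_
    rw [div_rpow_eq_mul_rpow_neg (by linarith), show -(α + 1) = -α - 1 by ring]
    ring
  rw [tripleComp, weylLeft, e1, e2]
  ring

/-- `tripleAux` along Lipschitz paths is a classical integral. -/
lemma tripleAux_eq (H : LipPair C x y h px q w) (K : LipPair C z y k pz q v) {α ε a b c : ℝ}
    (hγ : 1 / 2 < α - ε) (hε : 0 < ε) (hα1 : α < 1) (h1 : a ≤ b) :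
    tripleAux α ε x y z (lev x y h) (lev z y k) c a b =
      ∫ r in a..b, ((x r - x a) * (z c - z r) * q r + (z c - z r) * (w r - x r * q r) -
        (x r - x a) * (v r - z r * q r)) := by
  have hα0 : 0 < α := by linarith
  have mx := H.mx
  have mz := K.mx
  have mq := H.mq
  have mw := H.mw
  have mv := K.mw
  have hC := H.nonneg
  have mY := measurable_fracY (α := α) (b := b) mq
  have hΓ := (Real.Gamma_pos_of_pos hα0).ne'
  have hΓ' := (Real.Gamma_pos_of_pos (sub_pos.2 hα1)).ne'
  have bz : ∀ s, |z c - z s| ≤ C + C := fun s =>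
    (abs_sub _ _).trans (add_le_add (K.bx c) (K.bx s))
  have bx : ∀ s, |x s - x a| ≤ C + C := fun s =>
    (abs_sub _ _).trans (add_le_add (H.bx s) (H.bx a))
  have lz : ∀ s r, s ≤ r → |z c - z r - (z c - z s)| ≤ C * (r - s) := fun s r hsr => by
    rw [show z c - z r - (z c - z s) = -(z r - z s) by ring, abs_neg]
    exact K.abs_x_sub hsr
  have lx : ∀ s r, s ≤ r → |x r - x a - (x s - x a)| ≤ C * (r - s) := fun s r hsr => by
    rw [sub_sub_sub_cancel_right]
    exact H.abs_x_sub hsr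
  have bP : ∀ s, |(x s - x a) * (z c - z s)| ≤ (C + C) * (C + C) := fun s => by
    rw [abs_mul]
    exact mul_le_mul (bx s) (bz s) (abs_nonneg _) (by linarith)
  have lP : ∀ s r, s ≤ r → |(x r - x a) * (z c - z r) - (x s - x a) * (z c - z s)| ≤
      (2 * (C + C) * C) * (r - s) := fun s r hsr => by
    rw [show (x r - x a) * (z c - z r) - (x s - x a) * (z c - z s) =
      (x r - x a) * (z c - z r - (z c - z s)) + (x r - x a - (x s - x a)) * (z c - z s) by ring]
    refine (abs_add_le _ _).trans ?_
    rw [abs_mul, abs_mul]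
    have t1 := mul_le_mul (bx r) (lz s r hsr) (abs_nonneg _) (by linarith)
    have t2 := mul_le_mul (lx s r hsr) (bz s) (abs_nonneg _)
      (mul_nonneg hC (by linarith))
    linarith
  have mP : Measurable fun s => (x s - x a) * (z c - z s) := by fun_prop
  have T2 := H.weyl_lambda_integral bz (by fun_prop) hC lz hγ hε hα1 h1
  have T3 := K.weyl_lambda_integral bx (by fun_prop) hC lx hγ hε hα1 h1
  obtain ⟨j1, -, -⟩ := H.incr_swap bz (by fun_prop) hα0 hα1 h1
  obtain ⟨j2, -, -⟩ := K.incr_swap bx (by fun_prop) hα0 hα1 h1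
  have ibp := integral_by_parts_holder (γ := α) (p := 1) (a := a) (b := b) (m := q)
    (C₁ := 2 * (C + C) * C) hα0 hα1 hα1 h1 mP (by positivity) (fun r _ _ => bP r) (fun s r _ h3 _ => by simpa using lP s r h3.le) mq H.bq
  have ibp' : ∫ r in a..b, weylLeft α a (fun s => (x s - x a) * (z c - z s)) r *
      (1 / Real.Gamma α * fracY α b q r) = ∫ r in a..b, (x r - x a) * (z c - z r) * q r := ibp
  have jP : IntervalIntegrable (fun r => weylLeft α a (fun s => (x s - x a) * (z c - z s)) r *
      (1 / Real.Gamma α * fracY α b q r)) volume a b := by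
    have fc := FracClass.of_holder (γ := α) (p := 1) (a := a) (b := b) hα1 h1 mP
      (C₁ := 2 * (C + C) * C) (by positivity)
      (fun r _ _ => bP r) (fun s r _ h3 _ => by simpa using lP s r h3.le) one_pos
    refine intervalIntegrable_mul_bdd (K := |1 / Real.Gamma α| * (C * ((b - a) ^ α / α))) h1
      fc.measurable_weyl (fc.weyl_int hα0 hα1 hα1 one_pos h1) (by fun_prop) fun r h2 h3 => ?_
    rw [abs_mul]
    exact mul_le_mul_of_nonneg_left (H.fracY_bound hα0 h2.le h3.le) (abs_nonneg _)
  have T1 : ∫ r in a..b, tripleComp α x z c a r * weylRight (1 - α) b (fun s => y s - y b) r =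
      -((∫ r in a..b, (x r - x a) * (z c - z r) * q r) -
        α / (Real.Gamma (1 - α) * Real.Gamma α) *
        ((∫ r in a..b, incrInt α (fun s => z c - z s) x a r * fracY α b q r) -
          ∫ r in a..b, incrInt α (fun s => x s - x a) z a r * fracY α b q r)) := by
    rw [← ibp', ← intervalIntegral.integral_sub j1 j2, ← intervalIntegral.integral_const_mul,
      ← intervalIntegral.integral_sub jP ((j1.sub j2).const_mul _),
      ← intervalIntegral.integral_neg]
    refine integral_congr_Ioo h1 fun r h2 h3 => ?_
    rw [tripleComp_eq H K hα1 h2, H.weylRight_y hα0 hα1 h3]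
    field_simp
  have k1 : IntervalIntegrable (fun r => (x r - x a) * (z c - z r) * q r) volume a b :=
    intervalIntegrable_mul_bdd h1 mP (intervalIntegrable_of_bdd mP bP h1) mq fun r _ _ => H.bq r
  have k2 : IntervalIntegrable (fun r => (z c - z r) * (w r - x r * q r)) volume a b :=
    intervalIntegrable_mul_bdd h1 (by fun_prop) (intervalIntegrable_of_bdd (by fun_prop) bz h1)
      (by fun_prop) fun r _ _ => H.w_sub_bound r r
  have k3 : IntervalIntegrable (fun r => (x r - x a) * (v r - z r * q r)) volume a b :=
    intervalIntegrable_mul_bdd h1 (by fun_prop) (intervalIntegrable_of_bdd (by fun_prop) bx h1)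
      (by fun_prop) fun r _ _ => K.w_sub_bound r r
  -- The `incrInt` terms removed by the compensation in T1 are exactly those added by T2 and T3.
  rw [tripleAux, T1, T2, T3, intervalIntegral.integral_sub (k1.add k2) k3,
    intervalIntegral.integral_add k1 k2]
  ring

/-- The defect of additivity of `tripleAux` along Lipschitz paths. -/
lemma tripleAux_add_lip (H : LipPair C x y h px q w) (K : LipPair C z y k pz q v)
    {α ε c s t u : ℝ} (hγ : 1 / 2 < α - ε) (hε : 0 < ε) (hα1 : α < 1) (h1 : s ≤ t) (h2 : t ≤ u) :
    tripleAux α ε x y z (lev x y h) (lev z y k) c s u =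
      tripleAux α ε x y z (lev x y h) (lev z y k) c s t +
      tripleAux α ε x y z (lev x y h) (lev z y k) c t u +
      (x t - x s) * ((z c - z t) * (y u - y t) - lev z y k t u) := by
  have mx := H.mx
  have mz := K.mx
  have mq := H.mq
  have mw := H.mw
  have mv := K.mw
  have hC := H.nonneg
  have hi : ∀ a b e : ℝ, a ≤ b → IntervalIntegrable (fun r => (x r - x e) * (z c - z r) * q r +
      (z c - z r) * (w r - x r * q r) - (x r - x e) * (v r - z r * q r)) volume a b := by
    intro a b e hab
    have bz : ∀ s, |z c - z s| ≤ C + C := fun s =>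
      (abs_sub _ _).trans (add_le_add (K.bx c) (K.bx s))
    have bx : ∀ s, |x s - x e| ≤ C + C := fun s =>
      (abs_sub _ _).trans (add_le_add (H.bx s) (H.bx e))
    have bP : ∀ s, |(x s - x e) * (z c - z s)| ≤ (C + C) * (C + C) := fun s => by
      rw [abs_mul]
      exact mul_le_mul (bx s) (bz s) (abs_nonneg _) (by linarith)
    refine ((intervalIntegrable_mul_bdd hab (by fun_prop)
      (intervalIntegrable_of_bdd (by fun_prop) bP hab) mq fun r _ _ => H.bq r).add
      (intervalIntegrable_mul_bdd hab (by fun_prop) (intervalIntegrable_of_bdd (by fun_prop) bz hab)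
      (by fun_prop) fun r _ _ => H.w_sub_bound r r)).sub
      (intervalIntegrable_mul_bdd hab (by fun_prop) (intervalIntegrable_of_bdd (by fun_prop) bx hab)
      (by fun_prop) fun r _ _ => K.w_sub_bound r r)
  have iq := intervalIntegrable_of_bdd mq H.bq h2
  have iv := intervalIntegrable_of_bdd mv K.bw h2
  have e1 : lev z y k t u = (∫ r in t..u, v r) - z t * ∫ r in t..u, q r := by
    rw [lev, K.eh t u h2, H.ey t u h2]
  -- On [t, u] the base point of x changes from s to t. The integrand is affine in x - x_e, and the
  -- coefficient z_c q - v integrates to increments of y and of the primitive of the second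
  -- functional.
  have e2 : (∫ r in t..u, ((x r - x s) * (z c - z r) * q r +
      (z c - z r) * (w r - x r * q r) - (x r - x s) * (v r - z r * q r))) -
      (∫ r in t..u, ((x r - x t) * (z c - z r) * q r +
      (z c - z r) * (w r - x r * q r) - (x r - x t) * (v r - z r * q r))) =
      (x t - x s) * (z c * (∫ r in t..u, q r) - ∫ r in t..u, v r) := by
    rw [← intervalIntegral.integral_sub (hi t u s h2) (hi t u t h2),
      ← intervalIntegral.integral_const_mul, ← intervalIntegral.integral_sub (iq.const_mul _) iv,
      ← intervalIntegral.integral_const_mul]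
    congr 1
    ext r
    ring
  rw [tripleAux_eq H K hγ hε hα1 (h1.trans h2), tripleAux_eq H K hγ hε hα1 h1,
    tripleAux_eq H K hγ hε hα1 h2,
    ← intervalIntegral.integral_add_adjacent_intervals (hi s t s h1) (hi t u s h2), e1,
    H.ey t u h2]
  linear_combination e2

end

end RoughFrac

end

noncomputable section

namespace RoughFrac

open Filter Topology

/-! ### Bounds for `tripleAux` -/

/-- The weight G (r-a)^{-β} serves a function that need not vanish at a. -/
lemma weylLeft_bound_const {γ β G L a r : ℝ} {g : ℝ → ℝ} (hγ : 0 < γ) (hγ1 : γ < 1) (hβ : γ < β)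
    (har : a < r) (hL : L * (r - a) ^ β ≤ G) (hA : |g r| ≤ G)
    (he : ∀ s, a < s → s < r → |g r - g s| ≤ L * (r - s) ^ β) :
    |weylLeft γ a g r| ≤ weylC γ β 1 * G * (r - a) ^ (1 - γ - 1) := by
  have hr : 0 < r - a := by linarith
  have e : (r - a) ^ (-β) * (r - a) ^ β = 1 := by rw [← Real.rpow_add hr]; simp
  have n2 := Real.rpow_nonneg hr.le (-β)
  have := weylLeft_bound_holder (Ψ := G * (r - a) ^ (-β)) (g := g) hγ hγ1 hβ har
    (by rw [mul_assoc, e, mul_one]; exact hA) fun s h1 h2 => ?_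
  · refine this.trans (le_of_eq ?_)
    rw [show 1 - γ - 1 = -β + (β - γ) by ring, Real.rpow_add hr]
    ring
  · refine (he s h1 h2).trans ?_
    have := Real.rpow_nonneg (by linarith : 0 ≤ r - s) β
    gcongr
    calc L = L * (r - a) ^ β * (r - a) ^ (-β) := by
          rw [mul_assoc, mul_comm _ ((r - a) ^ (-β)), e, mul_one]
      _ ≤ _ := by gcongr

namespace RoughPair

variable {β X Y Z M L : ℝ} {x y z h k : ℝ → ℝ}

lemma le_of_le (H : RoughPair β X Y M x y h) (hβ : 0 < β) {s t e : ℝ} (h1 : s ≤ t)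
    (h2 : t - s ≤ e) : |x t - x s| ≤ X * e ^ β := by
  have := Real.rpow_le_rpow (by linarith) h2 hβ.le
  exact (H.holx s t h1).trans (mul_le_mul_of_nonneg_left this H.nonneg_x)

lemma weylRight_bound (H : RoughPair β X Y M x y h) {α b r : ℝ} (hα : 1 - β < α) (hα1 : α < 1)
    (hβ : β < 1 / 2) (h1 : r < b) :
    |weylRight (1 - α) b (fun s => y s - y b) r| ≤
      weylC (1 - α) β 1 * Y * (b - r) ^ (β + α - 1) := by
  have := weylRight_bound_holder (γ := 1 - α) (p := β) (Ψ := Y) (g := fun s => y s - y b)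
    (by linarith) (by linarith) (by linarith) h1
    (by rw [abs_sub_comm]; exact H.holp r b h1.le) fun s h2 _ => by
      rw [sub_sub_sub_cancel_right, abs_sub_comm]
      exact H.holp r s h2.le
  rwa [show β - (1 - α) = β + α - 1 by ring] at this

lemma comp_integrand_bound (H : RoughPair β X Y M x y h) (K : RoughPair β Z Y L z y k)
    {s r : ℝ} (h1 : s ≤ r) : |(z r - z s) * (x s - x r)| ≤ X * Z * (r - s) ^ (2 * β) := by
  have hX := H.nonneg_x
  have hZ := K.nonneg_x
  rcases eq_or_lt_of_le h1 with h2 | h2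
  · subst h2
    simp only [sub_self, zero_mul, abs_zero]
    positivity
  have n := Real.rpow_nonneg (by linarith : 0 ≤ r - s) β
  rw [abs_mul, abs_sub_comm (x s), two_mul, Real.rpow_add (by linarith)]
  have := mul_le_mul (K.holx s r h1) (H.holx s r h1) (abs_nonneg _) (by positivity)
  linarith

/-- Compensation leaves increments of order 2β > α, so the derivative of order α converges although
β < α is possible. The factor z_c - z_r is only of size (c-a)^β, whence the extra power. -/
lemma tripleComp_bound (H : RoughPair β X Y M x y h) (K : RoughPair β Z Y L z y k)
    {α a c r : ℝ} (hα : 0 < α) (hα1 : α < 1) (hα2 : α < 2 * β) (h1 : a < r) (h2 : r ≤ c) :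
    |tripleComp α x z c a r| ≤
      weylC α (2 * β) 1 * (X * Z * (c - a) ^ β) * (r - a) ^ (β - α + 1 - 1) := by
  have hX := H.nonneg_x
  have hZ := K.nonneg_x
  have hβ : 0 < β := by linarith
  have hr : 0 < r - a := by linarith
  have e : (r - a) ^ (-β) * (r - a) ^ β = 1 := by rw [← Real.rpow_add hr]; simp
  have n1 := Real.rpow_nonneg hr.le β
  have n2 := Real.rpow_nonneg hr.le (-β)
  have hle : (r - a) ^ β ≤ (c - a) ^ β := Real.rpow_le_rpow hr.le (by linarith) hβ.le
  have n3 := n1.trans hle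
  have := fracLeft_bound (p := 2 * β) (q := 1) (a := a) (r := r)
    (A := (x r - x a) * (z c - z r)) (Ψ := X * Z * (c - a) ^ β * (r - a) ^ (-β))
    (e := fun s => (z r - z s) * (x s - x r)) hα hα1 hα2 one_pos h1 ?_ fun s h3 h4 => ?_
  · refine this.trans (le_of_eq ?_)
    rw [show β - α + 1 - 1 = -β + (2 * β - α + 1 - 1) by ring, Real.rpow_add hr]
    ring
  · have b2 := K.le_of_le hβ h2 (by linarith : c - r ≤ c - a)
    have b1 := H.holx a r h1.le
    rw [abs_mul, show 2 * β + 1 - 1 = β + β by ring, Real.rpow_add hr]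
    calc _ ≤ X * (r - a) ^ β * (Z * (c - a) ^ β) :=
          mul_le_mul b1 b2 (abs_nonneg _) (by positivity)
      _ = X * Z * (c - a) ^ β * (r - a) ^ β * 1 := by ring
      _ = _ := by rw [← e]; ring
  · refine (comp_integrand_bound H K h4.le).trans ?_
    have n4 := Real.rpow_nonneg (by linarith : 0 ≤ r - s) (2 * β)
    rw [sub_self, Real.rpow_zero, mul_one]
    refine mul_le_mul_of_nonneg_right ?_ n4
    calc X * Z = X * Z * ((r - a) ^ (-β) * (r - a) ^ β) := by rw [e, mul_one]
      _ ≤ X * Z * ((r - a) ^ (-β) * (c - a) ^ β) := by gcongr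
      _ = _ := by ring

lemma weylLeft_z_bound (K : RoughPair β Z Y L z y k) {α a c r : ℝ} (hα : 1 / 2 < α)
    (hα1 : α < 1) (hα4 : 2 * α - 1 < β) (h1 : a < r) (h2 : r ≤ c) :
    |weylLeft (2 * α - 1) a (fun s => z c - z s) r| ≤
      weylC (2 * α - 1) β 1 * (Z * (c - a) ^ β) * (r - a) ^ (1 - (2 * α - 1) - 1) := by
  have hZ := K.nonneg_x
  refine weylLeft_bound_const (L := Z) (by linarith) (by linarith) hα4 h1 ?_
    (K.le_of_le (by linarith) h2 (by linarith)) fun s _ h4 => ?_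
  · exact mul_le_mul_of_nonneg_left
      (Real.rpow_le_rpow (by linarith) (by linarith) (by linarith)) hZ
  · rw [show z c - z r - (z c - z s) = -(z r - z s) by ring, abs_neg]
    exact K.holx s r h4.le

lemma weylLeft_x_bound (H : RoughPair β X Y M x y h) {α a c r : ℝ} (hα : 1 / 2 < α)
    (hα1 : α < 1) (hα4 : 2 * α - 1 < β) (h1 : a < r) (h2 : r ≤ c) :
    |weylLeft (2 * α - 1) a (fun s => x s - x a) r| ≤
      weylC (2 * α - 1) β 1 * (X * (c - a) ^ β) * (r - a) ^ (1 - (2 * α - 1) - 1) := by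
  have hX := H.nonneg_x
  refine weylLeft_bound_const (L := X) (by linarith) (by linarith) hα4 h1 ?_
    (H.le_of_le (by linarith) h1.le (by linarith)) fun s _ h4 => ?_
  · exact mul_le_mul_of_nonneg_left
      (Real.rpow_le_rpow (by linarith) (by linarith) (by linarith)) hX
  · rw [sub_sub_sub_cancel_right]
    exact H.holx s r h4.le

end RoughPair

/-- The constant in the bound for `tripleAux`. -/
def triC (α ε β : ℝ) : ℝ :=
  weylC α (2 * β) 1 * weylC (1 - α) β 1 * betaR (β - α + 1) (β + α) +
    weylC (2 * α - 1) β 1 * lamC α ε β * betaR (1 - (2 * α - 1)) (2 * β + 2 * α - 1)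

/-- The restrictions on the exponents. -/
structure Exps (α ε β : ℝ) : Prop where
  hγ : 1 - β < α - ε
  hε : 0 < ε
  hα1 : α < 1
  hβ : β < 1 / 2
  hα2 : α < 2 * β
  hα4 : 2 * α - 1 < β

namespace Exps

variable {α ε β : ℝ}

lemma hα (E : Exps α ε β) : 1 / 2 < α := by linarith [E.hγ, E.hε, E.hβ]
lemma hα0 (E : Exps α ε β) : 0 < α := by linarith [E.hα]
lemma hβ0 (E : Exps α ε β) : 0 < β := by linarith [E.hα2, E.hα]
lemma hαβ (E : Exps α ε β) : 1 - β < α := by linarith [E.hγ, E.hε]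

lemma triC_pos (E : Exps α ε β) : 0 < triC α ε β := by
  obtain ⟨hγ, hε, hα1, hβ, hα2, hα4⟩ := id E
  have hα := E.hα
  have h1 := weylC_pos (γ := α) (p := 2 * β) (q := 1) E.hα0 hα1 hα2 one_pos
  have h2 := weylC_pos (γ := 1 - α) (p := β) (q := 1) (by linarith) (by linarith)
    (by linarith) one_pos
  have h3 := weylC_pos (γ := 2 * α - 1) (p := β) (q := 1) (by linarith) (by linarith) hα4 one_pos
  have h4 := lamC_pos hγ hα1 hε hβ
  have h5 := betaR_pos (p := β - α + 1) (q := β + α) (by linarith) (by linarith)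
  have h6 := betaR_pos (p := 1 - (2 * α - 1)) (q := 2 * β + 2 * α - 1) (by linarith) (by linarith)
  unfold triC
  positivity

end Exps

section

variable {α ε β X Y Z M L : ℝ} {x y z h k : ℝ → ℝ}

lemma tripleAux_first_bound (E : Exps α ε β) (H : RoughPair β X Y M x y h)
    (K : RoughPair β Z Y L z y k) {a b c : ℝ} (h2 : b ≤ c) (r : ℝ) (h3 : a < r) (h4 : r < b) :
    |tripleComp α x z c a r * weylRight (1 - α) b (fun s => y s - y b) r| ≤
      weylC α (2 * β) 1 * weylC (1 - α) β 1 * (X * Z * Y * (c - a) ^ β) *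
        ((r - a) ^ (β - α + 1 - 1) * (b - r) ^ (β + α - 1)) := by
  have b1 := RoughPair.tripleComp_bound H K E.hα0 E.hα1 E.hα2 h3 (h4.le.trans h2)
  have b2 := H.weylRight_bound E.hαβ E.hα1 E.hβ h4
  rw [abs_mul]
  refine (mul_le_mul b1 b2 (abs_nonneg _) ((abs_nonneg _).trans b1)).trans (le_of_eq ?_)
  ring

lemma weyl_lambda_bound (E : Exps α ε β) (H : RoughPair β X Y M x y h) {a b A G : ℝ}
    (r : ℝ) (h4 : r < b) (hA : |A| ≤ weylC (2 * α - 1) β 1 * G * (r - a) ^ (1 - (2 * α - 1) - 1)) :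
    |A * lambdaOp α ε r b (lev x y h)| ≤
      weylC (2 * α - 1) β 1 * lamC α ε β * (G * (M + X * Y)) *
        ((r - a) ^ (1 - (2 * α - 1) - 1) * (b - r) ^ (2 * β + 2 * α - 1 - 1)) := by
  have b2 := H.lambda_bound E.hγ E.hα1 E.hε E.hβ h4
  rw [abs_mul]
  refine (mul_le_mul hA b2 (abs_nonneg _) ((abs_nonneg _).trans hA)).trans (le_of_eq ?_)
  rw [show 2 * β + 2 * α - 2 = 2 * β + 2 * α - 1 - 1 by ring]
  ring

/-- Each of the three integrals is a beta integral of total power 2β in b - a; the factor (c-a)^β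
comes from the increments of x or z over [a, c]. -/
lemma tripleAux_bound (E : Exps α ε β) (H : RoughPair β X Y M x y h)
    (K : RoughPair β Z Y L z y k) {a b c : ℝ} (h1 : a < b) (h2 : b ≤ c) :
    |tripleAux α ε x y z (lev x y h) (lev z y k) c a b| ≤
      triC α ε β * ((c - a) ^ β * (X * Z * Y + Z * (M + X * Y) + X * (L + Z * Y))) *
        (b - a) ^ (2 * β) := by
  obtain ⟨hγ, hε, hα1, hβ, hα2, hα4⟩ := id E
  have hα := E.hα
  have hX := H.nonneg_x
  have hZ := K.nonneg_x
  have hY := H.nonneg_p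
  have hM := H.nonneg_m
  have hL := K.nonneg_m
  have w1 := weylC_pos (γ := α) (p := 2 * β) (q := 1) E.hα0 hα1 hα2 one_pos
  have w2 := weylC_pos (γ := 1 - α) (p := β) (q := 1) (by linarith) (by linarith)
    (by linarith) one_pos
  have w3 := weylC_pos (γ := 2 * α - 1) (p := β) (q := 1) (by linarith) (by linarith) hα4 one_pos
  have w4 := lamC_pos hγ hα1 hε hβ
  have w5 := betaR_pos (p := β - α + 1) (q := β + α) (by linarith) (by linarith)
  have w6 := betaR_pos (p := 1 - (2 * α - 1)) (q := 2 * β + 2 * α - 1) (by linarith) (by linarith)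
  have hba : 0 < b - a := by linarith
  have n1 := Real.rpow_nonneg (by linarith : 0 ≤ c - a) β
  have n2 := Real.rpow_nonneg hba.le (2 * β)
  have i1 := intervalIntegrable_beta (p := β - α + 1) (q := β + α) (by linarith) (by linarith) h1.le
  have i2 := intervalIntegrable_beta (p := 1 - (2 * α - 1)) (q := 2 * β + 2 * α - 1) (by linarith)
    (by linarith) h1.le
  have t1 := abs_integral_le_of_Ioo h1.le (tripleAux_first_bound E H K h2) (i1.const_mul _)
  have t2 := abs_integral_le_of_Ioo h1.le (fun r h3 h4 => weyl_lambda_bound E H r h4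
    (K.weylLeft_z_bound hα hα1 hα4 h3 (h4.le.trans h2))) (i2.const_mul _)
  have t3 := abs_integral_le_of_Ioo h1.le (fun r h3 h4 => weyl_lambda_bound E K r h4
    (H.weylLeft_x_bound hα hα1 hα4 h3 (h4.le.trans h2))) (i2.const_mul _)
  rw [intervalIntegral.integral_const_mul, integral_beta _ _ h1,
    show β - α + 1 + (β + α) - 1 = 2 * β by ring] at t1
  rw [intervalIntegral.integral_const_mul, integral_beta _ _ h1,
    show 1 - (2 * α - 1) + (2 * β + 2 * α - 1) - 1 = 2 * β by ring] at t2 t3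
  have hc1 : weylC α (2 * β) 1 * weylC (1 - α) β 1 * betaR (β - α + 1) (β + α) ≤ triC α ε β := by
    rw [triC]
    have : 0 ≤ weylC (2 * α - 1) β 1 * lamC α ε β *
      betaR (1 - (2 * α - 1)) (2 * β + 2 * α - 1) := by positivity
    linarith
  have hc2 : weylC (2 * α - 1) β 1 * lamC α ε β *
      betaR (1 - (2 * α - 1)) (2 * β + 2 * α - 1) ≤ triC α ε β := by
    rw [triC]
    have : 0 ≤ weylC α (2 * β) 1 * weylC (1 - α) β 1 * betaR (β - α + 1) (β + α) := by positivity
    linarith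
  have hp1 : 0 ≤ X * Z * Y * (c - a) ^ β * (b - a) ^ (2 * β) := by positivity
  have hp2 : 0 ≤ Z * (c - a) ^ β * (M + X * Y) * (b - a) ^ (2 * β) := by positivity
  have hp3 : 0 ≤ X * (c - a) ^ β * (L + Z * Y) * (b - a) ^ (2 * β) := by positivity
  have u1 := mul_le_mul_of_nonneg_right hc1 hp1
  have u2 := mul_le_mul_of_nonneg_right hc2 hp2
  have u3 := mul_le_mul_of_nonneg_right hc2 hp3
  rw [tripleAux]
  refine (abs_sub _ _).trans ((add_le_add ((abs_add_le _ _).trans (add_le_add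
    (le_of_eq (abs_neg _)) le_rfl)) le_rfl).trans ?_)
  linarith

end

/-! ### Passing to the limit in `tripleAux` -/

lemma tendsto_weylLeft {gn : ℕ → ℝ → ℝ} {g : ℝ → ℝ} {γ p G a r : ℝ} (hp : γ < p) (har : a < r)
    (hm : ∀ n, Measurable (gn n)) (hl : ∀ s, Tendsto (fun n => gn n s) atTop (𝓝 (g s)))
    (he : ∀ n s, a < s → s < r → |gn n r - gn n s| ≤ G * (r - s) ^ p) :
    Tendsto (fun n => weylLeft γ a (gn n) r) atTop (𝓝 (weylLeft γ a g r)) := by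
  refine Tendsto.const_mul _ (((hl r).div_const _).add (Tendsto.const_mul _ ?_))
  refine tendsto_integral_Ioo har.le (fun n => ?_) (Eventually.of_forall fun n s h2 h3 => ?_)
    ((intervalIntegrable_rpow_right (q := p - γ) (by linarith) har.le).const_mul G)
    (fun s _ _ => ((hl r).sub (hl s)).div_const _)
  · have := hm n
    fun_prop
  · have h : 0 < r - s := by linarith
    rw [abs_div, abs_of_pos (Real.rpow_pos_of_pos h _), div_le_iff₀ (Real.rpow_pos_of_pos h _),
      mul_assoc, ← Real.rpow_add h, show p - γ - 1 + (γ + 1) = p by ring]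
    exact he n s h2 h3

lemma tendsto_weylRight {gn : ℕ → ℝ → ℝ} {g : ℝ → ℝ} {γ p G b r : ℝ} (hp : γ < p) (hrb : r < b)
    (hm : ∀ n, Measurable (gn n)) (hl : ∀ s, Tendsto (fun n => gn n s) atTop (𝓝 (g s)))
    (he : ∀ n s, r < s → s < b → |gn n r - gn n s| ≤ G * (s - r) ^ p) :
    Tendsto (fun n => weylRight γ b (gn n) r) atTop (𝓝 (weylRight γ b g r)) := by
  refine Tendsto.const_mul _ (((hl r).div_const _).add (Tendsto.const_mul _ ?_))
  refine tendsto_integral_Ioo hrb.le (fun n => ?_) (Eventually.of_forall fun n s h2 h3 => ?_)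
    ((intervalIntegrable_rpow_left (p := p - γ) (by linarith) hrb.le).const_mul G)
    (fun s _ _ => ((hl r).sub (hl s)).div_const _)
  · have := hm n
    fun_prop
  · have h : 0 < s - r := by linarith
    rw [abs_div, abs_of_pos (Real.rpow_pos_of_pos h _), div_le_iff₀ (Real.rpow_pos_of_pos h _),
      mul_assoc, ← Real.rpow_add h, show p - γ - 1 + (γ + 1) = p by ring]
    exact he n s h2 h3

lemma measurable_tripleComp {α c a : ℝ} {x z : ℝ → ℝ} (hx : Measurable x) (hz : Measurable z) :
    Measurable (tripleComp α x z c a) := by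
  have : Measurable fun r => ∫ θ in a..r, (z r - z θ) * (x θ - x r) / (r - θ) ^ (α + 1) :=
    measurable_intervalIntegral
      (f := fun r θ => (z r - z θ) * (x θ - x r) / (r - θ) ^ (α + 1))
      (by unfold Function.uncurry; fun_prop) measurable_const measurable_id
  unfold tripleComp
  fun_prop

lemma measurable_weylLeft_path {γ a : ℝ} {g : ℝ → ℝ} (hg : Measurable g) :
    Measurable (weylLeft γ a g) :=
  measurable_weylLeft (X := ℝ) (g := fun _ => g) (hg.comp measurable_snd) measurable_const
    measurable_id

lemma measurable_weylRight_path {γ b : ℝ} {g : ℝ → ℝ} (hg : Measurable g) :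
    Measurable (weylRight γ b g) :=
  measurable_weylRight (X := ℝ) (g := fun _ => g) (hg.comp measurable_snd) measurable_const
    measurable_id

section

variable {α ε β X Y Z M L : ℝ} {x y z h k : ℝ → ℝ} {xn yn zn hn kn : ℕ → ℝ → ℝ}

lemma tendsto_tripleComp (E : Exps α ε β) (H : ∀ n, RoughPair β X Y M (xn n) (yn n) (hn n))
    (K : ∀ n, RoughPair β Z Y L (zn n) (yn n) (kn n))
    (hx : ∀ t, Tendsto (fun n => xn n t) atTop (𝓝 (x t)))
    (hz : ∀ t, Tendsto (fun n => zn n t) atTop (𝓝 (z t))) {a c r : ℝ} (h1 : a < r) :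
    Tendsto (fun n => tripleComp α (xn n) (zn n) c a r) atTop (𝓝 (tripleComp α x z c a r)) := by
  refine Tendsto.const_mul _
    (((((hx r).sub (hx a)).mul ((hz c).sub (hz r))).div_const _).add (Tendsto.const_mul _ ?_))
  refine tendsto_integral_Ioo h1.le (fun n => ?_) (Eventually.of_forall fun n s h2 h3 => ?_)
    ((intervalIntegrable_rpow_right (q := 2 * β - α) (by linarith [E.hα2]) h1.le).const_mul (X * Z))
    (fun s _ _ => (((hz r).sub (hz s)).mul ((hx s).sub (hx r))).div_const _)
  · have := (H n).contx.measurable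
    have := (K n).contx.measurable
    fun_prop
  · have h : 0 < r - s := by linarith
    rw [abs_div, abs_of_pos (Real.rpow_pos_of_pos h _), div_le_iff₀ (Real.rpow_pos_of_pos h _),
      mul_assoc, ← Real.rpow_add h, show 2 * β - α - 1 + (α + 1) = 2 * β by ring]
    exact RoughPair.comp_integrand_bound (H n) (K n) h3.le

/-- The majorants behind `tripleAux_bound` involve only the Hölder constants, which are common to
the sequence, so dominated convergence applies to each integral. -/
lemma tendsto_tripleAux (E : Exps α ε β) (H : ∀ n, RoughPair β X Y M (xn n) (yn n) (hn n))
    (K : ∀ n, RoughPair β Z Y L (zn n) (yn n) (kn n))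
    (hx : ∀ t, Tendsto (fun n => xn n t) atTop (𝓝 (x t)))
    (hy : ∀ t, Tendsto (fun n => yn n t) atTop (𝓝 (y t)))
    (hz : ∀ t, Tendsto (fun n => zn n t) atTop (𝓝 (z t)))
    (hh : ∀ t, Tendsto (fun n => hn n t) atTop (𝓝 (h t)))
    (hk : ∀ t, Tendsto (fun n => kn n t) atTop (𝓝 (k t))) {a b c : ℝ} (h1 : a ≤ b) (h2 : b ≤ c) :
    Tendsto (fun n => tripleAux α ε (xn n) (yn n) (zn n) (lev (xn n) (yn n) (hn n))
      (lev (zn n) (yn n) (kn n)) c a b) atTop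
      (𝓝 (tripleAux α ε x y z (lev x y h) (lev z y k) c a b)) := by
  obtain ⟨hγ, hε, hα1, hβ, hα2, hα4⟩ := id E
  have hα := E.hα
  have i1 := intervalIntegrable_beta (p := β - α + 1) (q := β + α) (by linarith) (by linarith) h1
  have i2 := intervalIntegrable_beta (p := 1 - (2 * α - 1)) (q := 2 * β + 2 * α - 1) (by linarith)
    (by linarith) h1
  have mx := fun n => (H n).contx.measurable
  have my := fun n => (H n).contp.measurable
  have mz := fun n => (K n).contx.measurable
  refine ((Tendsto.neg ?_).add ?_).sub ?_
  · refine tendsto_integral_Ioo h1 (fun n => ?_) (Eventually.of_forall fun n =>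
      tripleAux_first_bound E (H n) (K n) h2) (i1.const_mul _) fun r h3 h4 => ?_
    · exact (measurable_tripleComp (mx n) (mz n)).mul
        (measurable_weylRight_path ((my n).sub_const _))
    · refine (tendsto_tripleComp E H K hx hz h3).mul (tendsto_weylRight (p := β) (G := Y)
        (by linarith) h4 (fun n => (my n).sub_const _) (fun s => (hy s).sub (hy b))
        fun n s h5 _ => ?_)
      rw [sub_sub_sub_cancel_right, abs_sub_comm]
      exact (H n).holp r s h5.le
  · refine tendsto_integral_Ioo h1 (fun n => ?_) (Eventually.of_forall fun n r h3 h4 =>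
      weyl_lambda_bound E (H n) r h4 ((K n).weylLeft_z_bound hα hα1 hα4 h3 (h4.le.trans h2)))
      (i2.const_mul _) fun r h3 h4 => ?_
    · exact (measurable_weylLeft_path ((mz n).const_sub _)).mul
        (measurable_lambdaOp_comp α ε (H n).meas_lev measurable_id measurable_const)
    · refine (tendsto_weylLeft (p := β) (G := Z) hα4 h3 (fun n => (mz n).const_sub _)
        (fun s => (hz c).sub (hz s)) fun n s _ h5 => ?_).mul
        (tendsto_lambdaOp H hx hy hh hγ hα1 hε hβ h4)
      rw [show zn n c - zn n r - (zn n c - zn n s) = -(zn n r - zn n s) by ring, abs_neg]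
      exact (K n).holx s r h5.le
  · refine tendsto_integral_Ioo h1 (fun n => ?_) (Eventually.of_forall fun n r h3 h4 =>
      weyl_lambda_bound E (K n) r h4 ((H n).weylLeft_x_bound hα hα1 hα4 h3 (h4.le.trans h2)))
      (i2.const_mul _) fun r h3 h4 => ?_
    · exact (measurable_weylLeft_path ((mx n).sub_const _)).mul
        (measurable_lambdaOp_comp α ε (K n).meas_lev measurable_id measurable_const)
    · refine (tendsto_weylLeft (p := β) (G := X) hα4 h3 (fun n => (mx n).sub_const _)
        (fun s => (hx s).sub (hx a)) fun n s _ h5 => ?_).mul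
        (tendsto_lambdaOp K hz hy hk hγ hα1 hε hβ h4)
      rw [sub_sub_sub_cancel_right]
      exact (H n).holx s r h5.le

end

end RoughFrac

end

/-! ### Smoothing by averages, and additivity in the limit -/

noncomputable section

namespace RoughFrac

open Filter Topology

/-- The average of `x` over `[t, t + δ]`. -/
def steklov (δ : ℝ) (x : ℝ → ℝ) (t : ℝ) : ℝ := δ⁻¹ * ∫ r in t..t + δ, x r

section

variable {δ : ℝ} {x : ℝ → ℝ}

lemma steklov_eq (δ : ℝ) (x : ℝ → ℝ) (t : ℝ) :
    steklov δ x t = δ⁻¹ * ∫ τ in (0 : ℝ)..δ, x (t + τ) := by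
  rw [steklov, intervalIntegral.integral_comp_add_left (fun r => x r) t, add_zero]

lemma continuous_steklov (hx : Continuous x) : Continuous (steklov δ x) := by
  have : steklov δ x = fun t => δ⁻¹ * ∫ τ in (0 : ℝ)..δ, x (t + τ) := funext (steklov_eq δ x)
  rw [this]
  refine continuous_const.mul (intervalIntegral.continuous_parametric_intervalIntegral_of_continuous'
    (f := fun t τ => x (t + τ)) ?_ 0 δ)
  unfold Function.uncurry
  fun_prop

lemma steklov_sub (hx : Continuous x) (s t : ℝ) :
    steklov δ x t - steklov δ x s = ∫ u in s..t, δ⁻¹ * (x (u + δ) - x u) := by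
  have hi : ∀ a b, IntervalIntegrable x volume a b := fun a b => hx.intervalIntegrable a b
  rw [intervalIntegral.integral_const_mul, intervalIntegral.integral_sub
    ((by fun_prop : Continuous fun u => x (u + δ)).intervalIntegrable _ _) (hi _ _),
    intervalIntegral.integral_comp_add_right (fun r => x r) δ, steklov, steklov, ← mul_sub,
    intervalIntegral.integral_interval_sub_interval_comm' (hi _ _) (hi _ _) (hi _ _)]

/-- An average is bounded by a bound of the integrand. -/
lemma abs_average_le (hδ : 0 < δ) {f : ℝ → ℝ} {K : ℝ} (h : ∀ τ, 0 < τ → τ < δ → |f τ| ≤ K) :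
    |δ⁻¹ * ∫ τ in (0 : ℝ)..δ, f τ| ≤ K := by
  have := abs_integral_le_of_Ioo hδ.le h intervalIntegrable_const
  rw [intervalIntegral.integral_const, sub_zero, smul_eq_mul] at this
  rw [abs_mul, abs_of_pos (inv_pos.2 hδ)]
  calc _ ≤ δ⁻¹ * (δ * K) := by gcongr
    _ = K := by field_simp

lemma average_const (hδ : 0 < δ) (K : ℝ) : δ⁻¹ * ∫ _τ in (0 : ℝ)..δ, K = K := by
  rw [intervalIntegral.integral_const, sub_zero, smul_eq_mul]
  field_simp

lemma tendsto_steklov (hx : Continuous x) (t : ℝ) :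
    Tendsto (fun n : ℕ => steklov (1 / ((n : ℝ) + 1)) x t) atTop (𝓝 (x t)) := by
  have h := tendsto_average_right (a := t) hx.measurable hx.continuousWithinAt
  refine h.comp (tendsto_nhdsWithin_iff.2 ⟨tendsto_one_div_add_atTop_nhds_zero_nat,
    Eventually.of_forall fun n => ?_⟩)
  simp only [mem_Ioi]
  positivity

end

lemma LipPair.mono {C C' : ℝ} {x y h px q w : ℝ → ℝ} (H : LipPair C x y h px q w) (hC : C ≤ C') :
    LipPair C' x y h px q w :=
  { H with
    bx := fun t => (H.bx t).trans hC
    bpx := fun t => (H.bpx t).trans hC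
    bq := fun t => (H.bq t).trans hC
    bw := fun t => (H.bw t).trans hC }

namespace RoughPair

variable {β X P M B δ : ℝ} {x p h : ℝ → ℝ}

lemma steklov_close (H : RoughPair β X P M x p h) (hβ : 0 < β) (hδ : 0 < δ) {s τ : ℝ}
    (h1 : 0 ≤ τ) (h2 : τ ≤ δ) : |x (s + τ) - steklov δ x s| ≤ X * δ ^ β := by
  have hx := H.contx
  rw [steklov_eq, ← average_const hδ (x (s + τ)), ← mul_sub, ← intervalIntegral.integral_sub
    intervalIntegrable_const ((by fun_prop : Continuous fun τ => x (s + τ)).intervalIntegrable _ _)]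
  refine abs_average_le hδ fun σ h3 h4 => ?_
  rcases le_total σ τ with h5 | h5
  · exact H.le_of_le hβ (by linarith) (by linarith)
  · rw [abs_sub_comm]
    exact H.le_of_le hβ (by linarith) (by linarith)

lemma steklov_holder {Y : ℝ} (hx : Continuous x) (hX : ∀ s t, s ≤ t → |x t - x s| ≤ Y * (t - s) ^ β)
    (hδ : 0 < δ) {s t : ℝ} (h1 : s ≤ t) :
    |steklov δ x t - steklov δ x s| ≤ Y * (t - s) ^ β := by
  rw [steklov_eq, steklov_eq, ← mul_sub, ← intervalIntegral.integral_sub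
    ((by fun_prop : Continuous fun τ => x (t + τ)).intervalIntegrable _ _)
    ((by fun_prop : Continuous fun τ => x (s + τ)).intervalIntegrable _ _)]
  refine abs_average_le hδ fun σ _ _ => ?_
  have := hX (s + σ) (t + σ) (by linarith)
  rwa [add_sub_add_right_eq_sub] at this

/-- Averaging commutes with h and p but not with the product x_s(p_t - p_s). The error is the
average of (x_{s+τ} minus the average of x) times an increment of p, at most X δ^β P (t-s)^β, and δ
≤ t - s. -/
lemma lev_steklov_long (H : RoughPair β X P M x p h) (hβ : 0 < β) (hδ : 0 < δ) {s t : ℝ}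
    (h1 : s ≤ t) (h2 : δ ≤ t - s) :
    |lev (steklov δ x) (steklov δ p) (steklov δ h) s t| ≤ (M + X * P) * (t - s) ^ (2 * β) := by
  have hx := H.contx
  have hp := H.contp
  have hh := H.conth
  have hX := H.nonneg_x
  have hP := H.nonneg_p
  have hM := H.nonneg_m
  have e : lev (steklov δ x) (steklov δ p) (steklov δ h) s t =
      δ⁻¹ * ∫ τ in (0 : ℝ)..δ, (lev x p h (s + τ) (t + τ) +
        (x (s + τ) - steklov δ x s) * (p (t + τ) - p (s + τ))) := by
    have e1 : ∀ τ, lev x p h (s + τ) (t + τ) +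
        (x (s + τ) - steklov δ x s) * (p (t + τ) - p (s + τ)) =
        h (t + τ) - h (s + τ) - steklov δ x s * (p (t + τ) - p (s + τ)) := by
      intro τ
      unfold lev
      ring
    simp only [e1]
    have i : ∀ g : ℝ → ℝ, Continuous g → IntervalIntegrable g volume 0 δ :=
      fun g hg => hg.intervalIntegrable _ _
    rw [intervalIntegral.integral_sub (i _ (by fun_prop)) (i _ (by fun_prop)),
      intervalIntegral.integral_sub (i _ (by fun_prop)) (i _ (by fun_prop)),
      intervalIntegral.integral_const_mul,
      intervalIntegral.integral_sub (i _ (by fun_prop)) (i _ (by fun_prop)), lev,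
      steklov_eq δ h, steklov_eq δ h, steklov_eq δ p, steklov_eq δ p]
    ring
  rw [e]
  refine abs_average_le hδ fun τ h3 h4 => ?_
  have a1 := H.hollev (s + τ) (t + τ) (by linarith)
  have a2 := H.holp (s + τ) (t + τ) (by linarith)
  rw [add_sub_add_right_eq_sub] at a1 a2
  have a3 := H.steklov_close hβ hδ (s := s) h3.le h4.le
  have n := Real.rpow_nonneg (by linarith : 0 ≤ t - s) β
  have nd := Real.rpow_nonneg hδ.le β
  have a4 : δ ^ β ≤ (t - s) ^ β := Real.rpow_le_rpow hδ.le h2 hβ.le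
  refine (abs_add_le _ _).trans ?_
  rw [abs_mul]
  calc _ ≤ M * (t - s) ^ (2 * β) + X * (t - s) ^ β * (P * (t - s) ^ β) := by
        gcongr
        exact a3.trans (by gcongr)
    _ = (M + X * P) * (t - s) ^ (2 * β) := by
        rw [two_mul, Real.rpow_add_of_nonneg (by linarith) hβ.le hβ.le]
        ring

/-- On scales below δ the smoothed functional has a density of size δ^{2β-1}. Since 2β < 1 and t - s
< δ, this is at most (t-s)^{2β-1}, and integrating gives the order 2β. -/
lemma lev_steklov_short (H : RoughPair β X P M x p h) (hβ : 0 < β) (hβ1 : β < 1 / 2) (hδ : 0 < δ)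
    {s t : ℝ} (h1 : s < t) (h2 : t - s < δ) :
    |lev (steklov δ x) (steklov δ p) (steklov δ h) s t| ≤ (M + X * P) * (t - s) ^ (2 * β) := by
  have hx := H.contx
  have hp := H.contp
  have hh := H.conth
  have hX := H.nonneg_x
  have hP := H.nonneg_p
  have hM := H.nonneg_m
  have hts : 0 < t - s := by linarith
  have e : lev (steklov δ x) (steklov δ p) (steklov δ h) s t =
      ∫ u in s..t, δ⁻¹ * (lev x p h u (u + δ) +
        (x u - steklov δ x s) * (p (u + δ) - p u)) := by
    have e1 : ∀ u, δ⁻¹ * (lev x p h u (u + δ) + (x u - steklov δ x s) * (p (u + δ) - p u)) =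
        δ⁻¹ * (h (u + δ) - h u) - steklov δ x s * (δ⁻¹ * (p (u + δ) - p u)) := by
      intro u
      unfold lev
      ring
    simp only [e1]
    rw [intervalIntegral.integral_sub
      ((by fun_prop : Continuous fun u => δ⁻¹ * (h (u + δ) - h u)).intervalIntegrable _ _)
      ((by fun_prop : Continuous fun u => steklov δ x s *
        (δ⁻¹ * (p (u + δ) - p u))).intervalIntegrable _ _),
      ← steklov_sub hh, intervalIntegral.integral_const_mul, ← steklov_sub hp, lev]
  rw [e]
  have nd := Real.rpow_nonneg hδ.le β
  refine (abs_integral_le_of_Ioo (g := fun _ => (M + X * P) * δ ^ (2 * β - 1)) h1.le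
    (fun u h3 h4 => ?_) intervalIntegrable_const).trans ?_
  · have a1 := H.hollev u (u + δ) (by linarith)
    have a2 := H.holp u (u + δ) (by linarith)
    rw [add_sub_cancel_left] at a1 a2
    have a3 := H.steklov_close hβ hδ (s := s) (τ := u - s) (by linarith) (by linarith)
    rw [add_sub_cancel] at a3
    rw [abs_mul, abs_of_pos (inv_pos.2 hδ), Real.rpow_sub_one hδ.ne']
    calc _ ≤ δ⁻¹ * (M * δ ^ (2 * β) + X * δ ^ β * (P * δ ^ β)) := by
          gcongr
          refine (abs_add_le _ _).trans (add_le_add a1 ?_)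
          rw [abs_mul]
          gcongr
      _ = δ⁻¹ * ((M + X * P) * δ ^ (2 * β)) := by
          rw [two_mul, Real.rpow_add hδ]
          ring
      _ = _ := by ring
  · rw [intervalIntegral.integral_const, smul_eq_mul]
    have a4 : δ ^ (2 * β - 1) ≤ (t - s) ^ (2 * β - 1) :=
      Real.rpow_le_rpow_of_nonpos hts h2.le (by linarith)
    calc _ ≤ (t - s) * ((M + X * P) * (t - s) ^ (2 * β - 1)) := by gcongr
      _ = _ := by rw [Real.rpow_sub_one hts.ne']; field_simp

/-- Smoothing keeps the Hölder constants and only enlarges M to M + X P, uniformly in δ. -/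
lemma steklov (H : RoughPair β X P M x p h) (hβ : 0 < β) (hβ1 : β < 1 / 2) (hδ : 0 < δ) :
    RoughPair β X P (M + X * P) (steklov δ x) (steklov δ p) (steklov δ h) where
  contx := continuous_steklov H.contx
  contp := continuous_steklov H.contp
  conth := continuous_steklov H.conth
  holx _ _ h1 := steklov_holder H.contx H.holx hδ h1
  holp _ _ h1 := steklov_holder H.contp H.holp hδ h1
  hollev s t h1 := by
    rcases le_or_gt δ (t - s) with h2 | h2
    · exact H.lev_steklov_long hβ hδ h1 h2
    · rcases eq_or_lt_of_le h1 with h3 | h3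
      · subst h3
        have : 0 < 2 * β := by linarith
        simp [lev, Real.zero_rpow this.ne']
      · exact H.lev_steklov_short hβ hβ1 hδ h3 h2

/-- The constant C degenerates as δ → 0, which is harmless: it does not enter the identity for which
Lipschitz paths are used. -/
lemma exists_lipPair (H : RoughPair β X P M x p h) (hB : ∀ t, |x t| ≤ B) (hδ : 0 < δ) :
    ∃ C, LipPair C (RoughFrac.steklov δ x) (RoughFrac.steklov δ p) (RoughFrac.steklov δ h)
      (fun u => δ⁻¹ * (x (u + δ) - x u)) (fun u => δ⁻¹ * (p (u + δ) - p u))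
      (fun u => δ⁻¹ * (h (u + δ) - h u)) := by
  have hx := H.contx
  have hp := H.contp
  have hh := H.conth
  have hX := H.nonneg_x
  have hP := H.nonneg_p
  have hM := H.nonneg_m
  have hB0 : 0 ≤ B := (abs_nonneg _).trans (hB 0)
  have n1 := Real.rpow_nonneg hδ.le β
  have n2 := Real.rpow_nonneg hδ.le (2 * β)
  have hi : 0 < δ⁻¹ := inv_pos.2 hδ
  set C := B + δ⁻¹ * (X * δ ^ β) + δ⁻¹ * (P * δ ^ β) + δ⁻¹ * (M * δ ^ (2 * β) + B * (P * δ ^ β))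
    with hC
  have c1 : 0 ≤ δ⁻¹ * (X * δ ^ β) := by positivity
  have c2 : 0 ≤ δ⁻¹ * (P * δ ^ β) := by positivity
  have c3 : 0 ≤ δ⁻¹ * (M * δ ^ (2 * β) + B * (P * δ ^ β)) := by positivity
  refine ⟨C, continuous_steklov hx, continuous_steklov hp, continuous_steklov hh,
    by fun_prop, by fun_prop, by fun_prop, fun t => ?_, fun t => ?_, fun t => ?_, fun t => ?_,
    fun s t _ => steklov_sub hx s t, fun s t _ => steklov_sub hp s t,
    fun s t _ => steklov_sub hh s t⟩
  · rw [steklov_eq]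
    exact (abs_average_le hδ fun τ _ _ => hB (t + τ)).trans (by linarith)
  · have := H.holx t (t + δ) (by linarith)
    rw [add_sub_cancel_left] at this
    rw [abs_mul, abs_of_pos hi]
    have := mul_le_mul_of_nonneg_left this hi.le
    linarith
  · have := H.holp t (t + δ) (by linarith)
    rw [add_sub_cancel_left] at this
    rw [abs_mul, abs_of_pos hi]
    have := mul_le_mul_of_nonneg_left this hi.le
    linarith
  · have a1 := H.hollev t (t + δ) (by linarith)
    have a2 := H.holp t (t + δ) (by linarith)
    rw [add_sub_cancel_left] at a1 a2
    have a3 : |h (t + δ) - h t| ≤ M * δ ^ (2 * β) + B * (P * δ ^ β) := by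
      rw [show h (t + δ) - h t = lev x p h t (t + δ) + x t * (p (t + δ) - p t) by unfold lev; ring]
      refine (abs_add_le _ _).trans (add_le_add a1 ?_)
      rw [abs_mul]
      exact mul_le_mul (hB t) a2 (abs_nonneg _) hB0
    rw [abs_mul, abs_of_pos hi]
    have := mul_le_mul_of_nonneg_left a3 hi.le
    linarith

end RoughPair

/-- The defect of additivity of `tripleAux`. -/
lemma tripleAux_add {α ε β X Y Z M L B : ℝ} {x y z h k : ℝ → ℝ} (E : Exps α ε β)
    (H : RoughPair β X Y M x y h) (K : RoughPair β Z Y L z y k) (hBx : ∀ t, |x t| ≤ B)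
    (hBz : ∀ t, |z t| ≤ B) {c s t u : ℝ} (h1 : s ≤ t) (h2 : t ≤ u) (h3 : u ≤ c) :
    tripleAux α ε x y z (lev x y h) (lev z y k) c s u =
      tripleAux α ε x y z (lev x y h) (lev z y k) c s t +
      tripleAux α ε x y z (lev x y h) (lev z y k) c t u +
      (x t - x s) * ((z c - z t) * (y u - y t) - lev z y k t u) := by
  set d : ℕ → ℝ := fun n => 1 / ((n : ℝ) + 1) with hd
  have hd0 : ∀ n, 0 < d n := fun n => by rw [hd]; positivity
  have Hn := fun n => H.steklov E.hβ0 E.hβ (hd0 n)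
  have Kn := fun n => K.steklov E.hβ0 E.hβ (hd0 n)
  have lx := tendsto_steklov H.contx
  have ly := tendsto_steklov H.contp
  have lz := tendsto_steklov K.contx
  have lh := tendsto_steklov H.conth
  have lk := tendsto_steklov K.conth
  have T : ∀ {a b : ℝ}, a ≤ b → b ≤ c → _ := fun {a b} hab hbc =>
    tendsto_tripleAux E Hn Kn lx ly lz lh lk (a := a) (b := b) (c := c) hab hbc
  have R := ((T h1 (h2.trans h3)).add (T h2 h3)).add (((lx t).sub (lx s)).mul
    ((((lz c).sub (lz t)).mul ((ly u).sub (ly t))).sub (tendsto_lev lz ly lk t u)))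
  -- Both sides converge, and the identity holds for each smoothed pair. A common Lipschitz constant
  -- for the two functionals is the maximum of the two.
  refine tendsto_nhds_unique (T (h1.trans h2) h3) (R.congr fun n => ?_)
  obtain ⟨C₁, L₁⟩ := H.exists_lipPair hBx (hd0 n)
  obtain ⟨C₂, L₂⟩ := K.exists_lipPair hBz (hd0 n)
  exact (tripleAux_add_lip (L₁.mono (le_max_left C₁ C₂)) (L₂.mono (le_max_right C₁ C₂))
    (by linarith [E.hγ, E.hβ]) E.hε E.hα1 h1 h2).symm

end RoughFrac

end

/-! ### Functionals over an interval and their extension to the line -/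

noncomputable section

namespace RoughFrac

open Filter Topology

/-- Real-valued paths with a second-order part over `[a, b]`, with explicit bounds. -/
structure RoughOn (β a b X P M : ℝ) (x p : ℝ → ℝ) (ψ : ℝ → ℝ → ℝ) : Prop where
  nonneg_x : 0 ≤ X
  nonneg_p : 0 ≤ P
  nonneg_m : 0 ≤ M
  holx : ∀ s t, a ≤ s → s ≤ t → t ≤ b → |x t - x s| ≤ X * (t - s) ^ β
  holp : ∀ s t, a ≤ s → s ≤ t → t ≤ b → |p t - p s| ≤ P * (t - s) ^ β
  holm : ∀ s t, a ≤ s → s ≤ t → t ≤ b → |ψ s t| ≤ M * (t - s) ^ (2 * β)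
  mult : ∀ s u t, a ≤ s → s ≤ u → u ≤ t → t ≤ b →
    ψ s u + ψ u t + (x u - x s) * (p t - p u) = ψ s t

/-- The projection onto `[a, b]`. -/
def clamp (a b t : ℝ) : ℝ := max a (min t b)

section

variable {a b s t : ℝ}

lemma clamp_eq (h1 : a ≤ t) (h2 : t ≤ b) : clamp a b t = t := by
  rw [clamp, min_eq_left h2, max_eq_right h1]

lemma le_clamp : a ≤ clamp a b t := le_max_left _ _

lemma clamp_le (hab : a ≤ b) : clamp a b t ≤ b := max_le hab (min_le_right _ _)

lemma clamp_mono (h : s ≤ t) : clamp a b s ≤ clamp a b t :=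
  max_le_max le_rfl (min_le_min h le_rfl)

lemma clamp_sub_le (h : s ≤ t) : clamp a b t - clamp a b s ≤ t - s := by
  unfold clamp
  rcases min_cases t b with h1 | h1 <;> rcases min_cases s b with h2 | h2 <;>
  rcases max_cases a (min t b) with h3 | h3 <;> rcases max_cases a (min s b) with h4 | h4 <;>
  linarith

lemma continuous_of_modulus {f ω : ℝ → ℝ} (h : ∀ s t, s ≤ t → |f t - f s| ≤ ω (t - s))
    (hω : Continuous ω) (h0 : ω 0 = 0) : Continuous f := by
  rw [continuous_iff_continuousAt]
  intro t
  rw [ContinuousAt, tendsto_iff_norm_sub_tendsto_zero]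
  have hl : Tendsto (fun s => ω |s - t|) (𝓝 t) (𝓝 0) := by
    have : Continuous fun s => ω |s - t| := by fun_prop
    have h2 := this.tendsto t
    simpa [h0] using h2
  refine squeeze_zero (fun _ => norm_nonneg _) (fun s => ?_) hl
  rw [Real.norm_eq_abs]
  rcases le_total s t with h1 | h1
  · rw [abs_sub_comm, abs_sub_comm s t, abs_of_nonneg (by linarith : 0 ≤ t - s)]
    exact h s t h1
  · rw [abs_of_nonneg (by linarith : 0 ≤ s - t)]
    exact h t s h1

end

/-- A primitive for the second-order part, constant outside `[a, b]`. -/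
def clampPrim (a b : ℝ) (x p : ℝ → ℝ) (ψ : ℝ → ℝ → ℝ) (t : ℝ) : ℝ :=
  ψ a (clamp a b t) + x a * (p (clamp a b t) - p a)

/-- The path stopped at the ends of `[a, b]`. -/
def clampPath (a b : ℝ) (x : ℝ → ℝ) (t : ℝ) : ℝ := x (clamp a b t)

lemma clampPath_eq {a b t : ℝ} (x : ℝ → ℝ) (h1 : a ≤ t) (h2 : t ≤ b) : clampPath a b x t = x t := by
  rw [clampPath, clamp_eq h1 h2]

namespace RoughOn

variable {β a b X P M : ℝ} {x p : ℝ → ℝ} {ψ : ℝ → ℝ → ℝ}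

/-- By the multiplicative relation based at a, `clampPrim` is a primitive of ψ. Stopping the paths
at the ends extends the functional to the line. -/
lemma lev_clamp' (H : RoughOn β a b X P M x p ψ) (hab : a ≤ b) {s t : ℝ} (hst : s ≤ t) :
    lev (clampPath a b x) (clampPath a b p) (clampPrim a b x p ψ) s t =
      ψ (clamp a b s) (clamp a b t) := by
  have := H.mult a (clamp a b s) (clamp a b t) le_rfl le_clamp (clamp_mono hst) (clamp_le hab)
  unfold lev clampPath clampPrim
  linear_combination -this

lemma lev_clamp (H : RoughOn β a b X P M x p ψ) {s t : ℝ} (h1 : a ≤ s) (h2 : s ≤ t) (h3 : t ≤ b) :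
    lev (clampPath a b x) (clampPath a b p) (clampPrim a b x p ψ) s t = ψ s t := by
  rw [H.lev_clamp' (by linarith) h2, clamp_eq h1 (by linarith), clamp_eq (by linarith) h3]

lemma clampPath_bdd (H : RoughOn β a b X P M x p ψ) (hab : a ≤ b) (hβ : 0 < β) (t : ℝ) :
    |clampPath a b x t| ≤ |x a| + X * (b - a) ^ β := by
  have h1 := H.holx a (clamp a b t) le_rfl le_clamp (clamp_le hab)
  have h2 : clamp a b t - a ≤ b - a := by linarith [clamp_le (t := t) hab]
  have h3 : (clamp a b t - a) ^ β ≤ (b - a) ^ β :=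
    Real.rpow_le_rpow (by linarith [le_clamp (a := a) (b := b) (t := t)]) h2 hβ.le
  have h4 := mul_le_mul_of_nonneg_left h3 H.nonneg_x
  have h5 := abs_add_le (x (clamp a b t) - x a) (x a)
  rw [sub_add_cancel] at h5
  rw [clampPath]
  linarith

lemma clampPath_holder {K : ℝ} {f : ℝ → ℝ} (hK : 0 ≤ K)
    (hf : ∀ s t, a ≤ s → s ≤ t → t ≤ b → |f t - f s| ≤ K * (t - s) ^ β) (hab : a ≤ b) (hβ : 0 < β)
    (s t : ℝ) (hst : s ≤ t) :
    |clampPath a b f t - clampPath a b f s| ≤ K * (t - s) ^ β := by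
  refine (hf _ _ le_clamp (clamp_mono hst) (clamp_le hab)).trans
    (mul_le_mul_of_nonneg_left ?_ hK)
  exact Real.rpow_le_rpow (by linarith [clamp_mono (a := a) (b := b) hst]) (clamp_sub_le hst) hβ.le

/-- Projection onto [a, b] does not increase distances, so the bounds persist on the line with the
same constants. -/
lemma roughPair (H : RoughOn β a b X P M x p ψ) (hab : a ≤ b) (hβ : 0 < β) :
    RoughPair β X P M (clampPath a b x) (clampPath a b p) (clampPrim a b x p ψ) := by
  have hx := clampPath_holder H.nonneg_x H.holx hab hβ
  have hp := clampPath_holder H.nonneg_p H.holp hab hβ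
  have hm : ∀ s t, s ≤ t → |lev (clampPath a b x) (clampPath a b p) (clampPrim a b x p ψ) s t| ≤
      M * (t - s) ^ (2 * β) := by
    intro s t hst
    rw [H.lev_clamp' hab hst]
    refine (H.holm _ _ le_clamp (clamp_mono hst) (clamp_le hab)).trans
      (mul_le_mul_of_nonneg_left ?_ H.nonneg_m)
    exact Real.rpow_le_rpow (by linarith [clamp_mono (a := a) (b := b) hst]) (clamp_sub_le hst)
      (by linarith)
  have hc : ∀ K : ℝ, Continuous fun u : ℝ => K * u ^ β := fun K =>
    continuous_const.mul (continuous_id.rpow_const fun _ => Or.inr hβ.le)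
  have hc2 : Continuous fun u : ℝ => M * u ^ (2 * β) :=
    continuous_const.mul (continuous_id.rpow_const fun _ => Or.inr (by linarith))
  have z1 : (0 : ℝ) ^ β = 0 := Real.zero_rpow hβ.ne'
  have z2 : (0 : ℝ) ^ (2 * β) = 0 := Real.zero_rpow (by linarith)
  refine ⟨continuous_of_modulus hx (hc X) (by rw [z1, mul_zero]),
    continuous_of_modulus hp (hc P) (by rw [z1, mul_zero]),
    continuous_of_modulus (ω := fun u => M * u ^ (2 * β) +
      (|x a| + X * (b - a) ^ β) * (P * u ^ β)) (fun s t hst => ?_)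
      (hc2.add (continuous_const.mul (hc P))) (by simp [z1, z2]), hx, hp, hm⟩
  have e : clampPrim a b x p ψ t - clampPrim a b x p ψ s =
      lev (clampPath a b x) (clampPath a b p) (clampPrim a b x p ψ) s t +
        clampPath a b x s * (clampPath a b p t - clampPath a b p s) := by
    unfold lev
    ring
  rw [e]
  refine (abs_add_le _ _).trans (add_le_add (hm s t hst) ?_)
  rw [abs_mul]
  exact mul_le_mul (H.clampPath_bdd hab hβ s) (hp s t hst) (abs_nonneg _)
    ((abs_nonneg _).trans (H.clampPath_bdd hab hβ s))

end RoughOn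

/-! ### Dependence on the values over the interval only -/

lemma gammaOp_congr {γ ξ η : ℝ} {ψ ψ' : ℝ → ℝ → ℝ} (h1 : ξ < η)
    (h : ∀ s t, ξ ≤ s → s ≤ t → t ≤ η → ψ s t = ψ' s t) : gammaOp γ ψ ξ η = gammaOp γ ψ' ξ η :=
  weylRight_congr h1 fun s h2 h3 => weylLeft_congr h3 fun t h4 h5 => h s t h2 h4.le h5

lemma lambdaOp_congr {α ε r b : ℝ} {ψ ψ' : ℝ → ℝ → ℝ} (h1 : r ≤ b)
    (h : ∀ s t, r ≤ s → s ≤ t → t ≤ b → ψ s t = ψ' s t) :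
    lambdaOp α ε r b ψ = lambdaOp α ε r b ψ' :=
  integral_congr_Ioo h1 fun η h2 h3 => integral_congr_Ioo h2.le fun ξ h4 h5 => by
    rw [gammaOp_congr h5 fun s t h6 h7 h8 => h s t (h4.le.trans h6) h7 (h8.trans h3.le)]

/-- Used to pass between original and stopped paths. The point c may lie beyond b, so z_c is matched
separately. -/
lemma tripleAux_congr {α ε a b c : ℝ} {x x' y y' z z' : ℝ → ℝ} {ψ₁ ψ₁' ψ₂ ψ₂' : ℝ → ℝ → ℝ}
    (hab : a ≤ b) (hx : ∀ r, a ≤ r → r ≤ b → x r = x' r) (hy : ∀ r, a ≤ r → r ≤ b → y r = y' r)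
    (hz : ∀ r, a ≤ r → r ≤ b → z r = z' r) (hc : z c = z' c)
    (h1 : ∀ s t, a ≤ s → s ≤ t → t ≤ b → ψ₁ s t = ψ₁' s t)
    (h2 : ∀ s t, a ≤ s → s ≤ t → t ≤ b → ψ₂ s t = ψ₂' s t) :
    tripleAux α ε x y z ψ₁ ψ₂ c a b = tripleAux α ε x' y' z' ψ₁' ψ₂' c a b := by
  have e1 : ∀ r, a < r → r < b → tripleComp α x z c a r = tripleComp α x' z' c a r := by
    intro r h3 h4
    rw [tripleComp, tripleComp, hx r h3.le h4.le, hx a le_rfl hab, hz r h3.le h4.le, hc]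
    congr 3
    exact integral_congr_Ioo h3.le fun s h5 h6 => by
      rw [hx s h5.le (h6.trans h4).le, hz s h5.le (h6.trans h4).le]
  unfold tripleAux
  congr 1
  · congr 1
    · congr 1
      refine integral_congr_Ioo hab fun r h3 h4 => ?_
      rw [e1 r h3 h4]
      congr 1
      exact weylRight_congr h4 fun s h5 h6 => by
        rw [hy s (h3.le.trans h5) h6.le, hy b hab le_rfl]
    · refine integral_congr_Ioo hab fun r h3 h4 => ?_
      congr 1
      · exact weylLeft_congr h3 fun s h5 h6 => by rw [hc, hz s h5.le (h6.trans h4.le)]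
      · exact lambdaOp_congr h4.le fun s t h5 h6 h7 => h1 s t (h3.le.trans h5) h6 h7
  · refine integral_congr_Ioo hab fun r h3 h4 => ?_
    congr 1
    · exact weylLeft_congr h3 fun s h5 h6 => by
        rw [hx a le_rfl hab, hx s h5.le (h6.trans h4.le)]
    · exact lambdaOp_congr h4.le fun s t h5 h6 h7 => h2 s t (h3.le.trans h5) h6 h7

/-! ### The tensor product as a second-order part -/

namespace RoughOn

variable {α ε β a b X Y Z P M L : ℝ} {x y z p : ℝ → ℝ} {ψ V U : ℝ → ℝ → ℝ}

lemma lambda_bound (H : RoughOn β a b X P M x p ψ) (E : Exps α ε β) {r : ℝ} (h1 : a ≤ r)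
    (h2 : r < b) :
    |lambdaOp α ε r b ψ| ≤ lamC α ε β * (M + X * P) * (b - r) ^ (2 * β + 2 * α - 2) := by
  rw [← lambdaOp_congr h2.le fun s t h3 h4 h5 => H.lev_clamp (h1.trans h3) h4 h5]
  exact (H.roughPair (h1.trans h2.le) E.hβ0).lambda_bound E.hγ E.hα1 E.hε E.hβ h2

lemma weylRight_bound (H : RoughOn β a b X P M x p ψ) (E : Exps α ε β) {r : ℝ} (h1 : a ≤ r)
    (h2 : r < b) :
    |weylRight (1 - α) b (fun s => p s - p b) r| ≤
      weylC (1 - α) β 1 * P * (b - r) ^ (β + α - 1) := by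
  have := (H.roughPair (h1.trans h2.le) E.hβ0).weylRight_bound E.hαβ E.hα1 E.hβ h2
  rwa [weylRight_congr (g₂ := fun s => p s - p b) h2 fun s h3 h4 => by
    rw [clampPath_eq p (h1.trans h3) h4.le, clampPath_eq p (h1.trans h2.le) le_rfl]] at this

/-- Interchanging the paths preserves multiplicativity; subtracting U from the full product of
increments costs Y Z in the bound. -/
lemma flip (K : RoughOn β a b Y Z L y z U) (hβ : 0 < β) :
    RoughOn β a b Z Y (L + Y * Z) z y (flipTensor y z U) where
  nonneg_x := K.nonneg_p
  nonneg_p := K.nonneg_x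
  nonneg_m := add_nonneg K.nonneg_m (mul_nonneg K.nonneg_x K.nonneg_p)
  holx := K.holp
  holp := K.holx
  holm s t h1 h2 h3 := by
    have a1 := mul_le_mul (K.holp s t h1 h2 h3) (K.holx s t h1 h2 h3) (abs_nonneg _)
      (mul_nonneg K.nonneg_p (Real.rpow_nonneg (by linarith) _))
    have a2 := K.holm s t h1 h2 h3
    rw [← abs_mul] at a1
    rw [flipTensor]
    refine (abs_sub _ _).trans ((add_le_add a1 a2).trans (le_of_eq ?_))
    rw [two_mul, Real.rpow_add_of_nonneg (by linarith) hβ.le hβ.le]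
    ring
  mult s u t h1 h2 h3 h4 := by
    have := K.mult s u t h1 h2 h3 h4
    unfold flipTensor
    linear_combination -this

/-- Multiplicativity over s, t, b writes the increment of r ↦ U r b as -(U s t + (y t - y s)(z b - z
t)): one factor (t-s)^β is the Hölder increment, and the other factor is at most (b-a)^β. -/
lemma tensor_path (K : RoughOn β a b Y Z L y z U) (hβ : 0 < β) {s t : ℝ} (h1 : a ≤ s) (h2 : s ≤ t)
    (h3 : t ≤ b) : |U t b - U s b| ≤ (L + Y * Z) * (b - a) ^ β * (t - s) ^ β := by
  have e : U t b - U s b = -(U s t + (y t - y s) * (z b - z t)) := by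
    have := K.mult s t b h1 h2 h3 le_rfl
    linear_combination this
  have hY := K.nonneg_x
  have hZ := K.nonneg_p
  have hL := K.nonneg_m
  have n1 := Real.rpow_nonneg (by linarith : 0 ≤ t - s) β
  have b1 : (t - s) ^ β ≤ (b - a) ^ β := Real.rpow_le_rpow (by linarith) (by linarith) hβ.le
  have b2 : (b - t) ^ β ≤ (b - a) ^ β := Real.rpow_le_rpow (by linarith) (by linarith) hβ.le
  have n2 := Real.rpow_nonneg (by linarith : 0 ≤ b - t) β
  have a1 := K.holm s t h1 h2 h3
  rw [two_mul, Real.rpow_add_of_nonneg (by linarith) hβ.le hβ.le] at a1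
  rw [e, abs_neg]
  refine (abs_add_le _ _).trans ?_
  rw [abs_mul]
  calc _ ≤ L * ((t - s) ^ β * (t - s) ^ β) + Y * (t - s) ^ β * (Z * (b - t) ^ β) := by
        gcongr
        · exact K.holx s t h1 h2 h3
        · exact K.holp t b (h1.trans h2) h3 le_rfl
    _ ≤ L * ((t - s) ^ β * (b - a) ^ β) + Y * (t - s) ^ β * (Z * (b - a) ^ β) := by gcongr
    _ = _ := by ring

/-- This makes the integral against d_r(y ⊗ z)_{r,b} an instance of the general one. The bound is
`tripleAux_bound` and the multiplicative relation is `tripleAux_add`, both transferred from the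
stopped paths. -/
lemma triple (H : RoughOn β a b X Y M x y V) (K : RoughOn β a b Y Z L y z U) (E : Exps α ε β)
    (hab : a ≤ b) :
    RoughOn β a b X ((L + Y * Z) * (b - a) ^ β)
      (triC α ε β * ((b - a) ^ β * (X * Z * Y + Z * (M + X * Y) + X * (L + Y * Z + Z * Y))))
      x (fun r => U r b) (fun s t => -tripleTensor α ε x y z V U b s t) := by
  have hβ := E.hβ0
  have hX := H.nonneg_x
  have hY := H.nonneg_p
  have hZ := K.nonneg_p
  have hM := H.nonneg_m
  have hL := K.nonneg_m
  have hC := E.triC_pos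
  have nb := Real.rpow_nonneg (by linarith : 0 ≤ b - a) β
  have F := K.flip hβ
  have RH := H.roughPair hab hβ
  have RF := F.roughPair hab hβ
  have e : ∀ s t, a ≤ s → s ≤ t → t ≤ b → tripleTensor α ε x y z V U b s t =
      tripleAux α ε (clampPath a b x) (clampPath a b y) (clampPath a b z)
        (lev (clampPath a b x) (clampPath a b y) (clampPrim a b x y V))
        (lev (clampPath a b z) (clampPath a b y) (clampPrim a b z y (flipTensor y z U))) b s t := by
    intro s t h1 h2 h3
    rw [tripleTensor_eq]
    refine tripleAux_congr h2 ?_ ?_ ?_ ?_ ?_ ?_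
    · exact fun r h4 h5 => (clampPath_eq x (h1.trans h4) (h5.trans h3)).symm
    · exact fun r h4 h5 => (clampPath_eq y (h1.trans h4) (h5.trans h3)).symm
    · exact fun r h4 h5 => (clampPath_eq z (h1.trans h4) (h5.trans h3)).symm
    · exact (clampPath_eq z hab le_rfl).symm
    · exact fun u v h4 h5 h6 => (H.lev_clamp (h1.trans h4) h5 (h6.trans h3)).symm
    · exact fun u v h4 h5 h6 => (F.lev_clamp (h1.trans h4) h5 (h6.trans h3)).symm
  refine ⟨hX, by positivity, by positivity, H.holx, fun s t h1 h2 h3 => K.tensor_path hβ h1 h2 h3,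
    fun s t h1 h2 h3 => ?_, fun s u t h1 h2 h3 h4 => ?_⟩
  · rw [abs_neg, e s t h1 h2 h3]
    rcases eq_or_lt_of_le h2 with h4 | h4
    · subst h4
      have : 0 ≤ (s - s) ^ (2 * β) := Real.rpow_nonneg (by linarith) _
      simp only [tripleAux, intervalIntegral.integral_same, neg_zero, add_zero, sub_zero, abs_zero]
      positivity
    · refine (tripleAux_bound E RH RF h4 h3).trans ?_
      have n1 : (b - s) ^ β ≤ (b - a) ^ β := Real.rpow_le_rpow (by linarith) (by linarith) hβ.le
      have n2 := Real.rpow_nonneg (by linarith : 0 ≤ t - s) (2 * β)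
      gcongr
  · have add := tripleAux_add (c := b) E RH RF
      (B := max (|x a| + X * (b - a) ^ β) (|z a| + Z * (b - a) ^ β))
      (fun t => (H.clampPath_bdd hab hβ t).trans (le_max_left _ _))
      (fun t => (F.clampPath_bdd hab hβ t).trans (le_max_right _ _)) h2 h3 h4
    rw [e s u h1 h2 (h3.trans h4), e u t (h1.trans h2) h3 h4, e s t h1 (h2.trans h3) h4, add,
      F.lev_clamp (h1.trans h2) h3 h4, clampPath_eq x (h1.trans h2) (h3.trans h4),
      clampPath_eq x h1 (h2.trans (h3.trans h4)), clampPath_eq z hab le_rfl,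
      clampPath_eq z (h1.trans h2) (h3.trans h4), clampPath_eq y (h1.trans (h2.trans h3)) h4,
      clampPath_eq y (h1.trans h2) (h3.trans h4), flipTensor]
    have m1 := K.mult u t b (h1.trans h2) h3 h4 le_rfl
    -- The defect of additivity is (x_u - x_s) times (z_b - z_t)(y_t - y_u) + U u t, and
    -- multiplicativity of U identifies the second factor with U u b - U t b.
    linear_combination (x u - x s) * m1

end RoughOn

end RoughFrac

end

noncomputable section

namespace RoughFrac

open Filter Topology

/-! ### The two kinds of terms of the integral -/

lemma fracLeft_bound_const {γ p G L a r A : ℝ} {e : ℝ → ℝ} (hγ : 0 < γ) (hγ1 : γ < 1) (hp : γ < p)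
    (har : a < r) (hL : L * (r - a) ^ p ≤ G) (hA : |A| ≤ G)
    (he : ∀ s, a < s → s < r → |e s| ≤ L * (r - s) ^ p) :
    |1 / Real.Gamma (1 - γ) * (A / (r - a) ^ γ + γ * ∫ s in a..r, e s / (r - s) ^ (γ + 1))| ≤
      weylC γ p 1 * G * (r - a) ^ (1 - γ - 1) := by
  have hr : 0 < r - a := by linarith
  have e1 : (r - a) ^ (-p) * (r - a) ^ p = 1 := by rw [← Real.rpow_add hr]; simp
  have n2 := Real.rpow_nonneg hr.le (-p)
  have := fracLeft_bound (Ψ := G * (r - a) ^ (-p)) (A := A) (e := e) hγ hγ1 hp one_pos har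
    (by rw [add_sub_cancel_right, mul_assoc, e1, mul_one]; exact hA) fun s h1 h2 => ?_
  · refine this.trans (le_of_eq ?_)
    rw [show 1 - γ - 1 = -p + (p - γ + 1 - 1) by ring, Real.rpow_add hr]
    ring
  · rw [sub_self, Real.rpow_zero, mul_one]
    refine (he s h1 h2).trans ?_
    have := Real.rpow_nonneg (by linarith : 0 ≤ r - s) p
    gcongr
    calc L = L * (r - a) ^ p * (r - a) ^ (-p) := by
          rw [mul_assoc, mul_comm _ ((r - a) ^ (-p)), e1, mul_one]
      _ ≤ _ := by gcongr

lemma abs_integral_mul_le_beta {p q A B a b : ℝ} (hp : 0 < p) (hq : 0 < q) (hab : a < b)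
    {u v : ℝ → ℝ} (hu : ∀ r, a < r → r < b → |u r| ≤ A * (r - a) ^ (p - 1))
    (hv : ∀ r, a < r → r < b → |v r| ≤ B * (b - r) ^ (q - 1)) :
    |∫ r in a..b, u r * v r| ≤ A * B * (betaR p q * (b - a) ^ (p + q - 1)) := by
  refine (abs_integral_le_of_Ioo hab.le (g := fun r => A * B *
    ((r - a) ^ (p - 1) * (b - r) ^ (q - 1))) (fun r h1 h2 => ?_)
    ((intervalIntegrable_beta hp hq hab.le).const_mul _)).trans (le_of_eq ?_)
  · rw [abs_mul]
    exact (mul_le_mul (hu r h1 h2) (hv r h1 h2) (abs_nonneg _)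
      ((abs_nonneg _).trans (hu r h1 h2))).trans (le_of_eq (by ring))
  · rw [intervalIntegral.integral_const_mul, integral_beta a b hab]

/-- Mean value inequality on the segment from v to u, where the derivative differs from its value at
v by at most K ‖u - v‖^λ. -/
lemma taylor_holder {E : Type*} [NormedAddCommGroup E] [NormedSpace ℝ E] {g : E → ℝ}
    {K lam : ℝ} (hK : 0 ≤ K) (hlam : 0 < lam) (hg : Differentiable ℝ g)
    (hl : ∀ u v, ‖fderiv ℝ g u - fderiv ℝ g v‖ ≤ K * ‖u - v‖ ^ lam) (u v : E) :
    |g u - g v - fderiv ℝ g v (u - v)| ≤ K * ‖u - v‖ ^ (1 + lam) := by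
  have := (convex_segment v u).norm_image_sub_le_of_norm_hasFDerivWithin_le'
    (f := g) (f' := fderiv ℝ g) (φ := fderiv ℝ g v) (C := K * ‖u - v‖ ^ lam)
    (fun w _ => (hg w).hasFDerivAt.hasFDerivWithinAt) (fun w hw => (hl w v).trans ?_)
    (left_mem_segment ℝ v u) (right_mem_segment ℝ v u)
  · rw [Real.norm_eq_abs] at this
    refine this.trans (le_of_eq ?_)
    rw [Real.rpow_add_of_nonneg (norm_nonneg _) zero_le_one hlam.le, Real.rpow_one]
    ring
  · gcongr
    obtain ⟨θ, ⟨h0, h1⟩, rfl⟩ := (segment_eq_image' ℝ v u ▸ hw)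
    rw [add_sub_cancel_left, norm_smul, Real.norm_of_nonneg h0]
    exact mul_le_of_le_one_left (norm_nonneg _) h1

section

variable {m : ℕ} {α β lam a b X F₀ F₁ K : ℝ} {x : ℝ → EuclideanSpace ℝ (Fin m)}
  {g : EuclideanSpace ℝ (Fin m) → ℝ}

/-- Along a β-Hölder path the Taylor remainder has order β(1+λ), above α, so the compensated
derivative converges; the value f(x_r) gives the singularity (r-a)^{-α}. -/
lemma compensatedDeriv_bound (hα0 : 0 < α) (hα1 : α < 1) (hβ : 0 < β)
    (hlam : 0 < lam) (hαl : α < β + lam * β) (hX : 0 ≤ X) (hK : 0 ≤ K) (hg : Differentiable ℝ g)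
    (hx : ∀ s t, a ≤ s → s ≤ t → t ≤ b → ‖x t - x s‖ ≤ X * (t - s) ^ β)
    (h0 : ∀ r, a ≤ r → r ≤ b → |g (x r)| ≤ F₀)
    (hl : ∀ u v, ‖fderiv ℝ g u - fderiv ℝ g v‖ ≤ K * ‖u - v‖ ^ lam) {r : ℝ} (h1 : a < r)
    (h2 : r ≤ b) :
    |compensatedDeriv α a g x r| ≤ weylC α (β + lam * β) 1 *
      (F₀ + K * X ^ (1 + lam) * (b - a) ^ (β + lam * β)) * (r - a) ^ (1 - α - 1) := by
  have n1 := Real.rpow_nonneg (by linarith : 0 ≤ b - a) (β + lam * β)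
  have n2 := Real.rpow_nonneg hX (1 + lam)
  have n3 := (abs_nonneg _).trans (h0 r h1.le h2)
  have hlb := mul_pos hlam hβ
  refine fracLeft_bound_const (L := K * X ^ (1 + lam)) hα0 hα1 hαl h1 ?_ ?_ fun s h3 h4 => ?_
  · have : (r - a) ^ (β + lam * β) ≤ (b - a) ^ (β + lam * β) :=
      Real.rpow_le_rpow (by linarith) (by linarith) (by linarith)
    have := mul_le_mul_of_nonneg_left this (mul_nonneg hK n2)
    linarith
  · have := mul_nonneg (mul_nonneg hK n2) n1
    linarith [h0 r h1.le h2]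
  · refine (taylor_holder hK hlam hg hl _ _).trans ?_
    rw [mul_assoc]
    refine mul_le_mul_of_nonneg_left ?_ hK
    have rs : 0 ≤ r - s := by linarith
    refine (Real.rpow_le_rpow (norm_nonneg _) (hx s r h3.le h4.le h2)
      (by linarith : 0 ≤ 1 + lam)).trans (le_of_eq ?_)
    rw [Real.mul_rpow hX (Real.rpow_nonneg rs _), ← Real.rpow_mul rs,
      show β * (1 + lam) = β + lam * β by ring]

lemma weylLeft_fderiv_bound (hα : 1 / 2 < α) (hα1 : α < 1) (hβ : 0 < β) (hlam : 0 < lam)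
    (hαl : 2 * α - 1 < lam * β) (hX : 0 ≤ X) (hK : 0 ≤ K)
    (hx : ∀ s t, a ≤ s → s ≤ t → t ≤ b → ‖x t - x s‖ ≤ X * (t - s) ^ β)
    (h0 : ∀ r, a ≤ r → r ≤ b → ‖fderiv ℝ g (x r)‖ ≤ F₁)
    (hl : ∀ u v, ‖fderiv ℝ g u - fderiv ℝ g v‖ ≤ K * ‖u - v‖ ^ lam) (i : Fin m) {r : ℝ}
    (h1 : a < r) (h2 : r ≤ b) :
    |weylLeft (2 * α - 1) a (fun s => fderiv ℝ g (x s) (EuclideanSpace.single i 1)) r| ≤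
      weylC (2 * α - 1) (lam * β) 1 * (F₁ + K * X ^ lam * (b - a) ^ (lam * β)) *
        (r - a) ^ (1 - (2 * α - 1) - 1) := by
  have n1 := Real.rpow_nonneg (by linarith : 0 ≤ b - a) (lam * β)
  have n2 := Real.rpow_nonneg hX lam
  have n3 := (norm_nonneg _).trans (h0 r h1.le h2)
  have hlb := mul_pos hlam hβ
  have hs : ∀ A : EuclideanSpace ℝ (Fin m) →L[ℝ] ℝ, |A (EuclideanSpace.single i 1)| ≤ ‖A‖ := by
    intro A
    simpa using A.le_opNorm (EuclideanSpace.single i (1 : ℝ))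
  refine weylLeft_bound_const (L := K * X ^ lam) (by linarith) (by linarith) hαl h1 ?_ ?_
    fun s h3 h4 => ?_
  · have : (r - a) ^ (lam * β) ≤ (b - a) ^ (lam * β) :=
      Real.rpow_le_rpow (by linarith) (by linarith) hlb.le
    have := mul_le_mul_of_nonneg_left this (mul_nonneg hK n2)
    linarith
  · have := mul_nonneg (mul_nonneg hK n2) n1
    linarith [h0 r h1.le h2, hs (fderiv ℝ g (x r))]
  · have rs : 0 ≤ r - s := by linarith
    rw [← sub_apply]
    refine (hs _).trans ((hl _ _).trans ?_)
    rw [mul_assoc]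
    refine mul_le_mul_of_nonneg_left ?_ hK
    refine (Real.rpow_le_rpow (norm_nonneg _) (hx s r h3.le h4.le h2) hlam.le).trans (le_of_eq ?_)
    rw [Real.mul_rpow hX (Real.rpow_nonneg rs _), ← Real.rpow_mul rs, mul_comm β]

end

/-! ### The integral of a function of the path -/

/-- Constant for the first-order terms. -/
def firC (α β lam : ℝ) : ℝ :=
  weylC α (β + lam * β) 1 * weylC (1 - α) β 1 * betaR (1 - α) (β + α)

/-- Constant for the second-order terms. -/
def secC (α ε β lam : ℝ) : ℝ :=
  weylC (2 * α - 1) (lam * β) 1 * lamC α ε β * betaR (1 - (2 * α - 1)) (2 * β + 2 * α - 1)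

section

variable {α ε β lam : ℝ}

lemma firC_pos (E : Exps α ε β) (hαl : α < β + lam * β) : 0 < firC α β lam := by
  obtain ⟨hγ, hε, hα1, hβ, hα2, hα4⟩ := id E
  have hα := E.hα
  have h1 := weylC_pos (γ := α) (q := 1) E.hα0 hα1 hαl one_pos
  have h2 := weylC_pos (γ := 1 - α) (p := β) (q := 1) (by linarith) (by linarith)
    (by linarith) one_pos
  have h3 := betaR_pos (p := 1 - α) (q := β + α) (by linarith) (by linarith)
  unfold firC
  positivity

lemma secC_pos (E : Exps α ε β) (hαl : 2 * α - 1 < lam * β) : 0 < secC α ε β lam := by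
  obtain ⟨hγ, hε, hα1, hβ, hα2, hα4⟩ := id E
  have hα := E.hα
  have h1 := weylC_pos (γ := 2 * α - 1) (q := 1) (by linarith) (by linarith) hαl one_pos
  have h2 := lamC_pos hγ hα1 hε hβ
  have h3 := betaR_pos (p := 1 - (2 * α - 1)) (q := 2 * β + 2 * α - 1) (by linarith) (by linarith)
  unfold secC
  positivity

end

lemma abs_sum_le_card_mul {ι : Type*} [Fintype ι] {u : ι → ℝ} {B : ℝ} (h : ∀ i, |u i| ≤ B) :
    |∑ i, u i| ≤ Fintype.card ι * B :=
  (Finset.abs_sum_le_sum_abs _ _).trans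
    ((Finset.sum_le_card_nsmul _ _ B fun i _ => h i).trans
      (by rw [nsmul_eq_mul, Finset.card_univ]))

lemma norm_euclidean_le {n : ℕ} {v : EuclideanSpace ℝ (Fin n)} {B : ℝ} (hB : 0 ≤ B)
    (h : ∀ i, |v i| ≤ B) : ‖v‖ ≤ n * B := by
  rw [EuclideanSpace.norm_eq]
  refine Real.sqrt_le_iff.2 ⟨by positivity, ?_⟩
  have h1 : ∑ i, ‖v i‖ ^ 2 ≤ n * B ^ 2 := by
    refine (Finset.sum_le_card_nsmul _ _ (B ^ 2) fun i _ =>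
      pow_le_pow_left₀ (norm_nonneg _) (h i) 2).trans (le_of_eq ?_)
    rw [nsmul_eq_mul, Finset.card_univ, Fintype.card_fin]
  have h2 : (n : ℝ) ≤ (n : ℝ) ^ 2 := by
    exact_mod_cast Nat.le_self_pow (two_ne_zero) n
  calc _ ≤ (n : ℝ) * B ^ 2 := h1
    _ ≤ (n : ℝ) ^ 2 * B ^ 2 := by gcongr
    _ = _ := by ring

lemma fderiv_component {m d : ℕ} {f : EuclideanSpace ℝ (Fin m) → EuclideanSpace ℝ (Fin d)}
    (hf : Differentiable ℝ f) (j : Fin d) (u w : EuclideanSpace ℝ (Fin m)) :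
    fderiv ℝ (fun u => f u j) u w = (fderiv ℝ f u w) j := by
  have h := ((EuclideanSpace.proj (𝕜 := ℝ) j).hasFDerivAt (x := f u)).comp u (hf u).hasFDerivAt
  have h2 : HasFDerivAt (fun u => f u j)
      ((EuclideanSpace.proj (𝕜 := ℝ) j).comp (fderiv ℝ f u)) u := h
  rw [h2.fderiv]
  rfl

lemma norm_fderiv_component_le {m d : ℕ}
    {f : EuclideanSpace ℝ (Fin m) → EuclideanSpace ℝ (Fin d)}
    (hf : Differentiable ℝ f) (j : Fin d) (u : EuclideanSpace ℝ (Fin m)) :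
    ‖fderiv ℝ (fun u => f u j) u‖ ≤ ‖fderiv ℝ f u‖ := by
  refine ContinuousLinearMap.opNorm_le_bound _ (norm_nonneg _) fun w => ?_
  rw [fderiv_component hf]
  exact (PiLp.norm_apply_le _ j).trans (ContinuousLinearMap.le_opNorm _ _)

lemma norm_fderiv_component_sub_le {m d : ℕ}
    {f : EuclideanSpace ℝ (Fin m) → EuclideanSpace ℝ (Fin d)}
    (hf : Differentiable ℝ f) (j : Fin d) (u v : EuclideanSpace ℝ (Fin m)) :
    ‖fderiv ℝ (fun u => f u j) u - fderiv ℝ (fun u => f u j) v‖ ≤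
      ‖fderiv ℝ f u - fderiv ℝ f v‖ := by
  refine ContinuousLinearMap.opNorm_le_bound _ (norm_nonneg _) fun w => ?_
  rw [sub_apply, fderiv_component hf, fderiv_component hf,
    ← PiLp.sub_apply, ← sub_apply]
  exact (PiLp.norm_apply_le _ j).trans (ContinuousLinearMap.le_opNorm _ _)

/-- The singularities at the two ends of each integrand form a beta integral, so only the constants
have to be tracked. The bounds F₀ and F₁ are needed along the path only. -/
lemma fracIntegral_bound {m d : ℕ} {α ε β lam a b X P M F₀ F₁ K : ℝ}
    {f : EuclideanSpace ℝ (Fin m) → EuclideanSpace ℝ (Fin d)}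
    {x : ℝ → EuclideanSpace ℝ (Fin m)} {p : ℝ → EuclideanSpace ℝ (Fin d)}
    {V : ℝ → ℝ → EuclideanSpace ℝ (Fin m × Fin d)} (E : Exps α ε β) (hlam : 0 < lam)
    (hαl : α < β + lam * β) (hαl' : 2 * α - 1 < lam * β) (hab : a < b) (hX : 0 ≤ X) (hK : 0 ≤ K)
    (hP : 0 ≤ P)
    (hx : ∀ s t, a ≤ s → s ≤ t → t ≤ b → ‖x t - x s‖ ≤ X * (t - s) ^ β)
    (H : ∀ i j, RoughOn β a b X P M (fun r => x r i) (fun r => p r j) fun s t => V s t (i, j))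
    (hp : ∀ j s t, a ≤ s → s ≤ t → t ≤ b → |p t j - p s j| ≤ P * (t - s) ^ β)
    (hf : Differentiable ℝ f) (h0 : ∀ r, a ≤ r → r ≤ b → ‖f (x r)‖ ≤ F₀)
    (h1 : ∀ r, a ≤ r → r ≤ b → ‖fderiv ℝ f (x r)‖ ≤ F₁)
    (hl : ∀ u v, ‖fderiv ℝ f u - fderiv ℝ f v‖ ≤ K * ‖u - v‖ ^ lam) :
    |fracIntegral α ε f x p V a b| ≤
      d * (firC α β lam * (F₀ + K * X ^ (1 + lam) * (b - a) ^ (β + lam * β)) * P *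
        (b - a) ^ β) +
      m * (d * (secC α ε β lam * (F₁ + K * X ^ lam * (b - a) ^ (lam * β)) * (M + X * P) *
        (b - a) ^ (2 * β))) := by
  have hα := E.hα
  have hα1 := E.hα1
  have hβ0 := E.hβ0
  have hg : ∀ j, Differentiable ℝ fun u => f u j := fun j u =>
    ((EuclideanSpace.proj (𝕜 := ℝ) j).hasFDerivAt (x := f u)).differentiableAt.comp u (hf u)
  have hgl : ∀ j u v, ‖fderiv ℝ (fun u => f u j) u - fderiv ℝ (fun u => f u j) v‖ ≤
      K * ‖u - v‖ ^ lam := fun j u v => (norm_fderiv_component_sub_le hf j u v).trans (hl u v)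
  rw [fracIntegral]
  refine (abs_add_le _ _).trans (add_le_add ?_ ?_)
  · rw [abs_neg]
    refine (abs_sum_le_card_mul fun j => ?_).trans (le_of_eq (by rw [Fintype.card_fin]))
    -- The bound on the right derivative concerns p alone; the zero path and zero second-order part
    -- complete it to a functional.
    have Hj : RoughOn β a b 0 P 0 (fun _ => 0) (fun r => p r j) fun _ _ => 0 :=
      ⟨le_rfl, hP, le_rfl, by simp, hp j, by simp, by simp⟩
    refine (abs_integral_mul_le_beta (p := 1 - α) (q := β + α) (by linarith) (by linarith) hab
      (fun r h3 h4 => compensatedDeriv_bound E.hα0 hα1 hβ0 hlam hαl hX hK (hg j) hx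
        (fun r h5 h6 => (PiLp.norm_apply_le _ j).trans (h0 r h5 h6)) (hgl j) h3 h4.le)
      (fun r h3 h4 => Hj.weylRight_bound E h3.le h4)).trans (le_of_eq ?_)
    rw [firC, show 1 - α + (β + α) - 1 = β by ring]
    ring
  · refine (abs_sum_le_card_mul fun i => abs_sum_le_card_mul fun j => ?_).trans
      (le_of_eq (by rw [Fintype.card_fin, Fintype.card_fin]))
    refine (abs_integral_mul_le_beta (p := 1 - (2 * α - 1)) (q := 2 * β + 2 * α - 1)
      (B := lamC α ε β * (M + X * P))
      (by linarith) (by linarith) hab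
      (fun r h3 h4 => weylLeft_fderiv_bound hα hα1 hβ0 hlam hαl' hX hK hx
        (fun r h5 h6 => (norm_fderiv_component_le hf j _).trans (h1 r h5 h6)) (hgl j) i h3 h4.le)
      (fun r h3 h4 => ?_)).trans (le_of_eq ?_)
    · refine ((H i j).lambda_bound E h3.le h4).trans (le_of_eq ?_)
      rw [show 2 * β + 2 * α - 1 - 1 = 2 * β + 2 * α - 2 by ring]
    · rw [secC, show 1 - (2 * α - 1) + (2 * β + 2 * α - 1) - 1 = 2 * β by ring]
      ring

end RoughFrac

end

noncomputable section

namespace RoughFrac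

open Filter Topology

/-! ### The estimate over one interval -/

/-- The constant in the estimate over one interval. -/
def intC (m d : ℕ) (α ε β lam : ℝ) : ℝ :=
  d * firC α β lam + m * (d * (secC α ε β lam * (4 * triC α ε β + 1)))

/-- Bookkeeping with q = (b-a)^β, e = (b-a)^{λβ}, Xl = X^λ and τ the constant `triC`. Every monomial
on the left occurs on the right up to a constant. -/
lemma bracket_bound {c₁ c₂ τ m d L Y Z X Xl M F₀ F₁ K q e : ℝ} (hc₁ : 0 ≤ c₁) (hc₂ : 0 ≤ c₂)
    (hτ : 0 ≤ τ) (hm : 0 ≤ m) (hd : 0 ≤ d) (hL : 0 ≤ L) (hY : 0 ≤ Y) (hZ : 0 ≤ Z) (hX : 0 ≤ X)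
    (hXl : 0 ≤ Xl) (hM : 0 ≤ M) (hF₀ : 0 ≤ F₀) (hF₁ : 0 ≤ F₁) (hK : 0 ≤ K) (hq : 0 ≤ q)
    (he : 0 ≤ e) :
    d * (c₁ * (F₀ + K * (X * Xl) * (q * e)) * ((L + Y * Z) * q) * q) +
      m * (d * (c₂ * (F₁ + K * Xl * e) *
        (τ * (q * (X * Z * Y + Z * (M + X * Y) + X * (L + Y * Z + Z * Y))) +
          X * ((L + Y * Z) * q)) * (q * q))) ≤
    (d * c₁ + m * (d * (c₂ * (4 * τ + 1)))) *
      ((L + Y * Z) * (F₀ + (X * F₁ + K * (X * Xl) * e) * q) +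
        Z * (F₁ + K * Xl * e) * M * q) * (q * q) := by
  have h1 : (F₀ + K * (X * Xl) * (q * e)) * (L + Y * Z) ≤
      (L + Y * Z) * (F₀ + (X * F₁ + K * (X * Xl) * e) * q) +
        Z * (F₁ + K * Xl * e) * M * q := by
    have n1 : 0 ≤ (L + Y * Z) * (X * F₁ * q) := by positivity
    have n2 : 0 ≤ Z * (F₁ + K * Xl * e) * M * q := by positivity
    linarith
  -- The monomial X Y Z occurs four times in the bound of the tensor product, whence 4τ; the 1 is
  -- for the product of the Hölder constants of x and of the new path.
  have h2 : τ * (q * (X * Z * Y + Z * (M + X * Y) + X * (L + Y * Z + Z * Y))) +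
      X * ((L + Y * Z) * q) ≤ (4 * τ + 1) * (q * (Z * M + X * (L + Y * Z))) := by
    have n1 : 0 ≤ τ * (q * (Z * M)) := by positivity
    have n2 : 0 ≤ τ * (q * (X * L)) := by positivity
    have n3 : 0 ≤ q * (Z * M) := by positivity
    linarith
  have h3 : (F₁ + K * Xl * e) * (q * (Z * M + X * (L + Y * Z))) ≤
      (L + Y * Z) * (F₀ + (X * F₁ + K * (X * Xl) * e) * q) +
        Z * (F₁ + K * Xl * e) * M * q := by
    have n1 : 0 ≤ (L + Y * Z) * F₀ := by positivity
    linarith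
  set S := (L + Y * Z) * (F₀ + (X * F₁ + K * (X * Xl) * e) * q) + Z * (F₁ + K * Xl * e) * M * q
  calc _ = d * c₁ * ((F₀ + K * (X * Xl) * (q * e)) * (L + Y * Z)) * (q * q) +
        m * (d * (c₂ * ((F₁ + K * Xl * e) *
        (τ * (q * (X * Z * Y + Z * (M + X * Y) + X * (L + Y * Z + Z * Y))) +
          X * ((L + Y * Z) * q))))) * (q * q) := by ring
    _ ≤ d * c₁ * S * (q * q) + m * (d * (c₂ * ((F₁ + K * Xl * e) *
        ((4 * τ + 1) * (q * (Z * M + X * (L + Y * Z))))))) * (q * q) := by gcongr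
    _ = d * c₁ * S * (q * q) + m * (d * (c₂ * ((4 * τ + 1) * ((F₁ + K * Xl * e) *
        (q * (Z * M + X * (L + Y * Z))))))) * (q * q) := by ring
    _ ≤ d * c₁ * S * (q * q) + m * (d * (c₂ * ((4 * τ + 1) * S))) * (q * q) := by gcongr
    _ = _ := by ring

/-- `fracIntegral_bound` for each coordinate, with the path and second-order part supplied by
`RoughOn.triple`. The new Hölder constant contains (b-a)^β, which raises the first-order term to the
order 2β. -/
lemma tensorIntegral_bound {m d n : ℕ} {α ε β lam a b X Y Z M L F₀ F₁ K : ℝ}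
    {f : EuclideanSpace ℝ (Fin m) → EuclideanSpace ℝ (Fin d)}
    {x : ℝ → EuclideanSpace ℝ (Fin m)} {y : ℝ → EuclideanSpace ℝ (Fin d)}
    {z : ℝ → EuclideanSpace ℝ (Fin n)}
    {V : ℝ → ℝ → EuclideanSpace ℝ (Fin m × Fin d)} {U : ℝ → ℝ → EuclideanSpace ℝ (Fin d × Fin n)}
    (E : Exps α ε β) (hlam : 0 < lam)
    (hαl : α < β + lam * β) (hαl' : 2 * α - 1 < lam * β) (hab : a < b)
    (hX : 0 ≤ X) (hY : 0 ≤ Y) (hZ : 0 ≤ Z) (hM : 0 ≤ M) (hL : 0 ≤ L) (hK : 0 ≤ K)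
    (hx : ∀ s t, a ≤ s → s ≤ t → t ≤ b → ‖x t - x s‖ ≤ X * (t - s) ^ β)
    (H : ∀ i j, RoughOn β a b X Y M (fun r => x r i) (fun r => y r j) fun s t => V s t (i, j))
    (H' : ∀ j l, RoughOn β a b Y Z L (fun r => y r j) (fun r => z r l) fun s t => U s t (j, l))
    (hf : Differentiable ℝ f) (h0 : ∀ r, a ≤ r → r ≤ b → ‖f (x r)‖ ≤ F₀)
    (h1 : ∀ r, a ≤ r → r ≤ b → ‖fderiv ℝ f (x r)‖ ≤ F₁)
    (hl : ∀ u v, ‖fderiv ℝ f u - fderiv ℝ f v‖ ≤ K * ‖u - v‖ ^ lam) :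
    ‖tensorIntegral α ε f x y z V U b a b‖ / (b - a) ^ (2 * β) ≤ n * intC m d α ε β lam *
      ((L + Y * Z) * (F₀ + (X * F₁ + K * X ^ (1 + lam) * (b - a) ^ (lam * β)) * (b - a) ^ β) +
        Z * (F₁ + K * X ^ lam * (b - a) ^ (lam * β)) * M * (b - a) ^ β) := by
  have hβ := E.hβ0
  have hba : 0 < b - a := by linarith
  have hF₀ := (norm_nonneg _).trans (h0 a le_rfl hab.le)
  have hF₁ := (norm_nonneg _).trans (h1 a le_rfl hab.le)
  have hq := Real.rpow_pos_of_pos hba β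
  have he := Real.rpow_pos_of_pos hba (lam * β)
  have hXl := Real.rpow_nonneg hX lam
  have c1 := firC_pos E hαl
  have c2 := secC_pos E hαl'
  have c3 := E.triC_pos
  rw [div_le_iff₀ (Real.rpow_pos_of_pos hba _), mul_assoc (n : ℝ), mul_assoc (n : ℝ)]
  have e1 : X ^ (1 + lam) = X * X ^ lam := by
    rw [Real.rpow_add_of_nonneg hX zero_le_one hlam.le, Real.rpow_one]
  have e2 : (b - a) ^ (2 * β) = (b - a) ^ β * (b - a) ^ β := by
    rw [two_mul, Real.rpow_add hba]
  refine norm_euclidean_le ?_ fun l => ?_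
  · unfold intC
    positivity
  · refine (fracIntegral_bound (P := (L + Y * Z) * (b - a) ^ β)
      (M := triC α ε β * ((b - a) ^ β * (X * Z * Y + Z * (M + X * Y) + X * (L + Y * Z + Z * Y))))
      E hlam hαl hαl' hab hX hK (by positivity) hx
      (fun i j => (H i j).triple (H' j l) E hab.le)
      (fun j s t h3 h4 h5 => (H' j l).tensor_path hβ h3 h4 h5) hf h0 h1 hl).trans ?_
    rw [e1, e2, Real.rpow_add hba]
    exact bracket_bound c1.le c2.le c3.le m.cast_nonneg d.cast_nonneg hL hY hZ hX hXl hM hF₀ hF₁ hK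
      hq.le he.le

/-! ### From the norms to explicit bounds -/

section

variable {E F : Type*} [NormedAddCommGroup E] [NormedAddCommGroup F]

lemma pathNorm_mono {β a b a' b' : ℝ} {x : ℝ → E} (ha : a ≤ a') (hb : b' ≤ b) :
    pathNorm β a' b' x ≤ pathNorm β a b x :=
  iSup_mono fun _ => iSup_mono fun _ => iSup_mono' fun h =>
    ⟨⟨ha.trans h.1, h.2.1, h.2.2.trans hb⟩, le_rfl⟩

lemma tensorNorm_mono {β a b a' b' : ℝ} {V : ℝ → ℝ → E} (ha : a ≤ a') (hb : b' ≤ b) :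
    tensorNorm β a' b' V ≤ tensorNorm β a b V :=
  iSup_mono fun _ => iSup_mono fun _ => iSup_mono' fun h =>
    ⟨⟨ha.trans h.1, h.2.1, h.2.2.trans hb⟩, le_rfl⟩

lemma le_mul_of_ofReal_div_le {u v : ℝ} {N : ℝ≥0∞} (hN : N ≠ ⊤) (hv : 0 < v)
    (h : ENNReal.ofReal (u / v) ≤ N) : u ≤ N.toReal * v :=
  (div_le_iff₀ hv).1 ((ENNReal.ofReal_le_iff_le_toReal hN).1 h)

lemma norm_sub_le_pathNorm {β a b : ℝ} {x : ℝ → E} (hβ : 0 < β) (hx : pathNorm β a b x ≠ ⊤)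
    {s t : ℝ} (h1 : a ≤ s) (h2 : s ≤ t) (h3 : t ≤ b) :
    ‖x t - x s‖ ≤ (pathNorm β a b x).toReal * (t - s) ^ β := by
  rcases h2.eq_or_lt with rfl | h2
  · simp [Real.zero_rpow hβ.ne']
  · exact le_mul_of_ofReal_div_le hx (Real.rpow_pos_of_pos (by linarith) _)
      (le_iSup_of_le s (le_iSup_of_le t (le_iSup_of_le ⟨h1, h2, h3⟩ le_rfl)))

lemma norm_le_tensorNorm {β a b : ℝ} {V : ℝ → ℝ → E} (hV : tensorNorm β a b V ≠ ⊤)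
    (hd : ∀ s, a ≤ s → s ≤ b → V s s = 0) {s t : ℝ} (h1 : a ≤ s) (h2 : s ≤ t) (h3 : t ≤ b) :
    ‖V s t‖ ≤ (tensorNorm β a b V).toReal * (t - s) ^ (2 * β) := by
  rcases h2.eq_or_lt with rfl | h2
  · rw [hd s h1 h3, norm_zero]
    exact mul_nonneg ENNReal.toReal_nonneg (Real.rpow_nonneg (by linarith) _)
  · exact le_mul_of_ofReal_div_le hV (Real.rpow_pos_of_pos (by linarith) _)
      (le_iSup_of_le s (le_iSup_of_le t (le_iSup_of_le ⟨h1, h2, h3⟩ le_rfl)))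

lemma norm_sub_le_holderNorm {lam : ℝ} {g : E → F} (hlam : 0 < lam) (hg : holderNorm lam g ≠ ⊤)
    (u v : E) : ‖g u - g v‖ ≤ (holderNorm lam g).toReal * ‖u - v‖ ^ lam := by
  rcases eq_or_ne u v with rfl | h
  · simp [Real.zero_rpow hlam.ne']
  · exact le_mul_of_ofReal_div_le hg (Real.rpow_pos_of_pos (norm_pos_iff.2 (sub_ne_zero.2 h)) _)
      (le_iSup_of_le u (le_iSup_of_le v (le_iSup_of_le h le_rfl)))

/-- If the supremum over the whole space is infinite, compactness still bounds g along the path. A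
finite number below `supNorm g` keeps the final comparison valid under the convention 0 · ∞ = 0. -/
lemma exists_bound_along {a b : ℝ} {x : ℝ → E} {g : E → F} (hg : Continuous g)
    (hx : ContinuousOn x (Icc a b)) :
    ∃ B : ℝ≥0, (B : ℝ≥0∞) ≤ supNorm g ∧ ∀ r, a ≤ r → r ≤ b → ‖g (x r)‖ ≤ B := by
  by_cases h : supNorm g = ⊤
  · obtain ⟨C, hC⟩ := isCompact_Icc.exists_bound_of_continuousOn (hg.comp_continuousOn hx)
    exact ⟨C.toNNReal, by simp [h], fun r h1 h2 => (hC r ⟨h1, h2⟩).trans (Real.le_coe_toNNReal C)⟩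
  · refine ⟨(supNorm g).toNNReal, (ENNReal.coe_toNNReal h).le, fun r _ _ => ?_⟩
    exact (ENNReal.ofReal_le_iff_le_toReal h).1 (le_iSup (fun u => ENNReal.ofReal ‖g u‖) (x r))

lemma continuousOn_of_pathNorm {β a b : ℝ} {x : ℝ → E} (hβ : 0 < β) (hx : pathNorm β a b x ≠ ⊤) :
    ContinuousOn x (Icc a b) := by
  intro t ht
  rw [ContinuousWithinAt, tendsto_iff_norm_sub_tendsto_zero]
  have hl : Tendsto (fun s => (pathNorm β a b x).toReal * |s - t| ^ β) (𝓝[Icc a b] t) (𝓝 0) := by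
    have : Continuous fun s => (pathNorm β a b x).toReal * |s - t| ^ β :=
      continuous_const.mul ((by fun_prop : Continuous fun s => |s - t|).rpow_const
        fun _ => Or.inr hβ.le)
    have h2 := this.tendsto t
    simp only [sub_self, abs_zero, Real.zero_rpow hβ.ne', mul_zero] at h2
    exact h2.mono_left nhdsWithin_le_nhds
  refine squeeze_zero' (Eventually.of_forall fun _ => norm_nonneg _)
    (eventually_nhdsWithin_of_forall fun s hs => ?_) hl
  rcases le_total s t with h1 | h1
  · rw [norm_sub_rev, abs_sub_comm, abs_of_nonneg (by linarith : 0 ≤ t - s)]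
    exact norm_sub_le_pathNorm hβ hx hs.1 h1 ht.2
  · rw [abs_of_nonneg (by linarith : 0 ≤ s - t)]
    exact norm_sub_le_pathNorm hβ hx ht.1 h1 hs.2

end

namespace IsMultFunctional

variable {m d : ℕ} {β T a b : ℝ} {x : ℝ → EuclideanSpace ℝ (Fin m)}
  {y : ℝ → EuclideanSpace ℝ (Fin d)} {V : ℝ → ℝ → EuclideanSpace ℝ (Fin m × Fin d)}

lemma diag (H : IsMultFunctional β T x y V) {s : ℝ} (h1 : 0 ≤ s) (h2 : s ≤ T) : V s s = 0 := by
  ext ⟨i, j⟩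
  have := H.mult s s s h1 le_rfl le_rfl h2 i j
  simp only [sub_self, mul_zero, add_zero] at this
  simpa using this

lemma tensorNorm_ne_top (H : IsMultFunctional β T x y V) : tensorNorm β 0 T V ≠ ⊤ := by
  obtain ⟨C, hC⟩ := H.bound
  refine ne_top_of_le_ne_top (ENNReal.ofReal_ne_top (r := C)) ?_
  refine iSup_le fun s => iSup_le fun t => iSup_le fun h => ENNReal.ofReal_le_ofReal ?_
  rw [div_le_iff₀ (Real.rpow_pos_of_pos (by linarith [h.2.1]) _)]
  exact hC s t h.1 h.2.1.le h.2.2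

/-- The constants are the norms over the large interval [a, b] while the functional is restricted to
[a', b'], so one set of constants serves every subinterval in the supremum. -/
lemma roughOn (H : IsMultFunctional β T x y V) (hβ : 0 < β) (ha : 0 ≤ a) (hb : b ≤ T)
    {a' b' : ℝ} (ha' : a ≤ a') (hb' : b' ≤ b) (i : Fin m) (j : Fin d) :
    RoughOn β a' b' (pathNorm β a b x).toReal (pathNorm β a b y).toReal
      (tensorNorm β a b V).toReal (fun r => x r i) (fun r => y r j) fun s t => V s t (i, j) where
  nonneg_x := ENNReal.toReal_nonneg
  nonneg_p := ENNReal.toReal_nonneg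
  nonneg_m := ENNReal.toReal_nonneg
  holx s t h1 h2 h3 := (PiLp.norm_apply_le (x t - x s) i).trans (norm_sub_le_pathNorm hβ
    (ne_top_of_le_ne_top H.holder_left (pathNorm_mono ha hb)) (ha'.trans h1) h2 (h3.trans hb'))
  holp s t h1 h2 h3 := (PiLp.norm_apply_le (y t - y s) j).trans (norm_sub_le_pathNorm hβ
    (ne_top_of_le_ne_top H.holder_right (pathNorm_mono ha hb)) (ha'.trans h1) h2 (h3.trans hb'))
  holm s t h1 h2 h3 := (PiLp.norm_apply_le (V s t) (i, j)).trans (norm_le_tensorNorm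
    (ne_top_of_le_ne_top H.tensorNorm_ne_top (tensorNorm_mono ha hb))
    (fun _ h4 h5 => H.diag (ha.trans h4) (h5.trans hb)) (ha'.trans h1) h2 (h3.trans hb'))
  mult s u t h1 h2 h3 h4 :=
    H.mult s u t (ha.trans (ha'.trans h1)) h2 h3 (h4.trans (hb'.trans hb)) i j

end IsMultFunctional

end RoughFrac

end

theorem propositionp3p1 (m d n : ℕ) (β T lam α ε : ℝ)
    (hβ₁ : 1 / 3 < β) (hβ₂ : β < 1 / 2) (hT : 0 < T)
    (hlam₁ : 1 / β - 2 < lam) (hlam₂ : lam ≤ 1)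
    (hα₁ : 1 - β < α) (hα₂ : α < 2 * β) (hα₃ : α < (lam * β + 1) / 2)
    (hε₁ : 0 < ε) (hε₂ : ε < α + β - 1) :
    ∃ k : ℝ≥0,
      ∀ (x : ℝ → EuclideanSpace ℝ (Fin m)) (y : ℝ → EuclideanSpace ℝ (Fin d))
        (z : ℝ → EuclideanSpace ℝ (Fin n))
        (V : ℝ → ℝ → EuclideanSpace ℝ (Fin m × Fin d))
        (U : ℝ → ℝ → EuclideanSpace ℝ (Fin d × Fin n))
        (f : EuclideanSpace ℝ (Fin m) → EuclideanSpace ℝ (Fin d)),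
        RoughFrac.IsMultFunctional β T x y V →
        RoughFrac.IsMultFunctional β T y z U →
        ContDiff ℝ 1 f →
        RoughFrac.holderNorm lam (fderiv ℝ f) ≠ ⊤ →
        ∀ a b : ℝ, 0 ≤ a → a < b → b ≤ T →
          (⨆ (ξ : ℝ) (η : ℝ) (_ : a ≤ ξ ∧ ξ < η ∧ η ≤ b),
              ENNReal.ofReal
                (‖RoughFrac.tensorIntegral α ε f x y z V U η ξ η‖ / (η - ξ) ^ (2 * β))) ≤
            (k : ℝ≥0∞) *
              (RoughFrac.constA β lam ε f x y z U a b +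
                RoughFrac.constB β lam f x z a b * RoughFrac.tensorNorm β a b V *
                  ENNReal.ofReal ((b - a) ^ (β - 2 * ε))) := by
  have hβ : 0 < β := by linarith
  -- The lower bound on λ multiplied by β. It gives λ > 0, and with 2α < λβ + 1 also α < β + λβ.
  have hlb : 1 - 2 * β < lam * β := by
    have := mul_lt_mul_of_pos_right hlam₁ hβ
    rwa [sub_mul, one_div, inv_mul_cancel₀ hβ.ne'] at this
  have hlam : 0 < lam := (mul_pos_iff_of_pos_right hβ).1 (by linarith)
  have hlb' : lam * β ≤ β := mul_le_of_le_one_left hβ.le hlam₂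
  have Ex : RoughFrac.Exps α ε β :=
    ⟨by linarith, hε₁, by linarith, hβ₂, hα₂, by linarith⟩
  have hαl : α < β + lam * β := by linarith
  have hαl' : 2 * α - 1 < lam * β := by linarith
  have hC : 0 ≤ n * RoughFrac.intC m d α ε β lam := by
    have c1 := RoughFrac.firC_pos Ex hαl
    have c2 := RoughFrac.secC_pos Ex hαl'
    have c3 := Ex.triC_pos
    unfold RoughFrac.intC
    positivity
  -- T^{2ε} pays for replacing (b-a)^β by (b-a)^{β-2ε}; the 1 is needed by the term with ‖f‖_∞,
  -- which carries no power.
  set τ : ℝ := max 1 (T ^ (2 * ε)) with hτ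
  have hτ0 : 0 ≤ τ := zero_le_one.trans (le_max_left _ _)
  refine ⟨(n * RoughFrac.intC m d α ε β lam * τ).toNNReal, ?_⟩
  intro x y z V U f HV HU hf hK a b ha hab hb
  refine iSup_le fun ξ => iSup_le fun η => iSup_le fun ⟨h1, h2, h3⟩ => ?_
  have nx := ne_top_of_le_ne_top HV.holder_left (RoughFrac.pathNorm_mono (x := x) (β := β) ha hb)
  have ny := ne_top_of_le_ne_top HV.holder_right (RoughFrac.pathNorm_mono (x := y) (β := β) ha hb)
  have nz := ne_top_of_le_ne_top HU.holder_right (RoughFrac.pathNorm_mono (x := z) (β := β) ha hb)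
  have nV := ne_top_of_le_ne_top HV.tensorNorm_ne_top
    (RoughFrac.tensorNorm_mono (V := V) (β := β) ha hb)
  have nU := ne_top_of_le_ne_top HU.tensorNorm_ne_top
    (RoughFrac.tensorNorm_mono (V := U) (β := β) ha hb)
  have cx := RoughFrac.continuousOn_of_pathNorm hβ nx
  have hfd : Continuous (fderiv ℝ f) := hf.continuous_fderiv one_ne_zero
  -- The suprema of f and f' may be infinite, so the real-valued estimate is run with finite bounds
  -- along x that lie below them.
  obtain ⟨F₀, hF₀, hF₀'⟩ := RoughFrac.exists_bound_along hf.continuous cx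
  obtain ⟨F₁, hF₁, hF₁'⟩ := RoughFrac.exists_bound_along hfd cx
  have key := RoughFrac.tensorIntegral_bound (n := n) Ex hlam hαl hαl' h2
    ENNReal.toReal_nonneg ENNReal.toReal_nonneg ENNReal.toReal_nonneg ENNReal.toReal_nonneg
    ENNReal.toReal_nonneg ENNReal.toReal_nonneg
    (fun s t h4 h5 h6 => RoughFrac.norm_sub_le_pathNorm hβ nx (h1.trans h4) h5 (h6.trans h3))
    (HV.roughOn hβ ha hb h1 h3) (HU.roughOn hβ ha hb h1 h3) (hf.differentiable one_ne_zero)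
    (fun r h4 h5 => hF₀' r (h1.trans h4) (h5.trans h3))
    (fun r h4 h5 => hF₁' r (h1.trans h4) (h5.trans h3))
    (RoughFrac.norm_sub_le_holderNorm hlam hK)
  unfold RoughFrac.constA RoughFrac.constB
  obtain ⟨X, hX⟩ : ∃ r : ℝ≥0, (r : ℝ≥0∞) = _ := ⟨_, ENNReal.coe_toNNReal nx⟩
  obtain ⟨Y, hY⟩ : ∃ r : ℝ≥0, (r : ℝ≥0∞) = _ := ⟨_, ENNReal.coe_toNNReal ny⟩
  obtain ⟨Z, hZ⟩ : ∃ r : ℝ≥0, (r : ℝ≥0∞) = _ := ⟨_, ENNReal.coe_toNNReal nz⟩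
  obtain ⟨M, hM⟩ : ∃ r : ℝ≥0, (r : ℝ≥0∞) = _ := ⟨_, ENNReal.coe_toNNReal nV⟩
  obtain ⟨L, hL⟩ : ∃ r : ℝ≥0, (r : ℝ≥0∞) = _ := ⟨_, ENNReal.coe_toNNReal nU⟩
  obtain ⟨K, hK'⟩ : ∃ r : ℝ≥0, (r : ℝ≥0∞) = _ := ⟨_, ENNReal.coe_toNNReal hK⟩
  rw [← hX, ← hY, ← hZ, ← hM, ← hL, ← hK'] at key ⊢
  simp only [ENNReal.coe_toReal] at key
  have hba : 0 < b - a := by linarith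
  have hηξ : 0 < η - ξ := by linarith
  have b1 : (η - ξ) ^ (lam * β) ≤ (b - a) ^ (lam * β) :=
    Real.rpow_le_rpow hηξ.le (by linarith) (by linarith)
  have b2 : (η - ξ) ^ β ≤ τ * (b - a) ^ (β - 2 * ε) := by
    calc (η - ξ) ^ β ≤ (b - a) ^ β := Real.rpow_le_rpow hηξ.le (by linarith) hβ.le
      _ = (b - a) ^ (2 * ε) * (b - a) ^ (β - 2 * ε) := by
          rw [← Real.rpow_add hba, add_sub_cancel]
      _ ≤ τ * (b - a) ^ (β - 2 * ε) := by
          refine mul_le_mul_of_nonneg_right ?_ (Real.rpow_nonneg hba.le _)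
          exact (Real.rpow_le_rpow hba.le (by linarith) (by linarith)).trans (le_max_right _ _)
  have hE := Real.rpow_nonneg hba.le (lam * β)
  have hD := Real.rpow_nonneg hba.le (β - 2 * ε)
  have hq := Real.rpow_nonneg hηξ.le β
  have he := Real.rpow_nonneg hηξ.le (lam * β)
  -- Once the powers are opaque nonnegative numbers, the real inequality can be stated with values
  -- in `ℝ≥0` and cast to `ℝ≥0∞`.
  generalize (b - a) ^ (lam * β) = E at *
  generalize (b - a) ^ (β - 2 * ε) = D at *
  generalize (η - ξ) ^ β = q at *
  generalize (η - ξ) ^ (lam * β) = e at *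
  lift E to ℝ≥0 using hE
  lift D to ℝ≥0 using hD
  have real : ‖RoughFrac.tensorIntegral α ε f x y z V U η ξ η‖ / (η - ξ) ^ (2 * β) ≤
      n * RoughFrac.intC m d α ε β lam * τ *
        (((L + Y * Z) * (F₀ + (X * F₁ + K * X ^ (1 + lam) * E) * D) +
          Z * (F₁ + K * X ^ lam * E) * M * D : ℝ≥0) : ℝ) := by
    refine key.trans ?_
    rw [mul_assoc _ τ]
    refine mul_le_mul_of_nonneg_left ?_ hC
    push_cast
    calc _ ≤ ((L : ℝ) + Y * Z) * (τ * F₀ + (X * F₁ + K * (X : ℝ) ^ (1 + lam) * E) * (τ * D)) +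
          Z * (F₁ + K * (X : ℝ) ^ lam * E) * M * (τ * D) := by
          gcongr
          exact le_mul_of_one_le_left F₀.coe_nonneg (le_max_left _ _)
      _ = _ := by ring
  refine (ENNReal.ofReal_le_ofReal real).trans ?_
  rw [ENNReal.ofReal_mul (mul_nonneg hC hτ0), ENNReal.ofReal_coe_nnreal, ENNReal.ofReal_coe_nnreal,
    ENNReal.ofReal_coe_nnreal, ← ENNReal.coe_rpow_of_nonneg _ hlam.le,
    ← ENNReal.coe_rpow_of_nonneg _ (by linarith : 0 ≤ 1 + lam)]
  push_cast
  gcongr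
  exact le_rfl
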